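/- A fundamental discriminant is an integer $d$ such that either $d\equiv 1 \pmod 4$ and $d$ is square-free, or $d=4m$ with $m\equiv 2,3 \pmod 4$ and $m$ square-free (so $d=1$ is included). For a fundamental discriminant $d$ let $\chi_d=\left(\frac{d}{\cdot}\right)$ be the Dirichlet character modulo $|d|$ given by the Kronecker symbol, and let $L(s,\chi_d)$ be its (analytically continued) Dirichlet $L$-function. Assume the generalized Riemann hypothesis for $L(s,\chi_d)$ for all fundamental discriminants $d$: every zero of $L(s,\chi_d)$ with $0<\Re(s)<1$ has $\Re(s)=\tfrac12$. Then for every $\varepsilon>0$ there are constants $C$ and $X_0$, depending only on $\varepsilon$, such that for all real $X\ge X_0$ and all $z_1,z_2\in\mathbb{C}$ with $0\le \Re(z_1),\Re(z_2)\le \frac{1}{\log X}$ and $|\Im(z_1)|,|\Im(z_2)|\le X$, $$\sum_{\substack{|d|\le X\\ d \text{ a fundamental discriminant}}} |L(\tfrac12+z_1,\chi_d)|^2\,|L(\tfrac12+z_2,\chi_d)|^2 \;\le\; C\,X(\log X)^{4+\varepsilon}\left(1+\min\left\{(\log X)^6,\ \frac{1}{|\Im(z_1)-\Im(z_2)|^6}\right\}\right),$$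 where the minimum is read as $(\log X)^6$ when $\Im(z_1)=\Im(z_2)$. -/

import Mathlib

namespace QuadraticMoment

/-- `d` is a fundamental discriminant: either `d ≡ 1 (mod 4)` is square-free, or `d = 4m` with
`m ≡ 2, 3 (mod 4)` square-free.  The value `d = 1` is a fundamental discriminant. -/
def IsFundamentalDiscriminant (d : ℤ) : Prop :=
  (d % 4 = 1 ∧ Squarefree d) ∨
    ∃ m : ℤ, d = 4 * m ∧ (m % 4 = 2 ∨ m % 4 = 3) ∧ Squarefree m

/-- The Kronecker symbol `(d / n)` for `n ≥ 0`.  Here `ordProj[2] n = 2 ^ n.factorization 2` and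
`ordCompl[2] n` is the odd part of `n`; the symbol `(d / 2)` is `0` for even `d`, `1` for
`d ≡ ±1 (mod 8)` and `-1` for `d ≡ ±3 (mod 8)`, which is the character `ZMod.χ₈`;
and `(d / 0)` is `1` if `d = ±1` and `0` otherwise. -/
def kroneckerSym (d : ℤ) (n : ℕ) : ℤ :=
  if n = 0 then (if d.natAbs = 1 then 1 else 0)
  else ZMod.χ₈ (d : ZMod 8) ^ n.factorization 2 * jacobiSym d (n / 2 ^ n.factorization 2)

/-! ### The Kronecker symbol of a fundamental discriminant is a character modulo `|d|` -/

theorem IsFundamentalDiscriminant.natAbs_ne_zero {d : ℤ} (hd : IsFundamentalDiscriminant d) :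
    d.natAbs ≠ 0 := by
  rcases hd with ⟨h, -⟩ | ⟨m, h, h', -⟩ <;> omega

theorem kroneckerSym_of_odd (d : ℤ) {n : ℕ} (hn : n % 2 = 1) :
    kroneckerSym d n = jacobiSym d n := by
  have h0 : n ≠ 0 := by omega
  have h2 : n.factorization 2 = 0 := Nat.factorization_eq_zero_of_not_dvd (by omega)
  simp [kroneckerSym, h0, h2]

theorem kroneckerSym_one (d : ℤ) : kroneckerSym d 1 = 1 := by
  simp [kroneckerSym]

theorem kroneckerSym_two (d : ℤ) : kroneckerSym d 2 = ZMod.χ₈ (d : ZMod 8) := by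
  simp [kroneckerSym, Nat.prime_two.factorization]

theorem kroneckerSym_zero (d : ℤ) : kroneckerSym d 0 = if d.natAbs = 1 then 1 else 0 := by
  simp [kroneckerSym]

theorem kroneckerSym_mul_of_ne_zero (d : ℤ) {m n : ℕ} (hm : m ≠ 0) (hn : n ≠ 0) :
    kroneckerSym d (m * n) = kroneckerSym d m * kroneckerSym d n := by
  have h1 : m / 2 ^ m.factorization 2 ≠ 0 := (Nat.ordCompl_pos 2 hm).ne'
  have h2 : n / 2 ^ n.factorization 2 ≠ 0 := (Nat.ordCompl_pos 2 hn).ne'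
  have h3 := Nat.ordCompl_mul m n 2
  have h4 : (m * n).factorization 2 = m.factorization 2 + n.factorization 2 := by
    rw [Nat.factorization_mul hm hn]; rfl
  unfold kroneckerSym
  rw [if_neg (Nat.mul_ne_zero hm hn), if_neg hm, if_neg hn, h3, jacobiSym.mul_right' d h1 h2, h4,
    pow_add]
  ring

/-- Two functions that are multiplicative on positive integers and agree at `2` and at odd numbers
agree. -/
theorem eq_of_two_of_odd {f g : ℕ → ℤ}
    (hf : ∀ m n, m ≠ 0 → n ≠ 0 → f (m * n) = f m * f n)
    (hg : ∀ m n, m ≠ 0 → n ≠ 0 → g (m * n) = g m * g n)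
    (h2 : f 2 = g 2) (hodd : ∀ n, n % 2 = 1 → f n = g n) (n : ℕ) (hn : n ≠ 0) : f n = g n := by
  induction n using Nat.strong_induction_on with
  | _ n ih =>
    rcases Nat.mod_two_eq_zero_or_one n with h | h
    · obtain ⟨k, rfl⟩ : ∃ k, n = 2 * k := ⟨n / 2, by omega⟩
      have hk : k ≠ 0 := by omega
      rw [hf 2 k two_ne_zero hk, hg 2 k two_ne_zero hk, h2, ih k (by omega) hk]
    · exact hodd n h

theorem kroneckerSym_eq_jacobiSym {d : ℤ} (hd : d % 4 = 1) (n : ℕ) :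
    kroneckerSym d n = jacobiSym n d.natAbs := by
  rcases eq_or_ne n 0 with rfl | hn
  · rw [kroneckerSym_zero]
    split_ifs with h
    · simp [h]
    · rw [Nat.cast_zero, jacobiSym.zero_left (by omega)]
  refine eq_of_two_of_odd (fun m n hm hn => kroneckerSym_mul_of_ne_zero d hm hn)
    (g := fun n => jacobiSym n d.natAbs)
    (fun m n _ _ => by push_cast; exact jacobiSym.mul_left _ _ _) ?_ (fun n hn => ?_) n hn
  · have hodd : Odd d.natAbs := Nat.odd_iff.2 (by omega)
    rw [kroneckerSym_two]
    push_cast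
    rw [jacobiSym.at_two hodd, ← Int.cast_natCast (R := ZMod 8) d.natAbs,
      ZMod.χ₈_int_eq_if_mod_eight, ZMod.χ₈_int_eq_if_mod_eight]
    split_ifs <;> first | rfl | (exfalso; omega)
  · rw [kroneckerSym_of_odd d hn]
    have hodd : Odd n := Nat.odd_iff.2 hn
    rcases Int.natAbs_eq d with h | h
    · conv_lhs => rw [h]
      exact jacobiSym.quadratic_reciprocity_one_mod_four (by omega) hodd
    · conv_lhs => rw [h]
      have h3 : d.natAbs % 4 = 3 := by omega
      rw [jacobiSym.neg _ hodd]
      rcases Nat.odd_mod_four_iff.1 hn with h1 | h1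
      · rw [ZMod.χ₄_nat_one_mod_four h1, one_mul]
        exact (jacobiSym.quadratic_reciprocity_one_mod_four h1
          (Nat.odd_iff.2 (by omega : d.natAbs % 2 = 1))).symm
      · rw [ZMod.χ₄_nat_three_mod_four h1,
          jacobiSym.quadratic_reciprocity_three_mod_four h3 h1]
        ring

theorem kroneckerSym_eq_zero_of_even {d : ℤ} (hd : d % 2 = 0) {n : ℕ} (hn : n % 2 = 0) :
    kroneckerSym d n = 0 := by
  rcases eq_or_ne n 0 with rfl | h0
  · rw [kroneckerSym_zero, if_neg (by omega)]
  · obtain ⟨k, rfl⟩ : ∃ k, n = 2 * k := ⟨n / 2, by omega⟩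
    rw [kroneckerSym_mul_of_ne_zero d two_ne_zero (by omega), kroneckerSym_two,
      ZMod.χ₈_int_eq_if_mod_eight, if_pos hd, zero_mul]

/-- The Kronecker symbol of a fundamental discriminant `d` is periodic modulo `|d|`. -/
theorem IsFundamentalDiscriminant.kroneckerSym_mod {d : ℤ} (hd : IsFundamentalDiscriminant d)
    (n : ℕ) : kroneckerSym d (n % d.natAbs) = kroneckerSym d n := by
  rcases hd with ⟨h, -⟩ | ⟨m, h, h', -⟩
  · rw [kroneckerSym_eq_jacobiSym h, kroneckerSym_eq_jacobiSym h, jacobiSym.mod_left (n : ℤ)]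
    push_cast
    rfl
  · have hN : d.natAbs = 4 * m.natAbs := by omega
    have hmod : n % d.natAbs % 2 = n % 2 := Nat.mod_mod_of_dvd _ ⟨2 * m.natAbs, by omega⟩
    rcases Nat.mod_two_eq_zero_or_one n with hn | hn
    · rw [kroneckerSym_eq_zero_of_even (by omega) hn,
        kroneckerSym_eq_zero_of_even (by omega) (hmod.trans hn)]
    · have key : ∀ k : ℕ, k % 2 = 1 → kroneckerSym d k = jacobiSym m k := fun k hk => by
        have hco : Int.gcd 2 k = 1 := by
          have : Nat.Coprime 2 k := (Nat.coprime_two_left).2 (Nat.odd_iff.2 hk)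
          simpa [Int.gcd] using this
        rw [kroneckerSym_of_odd d hk, h, jacobiSym.mul_left,
          show (4 : ℤ) = 2 ^ 2 by norm_num, jacobiSym.sq_one' hco, one_mul]
      rw [key _ hn, key _ (hmod.trans hn), hN]
      exact (jacobiSym.mod_right m (Nat.odd_iff.2 hn)).symm

theorem IsFundamentalDiscriminant.kroneckerSym_mul {d : ℤ} (hd : IsFundamentalDiscriminant d)
    (m n : ℕ) : kroneckerSym d (m * n) = kroneckerSym d m * kroneckerSym d n := by
  by_cases h1 : d.natAbs = 1
  · have key : ∀ k : ℕ, kroneckerSym d k = 1 := fun k => by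
      rw [← hd.kroneckerSym_mod k, h1, Nat.mod_one, kroneckerSym_zero, if_pos h1]
    simp [key]
  · rcases eq_or_ne m 0 with rfl | hm
    · simp [kroneckerSym_zero, h1]
    rcases eq_or_ne n 0 with rfl | hn
    · simp [kroneckerSym_zero, h1]
    exact kroneckerSym_mul_of_ne_zero d hm hn

theorem kroneckerSym_eq_zero_of_not_coprime {d : ℤ} {n : ℕ} (h : ¬ n.Coprime d.natAbs) :
    kroneckerSym d n = 0 := by
  rcases eq_or_ne n 0 with rfl | hn
  · rw [kroneckerSym_zero, if_neg (by simpa using h)]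
  obtain ⟨p, hp, hpn, hpd⟩ := Nat.Prime.not_coprime_iff_dvd.1 h
  obtain ⟨k, rfl⟩ := hpn
  have hk : k ≠ 0 := by rintro rfl; simp at hn
  rw [kroneckerSym_mul_of_ne_zero d hp.ne_zero hk]
  rcases hp.eq_two_or_odd with rfl | hodd
  · rw [kroneckerSym_eq_zero_of_even (by omega) rfl, zero_mul]
  · have : NeZero p := ⟨hp.ne_zero⟩
    rw [kroneckerSym_of_odd d hodd, jacobiSym.eq_zero_iff_not_coprime.2, zero_mul]
    intro hg
    have : p ∣ Int.gcd d p := Nat.dvd_gcd hpd (by simp)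
    rw [hg] at this
    exact hp.one_lt.ne' (Nat.dvd_one.1 this)

/-- The quadratic Dirichlet character `χ_d = (d / ·)` modulo `|d|`, for a fundamental
discriminant `d`. -/
noncomputable def quadraticCharacter (d : ℤ) (hd : IsFundamentalDiscriminant d) :
    DirichletCharacter ℂ d.natAbs :=
  haveI : NeZero d.natAbs := ⟨hd.natAbs_ne_zero⟩
  { toFun := fun a => (kroneckerSym d a.val : ℂ)
    map_one' := by
      rw [ZMod.val_one_eq_one_mod, hd.kroneckerSym_mod, kroneckerSym_one, Int.cast_one]
    map_mul' := fun a b => by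
      rw [ZMod.val_mul, hd.kroneckerSym_mod, hd.kroneckerSym_mul, Int.cast_mul]
    map_nonunit' := fun a ha => by
      rw [kroneckerSym_eq_zero_of_not_coprime, Int.cast_zero]
      intro hc
      apply ha
      have := (ZMod.isUnit_iff_coprime a.val d.natAbs).2 hc
      rwa [ZMod.natCast_zmod_val] at this }

/-- `χ_d(n)` is the Kronecker symbol `(d / n)` for all `n`. -/
theorem quadraticCharacter_natCast (d : ℤ) (hd : IsFundamentalDiscriminant d) (n : ℕ) :
    quadraticCharacter d hd (n : ZMod d.natAbs) = kroneckerSym d n := by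
  change ((kroneckerSym d (n : ZMod d.natAbs).val : ℤ) : ℂ) = _
  rw [ZMod.val_natCast, hd.kroneckerSym_mod]

open Classical in
/-- The (analytically continued) Dirichlet `L`-function `L(s, χ_d)` of a fundamental discriminant
`d`; it is only used for such `d`, and set to `0` for other integers. -/
noncomputable def quadraticL (d : ℤ) (s : ℂ) : ℂ :=
  if hd : IsFundamentalDiscriminant d then
    haveI : NeZero d.natAbs := ⟨hd.natAbs_ne_zero⟩
    DirichletCharacter.LFunction (quadraticCharacter d hd) s
  else 0

/-- The generalized Riemann hypothesis for `L(s, χ_d)` for all fundamental discriminants `d`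
(including `d = 1`, where `L(s, χ_1) = ζ(s)`): every zero in the open critical strip lies on the
critical line. -/
def GRH : Prop :=
  ∀ d : ℤ, IsFundamentalDiscriminant d →
    ∀ s : ℂ, 0 < s.re → s.re < 1 → quadraticL d s = 0 → s.re = 1 / 2

open Classical in
/-- The finite set of fundamental discriminants `d` with `|d| ≤ X`. -/
noncomputable def fundamentalDiscriminants (X : ℝ) : Finset ℤ :=
  (Finset.Icc (-⌊X⌋) ⌊X⌋).filter IsFundamentalDiscriminant

theorem mem_fundamentalDiscriminants {X : ℝ} {d : ℤ} :
    d ∈ fundamentalDiscriminants X ↔ |(d : ℝ)| ≤ X ∧ IsFundamentalDiscriminant d := by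
  have h : -⌊X⌋ ≤ d ↔ -X ≤ (d : ℝ) := by
    rw [neg_le, Int.le_floor, Int.cast_neg, neg_le]
  simp only [fundamentalDiscriminants, Finset.mem_filter, Finset.mem_Icc, abs_le, Int.le_floor, h]

/-- `min {(log X)^6, 1 / |t|^6}`, with the convention `1 / 0 = ∞`, so that it equals `(log X)^6`
for `t = 0`. -/
noncomputable def shiftMin (X t : ℝ) : ℝ :=
  if t = 0 then Real.log X ^ 6 else min (Real.log X ^ 6) (1 / |t| ^ 6)

end QuadraticMoment

/-!
# The shifted fourth moment of quadratic `L`-functions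

The argument is Soundararajan's method for upper bounds of moments, on the Riemann hypothesis for the
functions `L(s, χ_d)`. Write `ℓ = log log X`.

*A conditional bound for `|L|`.* The completed function `Ξ` satisfies `|Ξ(s - c)| ≤ |Ξ(s + c)|` to
the right of the critical line: the quotient has absolute value `1` on the line by the functional
equation and has no poles, so the principle of Phragmén and Lindelöf applies (`norm_completed_le`).
Hence `Re Ξ' / Ξ ≥ 0` there, and `Re L' / L` is at least minus a multiple of the logarithm of
the conductor (`le_re_logDeriv`). No product over zeros is needed. Integrating this lower bound against the Poisson
kernel times `cos ^ 2 (u log x / 2)` bounds `-Re L' / L` from above by a Dirichlet polynomial of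
length `x` (`le_cosh_sq_mul_re`, `neg_re_logDeriv_mul_le`), and a further integration bounds `log |L|`
by a Dirichlet polynomial of length `x`, with an error `O(log X / log x)` (`norm_le_mul_exp`,
`exists_norm_quadraticL_le_exp`). Only primes and squares of primes matter in it
(`exists_shiftedValue_le`).

*Moments.* Over all integers `|d| ≤ X`, the even moments of a short sum `Σ b_p χ_d(p)` are at most
those of a sum of independent random signs, because the Jacobi symbol modulo a number that is not a
square has bounded partial sums (`sum_pow_jacobiSym_le`). The moments of random signs are
sub-Gaussian with variance `Σ b_p ^ 2`; this gives high moments (`sum_charSum_pow_le`) and a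
truncated exponential moment (`sum_coshTrunc_le`).

*The variance.* Sums `Σ_{p ≤ y} cos (t log p) / p` are `log |ζ(1 + 1 / log y + it)|` up to `O(1)`.
They are at most `log min (log X, 1 / |t|) + o(ℓ)` for small `t`, and `o(ℓ)` otherwise, by the
conditional bound applied to `ζ` (`exists_sum_cos_le`). Half the variance of the Dirichlet polynomial,
together with the squares of primes, is therefore at most
`4 ℓ + 6 log min (log X, 1 / |t₁ - t₂|) + o(ℓ)`, where `t₁`, `t₂` are the heights of the two shifts
(`exists_squareSum_add_le`).

*Conclusion.* Take `x = X ^ (1 / (η ℓ))`, so that the error is `O(η ℓ)`, and split the sum over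
primes at `y = X ^ (1 / ℓ ^ 3)`. All but `X (log X) ^ (-B)` of the discriminants have a sum over
`p ≤ y` of absolute value at most `ℓ ^ 2` and a sum over `y < p ≤ x` of absolute value at most `η ℓ`
(`eventually_card_small_le`, `eventually_card_medium_le`). On these the truncated exponential moment
gives the claim. The others are dealt with by the Cauchy–Schwarz inequality and a crude bound
`X (log X) ^ O(1)` for the second moment of the averaged quantity (`exists_sum_shiftedValue_sq_le`).
The discriminant `d = 1` contributes a value of `ζ`, for which a subconvex bound suffices.
-/

open Complex MeasureTheory Filter Topology Set

namespace QuadraticMoment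

/-! ### The Poisson integral in a half-plane -/

/-- The Poisson kernel `v / (v ^ 2 + u ^ 2)` of the right half-plane, up to the factor `π`. -/
noncomputable def poissonH (v u : ℝ) : ℝ := v / (v ^ 2 + u ^ 2)

theorem poissonH_pos {v : ℝ} (hv : 0 < v) (u : ℝ) : 0 < poissonH v u := by
  unfold poissonH; positivity

theorem poissonH_neg (v u : ℝ) : poissonH v (-u) = poissonH v u := by
  simp [poissonH]

theorem continuous_poissonH {v : ℝ} (hv : 0 < v) : Continuous (poissonH v) := by
  unfold poissonH
  exact continuous_const.div (by fun_prop) fun u => by positivity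

theorem poissonH_mul_sqrt_le {v : ℝ} (hv : 0 < v) (u : ℝ) :
    poissonH v u * Real.sqrt (1 + |u|) ≤ (v * (2 / v ^ 2 + 2)) * (1 + ‖u‖) ^ (-(3 / 2 : ℝ)) := by
  have h1 : (0 : ℝ) < 1 + |u| := by positivity
  have e : (1 + |u|) ^ (-(3 / 2 : ℝ)) = Real.sqrt (1 + |u|) / (1 + |u|) ^ 2 := by
    rw [Real.sqrt_eq_rpow, ← Real.rpow_natCast, ← Real.rpow_sub h1]; norm_num
  rw [Real.norm_eq_abs, e, mul_div_assoc', le_div_iff₀ (by positivity), mul_right_comm]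
  refine mul_le_mul_of_nonneg_right ?_ (Real.sqrt_nonneg _)
  unfold poissonH
  rw [div_mul_eq_mul_div, div_le_iff₀ (by positivity)]
  have h2 : (1 + |u|) ^ 2 ≤ 2 + 2 * u ^ 2 := by nlinarith [sq_nonneg (1 - |u|), sq_abs u]
  have h3 : (2 / v ^ 2 + 2) * (v ^ 2 + u ^ 2) = 2 + 2 * u ^ 2 + (2 * u ^ 2 / v ^ 2 + 2 * v ^ 2) := by
    field_simp; ring
  have h4 : 0 ≤ 2 * u ^ 2 / v ^ 2 + 2 * v ^ 2 := by positivity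
  have : v * (1 + |u|) ^ 2 ≤ v * ((2 / v ^ 2 + 2) * (v ^ 2 + u ^ 2)) :=
    mul_le_mul_of_nonneg_left (by linarith) hv.le
  linarith

theorem integrable_poissonH_mul_sqrt {v : ℝ} (hv : 0 < v) :
    Integrable fun u => poissonH v u * Real.sqrt (1 + |u|) := by
  have h := (integrable_one_add_norm (E := ℝ) (μ := volume) (r := 3 / 2) (by simp; norm_num)).const_mul
    (v * (2 / v ^ 2 + 2))
  refine h.mono' ?_ (Eventually.of_forall fun u => ?_)
  · exact ((continuous_poissonH hv).mul (by fun_prop)).aestronglyMeasurable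
  · rw [Real.norm_of_nonneg (mul_nonneg (poissonH_pos hv u).le (Real.sqrt_nonneg _))]
    exact poissonH_mul_sqrt_le hv u

theorem integrable_poissonH_smul {v : ℝ} (hv : 0 < v) {g : ℝ → ℂ} (hg : Continuous g) {B : ℝ}
    (hB : ∀ u, ‖g u‖ ≤ B * Real.sqrt (1 + |u|)) :
    Integrable fun u => (poissonH v u : ℂ) * g u := by
  refine ((integrable_poissonH_mul_sqrt hv).const_mul B).mono' ?_ (Eventually.of_forall fun u => ?_)
  · exact ((continuous_ofReal.comp (continuous_poissonH hv)).mul hg).aestronglyMeasurable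
  · rw [norm_mul, norm_real, Real.norm_of_nonneg (poissonH_pos hv u).le]
    nlinarith [hB u, poissonH_pos hv u]

theorem integrable_poissonH {v : ℝ} (hv : 0 < v) : Integrable (poissonH v) := by
  refine (integrable_poissonH_mul_sqrt hv).mono' (continuous_poissonH hv).aestronglyMeasurable
    (Eventually.of_forall fun u => ?_)
  rw [Real.norm_of_nonneg (poissonH_pos hv u).le]
  have : 1 ≤ Real.sqrt (1 + |u|) := Real.one_le_sqrt.2 (by linarith [abs_nonneg u])
  nlinarith [poissonH_pos hv u]

theorem integral_poissonH {v : ℝ} (hv : 0 < v) : ∫ u, poissonH v u = Real.pi := by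
  have h := Measure.integral_comp_mul_left (fun x : ℝ => (1 + x ^ 2)⁻¹) v⁻¹
  rw [integral_univ_inv_one_add_sq] at h
  have e : ∀ u, poissonH v u = v⁻¹ * (1 + (v⁻¹ * u) ^ 2)⁻¹ := fun u => by
    unfold poissonH; field_simp
  simp_rw [e]
  rw [integral_const_mul, h, inv_inv, abs_of_pos hv, smul_eq_mul]
  field_simp

/-- The Poisson formula: a holomorphic function on the closed right half-plane that grows at most
like `√|w|` is the Poisson integral of its boundary values. -/
theorem integral_poissonH_mul {η : ℝ} (hη : 0 < η) {F : ℂ → ℂ}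
    (hF : DifferentiableOn ℂ F {w | -η < w.re}) {B : ℝ}
    (hB : ∀ w : ℂ, 0 ≤ w.re → ‖F w‖ ≤ B * Real.sqrt (1 + ‖w‖)) {v : ℝ} (hv : 0 < v) :
    ∫ u : ℝ, (poissonH v u : ℂ) * F (u * I) = Real.pi * F v := by
  have hopen : IsOpen {w : ℂ | -η < w.re} := isOpen_lt continuous_const continuous_re
  have hmemI : ∀ u : ℝ, ((u : ℂ) * I) ∈ {w : ℂ | -η < w.re} := fun u => by simp [hη]
  have hcont : Continuous fun u : ℝ => F (u * I) :=
    hF.continuousOn.comp_continuous (by fun_prop) hmemI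
  have hint : Integrable fun u : ℝ => (poissonH v u : ℂ) * F (u * I) :=
    integrable_poissonH_smul hv hcont fun u => by simpa using hB (u * I) (by simp)
  have hint2 : Integrable fun u : ℝ => (poissonH v u : ℂ) * F v :=
    ((integrable_poissonH hv).ofReal).mul_const _
  have hvmem : (v : ℂ) ∈ {w : ℂ | -η < w.re} := by simp; linarith
  -- `R` is holomorphic for `Re w ≥ 0`, has the boundary values `poissonH v u * (F (iu) - F v)` and
  -- is `O(|w| ^ (-3 / 2))`, so its integral along the imaginary axis vanishes
  set R : ℂ → ℂ := fun w => -(dslope F v w * (v / (v + w))) with hR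
  have hRd : DifferentiableOn ℂ R {w : ℂ | 0 ≤ w.re} := by
    have h1 : DifferentiableOn ℂ (dslope F v) {w | -η < w.re} :=
      (differentiableOn_dslope (hopen.mem_nhds hvmem)).2 hF
    refine ((h1.mono fun w (hw : 0 ≤ w.re) => ?_).mul
      (DifferentiableOn.div (by fun_prop) (by fun_prop) ?_)).neg
    · simp only [Set.mem_ofPred_eq]; linarith
    · intro w (hw : 0 ≤ w.re) h0
      have := congrArg Complex.re h0
      simp at this; linarith
  have hRI : ∀ u : ℝ, R (u * I) = (poissonH v u : ℂ) * F (u * I) - (poissonH v u : ℂ) * F v := by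
    intro u
    have hne : (u : ℂ) * I ≠ v := fun h => by
      have := congrArg Complex.re h; simp at this; linarith
    have h1 : (v : ℂ) + u * I ≠ 0 := fun h => by
      have := congrArg Complex.re h; simp at this; linarith
    have h2 : (u : ℂ) * I - v ≠ 0 := sub_ne_zero.2 hne
    have h3 : (v : ℂ) ^ 2 + u ^ 2 = -((v + u * I) * (u * I - v)) := by
      linear_combination (u : ℂ) ^ 2 * I_sq
    simp only [hR, dslope_of_ne _ hne, slope_def_field, poissonH]
    push_cast
    rw [h3]
    field_simp
    ring
  have hRint : Integrable fun u : ℝ => R (u * I) := by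
    simp_rw [hRI]; exact hint.sub hint2
  have hB0 : 0 ≤ B := by
    have := (norm_nonneg _).trans (hB 0 (by simp)); simpa using this
  -- the bound for `R` on the three far sides of the rectangle
  have hRb : ∀ T : ℝ, 2 * v + 1 ≤ T → ∀ w : ℂ, 0 ≤ w.re → T ≤ ‖w‖ → ‖w‖ ≤ 2 * T →
      ‖R w‖ ≤ v * (B * Real.sqrt (1 + 2 * T) + ‖F v‖) * 4 / T ^ 2 := by
    intro T hT w hw h1 h2
    have hT0 : 0 < T := by linarith
    have hne : w ≠ v := by
      rintro rfl
      rw [norm_real, Real.norm_of_nonneg hv.le] at h1; linarith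
    have hv' : ‖(v : ℂ)‖ = v := by rw [norm_real, Real.norm_of_nonneg hv.le]
    have h3 : T / 2 ≤ ‖w - v‖ := by
      have := norm_sub_norm_le w (v : ℂ); rw [hv'] at this; linarith
    have h4 : T / 2 ≤ ‖(v : ℂ) + w‖ := by
      have := norm_sub_norm_le w (-(v : ℂ)); rw [norm_neg, hv'] at this
      rw [sub_neg_eq_add, add_comm w] at this; linarith
    have h5 : ‖F w - F v‖ ≤ B * Real.sqrt (1 + 2 * T) + ‖F v‖ := by
      refine (norm_sub_le _ _).trans (add_le_add_left ((hB w hw).trans ?_) _)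
      gcongr
    simp only [hR, dslope_of_ne _ hne, slope_def_field, norm_neg, norm_mul, norm_div, hv']
    calc ‖F w - F v‖ / ‖w - v‖ * (v / ‖(v : ℂ) + w‖)
        ≤ (B * Real.sqrt (1 + 2 * T) + ‖F v‖) / (T / 2) * (v / (T / 2)) := by gcongr
      _ = _ := by field_simp; ring
  have hmain : ∀ T : ℝ, 2 * v + 1 ≤ T → ‖∫ y in (-T)..T, R (y * I)‖ ≤
      (v * (B * Real.sqrt (1 + 2 * T) + ‖F v‖) * 4 / T ^ 2) * (4 * T) := by
    intro T hT
    have hT0 : 0 < T := by linarith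
    have hrect := integral_boundary_rect_eq_zero_of_differentiableOn R (⟨0, -T⟩ : ℂ) ⟨T, T⟩
      (hRd.mono fun w hw => by
        rw [mem_reProdIm] at hw
        have := hw.1
        simp only [uIcc_of_le hT0.le] at this
        exact this.1)
    simp only [ofReal_zero, zero_add, smul_eq_mul] at hrect
    set b := v * (B * Real.sqrt (1 + 2 * T) + ‖F v‖) * 4 / T ^ 2
    have hnorm : ∀ a c : ℝ, |a| ≤ T → |c| ≤ T → (T ≤ |a| ∨ T ≤ |c|) → 0 ≤ a →
        ‖R (a + c * I)‖ ≤ b := by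
      intro a c ha hc hac ha0
      have e1 : ((a : ℂ) + c * I).re = a := by simp
      have e2 : ((a : ℂ) + c * I).im = c := by simp
      refine hRb T hT _ (by rw [e1]; exact ha0) ?_ ?_
      · rcases hac with h | h
        · have := abs_re_le_norm ((a : ℂ) + c * I); rw [e1] at this; linarith
        · have := abs_im_le_norm ((a : ℂ) + c * I); rw [e2] at this; linarith
      · have := norm_le_abs_re_add_abs_im ((a : ℂ) + c * I); rw [e1, e2] at this; linarith
    have i1 : ‖∫ x in (0 : ℝ)..T, R (x + ((-T : ℝ) : ℂ) * I)‖ ≤ b * |T - 0| :=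
      intervalIntegral.norm_integral_le_of_norm_le_const fun x hx => by
        rw [uIoc_of_le hT0.le] at hx
        exact hnorm x (-T) (by rw [abs_of_pos hx.1]; exact hx.2) (by rw [abs_neg, abs_of_pos hT0])
          (Or.inr (by rw [abs_neg, abs_of_pos hT0])) hx.1.le
    have i2 : ‖∫ x in (0 : ℝ)..T, R (x + (T : ℂ) * I)‖ ≤ b * |T - 0| :=
      intervalIntegral.norm_integral_le_of_norm_le_const fun x hx => by
        rw [uIoc_of_le hT0.le] at hx
        exact hnorm x T (by rw [abs_of_pos hx.1]; exact hx.2) (by rw [abs_of_pos hT0])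
          (Or.inr (by rw [abs_of_pos hT0])) hx.1.le
    have i3 : ‖∫ y in (-T)..T, R ((T : ℂ) + y * I)‖ ≤ b * |T - -T| :=
      intervalIntegral.norm_integral_le_of_norm_le_const fun y hy => by
        rw [uIoc_of_le (by linarith)] at hy
        exact hnorm T y (by rw [abs_of_pos hT0]) (abs_le.2 ⟨hy.1.le, hy.2⟩)
          (Or.inl (by rw [abs_of_pos hT0])) hT0.le
    rw [sub_zero, abs_of_pos hT0] at i1 i2
    rw [show T - -T = 2 * T by ring, abs_of_pos (by linarith)] at i3
    have e : I * (∫ y in (-T)..T, R (y * I)) =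
        (∫ x in (0 : ℝ)..T, R (x + ((-T : ℝ) : ℂ) * I)) - (∫ x in (0 : ℝ)..T, R (x + (T : ℂ) * I))
          + I * ∫ y in (-T)..T, R ((T : ℂ) + y * I) := by
      linear_combination -hrect
    have e2 : ‖∫ y in (-T)..T, R (y * I)‖ = ‖I * ∫ y in (-T)..T, R (y * I)‖ := by simp
    rw [e2, e]
    refine (norm_add_le _ _).trans ((add_le_add (norm_sub_le _ _) le_rfl).trans ?_)
    rw [norm_mul, norm_I, one_mul]
    linarith
  have hlim : Tendsto (fun T : ℝ => ∫ y in (-T)..T, R (y * I)) atTop (𝓝 (∫ y : ℝ, R (y * I))) :=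
    intervalIntegral_tendsto_integral hRint tendsto_neg_atTop_atBot tendsto_id
  have hlim0 : Tendsto (fun T : ℝ => ∫ y in (-T)..T, R (y * I)) atTop (𝓝 0) := by
    have hb : Tendsto (fun T : ℝ => 16 * v * (B * (2 * T ^ (-(1 / 2) : ℝ)) + ‖F v‖ * T⁻¹))
        atTop (𝓝 (16 * v * (B * (2 * 0) + ‖F v‖ * 0))) :=
      ((((tendsto_rpow_neg_atTop (by norm_num : (0 : ℝ) < 1 / 2)).const_mul 2).const_mul B).add
        (tendsto_inv_atTop_zero.const_mul _)).const_mul _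
    rw [show 16 * v * (B * (2 * 0) + ‖F v‖ * 0) = (0 : ℝ) by ring] at hb
    refine squeeze_zero_norm' ?_ hb
    filter_upwards [eventually_ge_atTop (2 * v + 1)] with T hT
    refine (hmain T hT).trans ?_
    have hT0 : 0 < T := by linarith
    have hs : Real.sqrt (1 + 2 * T) ≤ 2 * T * T ^ (-(1 / 2) : ℝ) := by
      rw [mul_assoc, ← Real.rpow_one_add' hT0.le (by norm_num)]
      norm_num
      rw [← Real.sqrt_eq_rpow, Real.sqrt_le_left (by positivity), mul_pow, Real.sq_sqrt hT0.le]
      linarith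
    have : v * (B * Real.sqrt (1 + 2 * T) + ‖F v‖) * 4 / T ^ 2 * (4 * T) =
      16 * v * (B * (Real.sqrt (1 + 2 * T) / T) + ‖F v‖ * T⁻¹) := by field_simp; ring
    rw [this]
    have h6 : Real.sqrt (1 + 2 * T) / T ≤ 2 * T ^ (-(1 / 2) : ℝ) := by
      rw [div_le_iff₀ hT0]; linarith
    gcongr
  have h0 := tendsto_nhds_unique hlim hlim0
  simp_rw [hRI] at h0
  rw [integral_sub hint hint2, sub_eq_zero] at h0
  rw [h0, integral_mul_const, integral_complex_ofReal, integral_poissonH hv]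

theorem norm_exp_neg_mul_le_one {c : ℝ} (hc : 0 ≤ c) {w : ℂ} (hw : 0 ≤ w.re) :
    ‖exp (-(c * w))‖ ≤ 1 := by
  rw [norm_exp, Real.exp_le_one_iff]
  simp only [neg_re, re_ofReal_mul]
  nlinarith

theorem one_le_sqrt_one_add_norm (w : ℂ) : 1 ≤ Real.sqrt (1 + ‖w‖) :=
  Real.one_le_sqrt.2 (by linarith [norm_nonneg w])

/-- The function `e ^ (-cw)` is bounded in the right half-plane, so the Poisson formula applies. -/
theorem integral_poissonH_exp_neg {c : ℝ} (hc : 0 ≤ c) {v : ℝ} (hv : 0 < v) :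
    ∫ u : ℝ, (poissonH v u : ℂ) * exp (-(c * (u * I))) = Real.pi * exp (-(c * v)) :=
  integral_poissonH_mul (F := fun w => exp (-(c * w))) one_pos (by fun_prop) (B := 1)
    (fun w hw => by
      rw [one_mul]
      exact (norm_exp_neg_mul_le_one hc hw).trans (one_le_sqrt_one_add_norm w)) hv

/-- The kernel is even, so the sign of the frequency does not matter: the value is the decaying
exponential again, not the continuation `e ^ (cw)` of the boundary values. -/
theorem integral_poissonH_exp {c : ℝ} (hc : 0 ≤ c) {v : ℝ} (hv : 0 < v) :
    ∫ u : ℝ, (poissonH v u : ℂ) * exp (c * (u * I)) = Real.pi * exp (-(c * v)) := by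
  rw [← integral_poissonH_exp_neg hc hv, ← integral_neg_eq_self]
  refine integral_congr_ae (Eventually.of_forall fun u => ?_)
  simp only [poissonH_neg]
  push_cast
  ring_nf

theorem integrable_poissonH_exp (c : ℝ) {v : ℝ} (hv : 0 < v) :
    Integrable fun u : ℝ => (poissonH v u : ℂ) * exp (c * (u * I)) :=
  integrable_poissonH_smul hv (by fun_prop) (B := 1) fun u => by
    have : (c : ℂ) * (u * I) = ((c * u : ℝ) : ℂ) * I := by push_cast; ring
    rw [this, norm_exp_ofReal_mul_I, one_mul]
    exact Real.one_le_sqrt.2 (by linarith [abs_nonneg u])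

/-- The real part of the Poisson formula for `log (1 + w)`. -/
theorem integrable_poissonH_log {v : ℝ} (hv : 0 < v) :
    Integrable (fun u : ℝ => poissonH v u * Real.log ‖1 + u * I‖) ∧
      ∫ u : ℝ, poissonH v u * Real.log ‖1 + u * I‖ = Real.pi * Real.log (1 + v) := by
  have hd : DifferentiableOn ℂ (fun w => log (1 + w)) {w : ℂ | -1 < w.re} := by
    intro w (hw : -1 < w.re)
    refine (DifferentiableAt.clog (by fun_prop) (Or.inl ?_)).differentiableWithinAt
    simp; linarith
  have hb : ∀ w : ℂ, 0 ≤ w.re → ‖log (1 + w)‖ ≤ (2 + Real.pi) * Real.sqrt (1 + ‖w‖) := by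
    intro w hw
    have h1 : 1 ≤ ‖1 + w‖ := by
      have := re_le_norm (1 + w); simp at this; linarith
    have h2 : ‖1 + w‖ ≤ 1 + ‖w‖ := by simpa using norm_add_le 1 w
    have h3 := Real.log_le_rpow_div (norm_nonneg (1 + w)) (by norm_num : (0 : ℝ) < 1 / 2)
    rw [← Real.sqrt_eq_rpow] at h3
    have h4 : Real.sqrt ‖1 + w‖ ≤ Real.sqrt (1 + ‖w‖) := Real.sqrt_le_sqrt h2
    have h5 : ‖log (1 + w)‖ ≤ Real.log ‖1 + w‖ + Real.pi := by
      refine (norm_le_abs_re_add_abs_im _).trans (add_le_add ?_ ?_)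
      · rw [log_re, abs_of_nonneg (Real.log_nonneg h1)]
      · rw [log_im]; exact abs_arg_le_pi _
    have h6 := one_le_sqrt_one_add_norm w
    nlinarith [Real.pi_pos]
  have hi : Integrable fun u : ℝ => (poissonH v u : ℂ) * log (1 + u * I) :=
    integrable_poissonH_smul hv
      (hd.continuousOn.comp_continuous (f := fun u : ℝ => (u : ℂ) * I) (by fun_prop)
        fun u => by simp) fun u => by simpa using hb (u * I) (by simp)
  have e : ∀ u : ℝ, ((poissonH v u : ℂ) * log (1 + u * I)).re
      = poissonH v u * Real.log ‖1 + u * I‖ := fun u => by rw [re_ofReal_mul, log_re]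
  have h := integral_poissonH_mul one_pos hd hb hv
  constructor
  · have h3 := hi.re
    simpa only [RCLike.re_to_complex, e] using h3
  · have h2 := integral_re hi
    simp only [RCLike.re_to_complex, e] at h2
    have e3 : (Real.pi * log (1 + v) : ℂ).re = Real.pi * Real.log (1 + v) := by
      rw [re_ofReal_mul, log_re]
      norm_cast
      rw [Real.norm_of_nonneg (by linarith)]
    rw [h2, h, e3]

/-- The truncation inequality behind the bounds for `L`-functions.  If `Re f` is bounded below on
the imaginary axis, then integrating `Re f` there against the nonnegative kernel
`v / (v ^ 2 + u ^ 2) * cos ^ 2 (u log x / 2)` gives a nonnegative quantity, up to the stated error,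
and `4 cos ^ 2 (u log x / 2) = 2 + x ^ (iu) + x ^ (-iu)` turns the integral into `f v` and a
Dirichlet polynomial of length `x`: this is where the sum approximating `-f` is truncated.
The function `E` compensates for a pole of the Dirichlet series. -/
theorem le_cosh_sq_mul_re {η : ℝ} (hη : 0 < η) {f E : ℂ → ℂ}
    (hf : DifferentiableOn ℂ f {w | -η < w.re}) (hE : DifferentiableOn ℂ E {w | -η < w.re})
    {B : ℝ} (hfB : ∀ w : ℂ, 0 ≤ w.re → ‖f w‖ ≤ B * Real.sqrt (1 + ‖w‖))
    {x : ℝ} (hx : 1 ≤ x) (a : ℕ → ℂ) {B' : ℝ}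
    (hFB : ∀ w : ℂ, 0 ≤ w.re → ‖exp (Real.log x * w) *
      (f w + ∑ n ∈ Finset.Icc 1 ⌊x⌋₊, a n * exp (-(Real.log n * w))) + E w‖
        ≤ B' * Real.sqrt (1 + ‖w‖))
    {M : ℝ} (hM : 0 ≤ M) (hpos : ∀ u : ℝ, -(M + Real.log ‖1 + u * I‖) ≤ (f (u * I)).re)
    {K : ℝ} (hEI : ∀ u : ℝ, ‖E (u * I)‖ ≤ K) {v : ℝ} (hv : 0 < v) (hEv : ‖E v‖ ≤ K) :
    -(M + Real.log (1 + v) + K / 2 +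
      (∑ n ∈ Finset.Icc 1 ⌊x⌋₊, a n * (Real.sinh (v * Real.log (x / n)) : ℂ)).re / 2)
      ≤ Real.cosh (v * Real.log x / 2) ^ 2 * (f v).re := by
  set Δ := Real.log x with hΔ
  have hΔ0 : 0 ≤ Δ := Real.log_nonneg hx
  set s := Finset.Icc 1 ⌊x⌋₊ with hs
  have hlog : ∀ n ∈ s, 0 ≤ Δ - Real.log n ∧ Real.log (x / n) = Δ - Real.log n := by
    intro n hn
    rw [hs, Finset.mem_Icc] at hn
    have h1 : (1 : ℝ) ≤ n := by exact_mod_cast hn.1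
    have h2 : (n : ℝ) ≤ x := (Nat.le_floor_iff (by linarith)).1 hn.2
    refine ⟨sub_nonneg.2 (Real.log_le_log (by linarith) h2), ?_⟩
    rw [Real.log_div (by linarith) (by linarith)]
  have hmemI : ∀ u : ℝ, ((u : ℂ) * I) ∈ {w : ℂ | -η < w.re} := fun u => by simp [hη]
  have hfc : Continuous fun u : ℝ => f (u * I) :=
    hf.continuousOn.comp_continuous (by fun_prop) hmemI
  have hEc : Continuous fun u : ℝ => E (u * I) :=
    hE.continuousOn.comp_continuous (by fun_prop) hmemI
  have hone : ∀ u : ℝ, 1 ≤ Real.sqrt (1 + |u|) := fun u =>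
    Real.one_le_sqrt.2 (by linarith [abs_nonneg u])
  have hfI : ∀ u : ℝ, ‖f (u * I)‖ ≤ B * Real.sqrt (1 + |u|) := fun u => by
    simpa using hfB (u * I) (by simp)
  have hK0 : 0 ≤ K := (norm_nonneg _).trans hEv
  have if0 : Integrable fun u : ℝ => (poissonH v u : ℂ) * f (u * I) :=
    integrable_poissonH_smul hv hfc hfI
  have hnexp : ∀ c u : ℝ, ‖exp (c * (u * I))‖ = 1 := fun c u => by
    have : (c : ℂ) * (u * I) = ((c * u : ℝ) : ℂ) * I := by push_cast; ring
    rw [this, norm_exp_ofReal_mul_I]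
  have ifm : Integrable fun u : ℝ => (poissonH v u : ℂ) * (exp (-(Δ * (u * I))) * f (u * I)) :=
    integrable_poissonH_smul hv (Continuous.mul (by fun_prop) hfc) (B := B) fun u => by
      have := hnexp (-Δ) u
      rw [norm_mul]
      push_cast at this
      rw [neg_mul] at this
      rw [this, one_mul]; exact hfI u
  have ifp : Integrable fun u : ℝ => (poissonH v u : ℂ) * (exp (Δ * (u * I)) * f (u * I)) :=
    integrable_poissonH_smul hv (Continuous.mul (by fun_prop) hfc) (B := B) fun u => by
      rw [norm_mul, hnexp, one_mul]; exact hfI u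
  have iE : Integrable fun u : ℝ => (poissonH v u : ℂ) * E (u * I) :=
    integrable_poissonH_smul hv hEc (B := K) fun u => by nlinarith [hEI u, hone u]
  set F : ℂ → ℂ := fun w => exp (Δ * w) * (f w + ∑ n ∈ s, a n * exp (-(Real.log n * w))) + E w
    with hF
  have hFd : DifferentiableOn ℂ F {w | -η < w.re} := by
    refine (DifferentiableOn.mul (by fun_prop) (hf.add ?_)).add hE
    exact DifferentiableOn.fun_sum fun n _ => by fun_prop
  have iF : Integrable fun u : ℝ => (poissonH v u : ℂ) * F (u * I) :=
    integrable_poissonH_smul hv (hFd.continuousOn.comp_continuous (by fun_prop) hmemI)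
      (B := B') fun u => (hFB (u * I) (by simp)).trans_eq (by simp)
  have p0 := integral_poissonH_mul hη hf hfB hv
  have pm : ∫ u : ℝ, (poissonH v u : ℂ) * (exp (-(Δ * (u * I))) * f (u * I)) =
      Real.pi * (exp (-(Δ * v)) * f v) := by
    refine integral_poissonH_mul (F := fun w => exp (-(Δ * w)) * f w) (B := B) hη
      (DifferentiableOn.mul (by fun_prop) hf) (fun w hw => ?_) hv
    rw [norm_mul]
    have h1 := norm_exp_neg_mul_le_one hΔ0 hw
    have h2 := hfB w hw
    nlinarith [norm_nonneg (f w)]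
  have pF := integral_poissonH_mul hη hFd hFB hv
  -- `x ^ w f w` grows too fast for the Poisson formula. It is applied to `F`, which differs from
  -- `x ^ w f w` on the imaginary axis by `E` and the terms `a n * (x / n) ^ (iu)`. These
  -- integrate to `(n / x) ^ v`, whereas `F v` contains `(x / n) ^ v`: the difference is a `sinh`.
  have pp : ∫ u : ℝ, (poissonH v u : ℂ) * (exp (Δ * (u * I)) * f (u * I)) =
      Real.pi * (exp (Δ * v) * f v + 2 * ∑ n ∈ s, a n * (Real.sinh (v * Real.log (x / n)) : ℂ)
        + E v) - ∫ u : ℝ, (poissonH v u : ℂ) * E (u * I) := by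
    have e : ∀ u : ℝ, (poissonH v u : ℂ) * (exp (Δ * (u * I)) * f (u * I)) =
        (poissonH v u : ℂ) * F (u * I) - ∑ n ∈ s, a n * ((poissonH v u : ℂ) *
          exp (((Δ - Real.log n : ℝ) : ℂ) * (u * I))) - (poissonH v u : ℂ) * E (u * I) := by
      intro u
      have h1 : ∑ n ∈ s, a n * ((poissonH v u : ℂ) *
          exp (((Δ - Real.log n : ℝ) : ℂ) * (u * I))) =
          (poissonH v u : ℂ) * (exp (Δ * (u * I)) *
            ∑ n ∈ s, a n * exp (-(Real.log n * (u * I)))) := by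
        rw [Finset.mul_sum, Finset.mul_sum]
        refine Finset.sum_congr rfl fun n _ => ?_
        have : ((Δ - Real.log n : ℝ) : ℂ) * (u * I) = Δ * (u * I) + -(Real.log n * (u * I)) := by
          push_cast; ring
        rw [this, exp_add]; ring
      rw [h1, hF]; ring
    have isum : ∀ n ∈ s, Integrable fun u : ℝ => a n * ((poissonH v u : ℂ) *
          exp (((Δ - Real.log n : ℝ) : ℂ) * (u * I))) := fun n _ =>
      (integrable_poissonH_exp _ hv).const_mul _
    simp_rw [e]
    have isub : Integrable fun u : ℝ => (poissonH v u : ℂ) * F (u * I) -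
        ∑ n ∈ s, a n * ((poissonH v u : ℂ) * exp (((Δ - Real.log n : ℝ) : ℂ) * (u * I))) :=
      iF.sub (integrable_finsetSum _ isum)
    rw [integral_sub isub iE, integral_sub iF (integrable_finsetSum _ isum), integral_finsetSum _ isum, pF, hF]
    congr 1
    have h2 : ∑ n ∈ s, ∫ u : ℝ, a n * ((poissonH v u : ℂ) *
          exp (((Δ - Real.log n : ℝ) : ℂ) * (u * I))) =
        Real.pi * ∑ n ∈ s, a n * exp (-(((Δ - Real.log n : ℝ) : ℂ) * v)) := by
      rw [Finset.mul_sum]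
      refine Finset.sum_congr rfl fun n hn => ?_
      rw [integral_const_mul, integral_poissonH_exp (hlog n hn).1 hv]; ring
    rw [h2, ← mul_sub]
    congr 1
    have h3 : 2 * ∑ n ∈ s, a n * (Real.sinh (v * Real.log (x / n)) : ℂ) =
        exp (Δ * v) * ∑ n ∈ s, a n * exp (-(Real.log n * v)) -
          ∑ n ∈ s, a n * exp (-(((Δ - Real.log n : ℝ) : ℂ) * v)) := by
      rw [Finset.mul_sum, Finset.mul_sum, ← Finset.sum_sub_distrib]
      refine Finset.sum_congr rfl fun n hn => ?_
      rw [(hlog n hn).2, ofReal_sinh, Complex.sinh]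
      simp only [ofReal_mul, ofReal_sub]
      have h4 : (v : ℂ) * (Δ - Real.log n) = Δ * v + -(Real.log n * v) := by ring
      have h5 : -((v : ℂ) * (Δ - Real.log n)) = -((Δ - Real.log n) * v) := by ring
      rw [h5, h4, exp_add]
      ring
    rw [h3]; ring
  -- assemble the integral against `cos ^ 2`
  have hcos : ∀ u : ℝ, (poissonH v u * Real.cos (Δ * u / 2) ^ 2 : ℝ) * f (u * I) =
      (1 / 2 : ℂ) * ((poissonH v u : ℂ) * f (u * I)) +
      ((1 / 4 : ℂ) * ((poissonH v u : ℂ) * (exp (-(Δ * (u * I))) * f (u * I))) +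
       (1 / 4 : ℂ) * ((poissonH v u : ℂ) * (exp (Δ * (u * I)) * f (u * I)))) := by
    intro u
    have h1 : ((Real.cos (Δ * u / 2) ^ 2 : ℝ) : ℂ) =
        1 / 2 + 1 / 4 * (exp (Δ * (u * I)) + exp (-(Δ * (u * I)))) := by
      rw [Real.cos_sq]
      push_cast
      rw [Complex.cos]
      have h2 : (2 : ℂ) * (Δ * u / 2) * I = Δ * (u * I) := by ring
      have h3 : -((2 : ℂ) * (Δ * u / 2)) * I = -(Δ * (u * I)) := by ring
      rw [h2, h3]; ring
    rw [ofReal_mul, h1]; ring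
  have hint : ∫ u : ℝ, (poissonH v u * Real.cos (Δ * u / 2) ^ 2 : ℝ) * f (u * I) =
      Real.pi * ((Real.cosh (v * Δ / 2) ^ 2 : ℝ) * f v +
        1 / 2 * (∑ n ∈ s, a n * (Real.sinh (v * Real.log (x / n)) : ℂ)) + 1 / 4 * E v)
        - 1 / 4 * ∫ u : ℝ, (poissonH v u : ℂ) * E (u * I) := by
    simp_rw [hcos]
    have hsplit : Integrable fun u : ℝ =>
        (1 / 4 : ℂ) * ((poissonH v u : ℂ) * (exp (-(Δ * (u * I))) * f (u * I))) +
        (1 / 4 : ℂ) * ((poissonH v u : ℂ) * (exp (Δ * (u * I)) * f (u * I))) :=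
      (ifm.const_mul (1 / 4 : ℂ)).add (ifp.const_mul (1 / 4 : ℂ))
    rw [integral_add (if0.const_mul _) hsplit,
      integral_add (ifm.const_mul _) (ifp.const_mul _), integral_const_mul, integral_const_mul,
      integral_const_mul, p0, pm, pp]
    have h1 : ((Real.cosh (v * Δ / 2) ^ 2 : ℝ) : ℂ) =
        1 / 2 + 1 / 4 * (exp (Δ * v) + exp (-(Δ * v))) := by
      have h2 : Real.cosh (v * Δ / 2) ^ 2 = 1 / 2 + Real.cosh (v * Δ) / 2 := by
        have := Real.cosh_sq (v * Δ / 2)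
        have h3 := Real.cosh_two_mul (v * Δ / 2)
        rw [show 2 * (v * Δ / 2) = v * Δ by ring] at h3
        linarith
      rw [h2]
      push_cast
      rw [Complex.cosh, mul_comm (v : ℂ)]; ring
    rw [h1]; ring
  have hgi : Integrable fun u : ℝ => ((poissonH v u * Real.cos (Δ * u / 2) ^ 2 : ℝ) : ℂ) * f (u * I) := by
    simp_rw [hcos]
    exact (if0.const_mul _).add ((ifm.const_mul _).add (ifp.const_mul _))
  obtain ⟨il, el⟩ := integrable_poissonH_log hv
  have hre := integral_re hgi
  rw [hint] at hre
  -- the lower bound for `Re f` is negative, so the factor `cos ^ 2 ≤ 1` can be dropped from it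
  have hlow : -(Real.pi * (M + Real.log (1 + v))) ≤
      ∫ u : ℝ, (((poissonH v u * Real.cos (Δ * u / 2) ^ 2 : ℝ) : ℂ) * f (u * I)).re := by
    have e : -(Real.pi * (M + Real.log (1 + v))) =
        ∫ u : ℝ, -(poissonH v u * M + poissonH v u * Real.log ‖1 + u * I‖) := by
      rw [integral_neg, integral_add ((integrable_poissonH hv).mul_const M) il, integral_mul_const,
        integral_poissonH hv, el]; ring
    rw [e]
    refine integral_mono ((((integrable_poissonH hv).mul_const M).add il).neg) hgi.re fun u => ?_
    simp only [re_ofReal_mul]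
    have h1 : 0 ≤ Real.log ‖1 + u * I‖ := Real.log_nonneg (by
      have := re_le_norm (1 + u * I); simpa using this)
    have h2 := Real.cos_sq_le_one (Δ * u / 2)
    have h3 := sq_nonneg (Real.cos (Δ * u / 2))
    have h4 := poissonH_pos hv u
    have h5 : -(M + Real.log ‖1 + u * I‖) ≤
        Real.cos (Δ * u / 2) ^ 2 * (f (u * I)).re := by
      nlinarith [hpos u, mul_le_mul_of_nonneg_left (hpos u) h3]
    nlinarith [mul_le_mul_of_nonneg_left h5 h4.le]
  have hEint : ‖∫ u : ℝ, (poissonH v u : ℂ) * E (u * I)‖ ≤ Real.pi * K := by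
    have h1 : ∫ u, poissonH v u * K = Real.pi * K := by
      rw [integral_mul_const, integral_poissonH hv]
    rw [← h1]
    refine norm_integral_le_of_norm_le ((integrable_poissonH hv).mul_const K)
      (Eventually.of_forall fun u => ?_)
    rw [norm_mul, norm_real, Real.norm_of_nonneg (poissonH_pos hv u).le]
    exact mul_le_mul_of_nonneg_left (hEI u) (poissonH_pos hv u).le
  simp only [RCLike.re_to_complex] at hre
  rw [hre] at hlow
  rw [sub_re, re_ofReal_mul, add_re, add_re, re_ofReal_mul] at hlow
  have r1 : ∀ z : ℂ, (1 / 2 * z).re = z.re / 2 := fun z => by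
    rw [show (1 / 2 : ℂ) = ((1 / 2 : ℝ) : ℂ) by push_cast; rfl, re_ofReal_mul]; ring
  have r2 : ∀ z : ℂ, (1 / 4 * z).re = z.re / 4 := fun z => by
    rw [show (1 / 4 : ℂ) = ((1 / 4 : ℝ) : ℂ) by push_cast; rfl, re_ofReal_mul]; ring
  rw [r1, r2, r2] at hlow
  have h1 := (abs_le.1 ((abs_re_le_norm _).trans hEint)).1
  have h2 := (abs_le.1 ((abs_re_le_norm _).trans hEv)).2
  have hpi := Real.pi_pos
  have : Real.pi * -(M + Real.log (1 + v) + K / 2 +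
      (∑ n ∈ s, a n * (Real.sinh (v * Real.log (x / n)) : ℂ)).re / 2) ≤
      Real.pi * (Real.cosh (v * Δ / 2) ^ 2 * (f v).re) := by
    nlinarith
  exact le_of_mul_le_mul_left this hpi

/-! ### Gamma functions -/

/-- The quotient `Γ(s) / Γ(s + c)` is bounded on half-planes `Re s ≥ y₀ > 0`, because it is a
multiple of a beta integral, which is largest at real points. -/
theorem exists_norm_Gamma_div_le {y₀ c : ℝ} (hy : 0 < y₀) (hc : 0 < c) :
    ∃ C : ℝ, ∀ s : ℂ, y₀ ≤ s.re → ‖Gamma s / Gamma (s + c)‖ ≤ C := by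
  refine ⟨(∫ x in (0 : ℝ)..1, ‖(x : ℂ) ^ ((y₀ : ℂ) - 1) * (1 - (x : ℂ)) ^ ((c : ℂ) - 1)‖)
    / ‖Gamma (c : ℂ)‖, fun s hs => ?_⟩
  have hs0 : 0 < s.re := hy.trans_le hs
  have hc' : 0 < (c : ℂ).re := by simpa using hc
  have h1 := Gamma_mul_Gamma_eq_betaIntegral hs0 hc'
  have h2 : Gamma (c : ℂ) ≠ 0 := Gamma_ne_zero_of_re_pos hc'
  have h3 : Gamma (s + c) ≠ 0 := Gamma_ne_zero_of_re_pos (by simp; linarith)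
  have h4 : Gamma s / Gamma (s + c) = betaIntegral s c / Gamma c := by
    rw [div_eq_div_iff h3 h2, h1]; ring
  rw [h4, norm_div]
  gcongr
  unfold betaIntegral
  refine (intervalIntegral.norm_integral_le_integral_norm zero_le_one).trans ?_
  refine intervalIntegral.integral_mono_on_of_le_Ioo zero_le_one
    (betaIntegral_convergent hs0 hc').norm
    (betaIntegral_convergent (u := y₀) (by simpa using hy) hc').norm fun x hx => ?_
  rw [norm_mul, norm_mul]
  refine mul_le_mul_of_nonneg_right ?_ (norm_nonneg _)
  rw [norm_cpow_eq_rpow_re_of_pos hx.1, norm_cpow_eq_rpow_re_of_pos hx.1]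
  refine Real.rpow_le_rpow_of_exponent_ge hx.1 hx.2.le ?_
  simpa using hs

/-- The derivative of `log ‖F‖` along a horizontal line is the real part of `F' / F`. -/
theorem hasDerivAt_log_norm {F : ℂ → ℂ} {s : ℂ} {v : ℝ} (hF : DifferentiableAt ℂ F (s + v))
    (h0 : F (s + v) ≠ 0) :
    HasDerivAt (fun h : ℝ => Real.log ‖F (s + h)‖) (logDeriv F (s + v)).re v := by
  have h1 : HasDerivAt (fun h : ℝ => F (s + h) / F (s + v)) (deriv F (s + v) / F (s + v)) v := by
    have := (hF.hasDerivAt.comp_const_add s (v : ℂ)).comp_ofReal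
    exact this.div_const _
  have h2 : F (s + v) / F (s + v) ∈ slitPlane := by rw [div_self h0]; exact one_mem_slitPlane
  have h3 := h1.clog_real h2
  rw [div_self h0, div_one] at h3
  have h4 : HasDerivAt (fun h : ℝ => (log (F (s + h) / F (s + v))).re)
      (deriv F (s + v) / F (s + v)).re v :=
    (reCLM.hasFDerivAt.comp_hasDerivAt v h3)
  have h5 := h4.add_const (Real.log ‖F (s + v)‖)
  rw [← logDeriv_apply] at h5
  refine h5.congr_of_eventuallyEq ?_
  have hne : ∀ᶠ h : ℝ in 𝓝 v, F (s + h) / F (s + v) ≠ 0 := by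
    refine h1.continuousAt.eventually_ne ?_
    rw [div_self h0]; exact one_ne_zero
  filter_upwards [hne] with h hh
  have h6 : F (s + h) ≠ 0 := fun h7 => hh (by rw [h7, zero_div])
  rw [log_re, norm_div, Real.log_div (norm_ne_zero_iff.2 h6) (norm_ne_zero_iff.2 h0)]
  ring

/-- The sum is the real part of `Σ 1 / (y + j + it)`, a partial sum of the digamma series. Its terms
are at least `1 / (y + j + |t|)` once `j ≥ |t|`. -/
theorem log_sub_log_le_sum {y : ℝ} (hy : 0 < y) (t : ℝ) (N : ℕ) :
    Real.log (N + y + |t|) - Real.log (y + 2 * |t| + 1) ≤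
      ∑ j ∈ Finset.range N, (y + j) / ((y + j) ^ 2 + t ^ 2) := by
  have ht := abs_nonneg t
  have hterm : ∀ j : ℕ, 0 ≤ (y + j) / ((y + j) ^ 2 + t ^ 2) := fun j => by positivity
  induction N with
  | zero =>
    simp only [Nat.cast_zero, Finset.range_zero, Finset.sum_empty]
    have := Real.log_le_log (by linarith : 0 < 0 + y + |t|)
      (by linarith : 0 + y + |t| ≤ y + 2 * |t| + 1)
    linarith
  | succ N ih =>
    rcases lt_or_ge (N : ℝ) |t| with h | h
    · have := Real.log_le_log (by positivity : 0 < ((N + 1 : ℕ) : ℝ) + y + |t|)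
        (by push_cast; linarith : ((N + 1 : ℕ) : ℝ) + y + |t| ≤ y + 2 * |t| + 1)
      have h2 := Finset.sum_nonneg fun j (_ : j ∈ Finset.range (N + 1)) => hterm j
      linarith
    · rw [Finset.sum_range_succ]
      have hp : 0 < (N : ℝ) + y + |t| := by positivity
      have h1 : Real.log (((N + 1 : ℕ) : ℝ) + y + |t|) - Real.log (N + y + |t|) ≤
          1 / (N + y + |t|) := by
        rw [← Real.log_div (by positivity) hp.ne']
        refine (Real.log_le_sub_one_of_pos (by positivity)).trans (le_of_eq ?_)
        push_cast; field_simp; ring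
      have h2 : 1 / (N + y + |t|) ≤ (y + N) / ((y + N) ^ 2 + t ^ 2) := by
        rw [div_le_div_iff₀ hp (by positivity), ← sq_abs t]
        nlinarith
      linarith

/-- The mean value inequality in `h` for the finite products of Euler that converge to `Γ`. -/
theorem log_norm_GammaSeq_le {z : ℂ} (hz : 0 < z.re) {h : ℝ} (hh : 0 ≤ h) {n : ℕ} (hn : n ≠ 0) :
    Real.log ‖GammaSeq (z + h) n‖ - Real.log ‖GammaSeq z n‖ ≤
      h * Real.log (z.re + h + 2 * |z.im| + 1) := by
  have hn0 : (0 : ℝ) < n := by exact_mod_cast Nat.pos_of_ne_zero hn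
  have hn1 : (1 : ℝ) ≤ n := by exact_mod_cast Nat.one_le_iff_ne_zero.2 hn
  have hq : ∀ v : ℝ, 0 ≤ v → ∀ j : ℕ, z + v + j ≠ 0 := fun v hv j h0 => by
    have := congrArg re h0
    simp at this
    have : (0 : ℝ) ≤ j := j.cast_nonneg
    linarith
  have hval : ∀ v : ℝ, 0 ≤ v → Real.log ‖GammaSeq (z + v) n‖ = (z.re + v) * Real.log n +
      Real.log (n.factorial) - ∑ j ∈ Finset.range (n + 1), Real.log ‖z + j + v‖ := by
    intro v hv
    unfold GammaSeq
    have e : ∀ j : ℕ, z + j + v = z + v + j := fun j => by ring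
    simp_rw [e]
    rw [norm_div, norm_mul, norm_prod, Real.log_div, Real.log_mul, Real.log_prod,
      norm_natCast_cpow_of_pos (Nat.pos_of_ne_zero hn), Real.log_rpow hn0, norm_natCast]
    · simp
    · exact fun j _ => norm_ne_zero_iff.2 (hq v hv j)
    · rw [norm_natCast_cpow_of_pos (Nat.pos_of_ne_zero hn)]; positivity
    · rw [norm_natCast]; positivity
    · rw [norm_natCast_cpow_of_pos (Nat.pos_of_ne_zero hn), norm_natCast]; positivity
    · exact Finset.prod_ne_zero_iff.2 fun j _ => norm_ne_zero_iff.2 (hq v hv j)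
  set g : ℝ → ℝ := fun v => (z.re + v) * Real.log n +
      Real.log (n.factorial) - ∑ j ∈ Finset.range (n + 1), Real.log ‖z + j + v‖ with hg
  have hder : ∀ v : ℝ, 0 ≤ v → HasDerivAt g (Real.log n - ∑ j ∈ Finset.range (n + 1),
      (z.re + v + j) / ((z.re + v + j) ^ 2 + z.im ^ 2)) v := by
    intro v hv
    refine HasDerivAt.sub ?_ (HasDerivAt.fun_sum fun j _ => ?_)
    · have := (((hasDerivAt_id v).const_add z.re).mul_const (Real.log n)).add_const
        (Real.log n.factorial)
      simpa using this
    · have := hasDerivAt_log_norm (F := fun w => w) (s := z + j) (v := v) (by fun_prop)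
        (by have := hq v hv j; rwa [show z + j + v = z + v + j by ring])
      have e : (logDeriv (fun w : ℂ => w) (z + j + v)).re =
          (z.re + v + j) / ((z.re + v + j) ^ 2 + z.im ^ 2) := by
        rw [logDeriv_apply, deriv_id'', one_div, inv_re, normSq_apply]
        simp
        congr 1 <;> ring
      rw [e] at this
      exact this
  have hmv := Convex.image_sub_le_mul_sub_of_deriv_le (convex_Icc 0 h) (f := g)
    (C := Real.log (z.re + h + 2 * |z.im| + 1))
    (fun v hv => (hder v hv.1).continuousAt.continuousWithinAt)
    (fun v hv => by
      rw [interior_Icc] at hv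
      exact (hder v hv.1.le).differentiableAt.differentiableWithinAt)
    (fun v hv => by
      rw [interior_Icc] at hv
      rw [(hder v hv.1.le).deriv]
      have h1 := log_sub_log_le_sum (y := z.re + v) (by linarith [hv.1]) z.im (n + 1)
      have h2 : Real.log n ≤ Real.log (((n + 1 : ℕ) : ℝ) + (z.re + v) + |z.im|) :=
        Real.log_le_log hn0 (by push_cast; linarith [hv.1, abs_nonneg z.im])
      have h3 : Real.log (z.re + v + 2 * |z.im| + 1) ≤ Real.log (z.re + h + 2 * |z.im| + 1) :=
        Real.log_le_log (by linarith [hv.1, abs_nonneg z.im]) (by linarith [hv.2])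
      linarith)
    0 ⟨le_rfl, hh⟩ h ⟨hh, le_rfl⟩ hh
  have e0 := hval 0 le_rfl
  rw [ofReal_zero, add_zero] at e0
  rw [hval h hh, e0]
  simp only [hg, sub_zero] at hmv
  rw [mul_comm h]
  convert hmv using 2
  simp

theorem log_norm_Gamma_add_le {z : ℂ} (hz : 0 < z.re) {h : ℝ} (hh : 0 ≤ h) :
    Real.log ‖Gamma (z + h)‖ - Real.log ‖Gamma z‖ ≤
      h * Real.log (z.re + h + 2 * |z.im| + 1) := by
  have h1 : Gamma (z + h) ≠ 0 := Gamma_ne_zero_of_re_pos (by simp; linarith)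
  have h2 : Gamma z ≠ 0 := Gamma_ne_zero_of_re_pos hz
  have t1 := ((GammaSeq_tendsto_Gamma (z + h)).norm).log (norm_ne_zero_iff.2 h1)
  have t2 := ((GammaSeq_tendsto_Gamma z).norm).log (norm_ne_zero_iff.2 h2)
  refine le_of_tendsto (t1.sub t2) ?_
  filter_upwards [eventually_ne_atTop 0] with n hn using log_norm_GammaSeq_le hz hh hn

/-- An upper bound for the logarithmic growth of Deligne's factor `Γ_ℝ` in the horizontal
direction. -/
theorem log_norm_Gammaℝ_add_le {s : ℂ} (hs : 0 < s.re) {h : ℝ} (hh : 0 ≤ h) :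
    Real.log ‖Gammaℝ (s + h)‖ - Real.log ‖Gammaℝ s‖ ≤
      h / 2 * Real.log (s.re + h + |s.im| + 1) := by
  have hpi : (0 : ℝ) < Real.pi := Real.pi_pos
  have hval : ∀ w : ℂ, 0 < w.re → Real.log ‖Gammaℝ w‖ =
      -(w.re / 2) * Real.log Real.pi + Real.log ‖Gamma (w / 2)‖ := by
    intro w hw
    have h1 : Gamma (w / 2) ≠ 0 := Gamma_ne_zero_of_re_pos (by simpa using hw)
    rw [Gammaℝ_def, norm_mul, norm_cpow_eq_rpow_re_of_pos hpi, Real.log_mul (by positivity)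
      (norm_ne_zero_iff.2 h1), Real.log_rpow hpi]
    simp [neg_div]
  rw [hval _ hs, hval (s + h) (by simp; linarith)]
  have h1 := log_norm_Gamma_add_le (z := s / 2) (by simpa using hs) (h := h / 2) (by linarith)
  have h2 : s / 2 + ((h / 2 : ℝ) : ℂ) = (s + h) / 2 := by push_cast; ring
  rw [h2] at h1
  have h3 : (s + h).re = s.re + h := by simp
  have h4 : (s / 2).re = s.re / 2 := by simp
  have h5 : (s / 2).im = s.im / 2 := by simp
  rw [h4, h5, abs_div, abs_two] at h1
  rw [h3]
  have h6 : Real.log (s.re / 2 + h / 2 + 2 * (|s.im| / 2) + 1) ≤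
      Real.log (s.re + h + |s.im| + 1) :=
    Real.log_le_log (by have := abs_nonneg s.im; linarith) (by linarith)
  have h7 : 0 ≤ Real.log Real.pi := Real.log_nonneg (by linarith [Real.pi_gt_three])
  nlinarith [mul_le_mul_of_nonneg_left h6 (by linarith : 0 ≤ h / 2), mul_nonneg hh h7]

/-! ### Bounds for nonvanishing holomorphic functions -/

/-- A nonvanishing holomorphic function on a disc that is at most `K` times as large as at the
centre is not much smaller than at the centre either, and its logarithmic derivative is `O(log K)`
on smaller discs: the Borel–Carathéodory theorem for a branch of its logarithm. -/
theorem norm_ge_and_norm_logDeriv_le {f : ℂ → ℂ} {c : ℂ} {R r K : ℝ} (hr : 0 < r) (hrR : r < R)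
    (hf : DifferentiableOn ℂ f (Metric.ball c R)) (h0 : ∀ z ∈ Metric.ball c R, f z ≠ 0)
    (hK : 1 < K) (hfK : ∀ z ∈ Metric.ball c R, ‖f z‖ ≤ K * ‖f c‖) {z : ℂ} (hz : ‖z - c‖ ≤ r) :
    ‖f c‖ * Real.exp (-(2 * r / (R - r) * Real.log K)) ≤ ‖f z‖ ∧
      ‖logDeriv f z‖ ≤ 8 * R / (R - r) ^ 2 * Real.log K := by
  have hR : 0 < R := hr.trans hrR
  have hcb : c ∈ Metric.ball c R := Metric.mem_ball_self hR
  have hld : DifferentiableOn ℂ (logDeriv f) (Metric.ball c R) :=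
    (hf.deriv Metric.isOpen_ball).div hf h0
  obtain ⟨g₀, hg₀⟩ := hld.isExactOn_ball
  set g : ℂ → ℂ := fun w => g₀ w - g₀ c with hg
  have hgd : ∀ w ∈ Metric.ball c R, HasDerivAt g (logDeriv f w) w := fun w hw =>
    (hg₀ w hw).sub_const _
  have hgdiff : DifferentiableOn ℂ g (Metric.ball c R) := fun w hw =>
    (hgd w hw).differentiableAt.differentiableWithinAt
  have hfd : ∀ w ∈ Metric.ball c R, HasDerivAt f (deriv f w) w := fun w hw =>
    (hf.differentiableAt (Metric.isOpen_ball.mem_nhds hw)).hasDerivAt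
  have hconst : ∀ w ∈ Metric.ball c R, f w * exp (-g w) = f c := by
    intro w hw
    have hd : ∀ y ∈ Metric.ball c R, HasDerivAt (fun y => f y * exp (-g y)) 0 y := by
      intro y hy
      have := (hfd y hy).mul (hgd y hy).neg.cexp
      refine this.congr_deriv ?_
      have := h0 y hy
      rw [logDeriv_apply]
      field_simp
      ring
    have := (convex_ball c R).is_const_of_fderivWithin_eq_zero (𝕜 := ℂ)
      (f := fun y => f y * exp (-g y))
      (fun y hy => (hd y hy).differentiableAt.differentiableWithinAt)
      (fun y hy => by
        rw [fderivWithin_of_isOpen Metric.isOpen_ball hy]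
        have h1 := (hd y hy).hasFDerivAt.fderiv
        rw [h1]; ext; simp) hw hcb
    simpa [hg] using this
  have hre : ∀ w ∈ Metric.ball c R, ‖f w‖ = ‖f c‖ * Real.exp (g w).re := by
    intro w hw
    rw [← hconst w hw, norm_mul, norm_exp, mul_assoc, ← Real.exp_add]
    simp
  have hfc : 0 < ‖f c‖ := norm_pos_iff.2 (h0 c hcb)
  have hlogK : 0 < Real.log K := Real.log_pos hK
  have hgre : ∀ w ∈ Metric.ball c R, (g w).re ≤ Real.log K := by
    intro w hw
    have h1 := hfK w hw
    rw [hre w hw, mul_comm K] at h1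
    have h2 := le_of_mul_le_mul_left h1 hfc
    rwa [← Real.le_log_iff_exp_le (by linarith)] at h2
  have hBC : ∀ w ∈ Metric.ball c R, ‖g w‖ ≤ 2 * Real.log K * ‖w - c‖ / (R - ‖w - c‖) := by
    intro w hw
    have hmaps : ∀ y ∈ Metric.ball (0 : ℂ) R, c + y ∈ Metric.ball c R := fun y hy => by
      simpa [dist_eq_norm] using hy
    have := borelCaratheodory_zero (f := fun y => g (c + y)) (z := w - c) hlogK
      (hgdiff.comp (by fun_prop) hmaps) (fun y hy => hgre _ (hmaps y hy)) hR
      (by simpa [dist_eq_norm] using hw) (by simp [hg])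
    simpa using this
  have hzb : z ∈ Metric.ball c R := by
    rw [Metric.mem_ball, dist_eq_norm]; linarith
  constructor
  · rw [hre z hzb]
    gcongr
    have h1 := hBC z hzb
    have h2 : 2 * Real.log K * ‖z - c‖ / (R - ‖z - c‖) ≤ 2 * r / (R - r) * Real.log K := by
      rw [div_mul_eq_mul_div]
      rw [div_le_div_iff₀ (by linarith) (by linarith)]
      nlinarith [norm_nonneg (z - c), mul_nonneg hlogK.le (sub_nonneg.2 hz), mul_pos hlogK hR]
    have h3 := (abs_le.1 (abs_re_le_norm (g z))).1
    linarith
  · have hρ : 0 < (R - r) / 2 := by linarith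
    have hsub : ∀ y, ‖y - z‖ ≤ (R - r) / 2 → ‖y - c‖ ≤ (R + r) / 2 := by
      intro y hy
      have := norm_sub_le_norm_sub_add_norm_sub y z c
      linarith
    have hd : DiffContOnCl ℂ g (Metric.ball z ((R - r) / 2)) := by
      refine DifferentiableOn.diffContOnCl (hgdiff.mono fun y hy => ?_)
      have hy' := Metric.closure_ball_subset_closedBall hy
      rw [Metric.mem_closedBall, dist_eq_norm] at hy'
      rw [Metric.mem_ball, dist_eq_norm]
      linarith [hsub y hy']
    have h1 := norm_deriv_le_of_forall_mem_sphere_norm_le hρ hd (C := 4 * R * Real.log K / (R - r))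
      (fun y hy => by
        rw [mem_sphere_iff_norm] at hy
        have h2 := hsub y hy.le
        refine (hBC y (by rw [Metric.mem_ball, dist_eq_norm]; linarith)).trans ?_
        rw [div_le_div_iff₀ (by linarith) (by linarith)]
        have h3 : ‖y - c‖ ≤ R := by linarith
        have h4 : (R - r) / 2 ≤ R - ‖y - c‖ := by linarith
        have h5 : ‖y - c‖ * (R - r) ≤ R * (2 * (R - ‖y - c‖)) :=
          mul_le_mul h3 (by linarith) (by linarith) hR.le
        nlinarith)
    rw [(hgd z hzb).deriv] at h1
    refine h1.trans (le_of_eq ?_)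
    have : R - r ≠ 0 := by linarith
    field_simp
    ring

/-! ### Monotonicity of the completed `L`-function off the critical line -/

/-- The properties of a primitive real Dirichlet `L`-function that the argument uses, with the
Riemann hypothesis included: `Λ` is `L(s)`, or `(s - 1) ζ(s)` when `r = 1`, the conductor is `N`,
the Gamma factor is `Γ_ℝ(s + κ)`, and `b n = Λ(n) χ(n)` are the coefficients of `-L' / L`.
The functional equation is recorded as the symmetry of the absolute value of the completed
function about the critical line. -/
structure IsCompletable (r : ℕ) (N κ : ℝ) (b : ℕ → ℂ) (Λ : ℂ → ℂ) : Prop where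
  r_le : r ≤ 1
  one_le_N : 1 ≤ N
  κ_nonneg : 0 ≤ κ
  κ_le : κ ≤ 1
  differentiable : Differentiable ℂ Λ
  ne_zero : ∀ s : ℂ, 1 / 2 < s.re → Λ s ≠ 0
  growth : ∃ A : ℝ, ∀ s : ℂ, 1 / 4 ≤ s.re → ‖Λ s‖ ≤ A * (1 + ‖s‖) ^ 2
  two_le_re : ∃ c C : ℝ, 0 < c ∧ ∀ s : ℂ, 2 ≤ s.re → c * ‖s‖ ^ r ≤ ‖Λ s‖ ∧ ‖Λ s‖ ≤ C * ‖s‖ ^ r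
  symm : ∀ c t : ℝ, 0 < c → c < 1 / 2 →
    ‖((1 / 2 - c + t * I : ℂ)) ^ r * (N : ℂ) ^ ((1 / 2 - c + t * I : ℂ) / 2) *
        Gammaℝ (1 / 2 - c + t * I + κ) * Λ (1 / 2 - c + t * I)‖ =
    ‖((1 / 2 + c + t * I : ℂ)) ^ r * (N : ℂ) ^ ((1 / 2 + c + t * I : ℂ) / 2) *
        Gammaℝ (1 / 2 + c + t * I + κ) * Λ (1 / 2 + c + t * I)‖
  norm_b_le : ∀ n, ‖b n‖ ≤ ArithmeticFunction.vonMangoldt n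
  logDeriv_eq : ∀ s : ℂ, 1 < s.re → logDeriv Λ s = -LSeries b s + r / (s - 1)

/-- The completed function `s ^ r N ^ (s / 2) Γ_ℝ(s + κ) Λ(s)`. -/
noncomputable def completed (r : ℕ) (N κ : ℝ) (Λ : ℂ → ℂ) (s : ℂ) : ℂ :=
  s ^ r * (N : ℂ) ^ (s / 2) * Gammaℝ (s + κ) * Λ s

namespace IsCompletable

variable {r : ℕ} {N κ : ℝ} {b : ℕ → ℂ} {Λ : ℂ → ℂ}

theorem N_pos (h : IsCompletable r N κ b Λ) : 0 < N := by linarith [h.one_le_N]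

/-- Near `2 + it`, where `Λ` is bounded below, Borel–Carathéodory applies with a bound that is
polynomial in `t`. -/
theorem disc_bound (h : IsCompletable r N κ b Λ) : ∃ A : ℝ, 1 ≤ A ∧ ∃ c : ℝ, 0 < c ∧
    ∀ δ : ℝ, 0 < δ → δ < 3 / 2 → ∀ s : ℂ, 1 / 2 + δ ≤ s.re → s.re ≤ 2 →
      c * Real.exp (-(3 / δ * Real.log (A * (5 + ‖s‖) ^ 2))) ≤ ‖Λ s‖ ∧
      ‖logDeriv Λ s‖ ≤ 12 / δ ^ 2 * Real.log (A * (5 + ‖s‖) ^ 2) := by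
  obtain ⟨A, hA⟩ := h.growth
  obtain ⟨c, C, hc, hcC⟩ := h.two_le_re
  refine ⟨max 1 (A / c), le_max_left _ _, c, hc, fun δ hδ hδ2 s hs1 hs2 => ?_⟩
  set z₀ : ℂ := 2 + s.im * I with hz₀
  have hz₀re : z₀.re = 2 := by simp [hz₀]
  have him : |s.im| ≤ ‖s‖ := abs_im_le_norm s
  have hz₀n : 1 ≤ ‖z₀‖ := by
    have := re_le_norm z₀; rw [hz₀re] at this; linarith
  have hz₀n2 : ‖z₀‖ ≤ 2 + ‖s‖ := by
    refine (norm_add_le _ _).trans ?_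
    simp [him]
  have hlow : c ≤ ‖Λ z₀‖ := by
    have := (hcC z₀ (by rw [hz₀re])).1
    have h1 : 1 ≤ ‖z₀‖ ^ r := one_le_pow₀ hz₀n
    nlinarith
  have hball : ∀ w ∈ Metric.ball z₀ (3 / 2), 1 / 2 < w.re ∧ ‖w‖ ≤ ‖s‖ + 4 := by
    intro w hw
    rw [Metric.mem_ball, dist_eq_norm] at hw
    have h1 := (abs_lt.1 ((abs_re_le_norm (w - z₀)).trans_lt hw)).1
    rw [sub_re, hz₀re] at h1
    have h2 := norm_sub_norm_le w z₀
    exact ⟨by linarith, by linarith⟩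
  have hK1 : 1 < max 1 (A / c) * (5 + ‖s‖) ^ 2 := by
    have := le_max_left 1 (A / c)
    nlinarith [norm_nonneg s]
  have := norm_ge_and_norm_logDeriv_le (f := Λ) (c := z₀) (R := 3 / 2) (r := 3 / 2 - δ)
    (K := max 1 (A / c) * (5 + ‖s‖) ^ 2) (z := s) (by linarith) (by linarith)
    h.differentiable.differentiableOn (fun w hw => h.ne_zero w (hball w hw).1) hK1
    (fun w hw => by
      have h1 := hA w (by linarith [(hball w hw).1])
      have h2 : (1 + ‖w‖) ^ 2 ≤ (5 + ‖s‖) ^ 2 := by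
        have := (hball w hw).2
        have := norm_nonneg w
        exact pow_le_pow_left₀ (by linarith) (by linarith) 2
      have h3 : A ≤ max 1 (A / c) * c := by
        have := le_max_right 1 (A / c)
        rw [div_le_iff₀ hc] at this; exact this
      have hm : 0 ≤ max 1 (A / c) := by have := le_max_left 1 (A / c); linarith
      calc ‖Λ w‖ ≤ A * (1 + ‖w‖) ^ 2 := h1
        _ ≤ (max 1 (A / c) * c) * (5 + ‖s‖) ^ 2 := by
          refine mul_le_mul h3 h2 (by positivity) (by positivity)
        _ = max 1 (A / c) * (5 + ‖s‖) ^ 2 * c := by ring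
        _ ≤ _ := mul_le_mul_of_nonneg_left hlow (by positivity))
    (by
      have : s - z₀ = ((s.re - 2 : ℝ) : ℂ) := by
        apply Complex.ext <;> simp [hz₀]
      rw [this, norm_real, Real.norm_eq_abs, abs_le]
      constructor <;> linarith)
  have hL : 0 ≤ Real.log (max 1 (A / c) * (5 + ‖s‖) ^ 2) := Real.log_nonneg hK1.le
  have e1 : 3 / 2 - (3 / 2 - δ) = δ := by ring
  rw [e1] at this
  refine ⟨le_trans ?_ this.1, this.2.trans (le_of_eq (by ring))⟩
  refine mul_le_mul hlow (Real.exp_le_exp.2 (neg_le_neg ?_)) (Real.exp_pos _).le (norm_nonneg _)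
  refine mul_le_mul_of_nonneg_right ?_ hL
  gcongr
  linarith

/-- `1 / Λ` has at most exponential growth to the right of the critical line, as the principle of
Phragmén and Lindelöf in a half-plane requires. -/
theorem exists_inv_norm_le (h : IsCompletable r N κ b Λ) {δ : ℝ} (hδ : 0 < δ) (hδ2 : δ < 3 / 2) :
    ∃ C : ℝ, 0 < C ∧ ∀ s : ℂ, 1 / 2 + δ ≤ s.re → ‖Λ s‖⁻¹ ≤ C * Real.exp (C * ‖s‖) := by
  obtain ⟨A, hA1, c, hc, hd⟩ := h.disc_bound
  obtain ⟨c', _, hc', hc2⟩ := h.two_le_re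
  have hA0 : 0 ≤ Real.log A := Real.log_nonneg hA1
  set C := max (c'⁻¹) (c⁻¹ * Real.exp (3 / δ * (Real.log A + 8))) + 6 / δ with hC
  have hCpos : 0 < C := by
    have : 0 < c'⁻¹ := inv_pos.2 hc'
    have := le_max_left (c'⁻¹) (c⁻¹ * Real.exp (3 / δ * (Real.log A + 8)))
    positivity
  refine ⟨C, hCpos, fun s hs => ?_⟩
  have h6 : 0 < 6 / δ := by positivity
  rcases le_total 2 s.re with h2 | h2
  · have h1 : c' ≤ ‖Λ s‖ := by
      have := (hc2 s h2).1
      have h1 : 1 ≤ ‖s‖ ^ r := one_le_pow₀ (by linarith [re_le_norm s])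
      nlinarith
    calc ‖Λ s‖⁻¹ ≤ c'⁻¹ := inv_anti₀ hc' h1
      _ ≤ C := by rw [hC]; linarith [le_max_left (c'⁻¹) (c⁻¹ * Real.exp (3 / δ * (Real.log A + 8)))]
      _ = C * 1 := (mul_one C).symm
      _ ≤ _ := mul_le_mul_of_nonneg_left
          (Real.one_le_exp (by positivity)) hCpos.le
  · have h1 := (hd δ hδ hδ2 s hs h2).1
    have hlog : Real.log (A * (5 + ‖s‖) ^ 2) ≤ Real.log A + 8 + 2 * ‖s‖ := by
      have h5 : (0 : ℝ) < 5 + ‖s‖ := by positivity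
      rw [Real.log_mul (by linarith) (by positivity), Real.log_pow]
      have := Real.log_le_sub_one_of_pos h5
      push_cast; linarith
    have h3 : c * Real.exp (-(3 / δ * (Real.log A + 8 + 2 * ‖s‖))) ≤ ‖Λ s‖ := by
      refine le_trans ?_ h1
      gcongr
    calc ‖Λ s‖⁻¹ ≤ (c * Real.exp (-(3 / δ * (Real.log A + 8 + 2 * ‖s‖))))⁻¹ :=
          inv_anti₀ (by positivity) h3
      _ = c⁻¹ * Real.exp (3 / δ * (Real.log A + 8)) * Real.exp (6 / δ * ‖s‖) := by
          rw [mul_inv, ← Real.exp_neg, neg_neg, mul_assoc, ← Real.exp_add]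
          congr 2; ring
      _ ≤ C * Real.exp (C * ‖s‖) := by
          have h7 := le_max_right (c'⁻¹) (c⁻¹ * Real.exp (3 / δ * (Real.log A + 8)))
          have h8 : 0 < max (c'⁻¹) (c⁻¹ * Real.exp (3 / δ * (Real.log A + 8))) :=
            lt_of_lt_of_le (by positivity) h7
          refine mul_le_mul (by rw [hC]; linarith) ?_ (Real.exp_pos _).le hCpos.le
          refine Real.exp_le_exp.2 (mul_le_mul_of_nonneg_right ?_ (norm_nonneg _))
          rw [hC]; linarith

theorem completed_ne_zero (h : IsCompletable r N κ b Λ) {s : ℂ} (hs : 1 / 2 < s.re) :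
    completed r N κ Λ s ≠ 0 := by
  have hκ := h.κ_nonneg
  refine mul_ne_zero (mul_ne_zero (mul_ne_zero (pow_ne_zero _ ?_) ?_) ?_) (h.ne_zero s hs)
  · rintro rfl; norm_num at hs
  · exact fun h0 => by
      have := (cpow_eq_zero_iff _ _).1 h0
      exact h.N_pos.ne' (by exact_mod_cast this.1)
  · exact Gammaℝ_ne_zero_of_re_pos (by simp; linarith)

theorem differentiableAt_Gammaℝ {s : ℂ} (hs : 0 < s.re) : DifferentiableAt ℂ Gammaℝ s := by
  unfold Gammaℝ
  refine DifferentiableAt.mul ?_ ?_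
  · exact DifferentiableAt.const_cpow (by fun_prop) (Or.inl (by exact_mod_cast Real.pi_ne_zero))
  · refine DifferentiableAt.comp s (differentiableAt_Gamma _ fun m hm => ?_) (by fun_prop)
    have := congrArg re hm
    simp at this
    have : (0 : ℝ) ≤ m := m.cast_nonneg
    linarith

theorem differentiableAt_completed (h : IsCompletable r N κ b Λ) {s : ℂ} (hs : 0 < s.re) :
    DifferentiableAt ℂ (completed r N κ Λ) s := by
  have hκ := h.κ_nonneg
  unfold completed
  refine DifferentiableAt.mul (DifferentiableAt.mul (DifferentiableAt.mul (by fun_prop) ?_) ?_)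
    h.differentiable.differentiableAt
  · exact DifferentiableAt.const_cpow (by fun_prop) (Or.inl (by exact_mod_cast h.N_pos.ne'))
  · exact DifferentiableAt.comp s (differentiableAt_Gammaℝ (by simp; linarith)) (by fun_prop)

/-- The elementary factors of the completed function contribute a bounded amount to the quotient of
its values at `p` and `p + 2 c`. -/
theorem exists_norm_completed_div_le (h : IsCompletable r N κ b Λ) {c : ℝ} (hc : 0 < c) :
    ∃ G : ℝ, 0 ≤ G ∧ ∀ p q : ℂ, q = p + 2 * c → 1 / 4 ≤ p.re →
      ‖completed r N κ Λ p / completed r N κ Λ q‖ ≤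
        G * (‖Λ p‖ * ‖Λ q‖⁻¹) * (‖p‖ / ‖q‖) ^ r := by
  have hκ := h.κ_nonneg
  have hN := h.N_pos
  have hN1 := h.one_le_N
  obtain ⟨G, hG⟩ := exists_norm_Gamma_div_le (y₀ := 1 / 8) (c := c) (by norm_num) hc
  have hG0 : 0 ≤ G := (norm_nonneg _).trans (hG 1 (by norm_num))
  refine ⟨Real.pi ^ c * G, by positivity, fun p q hpq hp => ?_⟩
  have hqre : q.re = p.re + 2 * c := by rw [hpq]; simp
  have hNp : ‖(N : ℂ) ^ (p / 2)‖ = N ^ (p.re / 2) := by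
    rw [norm_cpow_eq_rpow_re_of_pos hN]; simp
  have hNq : ‖(N : ℂ) ^ (q / 2)‖ = N ^ (q.re / 2) := by
    rw [norm_cpow_eq_rpow_re_of_pos hN]; simp
  have hN2 : ‖(N : ℂ) ^ (p / 2)‖ / ‖(N : ℂ) ^ (q / 2)‖ ≤ 1 := by
    rw [hNp, hNq]
    refine div_le_one_of_le₀ (Real.rpow_le_rpow_of_exponent_le hN1 ?_) (by positivity)
    rw [hqre]; linarith
  have hΓ : ‖Gammaℝ (p + κ)‖ / ‖Gammaℝ (q + κ)‖ ≤ Real.pi ^ c * G := by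
    have h1 := hG ((p + κ) / 2) (by simp; linarith)
    have e : (p + κ) / 2 + c = (q + κ) / 2 := by rw [hpq]; ring
    rw [e, norm_div] at h1
    rw [Gammaℝ_def, Gammaℝ_def, norm_mul, norm_mul,
      norm_cpow_eq_rpow_re_of_pos Real.pi_pos, norm_cpow_eq_rpow_re_of_pos Real.pi_pos,
      mul_div_mul_comm, ← Real.rpow_sub Real.pi_pos]
    have e2 : (-(p + κ) / 2).re - (-(q + κ) / 2).re = c := by
      simp [hqre]; ring
    rw [e2]
    gcongr
  have e3 : ∀ a₁ a₂ a₃ a₄ b₁ b₂ b₃ b₄ : ℝ, a₁ * a₂ * a₃ * a₄ / (b₁ * b₂ * b₃ * b₄) =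
      (a₂ / b₂) * (a₃ / b₃) * ((a₄ * b₄⁻¹) * (a₁ / b₁)) := by
    intros; simp only [div_eq_mul_inv, mul_inv]; ring
  simp only [completed, norm_div, norm_mul, norm_pow]
  rw [e3, ← div_pow, mul_assoc (Real.pi ^ c * G)]
  refine mul_le_mul_of_nonneg_right ?_ (by positivity)
  calc _ ≤ 1 * (Real.pi ^ c * G) := mul_le_mul hN2 hΓ (by positivity) zero_le_one
    _ = _ := one_mul _

/-- The absolute value of the completed `L`-function does not decrease when moving away from the
critical line: by the maximum principle of Phragmén and Lindelöf, the quotient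
`Ξ(s - c) / Ξ(s + c)`, which has absolute value `1` on the line, is bounded by `1` to its right. -/
theorem norm_completed_le (h : IsCompletable r N κ b Λ) {c : ℝ} (hc : 0 < c) (hc4 : c < 1 / 4)
    {s : ℂ} (hs : 1 / 2 ≤ s.re) :
    ‖completed r N κ Λ (s - c)‖ ≤ ‖completed r N κ Λ (s + c)‖ := by
  set Q : ℂ → ℂ := fun w => completed r N κ Λ (1 / 2 + w - c) / completed r N κ Λ (1 / 2 + w + c)
    with hQ
  have hne : ∀ w : ℂ, 0 ≤ w.re → completed r N κ Λ (1 / 2 + w + c) ≠ 0 := fun w hw =>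
    h.completed_ne_zero (by simp; linarith)
  have hQd : ∀ w : ℂ, 0 ≤ w.re → DifferentiableAt ℂ Q w := by
    intro w hw
    refine DifferentiableAt.div ?_ ?_ (hne w hw)
    · exact DifferentiableAt.comp w (h.differentiableAt_completed (by simp; linarith))
        (by fun_prop)
    · exact DifferentiableAt.comp w (h.differentiableAt_completed (by simp; linarith))
        (by fun_prop)
  obtain ⟨G, hG0, hG⟩ := h.exists_norm_completed_div_le hc
  have hfac : ∀ w : ℂ, 0 ≤ w.re → ‖Q w‖ ≤
      G * (‖Λ (1 / 2 + w - c)‖ * ‖Λ (1 / 2 + w + c)‖⁻¹) *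
        (‖1 / 2 + w - c‖ / ‖1 / 2 + w + c‖) ^ r := fun w hw =>
    hG (1 / 2 + w - c) (1 / 2 + w + c) (by ring) (by simp; linarith)
  have hratio : ∀ w : ℂ, 0 ≤ w.re → (‖1 / 2 + w - c‖ / ‖1 / 2 + w + c‖) ^ r ≤ 1 := by
    intro w hw
    refine pow_le_one₀ (by positivity) (div_le_one_of_le₀ ?_ (norm_nonneg _))
    rw [← sq_le_sq₀ (norm_nonneg _) (norm_nonneg _), ← normSq_eq_norm_sq, ← normSq_eq_norm_sq,
      normSq_apply, normSq_apply]
    simp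
    nlinarith
  have hPL : ∀ w : ℂ, 0 ≤ w.re → ‖Q w‖ ≤ 1 := by
    intro w hw
    refine PhragmenLindelof.right_half_plane_of_bounded_on_real (f := Q) (C := 1) ?_ ?_ ?_ ?_ hw
    · refine DifferentiableOn.diffContOnCl fun w hw => ?_
      rw [closure_setOfPred_lt_re] at hw
      exact (hQd w hw).differentiableWithinAt
    · refine ⟨1, by norm_num, ?_⟩
      obtain ⟨A, hA⟩ := h.growth
      obtain ⟨C, hC0, hC⟩ := h.exists_inv_norm_le hc (by linarith)
      have hA0 : 0 ≤ A := by
        have := (norm_nonneg _).trans (hA 1 (by norm_num))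
        norm_num at this; linarith
      refine ⟨2 + C, Asymptotics.IsBigO.of_bound
        (G * (A * Real.exp 4 * (C * Real.exp C))) ?_⟩
      filter_upwards [mem_inf_of_right (mem_principal_self _)] with w hw
      have hw' : 0 ≤ w.re := le_of_lt hw
      have hc1 : ‖(c : ℂ)‖ = c := by rw [norm_real, Real.norm_of_nonneg hc.le]
      have n1 : ‖1 / 2 + w - c‖ ≤ 1 + ‖w‖ := by
        refine (norm_sub_le _ _).trans ?_
        have := norm_add_le (1 / 2 : ℂ) w
        rw [hc1]; norm_num at this ⊢; linarith
      have n2 : ‖1 / 2 + w + c‖ ≤ 1 + ‖w‖ := by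
        refine (norm_add_le _ _).trans ?_
        have := norm_add_le (1 / 2 : ℂ) w
        rw [hc1]; norm_num at this ⊢; linarith
      have g1 : ‖Λ (1 / 2 + w - c)‖ ≤ A * Real.exp 4 * Real.exp (2 * ‖w‖) := by
        refine (hA _ (by simp; linarith)).trans ?_
        rw [mul_assoc, ← Real.exp_add]
        refine mul_le_mul_of_nonneg_left ?_ hA0
        have e1 : 1 + ‖1 / 2 + w - c‖ ≤ Real.exp (2 + ‖w‖) := by
          have := Real.add_one_le_exp (2 + ‖w‖)
          linarith
        calc (1 + ‖1 / 2 + w - c‖) ^ 2 ≤ Real.exp (2 + ‖w‖) ^ 2 := by gcongr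
          _ = _ := by rw [← Real.exp_nat_mul]; congr 1; push_cast; ring
      have g2 : ‖Λ (1 / 2 + w + c)‖⁻¹ ≤ C * Real.exp C * Real.exp (C * ‖w‖) := by
        refine (hC _ (by simp; linarith)).trans ?_
        rw [mul_assoc, ← Real.exp_add]
        refine mul_le_mul_of_nonneg_left (Real.exp_le_exp.2 ?_) hC0.le
        nlinarith
      rw [Real.norm_of_nonneg (Real.exp_pos _).le, Real.rpow_one]
      calc ‖Q w‖ ≤ _ := hfac w hw'
        _ ≤ G * ((A * Real.exp 4 * Real.exp (2 * ‖w‖)) *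
            (C * Real.exp C * Real.exp (C * ‖w‖))) * 1 := by
          gcongr
          exact hratio w hw'
        _ = _ := by rw [add_mul, Real.exp_add]; ring
    · obtain ⟨c', C', hc', hcC⟩ := h.two_le_re
      refine ⟨G * (C' * c'⁻¹), ?_⟩
      rw [eventually_map]
      filter_upwards [eventually_ge_atTop 2] with x hx
      have hx0 : 0 ≤ ((x : ℂ)).re := by simp; linarith
      have r1 : (2 : ℝ) ≤ (1 / 2 + (x : ℂ) - c).re := by simp; linarith
      have r2 : (2 : ℝ) ≤ (1 / 2 + (x : ℂ) + c).re := by simp; linarith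
      refine (hfac x hx0).trans ?_
      set p : ℂ := 1 / 2 + x - c
      set q : ℂ := 1 / 2 + x + c
      have hp : 0 < ‖p‖ := by linarith [re_le_norm p]
      have hq : 0 < ‖q‖ := by linarith [re_le_norm q]
      have h1 := (hcC p r1).2
      have h2 := (hcC q r2).1
      have hC'0 : 0 ≤ C' := by
        by_contra hneg
        have := (norm_nonneg _).trans h1
        nlinarith [pow_pos hp r]
      have h3 : ‖Λ q‖⁻¹ ≤ c'⁻¹ * (‖q‖ ^ r)⁻¹ := by
        rw [← mul_inv]; exact inv_anti₀ (by positivity) h2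
      have hr2 := hratio x hx0
      calc G * (‖Λ p‖ * ‖Λ q‖⁻¹) * (‖p‖ / ‖q‖) ^ r
          ≤ G * ((C' * ‖p‖ ^ r) * (c'⁻¹ * (‖q‖ ^ r)⁻¹)) * 1 := by gcongr
        _ = G * (C' * c'⁻¹) * (‖p‖ / ‖q‖) ^ r := by rw [div_pow]; ring
        _ ≤ G * (C' * c'⁻¹) * 1 := by gcongr
        _ = _ := mul_one _
    · intro t
      have := h.symm c t hc (by linarith)
      have e : ‖Q (t * I)‖ = ‖completed r N κ Λ (1 / 2 - c + t * I)‖ /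
          ‖completed r N κ Λ (1 / 2 + c + t * I)‖ := by
        have e1 : (1 / 2 : ℂ) + t * I - c = 1 / 2 - c + t * I := by ring
        have e2 : (1 / 2 : ℂ) + t * I + c = 1 / 2 + c + t * I := by ring
        rw [← norm_div, ← e1, ← e2]
      rw [e]
      unfold completed
      rw [this]
      exact div_self_le_one _
  have h1 := hPL (s - 1 / 2) (by simp; linarith)
  have e1 : (1 / 2 : ℂ) + (s - 1 / 2) - c = s - c := by ring
  have e2 : (1 / 2 : ℂ) + (s - 1 / 2) + c = s + c := by ring
  simp only [hQ, e1, e2, norm_div] at h1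
  have h2 : completed r N κ Λ (s + c) ≠ 0 := h.completed_ne_zero (by simp; linarith)
  rwa [div_le_one (norm_pos_iff.2 h2)] at h1

end IsCompletable

/-! ### The logarithmic derivative and its truncated Dirichlet series -/

namespace IsCompletable

variable {r : ℕ} {N κ : ℝ} {b : ℕ → ℂ} {Λ : ℂ → ℂ}

theorem log_norm_completed (h : IsCompletable r N κ b Λ) {s : ℂ} (hs : 1 / 2 < s.re) :
    Real.log ‖completed r N κ Λ s‖ = r * Real.log ‖s‖ + s.re / 2 * Real.log N +
      Real.log ‖Gammaℝ (s + κ)‖ + Real.log ‖Λ s‖ := by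
  have h0 := h.completed_ne_zero hs
  unfold completed at h0 ⊢
  have h1 := left_ne_zero_of_mul h0
  have h2 := left_ne_zero_of_mul h1
  have n1 := norm_ne_zero_iff.2 h1
  have n2 := norm_ne_zero_iff.2 h2
  rw [norm_mul, Real.log_mul n1 (norm_ne_zero_iff.2 (right_ne_zero_of_mul h0)), norm_mul,
    Real.log_mul n2 (norm_ne_zero_iff.2 (right_ne_zero_of_mul h1)), norm_mul,
    Real.log_mul (norm_ne_zero_iff.2 (left_ne_zero_of_mul h2))
    (norm_ne_zero_iff.2 (right_ne_zero_of_mul h2)), norm_pow, Real.log_pow,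
    norm_cpow_eq_rpow_re_of_pos h.N_pos, Real.log_rpow h.N_pos]
  simp

/-- The logarithmic derivative of the completed function has nonnegative real part to the right of
the critical line; hence a lower bound for `Re Λ' / Λ` in terms of the conductor. -/
theorem le_re_logDeriv (h : IsCompletable r N κ b Λ) {s : ℂ} (hs : 1 / 2 < s.re) :
    -(2 + Real.log N / 2 + Real.log (s.re + |s.im| + 2) / 2) ≤ (logDeriv Λ s).re := by
  have hκ := h.κ_nonneg
  have hκ1 := h.κ_le
  have hr : (r : ℝ) ≤ 1 := by exact_mod_cast h.r_le
  have hr0 : (0 : ℝ) ≤ r := r.cast_nonneg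
  have hd := hasDerivAt_log_norm (F := Λ) (s := s) (v := 0) h.differentiable.differentiableAt
    (by rw [ofReal_zero, add_zero]; exact h.ne_zero s hs)
  rw [ofReal_zero, add_zero, hasDerivAt_iff_tendsto_slope] at hd
  have hd2 := hd.mono_left (nhdsWithin_mono (0 : ℝ) (fun x (hx : (0 : ℝ) < x) => ne_of_gt hx) :
    𝓝[>] (0 : ℝ) ≤ 𝓝[≠] 0)
  have hsim := abs_nonneg s.im
  have hlim : Tendsto (fun u : ℝ => -(2 + Real.log N / 2 +
      Real.log (s.re + κ + u + |s.im| + 1) / 2)) (𝓝[>] 0)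
      (𝓝 (-(2 + Real.log N / 2 + Real.log (s.re + κ + 0 + |s.im| + 1) / 2))) := by
    refine Tendsto.mono_left ?_ nhdsWithin_le_nhds
    have : ContinuousAt (fun u : ℝ => -(2 + Real.log N / 2 +
      Real.log (s.re + κ + u + |s.im| + 1) / 2)) 0 := by
      have : s.re + κ + 0 + |s.im| + 1 ≠ 0 := by linarith
      fun_prop (disch := assumption)
    exact this
  have hmono : Real.log (s.re + κ + 0 + |s.im| + 1) ≤ Real.log (s.re + |s.im| + 2) :=
    Real.log_le_log (by linarith) (by linarith)
  refine le_trans (by linarith) (le_of_tendsto_of_tendsto hlim hd2 ?_)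
  filter_upwards [Ioo_mem_nhdsGT (by norm_num : (0 : ℝ) < 1 / 4)] with u hu
  have hu0 : 0 < u := hu.1
  have h1 := h.norm_completed_le (c := u / 2) (by linarith) (by linarith [hu.2])
    (s := s + ((u / 2 : ℝ) : ℂ)) (by
      rw [add_re, ofReal_re]; linarith)
  have e1 : s + ((u / 2 : ℝ) : ℂ) - ((u / 2 : ℝ) : ℂ) = s := by ring
  have e2 : s + ((u / 2 : ℝ) : ℂ) + ((u / 2 : ℝ) : ℂ) = s + u := by push_cast; ring
  rw [e1, e2] at h1
  have hsu : 1 / 2 < (s + u).re := by simp; linarith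
  have h2 := Real.log_le_log (norm_pos_iff.2 (h.completed_ne_zero hs)) h1
  rw [h.log_norm_completed hs, h.log_norm_completed hsu] at h2
  have h3 := log_norm_Gammaℝ_add_le (s := s + κ) (by simp; linarith) hu0.le
  have e3 : s + κ + u = s + u + κ := by ring
  rw [e3] at h3
  simp only [add_re, add_im, ofReal_re, ofReal_im, add_zero] at h2 h3
  have hsn : 1 / 2 < ‖s‖ := hs.trans_le (re_le_norm s)
  have h4 : Real.log ‖s + u‖ - Real.log ‖s‖ ≤ 2 * u := by
    have hsun : 0 < ‖s + u‖ := by linarith [re_le_norm (s + u)]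
    rw [← Real.log_div hsun.ne' (by linarith)]
    refine (Real.log_le_sub_one_of_pos (by positivity)).trans ?_
    have : ‖s + u‖ ≤ ‖s‖ + u := by
      refine (norm_add_le _ _).trans ?_
      rw [norm_real, Real.norm_of_nonneg hu0.le]
    rw [div_sub_one (by linarith), div_le_iff₀ (by linarith)]
    nlinarith
  have h5 : (r : ℝ) * (Real.log ‖s + u‖ - Real.log ‖s‖) ≤ 2 * u := by
    rcases le_total 0 (Real.log ‖s + u‖ - Real.log ‖s‖) with h6 | h6 <;> nlinarith
  rw [slope_def_field, sub_zero, le_div_iff₀ hu0]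
  simp only [ofReal_zero, add_zero]
  nlinarith

theorem LSeriesSummable_b (h : IsCompletable r N κ b Λ) {s : ℂ} (hs : 1 < s.re) :
    LSeriesSummable b s := by
  have h1 := (ArithmeticFunction.LSeriesSummable_vonMangoldt (s := s) hs)
  rw [LSeriesSummable, ← summable_norm_iff] at h1 ⊢
  refine h1.of_nonneg_of_le (fun n => norm_nonneg _) fun n => LSeries.norm_term_le s ?_
  refine (h.norm_b_le n).trans ?_
  rw [norm_real]
  exact Real.le_norm_self _

theorem norm_term_le_of_re (b : ℕ → ℂ) {s : ℂ} (hs : 2 ≤ s.re) (n : ℕ) :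
    ‖LSeries.term b s n‖ ≤ ‖LSeries.term b 2 n‖ := by
  rw [LSeries.norm_term_eq, LSeries.norm_term_eq]
  split_ifs with hn
  · exact le_rfl
  · have : (1 : ℝ) ≤ n := by exact_mod_cast Nat.one_le_iff_ne_zero.2 hn
    have hn0 : (0 : ℝ) < n := by linarith
    refine div_le_div_of_nonneg_left (norm_nonneg _) (by positivity)
      (Real.rpow_le_rpow_of_exponent_le this (by simpa using hs))

theorem norm_LSeries_b_le (h : IsCompletable r N κ b Λ) {s : ℂ} (hs : 2 ≤ s.re) :
    ‖LSeries b s‖ ≤ ∑' n, ‖LSeries.term b 2 n‖ := by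
  have h2 : Summable fun n => ‖LSeries.term b 2 n‖ :=
    summable_norm_iff.2 (h.LSeriesSummable_b (s := 2) (by norm_num))
  exact tsum_of_norm_bounded h2.hasSum fun n => norm_term_le_of_re b hs n

/-- The logarithmic derivative grows at most logarithmically; the square root is the growth that
`integral_poissonH_mul` allows. -/
theorem exists_norm_logDeriv_le (h : IsCompletable r N κ b Λ) {δ : ℝ} (hδ : 0 < δ)
    (hδ2 : δ < 3 / 2) :
    ∃ B : ℝ, 0 ≤ B ∧ ∀ s : ℂ, 1 / 2 + δ ≤ s.re → ‖logDeriv Λ s‖ ≤ B * Real.sqrt (1 + ‖s‖) := by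
  obtain ⟨A, hA1, c, hc, hd⟩ := h.disc_bound
  have hA0 : 0 ≤ Real.log A := Real.log_nonneg hA1
  set S := ∑' n, ‖LSeries.term b 2 n‖ with hS
  have hS0 : 0 ≤ S := tsum_nonneg fun n => norm_nonneg _
  have hr : (r : ℝ) ≤ 1 := by exact_mod_cast h.r_le
  refine ⟨(S + 1) + 12 / δ ^ 2 * (Real.log A + 12), by positivity, fun s hs => ?_⟩
  have hone := one_le_sqrt_one_add_norm s
  have hp : 0 ≤ 12 / δ ^ 2 * (Real.log A + 12) := by positivity
  rcases le_total 2 s.re with h2 | h2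
  · have h1 : ‖logDeriv Λ s‖ ≤ S + 1 := by
      rw [h.logDeriv_eq s (by linarith)]
      refine (norm_add_le _ _).trans (add_le_add ?_ ?_)
      · rw [norm_neg]; exact h.norm_LSeries_b_le h2
      · rw [norm_div, norm_natCast]
        have : 1 ≤ ‖s - 1‖ := by
          have := re_le_norm (s - 1); simp at this; linarith
        exact div_le_one_of_le₀ (by linarith) (norm_nonneg _)
    nlinarith
  · refine (hd δ hδ hδ2 s hs h2).2.trans ?_
    have h5 : (0 : ℝ) < 5 + ‖s‖ := by positivity
    have hlog : Real.log (A * (5 + ‖s‖) ^ 2) ≤ (Real.log A + 12) * Real.sqrt (1 + ‖s‖) := by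
      rw [Real.log_mul (by linarith) (by positivity), Real.log_pow]
      have h3 := Real.log_le_rpow_div h5.le (by norm_num : (0 : ℝ) < 1 / 2)
      rw [← Real.sqrt_eq_rpow] at h3
      have h4 : Real.sqrt (5 + ‖s‖) ≤ 3 * Real.sqrt (1 + ‖s‖) := by
        rw [show (3 : ℝ) = Real.sqrt (3 ^ 2) by rw [Real.sqrt_sq (by norm_num)],
          ← Real.sqrt_mul (by norm_num)]
        exact Real.sqrt_le_sqrt (by nlinarith [norm_nonneg s])
      push_cast
      nlinarith
    have h6 : 12 / δ ^ 2 * Real.log (A * (5 + ‖s‖) ^ 2) ≤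
        12 / δ ^ 2 * ((Real.log A + 12) * Real.sqrt (1 + ‖s‖)) := by gcongr
    have h7 : 0 ≤ (S + 1) * Real.sqrt (1 + ‖s‖) := by positivity
    nlinarith

theorem exp_neg_log_mul {n : ℕ} (hn : n ≠ 0) (w : ℂ) :
    exp (-(Real.log n * w)) = (n : ℂ) ^ (-w) := by
  rw [cpow_def_of_ne_zero (by exact_mod_cast hn), ← natCast_log]
  congr 1; ring

theorem term_add_eq (b : ℕ → ℂ) (s w : ℂ) {n : ℕ} (hn : n ≠ 0) :
    LSeries.term b (s + w) n = b n * (n : ℂ) ^ (-s) * exp (-(Real.log n * w)) := by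
  have hn' : (n : ℂ) ≠ 0 := by exact_mod_cast hn
  rw [LSeries.term_of_ne_zero hn, exp_neg_log_mul hn, cpow_add _ _ hn', cpow_neg, cpow_neg]
  field_simp

/-- The correction term for a pole at `w₀`. Multiplied by `x ^ w`, the polar part `r / (w - w₀)` of
the Dirichlet series grows exponentially; adding `poleTerm` replaces `x ^ w` by the constant
`x ^ w₀`. As a divided difference, `poleTerm` is entire in `w`. -/
noncomputable def poleTerm (r : ℕ) (x : ℝ) (w₀ w : ℂ) : ℂ :=
  -(r * dslope (fun w : ℂ => exp (Real.log x * w)) w₀ w)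

theorem norm_exp_log_mul {x : ℝ} (hx : 1 ≤ x) (w : ℂ) : ‖exp (Real.log x * w)‖ = x ^ w.re := by
  rw [norm_exp, re_ofReal_mul, Real.rpow_def_of_pos (by linarith)]

theorem poleTerm_of_ne {r : ℕ} {x : ℝ} {w₀ w : ℂ} (hw : w ≠ w₀) :
    poleTerm r x w₀ w = -(r * ((exp (Real.log x * w) - exp (Real.log x * w₀)) / (w - w₀))) := by
  rw [poleTerm, dslope_of_ne _ hw, slope_def_field]

/-- A bound for the divided difference by the derivative, uniform near `w₀`. -/
theorem norm_poleTerm_le {r : ℕ} (hr : r ≤ 1) {x : ℝ} (hx : 1 ≤ x) {w₀ w : ℂ}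
    (hw2 : w.re ≤ 2) (hw02 : w₀.re ≤ 2) :
    ‖poleTerm r x w₀ w‖ ≤ Real.log x * x ^ (2 : ℝ) := by
  have hΔ : 0 ≤ Real.log x := Real.log_nonneg hx
  have hr1 : ‖(r : ℂ)‖ ≤ 1 := by rw [norm_natCast]; exact_mod_cast hr
  have hder : ∀ y : ℂ, HasDerivAt (fun w : ℂ => exp (Real.log x * w))
      (exp (Real.log x * y) * Real.log x) y := fun y => by
    simpa using ((hasDerivAt_id y).const_mul (Real.log x : ℂ)).cexp
  have hb : ∀ y : ℂ, y.re ≤ 2 → ‖exp (Real.log x * y) * Real.log x‖ ≤ Real.log x * x ^ (2 : ℝ) := by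
    intro y hy
    rw [norm_mul, norm_exp_log_mul hx, norm_real, Real.norm_of_nonneg hΔ, mul_comm]
    exact mul_le_mul_of_nonneg_left (Real.rpow_le_rpow_of_exponent_le hx hy) hΔ
  have hD : ‖dslope (fun w : ℂ => exp (Real.log x * w)) w₀ w‖ ≤ Real.log x * x ^ (2 : ℝ) := by
    rcases eq_or_ne w w₀ with rfl | hne
    · rw [dslope_same, (hder _).deriv]; exact hb _ hw02
    · rw [dslope_of_ne _ hne, slope_def_field, norm_div,
        div_le_iff₀ (norm_pos_iff.2 (sub_ne_zero.2 hne))]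
      refine Convex.norm_image_sub_le_of_norm_hasDerivWithin_le (s := {y : ℂ | y.re ≤ 2})
        (fun y _ => (hder y).hasDerivWithinAt) (fun y hy => hb y hy)
        (convex_halfSpace_re_le 2) hw02 hw2
  rw [poleTerm, norm_neg, norm_mul]
  have := norm_nonneg (dslope (fun w : ℂ => exp (Real.log x * w)) w₀ w)
  nlinarith

/-- A bound away from `w₀`, without the factor `log x`. -/
theorem norm_poleTerm_le_of_le {r : ℕ} {x : ℝ} (hx : 1 ≤ x) {w₀ w : ℂ} {ρ : ℝ}
    (hρ : 0 < ρ) (hw : ρ ≤ ‖w - w₀‖) (hw0 : w₀.re ≤ 1 / 2) :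
    ‖poleTerm r x w₀ w‖ ≤ r * ((x ^ w.re + Real.sqrt x) / ρ) := by
  have hne : w ≠ w₀ := by
    rintro rfl; simp at hw; linarith
  rw [poleTerm_of_ne hne, norm_neg, norm_mul, norm_natCast, norm_div]
  refine mul_le_mul_of_nonneg_left ?_ r.cast_nonneg
  refine div_le_div₀ (by positivity) ((norm_sub_le _ _).trans (add_le_add ?_ ?_)) hρ hw
  · rw [norm_exp_log_mul hx]
  · rw [norm_exp_log_mul hx, Real.sqrt_eq_rpow]
    exact Real.rpow_le_rpow_of_exponent_le hx hw0

/-- Subtracting the terms `n ≤ x` of its Dirichlet series from `Λ' / Λ` and multiplying by `x ^ w`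
leaves a function of moderate growth in the half-plane. -/
theorem exists_truncated_growth (h : IsCompletable r N κ b Λ) {s : ℂ} (hs : 1 / 2 < s.re)
    (hs1 : s.re ≤ 3 / 4) {x : ℝ} (hx : 1 ≤ x) :
    ∃ B : ℝ, ∀ w : ℂ, 0 ≤ w.re → ‖exp (Real.log x * w) *
      (logDeriv Λ (s + w) + ∑ n ∈ Finset.Icc 1 ⌊x⌋₊, (b n * (n : ℂ) ^ (-s)) *
        exp (-(Real.log n * w))) + poleTerm r x (1 - s) w‖ ≤ B * Real.sqrt (1 + ‖w‖) := by
  obtain ⟨B, hB0, hB⟩ := h.exists_norm_logDeriv_le (δ := s.re - 1 / 2) (by linarith) (by linarith)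
  have hr1 : (r : ℝ) ≤ 1 := by exact_mod_cast h.r_le
  set S := Finset.Icc 1 ⌊x⌋₊ with hS
  set T := ∑ n ∈ S, ‖b n * (n : ℂ) ^ (-s)‖ with hT
  set V := ∑' n : {n // n ∉ S}, x ^ 2 * ‖LSeries.term b 2 n‖ with hV
  have hT0 : 0 ≤ T := Finset.sum_nonneg fun _ _ => norm_nonneg _
  have hV0 : 0 ≤ V := tsum_nonneg fun _ => by positivity
  have hΔ : 0 ≤ Real.log x := Real.log_nonneg hx
  have hw0re : (1 - s).re = 1 - s.re := by simp
  have hx2 : (0 : ℝ) ≤ x ^ (2 : ℝ) := by positivity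
  refine ⟨(x ^ (2 : ℝ) * (B * Real.sqrt (2 + ‖s‖) + T) + Real.log x * x ^ (2 : ℝ)) + (V + Real.sqrt x),
    fun w hw => ?_⟩
  have hone := one_le_sqrt_one_add_norm w
  have hP1 : 0 ≤ x ^ (2 : ℝ) * (B * Real.sqrt (2 + ‖s‖) + T) + Real.log x * x ^ (2 : ℝ) := by
    positivity
  -- for `Re w ≤ 2` every term is estimated separately; for `Re w ≥ 2` the Dirichlet series converges
  -- and only its terms with `n > x` are left, for which `(x / n) ^ (Re w - 2) ≤ 1`
  rcases le_total w.re 2 with hw2 | hw2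
  · have h1 : ‖logDeriv Λ (s + w)‖ ≤ B * Real.sqrt (2 + ‖s‖) * Real.sqrt (1 + ‖w‖) := by
      refine (hB _ (by simp; linarith)).trans ?_
      rw [mul_assoc, ← Real.sqrt_mul (by positivity)]
      refine mul_le_mul_of_nonneg_left (Real.sqrt_le_sqrt ?_) hB0
      nlinarith [norm_add_le s w, norm_nonneg s, norm_nonneg w]
    have h2 : ‖∑ n ∈ S, (b n * (n : ℂ) ^ (-s)) * exp (-(Real.log n * w))‖ ≤ T := by
      refine norm_sum_le_of_le _ fun n hn => ?_
      rw [norm_mul]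
      have hn1 : (1 : ℝ) ≤ n := by exact_mod_cast (Finset.mem_Icc.1 hn).1
      exact mul_le_of_le_one_right (norm_nonneg _)
        (norm_exp_neg_mul_le_one (Real.log_nonneg hn1) hw)
    have h3 := norm_poleTerm_le h.r_le hx hw2 (w₀ := 1 - s) (by rw [hw0re]; linarith)
    have h4 : ‖exp (Real.log x * w)‖ ≤ x ^ (2 : ℝ) := by
      rw [norm_exp_log_mul hx]; exact Real.rpow_le_rpow_of_exponent_le hx hw2
    refine (norm_add_le _ _).trans ?_
    rw [norm_mul]
    have h5 : ‖exp (Real.log x * w)‖ * ‖logDeriv Λ (s + w) + ∑ n ∈ S, (b n * (n : ℂ) ^ (-s)) *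
        exp (-(Real.log n * w))‖ ≤
        x ^ (2 : ℝ) * (B * Real.sqrt (2 + ‖s‖) * Real.sqrt (1 + ‖w‖) + T) :=
      mul_le_mul h4 ((norm_add_le _ _).trans (add_le_add h1 h2)) (norm_nonneg _) hx2
    have h6 : 0 ≤ (V + Real.sqrt x) * Real.sqrt (1 + ‖w‖) := by positivity
    have h7 : x ^ (2 : ℝ) * T ≤ x ^ (2 : ℝ) * T * Real.sqrt (1 + ‖w‖) :=
      le_mul_of_one_le_right (by positivity) hone
    have h8 : Real.log x * x ^ (2 : ℝ) ≤ Real.log x * x ^ (2 : ℝ) * Real.sqrt (1 + ‖w‖) :=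
      le_mul_of_one_le_right (by positivity) hone
    linarith
  · have hsw : 1 < (s + w).re := by simp; linarith
    have hsum := h.LSeriesSummable_b hsw
    have hne : w ≠ 1 - s := by
      intro h0; rw [h0, hw0re] at hw2; linarith
    have hne' : w - (1 - s) ≠ 0 := sub_ne_zero.2 hne
    have e1 : ∑ n ∈ S, (b n * (n : ℂ) ^ (-s)) * exp (-(Real.log n * w)) =
        ∑ n ∈ S, LSeries.term b (s + w) n :=
      Finset.sum_congr rfl fun n hn => (term_add_eq b s w (by
        have := (Finset.mem_Icc.1 hn).1; omega)).symm
    have e2 : LSeries b (s + w) = ∑ n ∈ S, LSeries.term b (s + w) n +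
        ∑' n : {n // n ∉ S}, LSeries.term b (s + w) n := (hsum.sum_add_tsum_compl (s := S)).symm
    have e3 : exp (Real.log x * w) * (logDeriv Λ (s + w) +
        ∑ n ∈ S, (b n * (n : ℂ) ^ (-s)) * exp (-(Real.log n * w))) + poleTerm r x (1 - s) w =
        -(∑' n : {n // n ∉ S}, exp (Real.log x * w) * LSeries.term b (s + w) n) +
          r * exp (Real.log x * (1 - s)) / (w - (1 - s)) := by
      rw [h.logDeriv_eq _ hsw, e1, e2, poleTerm_of_ne hne, tsum_mul_left]
      have : s + w - 1 = w - (1 - s) := by ring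
      rw [this]
      field_simp
      ring
    rw [e3]
    have h2 : Summable fun n : {n // n ∉ S} => x ^ 2 * ‖LSeries.term b 2 n‖ :=
      ((summable_norm_iff.2 (h.LSeriesSummable_b (s := 2) (by norm_num))).subtype _).mul_left _
    have h3 : ‖∑' n : {n // n ∉ S}, exp (Real.log x * w) * LSeries.term b (s + w) n‖ ≤ V := by
      refine tsum_of_norm_bounded h2.hasSum fun n => ?_
      obtain ⟨n, hn⟩ := n
      rw [norm_mul, norm_exp_log_mul hx, LSeries.norm_term_eq, LSeries.norm_term_eq]
      split_ifs with hn0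
      · simp
      · have hn1 : 1 ≤ n := Nat.one_le_iff_ne_zero.2 hn0
        have hn1' : (1 : ℝ) ≤ n := by exact_mod_cast hn1
        have hnx : x ≤ n := by
          by_contra hlt
          exact hn (Finset.mem_Icc.2 ⟨hn1, Nat.le_floor (by linarith)⟩)
        have hn0' : (0 : ℝ) < n := by linarith
        have hre2 : (2 : ℂ).re = 2 := by simp
        rw [mul_div_assoc', mul_div_assoc', hre2, div_le_div_iff₀ (by positivity) (by positivity)]
        have h4 : (x : ℝ) ^ w.re * (n : ℝ) ^ (2 : ℝ) ≤ x ^ 2 * (n : ℝ) ^ (s + w).re := by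
          have e4 : (x : ℝ) ^ w.re = x ^ 2 * x ^ (w.re - 2) := by
            rw [← Real.rpow_natCast x 2, ← Real.rpow_add (by linarith)]; congr 1; push_cast; ring
          have e5 : (n : ℝ) ^ (s + w).re = n ^ (2 : ℝ) * n ^ (w.re - 2) * n ^ s.re := by
            rw [← Real.rpow_add hn0', ← Real.rpow_add hn0']; congr 1; simp; ring
          have h5 : x ^ (w.re - 2) ≤ (n : ℝ) ^ (w.re - 2) :=
            Real.rpow_le_rpow (by linarith) hnx (by linarith)
          have h6 : 1 ≤ (n : ℝ) ^ s.re := Real.one_le_rpow hn1' (by linarith)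
          rw [e4, e5]
          have h7 : x ^ (w.re - 2) ≤ (n : ℝ) ^ (w.re - 2) * n ^ s.re := by
            have : 0 ≤ (n : ℝ) ^ (w.re - 2) := by positivity
            nlinarith
          have h8 : 0 ≤ x ^ 2 * (n : ℝ) ^ (2 : ℝ) := by positivity
          nlinarith [mul_le_mul_of_nonneg_left h7 h8]
        nlinarith [norm_nonneg (b n), mul_le_mul_of_nonneg_left h4 (norm_nonneg (b n))]
    have h4 : ‖r * exp (Real.log x * (1 - s)) / (w - (1 - s))‖ ≤ Real.sqrt x := by
      rw [norm_div, norm_mul, norm_natCast, norm_exp_log_mul hx]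
      have h5 : 1 ≤ ‖w - (1 - s)‖ := by
        have := re_le_norm (w - (1 - s)); rw [sub_re, hw0re] at this; linarith
      have h6 : x ^ (1 - s).re ≤ Real.sqrt x := by
        rw [Real.sqrt_eq_rpow, hw0re]
        exact Real.rpow_le_rpow_of_exponent_le hx (by linarith)
      refine (div_le_self (by positivity) h5).trans ?_
      have : (0 : ℝ) ≤ x ^ (1 - s).re := by positivity
      nlinarith
    refine (norm_add_le _ _).trans ?_
    rw [norm_neg]
    have h7 : V + Real.sqrt x ≤ (V + Real.sqrt x) * Real.sqrt (1 + ‖w‖) :=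
      le_mul_of_one_le_right (by positivity) hone
    have h8 := mul_nonneg hP1 (Real.sqrt_nonneg (1 + ‖w‖))
    linarith

/-- The conditional upper bound for `-Re Λ' / Λ` by a Dirichlet polynomial of arbitrary
length `x`. For the zeta function, `hsr` keeps the point `v` away from the pole at `1 - s`. -/
theorem neg_re_logDeriv_mul_le (h : IsCompletable r N κ b Λ) {s : ℂ} (hs : 1 / 2 < s.re)
    (hs1 : s.re ≤ 3 / 4) (hsr : r = 1 → 1 ≤ |s.im|) {x : ℝ} (hx : 1 ≤ x) {v : ℝ} (hv : 0 < v)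
    (hv1 : v ≤ 1) :
    -(logDeriv Λ (s + v)).re * Real.cosh (v * Real.log x / 2) ^ 2 ≤
      4 + Real.log N / 2 + Real.log (3 + |s.im|) / 2 + r * (4 * Real.sqrt x + x ^ v) +
      (∑ n ∈ Finset.Icc 1 ⌊x⌋₊, b n * (n : ℂ) ^ (-s) * (Real.sinh (v * Real.log (x / n)) : ℂ)).re
        / 2 := by
  have hN0 : 0 ≤ Real.log N := Real.log_nonneg h.one_le_N
  have hw0re : (1 - s).re = 1 - s.re := by simp
  obtain ⟨B', hB'⟩ := h.exists_truncated_growth hs hs1 hx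
  obtain ⟨B, hB0, hB⟩ := h.exists_norm_logDeriv_le (δ := s.re - 1 / 2) (by linarith) (by linarith)
  have hη : 0 < s.re - 1 / 2 := by linarith
  have hmem : ∀ w : ℂ, -(s.re - 1 / 2) < w.re → 1 / 2 < (s + w).re := fun w hw => by
    simp; linarith
  have hlog3 : 0 ≤ Real.log (3 + |s.im|) := Real.log_nonneg (by linarith [abs_nonneg s.im])
  have key := le_cosh_sq_mul_re (η := s.re - 1 / 2) hη (f := fun w => logDeriv Λ (s + w))
    (E := poleTerm r x (1 - s)) ?_ ?_ (B := B * Real.sqrt (1 + ‖s‖)) ?_ hx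
    (fun n => b n * (n : ℂ) ^ (-s)) (B' := B') hB'
    (M := 3 + Real.log N / 2 + Real.log (3 + |s.im|) / 2) (by positivity) ?_
    (K := r * (8 * Real.sqrt x + x ^ v)) ?_ hv ?_
  · have hl : Real.log (1 + v) ≤ 1 := by
      have := Real.log_le_sub_one_of_pos (by linarith : 0 < 1 + v); linarith
    have hxv : 0 ≤ (r : ℝ) * x ^ v := by positivity
    nlinarith
  · intro w hw
    have hw' := hmem w hw
    have : DifferentiableAt ℂ (logDeriv Λ) (s + w) :=
      ((h.differentiable.contDiff (n := 2)).differentiable_deriv_two _).div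
        h.differentiable.differentiableAt (h.ne_zero _ hw')
    exact (DifferentiableAt.comp w this (by fun_prop)).differentiableWithinAt
  · have : Differentiable ℂ (dslope (fun w : ℂ => exp (Real.log x * w)) (1 - s)) := by
      rw [← differentiableOn_univ]
      exact (differentiableOn_dslope univ_mem).2 (by fun_prop)
    exact (this.const_mul _).neg.differentiableOn
  · intro w hw
    refine (hB _ (by simp; linarith)).trans ?_
    rw [mul_assoc, ← Real.sqrt_mul (by positivity)]
    refine mul_le_mul_of_nonneg_left (Real.sqrt_le_sqrt ?_) hB0
    nlinarith [norm_add_le s w, norm_nonneg s, norm_nonneg w]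
  · intro u
    have h1 := h.le_re_logDeriv (s := s + u * I) (hmem _ (by simp; linarith))
    have e1 : (s + u * I).re = s.re := by simp
    have e2 : (s + u * I).im = s.im + u := by simp
    rw [e1, e2] at h1
    have hu1 : 1 ≤ ‖1 + u * I‖ := by have := re_le_norm (1 + u * I); simpa using this
    have hu2 : |u| ≤ ‖1 + u * I‖ := by have := abs_im_le_norm (1 + u * I); simpa using this
    have h2 : Real.log (s.re + |s.im + u| + 2) ≤
        Real.log (3 + |s.im|) + (1 + Real.log ‖1 + u * I‖) := by
      have h3 : s.re + |s.im + u| + 2 ≤ (3 + |s.im|) * (2 * ‖1 + u * I‖) := by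
        nlinarith [abs_add_le s.im u, abs_nonneg s.im]
      have h4 := Real.log_le_log (by linarith [abs_nonneg (s.im + u)]) h3
      have h5 : (0 : ℝ) < 3 + |s.im| := by positivity
      rw [Real.log_mul h5.ne' (by positivity), Real.log_mul (by norm_num) (by positivity)] at h4
      have h6 : Real.log 2 ≤ 1 := by
        have := Real.log_le_sub_one_of_pos (by norm_num : (0 : ℝ) < 2); linarith
      linarith
    have h7 : 0 ≤ Real.log ‖1 + u * I‖ := Real.log_nonneg hu1
    linarith
  · intro u
    have h1 := norm_poleTerm_le_of_le (r := r) hx (w₀ := 1 - s) (w := u * I) (ρ := 1 / 4)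
      (by norm_num) (by
        have := abs_re_le_norm (u * I - (1 - s))
        rw [sub_re, hw0re] at this
        simp at this
        have h2 := neg_abs_le (s.re - 1)
        linarith) (by rw [hw0re]; linarith)
    refine h1.trans (mul_le_mul_of_nonneg_left ?_ r.cast_nonneg)
    have e : (u * I : ℂ).re = 0 := by simp
    rw [e, Real.rpow_zero]
    have h3 : 1 ≤ Real.sqrt x := Real.one_le_sqrt.2 hx
    have h4 : 0 ≤ x ^ v := by positivity
    linarith
  · rcases Nat.le_one_iff_eq_zero_or_eq_one.1 h.r_le with h0 | h1
    · simp [poleTerm, h0]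
    · have h2 := norm_poleTerm_le_of_le (r := r) hx (w₀ := 1 - s) (w := v) (ρ := 1) one_pos (by
        have := abs_im_le_norm ((v : ℂ) - (1 - s))
        simp at this
        linarith [hsr h1]) (by rw [hw0re]; linarith)
      refine h2.trans (mul_le_mul_of_nonneg_left ?_ r.cast_nonneg)
      rw [div_one, ofReal_re]
      have := Real.sqrt_nonneg x
      linarith

end IsCompletable

/-! ### Primitivity of the quadratic character -/

/-- By quadratic reciprocity `(d / n)` depends only on `n` modulo `4 d`. -/
theorem jacobiSym_eq_one_of_modEq (d : ℤ) {n : ℕ} (hn : n % 2 = 1)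
    (h : n ≡ 1 [MOD 4 * d.natAbs]) : jacobiSym d n = 1 := by
  rw [jacobiSym.mod_right d (Nat.odd_iff.2 hn), h, ← jacobiSym.mod_right d odd_one,
    jacobiSym.one_right]

theorem exists_jacobiSym_eq_neg_one {p : ℕ} (hp : p.Prime) (hp2 : p ≠ 2) :
    ∃ g : ℕ, jacobiSym g p = -1 := by
  have := Fact.mk hp
  obtain ⟨a, ha⟩ := FiniteField.exists_nonsquare (F := ZMod p) (by rwa [ZMod.ringChar_zmod_n])
  refine ⟨a.val, ?_⟩
  rw [← jacobiSym.legendreSym.to_jacobiSym, legendreSym.eq_neg_one_iff]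
  simpa using ha

/-- For every prime `p ∣ d` some `n ≡ 1 (mod |d| / p)` has `(d / n) = -1`. -/
theorem IsFundamentalDiscriminant.exists_kroneckerSym_eq_neg_one {d : ℤ}
    (hd : IsFundamentalDiscriminant d) {p : ℕ} (hp : p.Prime) (hpd : p ∣ d.natAbs) :
    ∃ n : ℕ, n ≡ 1 [MOD d.natAbs / p] ∧ kroneckerSym d n = -1 := by
  have hd0 := hd.natAbs_ne_zero
  rcases hp.eq_two_or_odd with rfl | hodd
  · rcases hd with ⟨h, -⟩ | ⟨m, h, h', hsq⟩
    · omega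
    rcases h' with h2 | h3
    · -- `d = 8 k` with `k` odd: take `n ≡ 5 (mod 8)` and `n ≡ 1 (mod k)`
      obtain ⟨k, rfl⟩ : ∃ k, m = 2 * k := ⟨m / 2, by omega⟩
      have hco : Nat.Coprime 8 k.natAbs := by
        have : Nat.Coprime 2 k.natAbs := (Nat.coprime_two_left).2 (Nat.odd_iff.2 (by omega))
        simpa using this.pow_left 3
      obtain ⟨n, hn8, hnk⟩ := Nat.chineseRemainder hco 5 1
      have hn8' : n % 8 = 5 := hn8
      have hn4 : n ≡ 1 [MOD 4] := by unfold Nat.ModEq; omega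
      have h4k : n ≡ 1 [MOD 4 * k.natAbs] :=
        (Nat.modEq_and_modEq_iff_modEq_mul (Nat.Coprime.coprime_dvd_left ⟨2, rfl⟩ hco)).1 ⟨hn4, hnk⟩
      refine ⟨n, ?_, ?_⟩
      · have : d.natAbs / 2 = 4 * k.natAbs := by omega
        rwa [this]
      · rw [kroneckerSym_of_odd d (by omega), h, ← mul_assoc, jacobiSym.mul_left,
          jacobiSym_eq_one_of_modEq k (by omega) h4k, show (4 * 2 : ℤ) = 2 ^ 3 by norm_num,
          jacobiSym.pow_left, jacobiSym.at_two (Nat.odd_iff.2 (by omega)),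
          ZMod.χ₈_nat_eq_if_mod_eight]
        simp [hn8', show n % 2 = 1 by omega]
    · -- `d = 4 m` with `m ≡ 3 (mod 4)`: take `n ≡ 3 (mod 4)` and `n ≡ 1 (mod m)`
      have hco2 : Nat.Coprime 2 m.natAbs := (Nat.coprime_two_left).2 (Nat.odd_iff.2 (by omega))
      have hco : Nat.Coprime 4 m.natAbs := by simpa using hco2.pow_left 2
      obtain ⟨n, hn4, hnm⟩ := Nat.chineseRemainder hco 3 1
      have hn4' : n % 4 = 3 := hn4
      have h2m : n ≡ 1 [MOD 2 * m.natAbs] :=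
        (Nat.modEq_and_modEq_iff_modEq_mul hco2).1 ⟨by unfold Nat.ModEq; omega, hnm⟩
      refine ⟨n, ?_, ?_⟩
      · have : d.natAbs / 2 = 2 * m.natAbs := by omega
        rwa [this]
      · have hoddn : Odd n := Nat.odd_iff.2 (by omega)
        have e : d = (2 : ℤ) ^ 2 * -(-m) := by rw [h]; ring
        have hco3 : Int.gcd 2 n = 1 := by
          have : Nat.Coprime 2 n := (Nat.coprime_two_left).2 hoddn
          simpa [Int.gcd] using this
        rw [kroneckerSym_of_odd d (by omega), e, jacobiSym.mul_left, jacobiSym.sq_one' hco3,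
          one_mul, jacobiSym.neg _ hoddn, ← kroneckerSym_of_odd (-m) (by omega),
          kroneckerSym_eq_jacobiSym (by omega), ZMod.χ₄_nat_three_mod_four hn4', Int.natAbs_neg,
          jacobiSym.mod_left' (b := m.natAbs) (a₂ := 1) (by exact_mod_cast hnm),
          jacobiSym.one_left, mul_one]
  · -- write `d = p' e` with `p' = ± p ≡ 1 (mod 4)`
    obtain ⟨p', hp', hp'4⟩ : ∃ p' : ℤ, p'.natAbs = p ∧ p' % 4 = 1 := by
      rcases (show p % 4 = 1 ∨ p % 4 = 3 by omega) with h | h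
      · exact ⟨p, by simp, by omega⟩
      · exact ⟨-p, by simp, by omega⟩
    obtain ⟨e, he⟩ : p' ∣ d := by rwa [← Int.natAbs_dvd_natAbs, hp']
    have hNe : d.natAbs = p * e.natAbs := by rw [he, Int.natAbs_mul, hp']
    have hpe : ¬ p ∣ e.natAbs := by
      intro hpe
      have hpp : p * p ∣ d.natAbs := by rw [hNe]; exact Nat.mul_dvd_mul_left p hpe
      have hsq : ∀ m : ℤ, Squarefree m → ¬ p * p ∣ m.natAbs := fun m hm hdvd =>
        hp.one_lt.ne' (Nat.isUnit_iff.1 ((Int.squarefree_natAbs.2 hm) p hdvd))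
      rcases hd with ⟨-, hm⟩ | ⟨m, h, -, hm⟩
      · exact hsq d hm hpp
      · refine hsq m hm ?_
        have : d.natAbs = 2 ^ 2 * m.natAbs := by omega
        rw [this] at hpp
        refine Nat.Coprime.dvd_of_dvd_mul_left (Nat.Coprime.pow_right 2 ?_) hpp
        have : Nat.Coprime p 2 := (Nat.coprime_two_right).2 (Nat.odd_iff.2 hodd)
        exact this.mul_left this
    have hco : Nat.Coprime (8 * e.natAbs) p := by
      have h2 : Nat.Coprime 2 p := (Nat.coprime_two_left).2 (Nat.odd_iff.2 hodd)
      exact Nat.Coprime.mul_left (by simpa using h2.pow_left 3)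
        ((Nat.Prime.coprime_iff_not_dvd hp).2 hpe).symm
    obtain ⟨g, hg⟩ := exists_jacobiSym_eq_neg_one hp (by omega)
    obtain ⟨n, hne, hnp⟩ := Nat.chineseRemainder hco 1 g
    have hn2 : n % 2 = 1 := hne.of_dvd ⟨4 * e.natAbs, by ring⟩
    refine ⟨n, ?_, ?_⟩
    · rw [hNe, Nat.mul_div_cancel_left _ hp.pos]
      exact hne.of_dvd ⟨8, by ring⟩
    · rw [kroneckerSym_of_odd d hn2, he, jacobiSym.mul_left,
        jacobiSym_eq_one_of_modEq e hn2 (hne.of_dvd ⟨2, by ring⟩), mul_one,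
        ← kroneckerSym_of_odd p' hn2, kroneckerSym_eq_jacobiSym hp'4, hp', ← hg]
      exact jacobiSym.mod_left' (by exact_mod_cast hnp)

/-- If the conductor were a proper divisor of `|d|`, it would divide `|d| / p` for some prime `p`,
and the character would take the value `1` at every `n ≡ 1 (mod |d| / p)` coprime to `d`. -/
theorem IsFundamentalDiscriminant.isPrimitive {d : ℤ} (hd : IsFundamentalDiscriminant d) :
    (quadraticCharacter d hd).IsPrimitive := by
  have : NeZero d.natAbs := ⟨hd.natAbs_ne_zero⟩
  set χ := quadraticCharacter d hd with hχ
  rw [DirichletCharacter.isPrimitive_def]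
  by_contra hne
  obtain ⟨e, he⟩ := χ.conductor_dvd_level
  have he1 : e ≠ 1 := by rintro rfl; exact hne (by rw [mul_one] at he; exact he.symm)
  obtain ⟨p, hp, q, rfl⟩ := Nat.exists_prime_and_dvd he1
  have hdiv : d.natAbs / p = χ.conductor * q := by
    conv_lhs => rw [he]
    rw [show χ.conductor * (p * q) = p * (χ.conductor * q) by ring, Nat.mul_div_cancel_left _ hp.pos]
  have hpd : p ∣ d.natAbs := ⟨χ.conductor * q, he.trans (by ring)⟩
  obtain ⟨n, hn, hkn⟩ := hd.exists_kroneckerSym_eq_neg_one hp hpd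
  have hM : d.natAbs / p ∣ d.natAbs := Nat.div_dvd_of_dvd hpd
  obtain ⟨_, χ₀, h₀⟩ := χ.factorsThrough_conductor.mono χ (by rw [hdiv]; exact ⟨q, rfl⟩) hM
  have hcop : n.Coprime d.natAbs := by
    by_contra h
    rw [kroneckerSym_eq_zero_of_not_coprime h] at hkn
    norm_num at hkn
  have h1 := DirichletCharacter.changeLevel_eq_cast_of_dvd' χ₀ hM (a := n)
    (Nat.isCoprime_iff_coprime.2 hcop)
  rw [← h₀] at h1
  have h2 : χ ((n : ℤ) : ZMod d.natAbs) = -1 := by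
    have := quadraticCharacter_natCast d hd n
    rw [hkn] at this
    push_cast at this ⊢
    exact this
  have h3 : ((n : ℤ) : ZMod (d.natAbs / p)) = 1 := by
    have := (ZMod.natCast_eq_natCast_iff _ _ _).2 hn
    push_cast at this ⊢
    exact this
  rw [h2, h3, map_one] at h1
  norm_num at h1

theorem IsFundamentalDiscriminant.natAbs_ne_one {d : ℤ} (hd : IsFundamentalDiscriminant d)
    (h1 : d ≠ 1) : d.natAbs ≠ 1 := by
  rcases hd with ⟨h, -⟩ | ⟨m, h, h', -⟩ <;> omega

theorem IsFundamentalDiscriminant.quadraticCharacter_ne_one {d : ℤ}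
    (hd : IsFundamentalDiscriminant d) (h1 : d ≠ 1) : quadraticCharacter d hd ≠ 1 := by
  have : NeZero d.natAbs := ⟨hd.natAbs_ne_zero⟩
  intro h
  have := DirichletCharacter.eq_one_iff_conductor_eq_one.1 h
  rw [(DirichletCharacter.isPrimitive_def _).1 hd.isPrimitive] at this
  exact hd.natAbs_ne_one h1 this

theorem kroneckerSym_eq (d : ℤ) (n : ℕ) :
    kroneckerSym d n = 0 ∨ kroneckerSym d n = 1 ∨ kroneckerSym d n = -1 := by
  have hj : ∀ m : ℕ, jacobiSym d m = 0 ∨ jacobiSym d m = 1 ∨ jacobiSym d m = -1 :=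
    fun m => jacobiSym.trichotomy d m
  have h8 : ZMod.χ₈ (d : ZMod 8) = 0 ∨ ZMod.χ₈ (d : ZMod 8) = 1 ∨ ZMod.χ₈ (d : ZMod 8) = -1 := by
    rw [ZMod.χ₈_int_eq_if_mod_eight]; split_ifs <;> simp
  unfold kroneckerSym
  split_ifs
  · simp
  · simp
  · have hpow : ∀ k : ℕ, ZMod.χ₈ (d : ZMod 8) ^ k = 0 ∨ ZMod.χ₈ (d : ZMod 8) ^ k = 1 ∨
        ZMod.χ₈ (d : ZMod 8) ^ k = -1 := fun k => by
      rcases h8 with h | h | h <;> rw [h]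
      · rcases k.eq_zero_or_pos with rfl | hk
        · simp
        · simp [hk.ne']
      · simp
      · rcases neg_one_pow_eq_or ℤ k with h | h <;> simp [h]
    rcases hpow (n.factorization 2) with h | h | h <;>
      rcases hj (n / 2 ^ n.factorization 2) with h' | h' | h' <;> rw [h, h'] <;> norm_num

theorem abs_kroneckerSym_le_one (d : ℤ) (n : ℕ) : |(kroneckerSym d n : ℝ)| ≤ 1 := by
  rcases kroneckerSym_eq d n with h | h | h <;> simp [h]

/-! ### Primitive real `L`-functions satisfy the axioms -/

/-- Abel summation continues a Dirichlet series whose partial sums are `c n + O(1)` to the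
half-plane `Re s > 0`, with linear growth. -/
theorem exists_continuation {f : ℕ → ℂ} (hf : ∀ n, ‖f n‖ ≤ 1) {c : ℂ} {B : ℝ}
    (hB : ∀ n : ℕ, ‖∑ k ∈ Finset.Icc 1 n, f k - c * n‖ ≤ B) :
    ∃ G : ℂ → ℂ, DifferentiableOn ℂ G {s | 0 < s.re} ∧
      (∀ s : ℂ, 0 < s.re → ‖G s‖ ≤ ‖s‖ * ((B + ‖c‖) / s.re)) ∧
      ∀ s : ℂ, 1 < s.re → LSeries f s = G s + c * s / (s - 1) := by
  set S : ℝ → ℂ := fun t => ∑ k ∈ Finset.Icc 1 ⌊t⌋₊, f k with hS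
  set E : ℝ → ℂ := (Ioi (1 : ℝ)).indicator fun t => S t - c * t with hE
  have hB0 : 0 ≤ B := (norm_nonneg _).trans (hB 0)
  have hbound : ∀ t : ℝ, 1 < t → ‖S t - c * t‖ ≤ B + ‖c‖ := by
    intro t ht
    have e : S t - c * t = (S t - c * ⌊t⌋₊) + c * (⌊t⌋₊ - t) := by ring
    rw [e]
    refine (norm_add_le _ _).trans (add_le_add (hB _) ?_)
    rw [norm_mul]
    refine mul_le_of_le_one_right (norm_nonneg _) ?_
    have h1 := Nat.floor_le (by linarith : 0 ≤ t)
    have h2 := Nat.lt_floor_add_one t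
    rw [← ofReal_natCast, ← ofReal_sub, norm_real, Real.norm_eq_abs, abs_le]
    constructor <;> linarith
  have hEb : ∀ t, ‖E t‖ ≤ B + ‖c‖ := by
    intro t
    by_cases ht : t ∈ Ioi (1 : ℝ)
    · rw [hE, indicator_of_mem ht]; exact hbound t ht
    · rw [hE, indicator_of_notMem ht, norm_zero]; positivity
  have hSm : Measurable S :=
    (measurable_from_nat (f := fun n : ℕ => ∑ k ∈ Finset.Icc 1 n, f k)).comp Nat.measurable_floor
  have hEm : Measurable E := (hSm.sub (by fun_prop)).indicator measurableSet_Ioi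
  have hloc : LocallyIntegrableOn E (Ioi 0) := by
    refine LocallyIntegrable.locallyIntegrableOn ?_ _
    refine (locallyIntegrable_const (B + ‖c‖)).mono hEm.aestronglyMeasurable
      (ae_of_all _ fun t => ?_)
    exact (hEb t).trans (Real.le_norm_self _)
  have hmel : ∀ s : ℂ, mellin E (-s) = ∫ t in Ioi (1 : ℝ), (t : ℂ) ^ (-s - 1) * (S t - c * t) := by
    intro s
    have e : (fun t : ℝ => (t : ℂ) ^ (-s - 1) • E t) =
        (Ioi (1 : ℝ)).indicator fun t : ℝ => (t : ℂ) ^ (-s - 1) * (S t - c * t) := by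
      funext t
      by_cases ht : t ∈ Ioi (1 : ℝ)
      · rw [hE, indicator_of_mem ht, indicator_of_mem ht, smul_eq_mul]
      · rw [hE, indicator_of_notMem ht, indicator_of_notMem ht, smul_zero]
    rw [mellin, e, setIntegral_indicator measurableSet_Ioi]
    congr 2
    rw [inter_eq_right]
    exact Ioi_subset_Ioi zero_le_one
  have hdom : ∀ s : ℂ, 0 < s.re → ∀ t ∈ Ioi (1 : ℝ),
      ‖(t : ℂ) ^ (-s - 1) * (S t - c * t)‖ ≤ (B + ‖c‖) * t ^ (-s.re - 1) := by
    intro s hs t ht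
    have ht0 : (0 : ℝ) < t := lt_trans one_pos ht
    rw [norm_mul, norm_cpow_eq_rpow_re_of_pos ht0, mul_comm]
    have : (-s - 1).re = -s.re - 1 := by simp
    rw [this]
    exact mul_le_mul_of_nonneg_right (hbound t ht) (by positivity)
  have hint : ∀ s : ℂ, 0 < s.re →
      IntegrableOn (fun t : ℝ => (t : ℂ) ^ (-s - 1) * (S t - c * t)) (Ioi 1) := by
    intro s hs
    have h1 : IntegrableOn (fun t : ℝ => (B + ‖c‖) * t ^ (-s.re - 1)) (Ioi 1) :=
      (integrableOn_Ioi_rpow_of_lt (by linarith) one_pos).const_mul _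
    refine h1.mono' ?_ ((ae_restrict_iff' measurableSet_Ioi).2 (ae_of_all _ (hdom s hs)))
    refine Measurable.aestronglyMeasurable ?_
    exact (Measurable.pow_const (by fun_prop) _).mul (hSm.sub (by fun_prop))
  refine ⟨fun s => s * mellin E (-s), ?_, ?_, ?_⟩
  · intro s hs
    have h1 : DifferentiableAt ℂ (mellin E) (-s) := by
      refine mellin_differentiableAt_of_isBigO_rpow (a := 0) (b := (-s).re - 1) hloc ?_ ?_ ?_
        (by linarith)
      · refine Asymptotics.IsBigO.of_bound (B + ‖c‖) (Eventually.of_forall fun t => ?_)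
        simpa using hEb t
      · simpa using hs
      · refine Asymptotics.IsBigO.of_bound 0 ?_
        filter_upwards [Ioo_mem_nhdsGT (zero_lt_one (α := ℝ))] with t ht
        have ht1 : t ∉ Ioi (1 : ℝ) := fun h => lt_asymm ht.2 h
        rw [hE, indicator_of_notMem ht1, norm_zero, zero_mul]
    exact (differentiableAt_id.mul (h1.comp s (by fun_prop))).differentiableWithinAt
  · intro s hs
    simp only [norm_mul]
    refine mul_le_mul_of_nonneg_left ?_ (norm_nonneg _)
    rw [hmel]
    have h1 : IntegrableOn (fun t : ℝ => (B + ‖c‖) * t ^ (-s.re - 1)) (Ioi 1) :=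
      (integrableOn_Ioi_rpow_of_lt (by linarith) one_pos).const_mul _
    refine (norm_integral_le_of_norm_le h1
      ((ae_restrict_iff' measurableSet_Ioi).2 (ae_of_all _ (hdom s hs)))).trans ?_
    rw [integral_const_mul, integral_Ioi_rpow_of_lt (by linarith) one_pos, Real.one_rpow]
    apply le_of_eq
    rw [show -s.re - 1 + 1 = -s.re by ring]
    field_simp
  · intro s hs
    have hO : (fun n : ℕ => ∑ k ∈ Finset.Icc 1 n, ‖f k‖) =O[atTop] fun n => (n : ℝ) ^ (1 : ℝ) := by
      refine Asymptotics.IsBigO.of_bound 1 (Eventually.of_forall fun n => ?_)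
      rw [Real.norm_of_nonneg (Finset.sum_nonneg fun _ _ => norm_nonneg _), Real.rpow_one, one_mul,
        Real.norm_of_nonneg n.cast_nonneg]
      refine (Finset.sum_le_sum fun k _ => hf k).trans ?_
      simp
    have hs0 : 0 < s.re := by linarith
    have hs1 : s - 1 ≠ 0 := by
      intro h
      have := congrArg re h
      simp at this; linarith
    rw [LSeries_eq_mul_integral' f zero_le_one hs hO]
    simp only [hmel]
    have h2 : IntegrableOn (fun t : ℝ => c * (t : ℂ) ^ (-s)) (Ioi 1) :=
      (integrableOn_Ioi_cpow_of_lt (by simpa using hs) one_pos).const_mul _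
    have h3 : ∫ t in Ioi (1 : ℝ), (∑ k ∈ Finset.Icc 1 ⌊t⌋₊, f k) * (t : ℂ) ^ (-(s + 1)) =
        ∫ t in Ioi (1 : ℝ), ((t : ℂ) ^ (-s - 1) * (S t - c * t) + c * (t : ℂ) ^ (-s)) := by
      refine setIntegral_congr_fun measurableSet_Ioi fun t ht => ?_
      have ht0 : (t : ℂ) ≠ 0 := ofReal_ne_zero.2 (lt_trans one_pos ht).ne'
      have e : (t : ℂ) ^ (-s) = (t : ℂ) ^ (-s - 1) * t := by
        rw [cpow_sub _ _ ht0, cpow_one]; field_simp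
      simp only [hS]
      rw [e, show -(s + 1) = -s - 1 by ring]
      ring
    rw [h3, integral_add (hint s hs0) h2, integral_const_mul,
      integral_Ioi_cpow_of_lt (by simpa using hs) one_pos, ofReal_one, one_cpow, mul_add]
    congr 1
    have hs2 : -s + 1 ≠ 0 := by
      intro h; apply hs1; linear_combination -h
    field_simp
    ring

/-- The lower bound `2 - ζ(2)` is positive. -/
theorem LSeries_norm_bounds {f : ℕ → ℂ} (hf : ∀ n, ‖f n‖ ≤ 1) (h1 : f 1 = 1) {s : ℂ}
    (hs : 2 ≤ s.re) :
    2 - Real.pi ^ 2 / 6 ≤ ‖LSeries f s‖ ∧ ‖LSeries f s‖ ≤ Real.pi ^ 2 / 6 := by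
  have hz := hasSum_zeta_two
  have hterm : ∀ n, ‖LSeries.term f s n‖ ≤ 1 / (n : ℝ) ^ 2 := by
    intro n
    rw [LSeries.norm_term_eq]
    split_ifs with hn
    · simp [hn]
    · have hn1 : (1 : ℝ) ≤ n := by exact_mod_cast Nat.one_le_iff_ne_zero.2 hn
      refine div_le_div₀ zero_le_one (hf n) (by positivity) ?_
      rw [← Real.rpow_natCast (n : ℝ) 2]
      exact Real.rpow_le_rpow_of_exponent_le hn1 (by exact_mod_cast hs)
  have hsum : Summable fun n => LSeries.term f s n :=
    Summable.of_norm_bounded hz.summable hterm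
  refine ⟨?_, tsum_of_norm_bounded hz hterm⟩
  have h3 : HasSum (fun n => LSeries.term f s n - if n = 1 then 1 else 0) (LSeries f s - 1) :=
    hsum.hasSum.sub (hasSum_ite_eq 1 1)
  have h4 : HasSum (fun n : ℕ => 1 / (n : ℝ) ^ 2 - if n = 1 then 1 else 0)
      (Real.pi ^ 2 / 6 - 1) := hz.sub (hasSum_ite_eq 1 1)
  have h5 : ‖LSeries f s - 1‖ ≤ Real.pi ^ 2 / 6 - 1 := by
    rw [← h3.tsum_eq]
    refine tsum_of_norm_bounded h4 fun n => ?_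
    split_ifs with hn
    · subst hn; simp [LSeries.term, h1]
    · simpa using hterm n
  have h6 := norm_sub_norm_le 1 (1 - LSeries f s)
  rw [norm_one, sub_sub_cancel, norm_sub_rev] at h6
  linarith

theorem LSeries_conj {f : ℕ → ℝ} (s : ℂ) :
    LSeries (fun n => (f n : ℂ)) (starRingEnd ℂ s) =
      starRingEnd ℂ (LSeries (fun n => (f n : ℂ)) s) := by
  rw [LSeries, LSeries, Complex.conj_tsum]
  refine tsum_congr fun n => ?_
  rcases eq_or_ne n 0 with rfl | hn
  · simp
  · rw [LSeries.term_of_ne_zero hn, LSeries.term_of_ne_zero hn, map_div₀, conj_ofReal,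
      cpow_conj _ _ (by rw [natCast_arg]; exact Real.pi_pos.ne), conj_natCast]

theorem norm_Gammaℝ_conj (s : ℂ) : ‖Gammaℝ (starRingEnd ℂ s)‖ = ‖Gammaℝ s‖ := by
  have e : starRingEnd ℂ s / 2 = starRingEnd ℂ (s / 2) := by rw [map_div₀, map_ofNat]
  have hπ : ∀ w : ℂ, ‖(Real.pi : ℂ) ^ w‖ = Real.pi ^ w.re := fun w =>
    norm_cpow_eq_rpow_re_of_pos Real.pi_pos w
  rw [Gammaℝ_def, Gammaℝ_def, norm_mul, norm_mul, e, Gamma_conj, norm_conj, hπ, hπ]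
  simp

/-- The axioms for a real Dirichlet series `Σ f n n⁻ˢ` with partial sums `r n + O(1)`, with a
functional equation and no zeros to the right of the critical line. -/
theorem IsCompletable.of_real {r : ℕ} (hr : r ≤ 1) {N κ : ℝ} (hN : 1 ≤ N) (hκ : 0 ≤ κ)
    (hκ1 : κ ≤ 1) {f : ℕ → ℝ} {b : ℕ → ℂ} {Λ : ℂ → ℂ} (hΛ : Differentiable ℂ Λ)
    (hne : ∀ s : ℂ, 1 / 2 < s.re → Λ s ≠ 0) (hf : ∀ n, |f n| ≤ 1) (hf1 : f 1 = 1)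
    {B : ℝ} (hB : ∀ n : ℕ, |∑ k ∈ Finset.Icc 1 n, f k - r * n| ≤ B)
    (hL : ∀ s : ℂ, 1 < s.re → Λ s = (s - 1) ^ r * LSeries (fun n => (f n : ℂ)) s)
    (hfe : ∀ s : ℂ, 1 / 2 < s.re → s.re < 1 →
      ‖completed r N κ Λ (1 - s)‖ = ‖completed r N κ Λ s‖)
    (hb : ∀ n, ‖b n‖ ≤ ArithmeticFunction.vonMangoldt n)
    (hlog : ∀ s : ℂ, 1 < s.re → logDeriv Λ s = -LSeries b s + r / (s - 1)) :
    IsCompletable r N κ b Λ := by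
  have hN0 : 0 < N := by linarith
  have hfn : ∀ n, ‖(f n : ℂ)‖ ≤ 1 := fun n => by simpa using hf n
  have hopen : IsOpen {s : ℂ | 1 < s.re} := isOpen_lt continuous_const continuous_re
  have hconj : ∀ s : ℂ, Λ (starRingEnd ℂ s) = starRingEnd ℂ (Λ s) := by
    have hg : Differentiable ℂ (starRingEnd ℂ ∘ Λ ∘ starRingEnd ℂ) := fun s => by
      have := (hΛ (starRingEnd ℂ s)).conj_conj
      simpa using this
    have heq : starRingEnd ℂ ∘ Λ ∘ starRingEnd ℂ = Λ := by
      refine AnalyticOnNhd.eq_of_eventuallyEq (𝕜 := ℂ) (z₀ := 2)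
        (hg.differentiableOn.analyticOnNhd isOpen_univ)
        (hΛ.differentiableOn.analyticOnNhd isOpen_univ) ?_
      filter_upwards [hopen.mem_nhds (show (2 : ℂ) ∈ {s : ℂ | 1 < s.re} by simp)] with s hs
      have hs' : 1 < (starRingEnd ℂ s).re := by simpa using hs
      simp only [Function.comp_apply]
      rw [hL s hs, hL _ hs', LSeries_conj]
      simp
    intro s
    have := congrFun heq (starRingEnd ℂ s)
    simpa using this.symm
  -- conjugation turns the reflection `s ↦ 1 - s` into the one that preserves the imaginary part
  have hcompconj : ∀ s : ℂ, ‖completed r N κ Λ (starRingEnd ℂ s)‖ = ‖completed r N κ Λ s‖ := by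
    intro s
    have e : starRingEnd ℂ s + κ = starRingEnd ℂ (s + κ) := by simp
    simp only [completed, norm_mul, norm_pow, hconj, norm_conj, e, norm_Gammaℝ_conj,
      norm_cpow_eq_rpow_re_of_pos hN0]
    simp
  refine ⟨hr, hN, hκ, hκ1, hΛ, hne, ?_, ?_, ?_, hb, hlog⟩
  · obtain ⟨G, hGd, hGb, hGL⟩ := exists_continuation (f := fun n => (f n : ℂ)) (c := r) (B := B) hfn
      (fun n => by
        have e : ∑ k ∈ Finset.Icc 1 n, (f k : ℂ) - r * n =
            ((∑ k ∈ Finset.Icc 1 n, f k - r * n : ℝ) : ℂ) := by push_cast; ring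
        rw [e, norm_real]; exact hB n)
    have hGΛ : EqOn Λ (fun s => (s - 1) ^ r * G s + r * s) {s : ℂ | 0 < s.re} := by
      refine AnalyticOnNhd.eqOn_of_preconnected_of_eventuallyEq (z₀ := 2)
        (hΛ.differentiableOn.analyticOnNhd (isOpen_lt continuous_const continuous_re))
        (DifferentiableOn.analyticOnNhd ?_ (isOpen_lt continuous_const continuous_re))
        (convex_halfSpace_re_gt 0).isPreconnected (by simp) ?_
      · exact (DifferentiableOn.mul (by fun_prop) hGd).add (by fun_prop)
      · filter_upwards [hopen.mem_nhds (show (2 : ℂ) ∈ {s : ℂ | 1 < s.re} by simp)] with s hs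
        have hs1 : s - 1 ≠ 0 := by
          intro h
          have h2 := congrArg re h
          simp only [sub_re, one_re, zero_re] at h2
          have hs' : 1 < s.re := hs
          linarith
        rw [hL s hs, hGL s hs]
        rcases Nat.le_one_iff_eq_zero_or_eq_one.1 hr with h0 | h0 <;> subst h0
        · simp
        · simp; field_simp
    refine ⟨4 * (B + r) + 1, fun s hs => ?_⟩
    have hB0 : 0 ≤ B := (abs_nonneg _).trans (hB 0)
    rw [hGΛ (show 0 < s.re by linarith)]
    have h1 : ‖G s‖ ≤ ‖s‖ * (4 * (B + r)) := by
      refine (hGb s (by linarith)).trans (mul_le_mul_of_nonneg_left ?_ (norm_nonneg _))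
      rw [Complex.norm_natCast, div_le_iff₀ (by linarith)]
      have : 0 ≤ B + r := by positivity
      nlinarith
    have hs0 := norm_nonneg s
    have h2 : ‖(s - 1) ^ r‖ ≤ 1 + ‖s‖ := by
      rcases Nat.le_one_iff_eq_zero_or_eq_one.1 hr with h0 | h0 <;> subst h0
      · simp
      · rw [pow_one]; refine (norm_sub_le _ _).trans ?_; simp [add_comm]
    have h3 : ‖(r : ℂ) * s‖ ≤ ‖s‖ := by
      rw [norm_mul, Complex.norm_natCast]
      exact mul_le_of_le_one_left hs0 (by exact_mod_cast hr)
    have h4 : ‖(s - 1) ^ r * G s‖ ≤ (1 + ‖s‖) * (‖s‖ * (4 * (B + r))) := by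
      rw [norm_mul]
      exact mul_le_mul h2 h1 (norm_nonneg _) (by linarith)
    have h5 := norm_add_le ((s - 1) ^ r * G s) (r * s)
    have h6 : 0 ≤ 4 * (B + r) := by positivity
    nlinarith [mul_nonneg h6 hs0]
  · have hπ : Real.pi ^ 2 < 12 := by nlinarith [Real.pi_lt_d2, Real.pi_gt_three]
    refine ⟨(2 - Real.pi ^ 2 / 6) / 2, Real.pi ^ 2 / 6 , by linarith, fun s hs => ?_⟩
    obtain ⟨h1, h2⟩ := LSeries_norm_bounds (f := fun n => (f n : ℂ)) hfn (by simp [hf1]) hs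
    rw [hL s (by linarith), norm_mul, norm_pow]
    have hs0 := norm_nonneg s
    have hs2 : 2 ≤ ‖s‖ := hs.trans (re_le_norm s)
    rcases Nat.le_one_iff_eq_zero_or_eq_one.1 hr with h0 | h0 <;> subst h0
    · simp only [pow_zero, mul_one, one_mul]
      constructor <;> linarith
    · simp only [pow_one]
      have h3 : ‖s‖ / 2 ≤ ‖s - 1‖ := by
        have := norm_sub_norm_le s 1; rw [norm_one] at this; linarith
      have h4 : ‖s - 1‖ ≤ ‖s‖ := by
        rw [← sq_le_sq₀ (norm_nonneg _) hs0, ← normSq_eq_norm_sq, ← normSq_eq_norm_sq, normSq_apply,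
          normSq_apply]
        simp; nlinarith
      constructor
      · nlinarith [norm_nonneg (s - 1)]
      · nlinarith [norm_nonneg (s - 1), norm_nonneg (LSeries (fun n => (f n : ℂ)) s)]
  · intro c t hc hc2
    have e1 : (1 / 2 - c + t * I : ℂ) = 1 - starRingEnd ℂ (1 / 2 + c + t * I) := by
      simp only [map_add, map_mul, conj_ofReal, conj_I, map_div₀, map_one, map_ofNat]
      ring
    have h := hfe (starRingEnd ℂ (1 / 2 + c + t * I)) (by simp; linarith) (by simp; linarith)
    rw [← e1, hcompconj] at h
    exact h

/-! ### The zeta function and the quadratic `L`-functions -/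

theorem quadraticL_of_isFundamentalDiscriminant {d : ℤ} (hd : IsFundamentalDiscriminant d)
    [NeZero d.natAbs] (s : ℂ) :
    quadraticL d s = DirichletCharacter.LFunction (quadraticCharacter d hd) s := by
  rw [quadraticL, dif_pos hd]

theorem isFundamentalDiscriminant_one : IsFundamentalDiscriminant 1 :=
  Or.inl ⟨rfl, squarefree_one⟩

theorem quadraticL_one (s : ℂ) : quadraticL 1 s = riemannZeta s := by
  have : NeZero (1 : ℤ).natAbs := ⟨one_ne_zero⟩
  rw [quadraticL_of_isFundamentalDiscriminant isFundamentalDiscriminant_one]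
  exact congrFun DirichletCharacter.LFunction_modOne_eq s

/-- The entire function `(s - 1) ζ(s)`. -/
noncomputable def zetaEntire : ℂ → ℂ := DirichletCharacter.LFunctionTrivChar₁ 1

theorem zetaEntire_of_ne_one {s : ℂ} (hs : s ≠ 1) : zetaEntire s = (s - 1) * riemannZeta s := by
  rw [zetaEntire, DirichletCharacter.LFunctionTrivChar₁, Function.update_of_ne hs,
    DirichletCharacter.LFunctionTrivChar, DirichletCharacter.LFunction_modOne_eq]

theorem ne_one_of_one_lt_re {s : ℂ} (hs : 1 < s.re) : s ≠ 1 := by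
  rintro rfl; simp at hs

/-- The zeta function satisfies the axioms with `r = 1`. -/
theorem isCompletable_zeta (hGRH : GRH) :
    IsCompletable 1 1 0 (fun n => (ArithmeticFunction.vonMangoldt n : ℂ)) zetaEntire := by
  have hdiff : Differentiable ℂ zetaEntire := DirichletCharacter.differentiable_LFunctionTrivChar₁ 1
  have hopen : IsOpen {s : ℂ | 1 < s.re} := isOpen_lt continuous_const continuous_re
  refine IsCompletable.of_real (f := fun _ => 1) (B := 0) le_rfl le_rfl le_rfl zero_le_one
    hdiff ?_ (fun n => by simp) rfl (fun n => by simp) ?_ ?_ ?_ ?_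
  · intro s hs
    rcases eq_or_ne s 1 with rfl | h1
    · exact DirichletCharacter.LFunctionTrivChar₁_apply_one_ne_zero 1
    · rw [zetaEntire_of_ne_one h1]
      refine mul_ne_zero (sub_ne_zero.2 h1) ?_
      rcases lt_or_ge s.re 1 with h | h
      · intro h0
        have := hGRH 1 isFundamentalDiscriminant_one s (by linarith) h (by rw [quadraticL_one, h0])
        linarith
      · exact riemannZeta_ne_zero_of_one_le_re h
  · intro s hs
    rw [zetaEntire_of_ne_one (ne_one_of_one_lt_re hs), pow_one, ← LSeries_one_eq_riemannZeta hs]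
    simp only [ofReal_one]
    rfl
  · intro s hs hs1
    have hs0 : s ≠ 0 := by rintro rfl; simp at hs; linarith
    have hs1' : s ≠ 1 := by rintro rfl; simp at hs1
    have h1s0 : 1 - s ≠ 0 := sub_ne_zero.2 hs1'.symm
    have h1s1 : 1 - s ≠ 1 := by intro h; apply hs0; linear_combination -h
    have hG1 : Gammaℝ s ≠ 0 := Gammaℝ_ne_zero_of_re_pos (by linarith)
    have hG2 : Gammaℝ (1 - s) ≠ 0 := Gammaℝ_ne_zero_of_re_pos (by simp; linarith)
    rw [completed, completed, zetaEntire_of_ne_one hs1', zetaEntire_of_ne_one h1s1,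
      riemannZeta_def_of_ne_zero hs0, riemannZeta_def_of_ne_zero h1s0,
      completedRiemannZeta_one_sub]
    simp only [ofReal_one, one_cpow, ofReal_zero, add_zero, pow_one, mul_one]
    congr 1
    field_simp
    ring
  · intro n
    rw [norm_real, Real.norm_of_nonneg ArithmeticFunction.vonMangoldt_nonneg]
  · intro s hs
    have h1 := ne_one_of_one_lt_re hs
    rw [ArithmeticFunction.LSeries_vonMangoldt_eq_deriv_riemannZeta_div hs]
    have hζ : riemannZeta s ≠ 0 := riemannZeta_ne_zero_of_one_le_re hs.le
    have h2 : zetaEntire =ᶠ[𝓝 s] fun w => (w - 1) * riemannZeta w := by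
      filter_upwards [isOpen_ne.mem_nhds h1] with w hw using zetaEntire_of_ne_one hw
    rw [logDeriv_apply, h2.deriv_eq, h2.self_of_nhds, deriv_fun_mul (by fun_prop)
      (differentiableAt_riemannZeta h1)]
    have h3 : s - 1 ≠ 0 := sub_ne_zero.2 h1
    simp only [deriv_sub_const, deriv_id'', Nat.cast_one]
    field_simp
    ring

/-- Partial sums of a periodic sequence with mean zero are bounded by the period. -/
theorem abs_sum_periodic_le {f : ℕ → ℝ} {N : ℕ} (hN : N ≠ 0) (hf : ∀ n, |f n| ≤ 1)
    (hper : ∀ n, f (n + N) = f n) (hsum : ∑ k ∈ Finset.range N, f k = 0) (n : ℕ) :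
    |∑ k ∈ Finset.range n, f k| ≤ N := by
  have h1 : Function.Periodic (fun n => ∑ k ∈ Finset.range n, f k) N := by
    intro n
    simp only
    rw [add_comm, Finset.sum_range_add, hsum, zero_add]
    refine Finset.sum_congr rfl fun k _ => ?_
    rw [add_comm, hper]
  rw [← h1.map_mod_nat n]
  refine (Finset.abs_sum_le_sum_abs _ _).trans ((Finset.sum_le_sum fun k _ => hf k).trans ?_)
  simp only [Finset.sum_const, Finset.card_range, nsmul_eq_mul, mul_one]
  exact_mod_cast (Nat.mod_lt n (Nat.pos_of_ne_zero hN)).le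

theorem IsFundamentalDiscriminant.abs_sum_kroneckerSym_le {d : ℤ}
    (hd : IsFundamentalDiscriminant d) (h1 : d ≠ 1) (n : ℕ) :
    |∑ k ∈ Finset.Icc 1 n, (kroneckerSym d k : ℝ)| ≤ d.natAbs := by
  have : NeZero d.natAbs := ⟨hd.natAbs_ne_zero⟩
  have hsum : ∑ k ∈ Finset.range d.natAbs, (kroneckerSym d k : ℝ) = 0 := by
    have h := MulChar.sum_eq_zero_of_ne_one (hd.quadraticCharacter_ne_one h1)
    have h2 : ∑ k ∈ Finset.range d.natAbs, (quadraticCharacter d hd) (k : ZMod d.natAbs) = 0 := by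
      rw [← h]
      refine Finset.sum_nbij' (fun k => (k : ZMod d.natAbs)) ZMod.val ?_ ?_ ?_ ?_ ?_
      · simp
      · intro a _; simpa using ZMod.val_lt a
      · intro a ha; exact ZMod.val_cast_of_lt (by simpa using ha)
      · intro a _; simp
      · intro a _; rfl
    simp only [quadraticCharacter_natCast] at h2
    exact_mod_cast h2
  have h := abs_sum_periodic_le (f := fun k => (kroneckerSym d k : ℝ)) hd.natAbs_ne_zero
    (abs_kroneckerSym_le_one d) (fun n => by
      rw [← hd.kroneckerSym_mod, Nat.add_mod_right, hd.kroneckerSym_mod]) hsum (n + 1)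
  have h0 : kroneckerSym d 0 = 0 := by
    rw [kroneckerSym_zero, if_neg (hd.natAbs_ne_one h1)]
  rw [Finset.sum_range_eq_add_Ico _ (by omega), h0, Int.cast_zero, zero_add] at h
  exact h

theorem quadraticCharacter_inv (d : ℤ) (hd : IsFundamentalDiscriminant d) :
    (quadraticCharacter d hd)⁻¹ = quadraticCharacter d hd := by
  have : NeZero d.natAbs := ⟨hd.natAbs_ne_zero⟩
  ext a
  rw [MulChar.inv_apply_eq_inv']
  have h := quadraticCharacter_natCast d hd (a : ZMod d.natAbs).val
  rw [ZMod.natCast_zmod_val] at h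
  rw [h]
  rcases kroneckerSym_eq d (a : ZMod d.natAbs).val with h | h | h <;> rw [h] <;> norm_num

/-- Applying the functional equation twice gives `W ^ 2 = 1` for the root number `W` of a real
character. -/
theorem norm_rootNumber_eq_one {N : ℕ} [NeZero N] {χ : DirichletCharacter ℂ N}
    (hχ : χ.IsPrimitive) (hreal : χ⁻¹ = χ) : ‖χ.rootNumber‖ = 1 := by
  have hN : (N : ℂ) ≠ 0 := by exact_mod_cast NeZero.ne N
  have h1 := hχ.completedLFunction_one_sub 2
  have h2 := hχ.completedLFunction_one_sub (1 - 2)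
  rw [hreal] at h1 h2
  rw [sub_sub_cancel, h1] at h2
  have h0 : DirichletCharacter.completedLFunction χ 2 ≠ 0 := by
    have h3 := DirichletCharacter.LFunction_eq_completed_div_gammaFactor χ 2 (Or.inl two_ne_zero)
    intro h
    rw [h, zero_div] at h3
    exact DirichletCharacter.LFunction_ne_zero_of_one_le_re χ (s := 2)
      (Or.inr (by norm_num)) (by norm_num) h3
  have h4 : (N : ℂ) ^ ((1 : ℂ) - 2 - 1 / 2) * (N : ℂ) ^ ((2 : ℂ) - 1 / 2) = 1 := by
    rw [← cpow_add _ _ hN]; norm_num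
  have h5 : χ.rootNumber ^ 2 = 1 := by
    have h6 : (χ.rootNumber ^ 2 - 1) * DirichletCharacter.completedLFunction χ 2 = 0 := by
      linear_combination -h2 + χ.rootNumber ^ 2 * DirichletCharacter.completedLFunction χ 2 * (- h4)
    rcases mul_eq_zero.1 h6 with h7 | h7
    · linear_combination h7
    · exact absurd h7 h0
  have h6 : ‖χ.rootNumber‖ ^ 2 = 1 := by rw [← norm_pow, h5, norm_one]
  nlinarith [norm_nonneg χ.rootNumber]

/-- The `L`-function of a fundamental discriminant `d ≠ 1` satisfies the axioms with `r = 0`; the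
parameter `κ` is `0` or `1` according to the sign of `d`. -/
theorem isCompletable_quadraticL (hGRH : GRH) {d : ℤ} (hd : IsFundamentalDiscriminant d)
    (h1 : d ≠ 1) : ∃ κ : ℝ, IsCompletable 0 d.natAbs κ
      (fun n => ((ArithmeticFunction.vonMangoldt n * kroneckerSym d n : ℝ) : ℂ))
      (quadraticL d) := by
  have : NeZero d.natAbs := ⟨hd.natAbs_ne_zero⟩
  set χ := quadraticCharacter d hd with hχ
  have hχ1 : χ ≠ 1 := hd.quadraticCharacter_ne_one h1
  have hL : quadraticL d = DirichletCharacter.LFunction χ :=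
    funext fun s => quadraticL_of_isFundamentalDiscriminant hd s
  have hfχ : (fun n : ℕ => ((kroneckerSym d n : ℝ) : ℂ)) = fun n : ℕ => χ n := by
    funext n; rw [hχ, quadraticCharacter_natCast]; push_cast; rfl
  have hN1 : (1 : ℝ) ≤ d.natAbs := by exact_mod_cast Nat.one_le_iff_ne_zero.2 hd.natAbs_ne_zero
  obtain ⟨κ, hκ0, hκ1, hκ⟩ : ∃ κ : ℝ, 0 ≤ κ ∧ κ ≤ 1 ∧ ∀ s, χ.gammaFactor s = Gammaℝ (s + κ) := by
    rcases χ.even_or_odd with h | h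
    · exact ⟨0, le_rfl, zero_le_one, fun s => by rw [h.gammaFactor_def]; simp⟩
    · exact ⟨1, zero_le_one, le_rfl, fun s => by rw [h.gammaFactor_def]; simp⟩
  have hcomp : ∀ s : ℂ, 0 < s.re → completed 0 d.natAbs κ (quadraticL d) s =
      ((d.natAbs : ℝ) : ℂ) ^ (s / 2) * χ.completedLFunction s := by
    intro s hs
    have hG : Gammaℝ (s + κ) ≠ 0 := Gammaℝ_ne_zero_of_re_pos (by simp; linarith)
    have hs0 : s ≠ 0 := by rintro rfl; simp at hs
    rw [completed, hL, χ.LFunction_eq_completed_div_gammaFactor s (Or.inl hs0), hκ]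
    field_simp
  refine ⟨κ, IsCompletable.of_real (f := fun n => kroneckerSym d n) (B := d.natAbs) zero_le_one
    hN1 hκ0 hκ1 ?_ ?_ (abs_kroneckerSym_le_one d) (by simp [kroneckerSym_one]) ?_ ?_ ?_ ?_ ?_⟩
  · rw [hL]; exact DirichletCharacter.differentiable_LFunction hχ1
  · intro s hs
    rcases lt_or_ge s.re 1 with h | h
    · intro h0
      have := hGRH d hd s (by linarith) h h0
      linarith
    · rw [hL]; exact DirichletCharacter.LFunction_ne_zero_of_one_le_re χ (Or.inl hχ1) h
  · intro n
    simpa using hd.abs_sum_kroneckerSym_le h1 n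
  · intro s hs
    rw [pow_zero, one_mul, hL, DirichletCharacter.LFunction_eq_LSeries χ hs, hfχ]
  · intro s hs hs1
    have hN0 : (0 : ℝ) < d.natAbs := by linarith
    rw [hcomp _ (by simp; linarith), hcomp _ (by linarith), hd.isPrimitive.completedLFunction_one_sub,
      quadraticCharacter_inv, norm_mul, norm_mul, norm_mul,
      norm_rootNumber_eq_one hd.isPrimitive (quadraticCharacter_inv d hd), norm_mul, mul_one,
      ← mul_assoc]
    congr 1
    rw [norm_cpow_eq_rpow_re_of_pos hN0, norm_cpow_eq_rpow_re_of_pos hN0, ← ofReal_natCast,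
      norm_cpow_eq_rpow_re_of_pos hN0, ← Real.rpow_add hN0]
    congr 1
    simp
    ring
  · intro n
    rw [norm_real, norm_mul, Real.norm_of_nonneg ArithmeticFunction.vonMangoldt_nonneg]
    exact mul_le_of_le_one_right ArithmeticFunction.vonMangoldt_nonneg
      (abs_kroneckerSym_le_one d n)
  · intro s hs
    have h := DirichletCharacter.LSeries_twist_vonMangoldt_eq χ hs
    have e : (fun n => ((ArithmeticFunction.vonMangoldt n * kroneckerSym d n : ℝ) : ℂ)) =
        (fun n : ℕ => χ n) * fun n : ℕ => (ArithmeticFunction.vonMangoldt n : ℂ) := by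
      funext n
      rw [Pi.mul_apply, ← congrFun hfχ n]; push_cast; ring
    rw [e, h, logDeriv_apply, hL, DirichletCharacter.deriv_LFunction_eq_deriv_LSeries χ hs,
      DirichletCharacter.LFunction_eq_LSeries χ hs]
    simp [neg_div]

/-! ### The conditional bound for `|L|` by a short Dirichlet polynomial -/

/-- The smooth weights of the Dirichlet polynomial; when `u = 0` they are close to
`(1 - 1 / n) / log n` for `log n` much smaller than `log x`. -/
noncomputable def weight (x u : ℝ) (n : ℕ) : ℝ :=
  ∫ v in u..1, Real.sinh (v * Real.log (x / n)) / (2 * Real.cosh (v * Real.log x / 2) ^ 2)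

theorem continuous_weight_integrand (x : ℝ) (n : ℕ) : Continuous fun v : ℝ =>
    Real.sinh (v * Real.log (x / n)) / (2 * Real.cosh (v * Real.log x / 2) ^ 2) := by
  refine Continuous.div (by fun_prop) (by fun_prop) fun v => ?_
  have := Real.cosh_pos (v * Real.log x / 2)
  positivity

theorem inv_cosh_sq_le (y : ℝ) : (Real.cosh (y / 2) ^ 2)⁻¹ ≤ 4 * Real.exp (-y) := by
  have h1 : Real.exp (y / 2) / 2 ≤ Real.cosh (y / 2) := by
    rw [Real.cosh_eq]
    have := Real.exp_pos (-(y / 2)); linarith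
  have h2 : Real.exp y / 4 ≤ Real.cosh (y / 2) ^ 2 := by
    have e : Real.exp y = Real.exp (y / 2) ^ 2 := by rw [← Real.exp_nat_mul]; congr 1; push_cast; ring
    have := pow_le_pow_left₀ (by positivity) h1 2
    rw [e]; linarith
  rw [inv_le_comm₀ (by have := Real.cosh_pos (y / 2); positivity) (by positivity), mul_inv,
    ← Real.exp_neg, neg_neg]
  linarith

theorem integral_exp_neg_mul_le {a : ℝ} (ha : 0 < a) (u w : ℝ) :
    ∫ v in u..w, Real.exp (-(v * a)) ≤ Real.exp (-(u * a)) / a := by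
  have h : ∀ v ∈ uIcc u w, HasDerivAt (fun v => -(Real.exp (-(v * a)) / a))
      (Real.exp (-(v * a))) v := fun v _ => by
    have := ((((hasDerivAt_id v).mul_const a).neg.exp).div_const a).neg
    refine this.congr_deriv ?_
    simp only [id, Pi.neg_apply]
    field_simp
  rw [intervalIntegral.integral_eq_sub_of_hasDerivAt h
    ((by fun_prop : Continuous fun v : ℝ => Real.exp (-(v * a))).intervalIntegrable _ _)]
  have : 0 < Real.exp (-(w * a)) / a := by positivity
  linarith

theorem continuous_inv_cosh_sq (x : ℝ) :
    Continuous fun v : ℝ => (Real.cosh (v * Real.log x / 2) ^ 2)⁻¹ := by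
  refine Continuous.inv₀ (by fun_prop) fun v => ?_
  have := Real.cosh_pos (v * Real.log x / 2)
  positivity

theorem integral_inv_cosh_sq_le {x : ℝ} (hx : 1 < x) {u : ℝ} (hu : u ≤ 1) :
    ∫ v in u..1, (Real.cosh (v * Real.log x / 2) ^ 2)⁻¹ ≤ 4 * x ^ (-u) / Real.log x := by
  have hl := Real.log_pos hx
  have h1 : ∫ v in u..1, (Real.cosh (v * Real.log x / 2) ^ 2)⁻¹ ≤
      ∫ v in u..1, 4 * Real.exp (-(v * Real.log x)) :=
    intervalIntegral.integral_mono_on hu ((continuous_inv_cosh_sq x).intervalIntegrable _ _)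
      ((by fun_prop : Continuous fun v : ℝ => 4 * Real.exp (-(v * Real.log x))).intervalIntegrable
        _ _) fun v _ => inv_cosh_sq_le _
  refine h1.trans ?_
  rw [intervalIntegral.integral_const_mul, Real.rpow_def_of_pos (by linarith), mul_div_assoc]
  have := integral_exp_neg_mul_le hl u 1
  rw [show -(u * Real.log x) = Real.log x * -u by ring] at this
  linarith

/-- The integrand of `weight` is nonnegative, at most `n ^ (-v)`, and differs from it by at most
`1 / cosh ^ 2`. -/
theorem weight_integrand_bounds {x : ℝ} {n : ℕ} (hn : 1 ≤ n) (hnx : (n : ℝ) ≤ x) {v : ℝ}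
    (hv : 0 ≤ v) :
    0 ≤ Real.sinh (v * Real.log (x / n)) / (2 * Real.cosh (v * Real.log x / 2) ^ 2) ∧
    Real.sinh (v * Real.log (x / n)) / (2 * Real.cosh (v * Real.log x / 2) ^ 2) ≤
      Real.exp (-(v * Real.log n)) ∧
    Real.exp (-(v * Real.log n)) - (Real.cosh (v * Real.log x / 2) ^ 2)⁻¹ ≤
      Real.sinh (v * Real.log (x / n)) / (2 * Real.cosh (v * Real.log x / 2) ^ 2) := by
  have hn1 : (1 : ℝ) ≤ n := by exact_mod_cast hn
  have hn0 : (0 : ℝ) < n := by linarith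
  have hx0 : 0 < x := by linarith
  have hL : 0 ≤ Real.log n := Real.log_nonneg hn1
  have hLΔ : Real.log n ≤ Real.log x := Real.log_le_log hn0 hnx
  rw [Real.log_div hx0.ne' hn0.ne']
  set L := Real.log n
  set Δ := Real.log x
  have hc : 0 < 2 * Real.cosh (v * Δ / 2) ^ 2 := by
    have := Real.cosh_pos (v * Δ / 2); positivity
  have e1 : 2 * Real.cosh (v * Δ / 2) ^ 2 = (Real.exp (v * Δ) + 2 + Real.exp (-(v * Δ))) / 2 := by
    have h1 : Real.exp (v * Δ) = Real.exp (v * Δ / 2) ^ 2 := by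
      rw [← Real.exp_nat_mul]; congr 1; push_cast; ring
    have h2 : Real.exp (-(v * Δ)) = Real.exp (-(v * Δ / 2)) ^ 2 := by
      rw [← Real.exp_nat_mul]; congr 1; push_cast; ring
    have h3 : Real.exp (v * Δ / 2) * Real.exp (-(v * Δ / 2)) = 1 := by
      rw [← Real.exp_add]; simp
    rw [Real.cosh_eq, h1, h2]
    linear_combination h3
  have e2 : Real.sinh (v * (Δ - L)) =
      (Real.exp (v * Δ) * Real.exp (-(v * L)) - Real.exp (-(v * (Δ - L)))) / 2 := by
    rw [Real.sinh_eq, ← Real.exp_add]; congr 3; ring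
  have h4 : Real.exp (-(v * L)) ≤ 1 := Real.exp_le_one_iff.2 (by nlinarith)
  have h5 : Real.exp (-(v * (Δ - L))) ≤ 1 := Real.exp_le_one_iff.2 (by nlinarith)
  have h6 : Real.exp (-(v * Δ)) ≤ 1 := Real.exp_le_one_iff.2 (by nlinarith)
  have p4 := Real.exp_pos (-(v * L))
  have p5 := Real.exp_pos (-(v * (Δ - L)))
  have p6 := Real.exp_pos (-(v * Δ))
  refine ⟨div_nonneg (Real.sinh_nonneg_iff.2 (by nlinarith)) hc.le, ?_, ?_⟩
  · rw [div_le_iff₀ hc, e1, e2]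
    nlinarith
  · have e3 : (Real.cosh (v * Δ / 2) ^ 2)⁻¹ = 2 / (2 * Real.cosh (v * Δ / 2) ^ 2) := by
      have := (Real.cosh_pos (v * Δ / 2)).ne'
      field_simp
    rw [e3, sub_le_iff_le_add, ← add_div, le_div_iff₀ hc, e1, e2]
    nlinarith

theorem weight_nonneg {x u : ℝ} (hu : 0 ≤ u) (hu1 : u ≤ 1) {n : ℕ} (hn : 1 ≤ n)
    (hnx : (n : ℝ) ≤ x) : 0 ≤ weight x u n :=
  intervalIntegral.integral_nonneg hu1 fun _ hv =>
    (weight_integrand_bounds hn hnx (hu.trans hv.1)).1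

theorem weight_le {x u : ℝ} (hu : 0 ≤ u) (hu1 : u ≤ 1) {n : ℕ} (hn : 2 ≤ n)
    (hnx : (n : ℝ) ≤ x) : weight x u n ≤ (n : ℝ) ^ (-u) / Real.log n := by
  have hn1 : (1 : ℝ) < n := by exact_mod_cast hn
  have h1 : weight x u n ≤ ∫ v in u..1, Real.exp (-(v * Real.log n)) :=
    intervalIntegral.integral_mono_on hu1 ((continuous_weight_integrand x n).intervalIntegrable _ _)
      ((by fun_prop : Continuous fun v : ℝ => Real.exp (-(v * Real.log n))).intervalIntegrable _ _)
      fun v hv => (weight_integrand_bounds (by omega) hnx (hu.trans hv.1)).2.1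
  refine h1.trans ((integral_exp_neg_mul_le (Real.log_pos hn1) u 1).trans (le_of_eq ?_))
  rw [Real.rpow_def_of_pos (by linarith)]
  congr 2; ring

/-- For `u = 0` the weight is close to `1 / log n` when both `n` and `log x / log n` are large. -/
theorem le_weight {x : ℝ} (hx : 1 < x) {n : ℕ} (hn : 2 ≤ n) (hnx : (n : ℝ) ≤ x) :
    1 - 1 / n - 4 * Real.log n / Real.log x ≤ Real.log n * weight x 0 n := by
  have hn1 : (1 : ℝ) < n := by exact_mod_cast hn
  have hl := Real.log_pos hn1
  have h1 : ∫ v in (0 : ℝ)..1, (Real.exp (-(v * Real.log n)) -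
      (Real.cosh (v * Real.log x / 2) ^ 2)⁻¹) ≤ weight x 0 n :=
    intervalIntegral.integral_mono_on zero_le_one
      (((by fun_prop : Continuous fun v : ℝ => Real.exp (-(v * Real.log n))).sub
        (continuous_inv_cosh_sq x)).intervalIntegrable _ _)
      ((continuous_weight_integrand x n).intervalIntegrable _ _)
      fun v hv => (weight_integrand_bounds (by omega) hnx hv.1).2.2
  rw [intervalIntegral.integral_sub
    ((by fun_prop : Continuous fun v : ℝ => Real.exp (-(v * Real.log n))).intervalIntegrable _ _)
    ((continuous_inv_cosh_sq x).intervalIntegrable _ _)] at h1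
  have h2 := integral_inv_cosh_sq_le hx zero_le_one
  have h3 : ∫ v in (0 : ℝ)..1, Real.exp (-(v * Real.log n)) = (1 - 1 / n) / Real.log n := by
    have h : ∀ v ∈ uIcc (0 : ℝ) 1, HasDerivAt (fun v => -(Real.exp (-(v * Real.log n)) / Real.log n))
        (Real.exp (-(v * Real.log n))) v := fun v _ => by
      have := ((((hasDerivAt_id v).mul_const (Real.log n)).neg.exp).div_const (Real.log n)).neg
      refine this.congr_deriv ?_
      simp only [id, Pi.neg_apply]
      field_simp
    rw [intervalIntegral.integral_eq_sub_of_hasDerivAt h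
      ((by fun_prop : Continuous fun v : ℝ => Real.exp (-(v * Real.log n))).intervalIntegrable _ _),
      one_mul, Real.exp_neg, Real.exp_log (by linarith)]
    simp
    ring
  rw [h3] at h1
  rw [neg_zero, Real.rpow_zero, mul_one] at h2
  have h4 := mul_le_mul_of_nonneg_left h1 hl.le
  have h5 := mul_le_mul_of_nonneg_left h2 hl.le
  have e : Real.log n * ((1 - 1 / n) / Real.log n) = 1 - 1 / (n : ℝ) := by field_simp
  rw [mul_sub, e] at h4
  have e2 : Real.log n * (4 / Real.log x) = 4 * Real.log n / Real.log x := by ring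
  rw [e2] at h5
  linarith

namespace IsCompletable

variable {r : ℕ} {N κ : ℝ} {b : ℕ → ℂ} {Λ : ℂ → ℂ}

/-- The bound for `-Re Λ' / Λ`, integrated from `s + u` to `s + 1`. -/
theorem norm_le_mul_exp (h : IsCompletable r N κ b Λ) {s : ℂ} (hs : 1 / 2 < s.re)
    (hs1 : s.re ≤ 3 / 4) (hsr : r = 1 → 1 ≤ |s.im|) {x : ℝ} (hx : 1 < x) {u : ℝ} (hu : 0 ≤ u)
    (hu1 : u ≤ 1) :
    ‖Λ (s + u)‖ ≤ ‖Λ (s + 1)‖ *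
      Real.exp ((4 + Real.log N / 2 + Real.log (3 + |s.im|) / 2 + r * (4 * Real.sqrt x)) *
        (4 * x ^ (-u) / Real.log x) + 4 * r +
        (∑ n ∈ Finset.Icc 1 ⌊x⌋₊, b n * (n : ℂ) ^ (-s) * (weight x u n : ℂ)).re) := by
  set M := 4 + Real.log N / 2 + Real.log (3 + |s.im|) / 2 + r * (4 * Real.sqrt x) with hM
  have hM0 : 0 ≤ M := by
    have h1 := Real.log_nonneg h.one_le_N
    have h2 := Real.log_nonneg (by linarith [abs_nonneg s.im] : 1 ≤ 3 + |s.im|)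
    positivity
  have hne : ∀ v : ℝ, 0 ≤ v → Λ (s + v) ≠ 0 := fun v hv => h.ne_zero _ (by simp; linarith)
  have hder : ∀ v ∈ uIcc u 1, HasDerivAt (fun v : ℝ => Real.log ‖Λ (s + v)‖)
      (logDeriv Λ (s + v)).re v := fun v hv => by
    rw [uIcc_of_le hu1] at hv
    exact hasDerivAt_log_norm h.differentiable.differentiableAt (hne v (hu.trans hv.1))
  have hcont : ContinuousOn (fun v : ℝ => (logDeriv Λ (s + v)).re) (uIcc u 1) := by
    rw [uIcc_of_le hu1]
    have h1 : ContinuousOn (fun v : ℝ => deriv Λ (s + v) / Λ (s + v)) (Icc u 1) := by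
      refine ContinuousOn.div ?_ ?_ fun v hv => hne v (hu.trans hv.1)
      · exact ((h.differentiable.contDiff.continuous_deriv le_rfl).comp
          (by fun_prop : Continuous fun v : ℝ => s + v)).continuousOn
      · exact (h.differentiable.continuous.comp
          (by fun_prop : Continuous fun v : ℝ => s + v)).continuousOn
    exact continuous_re.comp_continuousOn h1
  have hFTC := intervalIntegral.integral_eq_sub_of_hasDerivAt hder hcont.intervalIntegrable
  set a : ℕ → ℂ := fun n => b n * (n : ℂ) ^ (-s) with ha
  set S : ℝ → ℝ := fun v => ∑ n ∈ Finset.Icc 1 ⌊x⌋₊,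
    (a n).re * (Real.sinh (v * Real.log (x / n)) / (2 * Real.cosh (v * Real.log x / 2) ^ 2)) with hS
  have hScont : Continuous S :=
    continuous_finsetSum _ fun n _ => (continuous_weight_integrand x n).const_mul _
  have hpt : ∀ v ∈ Ioo u 1, -(logDeriv Λ (s + v)).re ≤
      M * (Real.cosh (v * Real.log x / 2) ^ 2)⁻¹ + 4 * r + S v := by
    intro v hv
    have hv0 : 0 < v := hu.trans_lt hv.1
    have h1 := h.neg_re_logDeriv_mul_le hs hs1 hsr hx.le hv0 hv.2.le
    have hc : 0 < Real.cosh (v * Real.log x / 2) ^ 2 := by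
      have := Real.cosh_pos (v * Real.log x / 2); positivity
    have h2 : S v * Real.cosh (v * Real.log x / 2) ^ 2 =
        (∑ n ∈ Finset.Icc 1 ⌊x⌋₊, b n * (n : ℂ) ^ (-s) *
          (Real.sinh (v * Real.log (x / n)) : ℂ)).re / 2 := by
      rw [hS, Finset.sum_mul, re_sum, Finset.sum_div]
      refine Finset.sum_congr rfl fun n _ => ?_
      rw [re_mul_ofReal]
      field_simp
      rw [mul_comm]
    have h3 : x ^ v ≤ 4 * Real.cosh (v * Real.log x / 2) ^ 2 := by
      have h4 := inv_cosh_sq_le (v * Real.log x)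
      rw [Real.rpow_def_of_pos (by linarith), mul_comm (Real.log x) v]
      rw [inv_le_comm₀ hc (by positivity), mul_inv, ← Real.exp_neg, neg_neg] at h4
      linarith
    have h4 : (r : ℝ) * x ^ v ≤ 4 * r * Real.cosh (v * Real.log x / 2) ^ 2 := by
      have := mul_le_mul_of_nonneg_left h3 r.cast_nonneg; linarith
    rw [← h2] at h1
    refine le_of_mul_le_mul_right ?_ hc
    refine h1.trans ?_
    rw [add_mul, add_mul, inv_mul_cancel_right₀ hc.ne']
    rw [hM]
    linarith
  have hint : -∫ v in u..1, (logDeriv Λ (s + v)).re ≤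
      ∫ v in u..1, (M * (Real.cosh (v * Real.log x / 2) ^ 2)⁻¹ + 4 * r + S v) := by
    rw [← intervalIntegral.integral_neg]
    exact intervalIntegral.integral_mono_on_of_le_Ioo hu1 hcont.intervalIntegrable.neg
      (((((continuous_inv_cosh_sq x).const_mul _).add continuous_const).add
        hScont).intervalIntegrable _ _) hpt
  have i1 : IntervalIntegrable (fun v : ℝ => M * (Real.cosh (v * Real.log x / 2) ^ 2)⁻¹ + 4 * r)
      volume u 1 := (((continuous_inv_cosh_sq x).const_mul _).add
        continuous_const).intervalIntegrable _ _
  have i2 : IntervalIntegrable (fun v : ℝ => M * (Real.cosh (v * Real.log x / 2) ^ 2)⁻¹)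
      volume u 1 := ((continuous_inv_cosh_sq x).const_mul _).intervalIntegrable _ _
  have hSint : ∫ v in u..1, S v =
      (∑ n ∈ Finset.Icc 1 ⌊x⌋₊, b n * (n : ℂ) ^ (-s) * (weight x u n : ℂ)).re := by
    rw [hS, intervalIntegral.integral_finsetSum fun n _ =>
      ((continuous_weight_integrand x n).const_mul _).intervalIntegrable _ _, re_sum]
    refine Finset.sum_congr rfl fun n _ => ?_
    rw [intervalIntegral.integral_const_mul, re_mul_ofReal]
    rfl
  rw [intervalIntegral.integral_add i1 (hScont.intervalIntegrable _ _),
    intervalIntegral.integral_add i2 intervalIntegrable_const, intervalIntegral.integral_const_mul,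
    intervalIntegral.integral_const, hFTC, hSint, smul_eq_mul] at hint
  have h5 := mul_le_mul_of_nonneg_left (integral_inv_cosh_sq_le hx hu1) hM0
  have h6 : (1 - u) * (4 * r) ≤ 4 * (r : ℝ) := by
    have : (0 : ℝ) ≤ r := r.cast_nonneg
    nlinarith
  have p1 : 0 < ‖Λ (s + u)‖ := norm_pos_iff.2 (hne u hu)
  have p2 : 0 < ‖Λ (s + 1)‖ := by
    have := norm_pos_iff.2 (hne 1 zero_le_one); rwa [ofReal_one] at this
  rw [ofReal_one] at hint
  have h7 : Real.log ‖Λ (s + u)‖ ≤ Real.log ‖Λ (s + 1)‖ +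
      (M * (4 * x ^ (-u) / Real.log x) + 4 * r +
      (∑ n ∈ Finset.Icc 1 ⌊x⌋₊, b n * (n : ℂ) ^ (-s) * (weight x u n : ℂ)).re) := by
    linarith
  rw [← Real.exp_log p1]
  conv_rhs => rw [← Real.exp_log p2, ← Real.exp_add]
  exact Real.exp_le_exp.2 h7

end IsCompletable

/-! ### Primes and squares of primes -/

/-- The prime powers with exponent at least three contribute a bounded amount. -/
theorem exists_sum_prime_pow_le : ∃ C : ℝ, 0 ≤ C ∧ ∀ M : ℕ,
    ∑ q ∈ Finset.Icc 2 M ×ˢ Finset.Icc 3 M, (((q.1 ^ q.2 : ℕ) : ℝ)) ^ (-(1 / 2) : ℝ) ≤ C := by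
  set ρ : ℝ := (2 : ℝ) ^ (-(1 / 2) : ℝ) with hρ
  have hρ0 : 0 ≤ ρ := by positivity
  have hρ1 : ρ < 1 := Real.rpow_lt_one_of_one_lt_of_neg (by norm_num) (by norm_num)
  have h1 : Summable fun m : ℕ => (m : ℝ) ^ (-(3 / 2) : ℝ) :=
    Real.summable_nat_rpow.2 (by norm_num)
  have h2 : Summable fun j : ℕ => ρ ^ j := summable_geometric_of_lt_one hρ0 hρ1
  refine ⟨(∑' m : ℕ, (m : ℝ) ^ (-(3 / 2) : ℝ)) * ∑' j : ℕ, ρ ^ j,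
    mul_nonneg (tsum_nonneg fun m => by positivity) (tsum_nonneg fun j => by positivity),
    fun M => ?_⟩
  have h3 : ∑ q ∈ Finset.Icc 2 M ×ˢ Finset.Icc 3 M, (((q.1 ^ q.2 : ℕ) : ℝ)) ^ (-(1 / 2) : ℝ) ≤
      ∑ q ∈ Finset.Icc 2 M ×ˢ Finset.Icc 3 M, (q.1 : ℝ) ^ (-(3 / 2) : ℝ) * ρ ^ (q.2 - 3) := by
    refine Finset.sum_le_sum fun q hq => ?_
    obtain ⟨m, k⟩ := q
    simp only [Finset.mem_product, Finset.mem_Icc] at hq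
    have hm : (2 : ℝ) ≤ m := by exact_mod_cast hq.1.1
    obtain ⟨j, rfl⟩ : ∃ j, k = 3 + j := ⟨k - 3, by omega⟩
    simp only [Nat.add_sub_cancel_left]
    have e : (((m ^ (3 + j) : ℕ) : ℝ)) ^ (-(1 / 2) : ℝ) =
        (m : ℝ) ^ (-(3 / 2) : ℝ) * ((m : ℝ) ^ (-(1 / 2) : ℝ)) ^ j := by
      push_cast
      rw [← Real.rpow_natCast (m : ℝ) (3 + j), ← Real.rpow_mul (by linarith),
        ← Real.rpow_natCast ((m : ℝ) ^ (-(1 / 2) : ℝ)) j, ← Real.rpow_mul (by linarith),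
        ← Real.rpow_add (by linarith)]
      congr 1; push_cast; ring
    rw [e]
    refine mul_le_mul_of_nonneg_left (pow_le_pow_left₀ (by positivity) ?_ j) (by positivity)
    exact Real.rpow_le_rpow_of_nonpos (by norm_num) hm (by norm_num)
  refine h3.trans ?_
  rw [Finset.sum_product]
  simp only [← Finset.mul_sum]
  rw [← Finset.sum_mul]
  refine mul_le_mul (h1.sum_le_tsum _ fun m _ => by positivity) ?_
    (Finset.sum_nonneg fun j _ => by positivity) (tsum_nonneg fun m => by positivity)
  have e : ∑ k ∈ Finset.Icc 3 M, ρ ^ (k - 3) = ∑ j ∈ (Finset.Icc 3 M).image (fun k => k - 3), ρ ^ j := by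
    rw [Finset.sum_image]
    intro a ha b hb hab
    simp only [Finset.coe_Icc, Set.mem_Icc] at ha hb
    simp only at hab
    omega
  rw [e]
  exact h2.sum_le_tsum _ fun j _ => by positivity

/-- In sums over prime powers only the odd primes and the squares of primes matter. -/
theorem exists_sum_vonMangoldt_le : ∃ C : ℝ, 0 ≤ C ∧ ∀ (M : ℕ) (g : ℕ → ℝ),
    (∀ n, 2 ≤ n → n ≤ M → |g n| ≤ (n : ℝ) ^ (-(1 / 2) : ℝ) / Real.log n) →
    ∑ n ∈ Finset.Icc 1 M, ArithmeticFunction.vonMangoldt n * g n ≤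
      ∑ p ∈ (Finset.Icc 3 M).filter Nat.Prime, Real.log p * g p +
      ∑ p ∈ (Finset.Icc 1 (Nat.sqrt M)).filter Nat.Prime, Real.log p * g (p ^ 2) + C := by
  obtain ⟨C, hC0, hC⟩ := exists_sum_prime_pow_le
  refine ⟨C + 1, by linarith, fun M g hg => ?_⟩
  set A := (Finset.Icc 3 M).filter Nat.Prime with hA
  set P := (Finset.Icc 1 (Nat.sqrt M)).filter Nat.Prime with hP
  set B := P.image (fun p => p ^ 2) with hB
  have hinj : ∀ a ∈ P, ∀ b ∈ P, a ^ 2 = b ^ 2 → a = b := fun a _ b _ h =>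
    Nat.pow_left_injective two_ne_zero h
  have hAs : A ⊆ Finset.Icc 1 M := fun n hn => by
    simp only [hA, Finset.mem_filter, Finset.mem_Icc] at hn ⊢; omega
  have hBs : B ⊆ Finset.Icc 1 M := fun n hn => by
    simp only [hB, hP, Finset.mem_image, Finset.mem_filter, Finset.mem_Icc] at hn
    obtain ⟨p, ⟨⟨h1, h2⟩, -⟩, rfl⟩ := hn
    rw [Finset.mem_Icc]
    exact ⟨Nat.one_le_pow _ _ (by omega), by rw [Nat.le_sqrt'] at h2; exact h2⟩
  have hAB : Disjoint A B := by
    rw [Finset.disjoint_left]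
    intro n hn hn2
    simp only [hA, hB, hP, Finset.mem_image, Finset.mem_filter] at hn hn2
    obtain ⟨p, ⟨-, hp⟩, rfl⟩ := hn2
    exact (Nat.Prime.not_prime_pow le_rfl) hn.2
  have e1 : ∑ n ∈ A, ArithmeticFunction.vonMangoldt n * g n = ∑ p ∈ A, Real.log p * g p :=
    Finset.sum_congr rfl fun p hp => by
      rw [ArithmeticFunction.vonMangoldt_apply_prime (Finset.mem_filter.1 hp).2]
  have e2 : ∑ n ∈ B, ArithmeticFunction.vonMangoldt n * g n =
      ∑ p ∈ P, Real.log p * g (p ^ 2) := by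
    rw [hB, Finset.sum_image hinj]
    refine Finset.sum_congr rfl fun p hp => ?_
    rw [ArithmeticFunction.vonMangoldt_apply_pow two_ne_zero,
      ArithmeticFunction.vonMangoldt_apply_prime (Finset.mem_filter.1 hp).2]
  rw [← Finset.sum_sdiff (Finset.union_subset hAs hBs), Finset.sum_union hAB, e1, e2]
  set R := Finset.Icc 1 M \ (A ∪ B) with hR
  have hterm : ∀ n, 2 ≤ n → n ≤ M → ArithmeticFunction.vonMangoldt n * g n ≤
      (n : ℝ) ^ (-(1 / 2) : ℝ) := by
    intro n hn hnM
    have hn1 : (1 : ℝ) < n := by exact_mod_cast hn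
    have hl := Real.log_pos hn1
    have h1 := (le_abs_self _).trans (hg n hn hnM)
    have h2 := ArithmeticFunction.vonMangoldt_le_log (n := n)
    have h3 : (0 : ℝ) ≤ (n : ℝ) ^ (-(1 / 2) : ℝ) / Real.log n := by positivity
    calc ArithmeticFunction.vonMangoldt n * g n
        ≤ ArithmeticFunction.vonMangoldt n * ((n : ℝ) ^ (-(1 / 2) : ℝ) / Real.log n) :=
          mul_le_mul_of_nonneg_left h1 ArithmeticFunction.vonMangoldt_nonneg
      _ ≤ Real.log n * ((n : ℝ) ^ (-(1 / 2) : ℝ) / Real.log n) :=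
          mul_le_mul_of_nonneg_right h2 h3
      _ = _ := by field_simp
  have hpp : ∀ n ∈ R, ArithmeticFunction.vonMangoldt n ≠ 0 → n ≠ 2 →
      n ∈ (Finset.Icc 2 M ×ˢ Finset.Icc 3 M).image fun q : ℕ × ℕ => q.1 ^ q.2 := by
    intro n hn hΛ hn2
    simp only [hR, Finset.mem_sdiff, Finset.mem_union, not_or] at hn
    obtain ⟨hnM, hnA, hnB⟩ := hn
    rw [Finset.mem_Icc] at hnM
    obtain ⟨p, k, hp, hk, rfl⟩ := (isPrimePow_nat_iff _).1
      (ArithmeticFunction.vonMangoldt_ne_zero_iff.1 hΛ)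
    have hk1 : k ≠ 1 := by
      rintro rfl
      rw [pow_one] at hnA hn2 hnM
      refine hnA (Finset.mem_filter.2 ⟨Finset.mem_Icc.2 ⟨?_, hnM.2⟩, hp⟩)
      have := hp.two_le; omega
    have hk2 : k ≠ 2 := by
      rintro rfl
      exact hnB (Finset.mem_image.2 ⟨p, Finset.mem_filter.2
        ⟨Finset.mem_Icc.2 ⟨hp.one_le, Nat.le_sqrt'.2 hnM.2⟩, hp⟩, rfl⟩)
    refine Finset.mem_image.2 ⟨(p, k), Finset.mem_product.2 ⟨Finset.mem_Icc.2 ⟨hp.two_le, ?_⟩,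
      Finset.mem_Icc.2 ⟨by omega, ?_⟩⟩, rfl⟩
    · exact (Nat.le_self_pow hk.ne' p).trans hnM.2
    · exact (Nat.lt_pow_self hp.one_lt).le.trans hnM.2
  set R' := R.filter fun n => ArithmeticFunction.vonMangoldt n ≠ 0 with hR'
  have e3 : ∑ n ∈ R, ArithmeticFunction.vonMangoldt n * g n =
      ∑ n ∈ R', ArithmeticFunction.vonMangoldt n * g n := by
    symm
    refine Finset.sum_subset (Finset.filter_subset _ _) fun n hn hn' => ?_
    have : ArithmeticFunction.vonMangoldt n = 0 := by
      by_contra h; exact hn' (Finset.mem_filter.2 ⟨hn, h⟩)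
    rw [this, zero_mul]
  have h1 : ∑ n ∈ R, ArithmeticFunction.vonMangoldt n * g n ≤
      ∑ n ∈ R', (n : ℝ) ^ (-(1 / 2) : ℝ) := by
    rw [e3]
    refine Finset.sum_le_sum fun n hn => ?_
    rw [hR', Finset.mem_filter] at hn
    have hn1 : n ≠ 1 := by rintro rfl; exact hn.2 (by simp)
    have := Finset.mem_Icc.1 (Finset.mem_sdiff.1 hn.1).1
    exact hterm n (by omega) this.2
  have h2 : ∑ n ∈ R', (n : ℝ) ^ (-(1 / 2) : ℝ) ≤ 1 + C := by
    rw [← Finset.sum_filter_add_sum_filter_not R' (fun n => n = 2)]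
    refine add_le_add ?_ ?_
    · refine (Finset.sum_le_sum_of_subset_of_nonneg (t := {2}) ?_ fun n _ _ => by positivity).trans ?_
      · intro n hn; rw [Finset.mem_singleton]; exact (Finset.mem_filter.1 hn).2
      · rw [Finset.sum_singleton]
        exact Real.rpow_le_one_of_one_le_of_nonpos (by norm_num) (by norm_num)
    · refine le_trans (Finset.sum_le_sum_of_subset_of_nonneg (t := (Finset.Icc 2 M ×ˢ
        Finset.Icc 3 M).image fun q : ℕ × ℕ => q.1 ^ q.2) ?_ fun n _ _ => by positivity) ?_
      · intro n hn
        rw [Finset.mem_filter, hR', Finset.mem_filter] at hn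
        exact hpp n hn.1.1 hn.1.2 hn.2
      · exact (Finset.sum_image_le_of_nonneg (f := fun n : ℕ => (n : ℝ) ^ (-(1 / 2) : ℝ))
          fun n _ => by positivity).trans (hC M)
  linarith

/-- `L(s, χ_d)` is bounded for `Re s ≥ 3 / 2`, uniformly in `d`. -/
theorem exists_norm_quadraticL_le : ∃ C : ℝ, 1 ≤ C ∧ ∀ d : ℤ, IsFundamentalDiscriminant d →
    ∀ s : ℂ, 3 / 2 ≤ s.re → ‖quadraticL d s‖ ≤ C := by
  have h1 : Summable fun m : ℕ => (m : ℝ) ^ (-(3 / 2) : ℝ) :=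
    Real.summable_nat_rpow.2 (by norm_num)
  refine ⟨max 1 (∑' m : ℕ, (m : ℝ) ^ (-(3 / 2) : ℝ)), le_max_left _ _, fun d hd s hs => ?_⟩
  have : NeZero d.natAbs := ⟨hd.natAbs_ne_zero⟩
  refine le_trans ?_ (le_max_right _ _)
  rw [quadraticL_of_isFundamentalDiscriminant hd,
    DirichletCharacter.LFunction_eq_LSeries _ (by linarith)]
  refine tsum_of_norm_bounded h1.hasSum fun n => ?_
  rw [LSeries.norm_term_eq]
  split_ifs with hn
  · positivity
  · have hn1 : (1 : ℝ) ≤ n := by exact_mod_cast Nat.one_le_iff_ne_zero.2 hn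
    rw [Real.rpow_neg (by linarith), ← one_div]
    refine div_le_div₀ zero_le_one ?_ (by positivity)
      (Real.rpow_le_rpow_of_exponent_le hn1 hs)
    rw [quadraticCharacter_natCast]
    rcases kroneckerSym_eq d n with h | h | h <;> simp [h]

theorem cpow_neg_re {n : ℕ} (hn : n ≠ 0) (s : ℂ) :
    ((n : ℂ) ^ (-s)).re = (n : ℝ) ^ (-s.re) * Real.cos (s.im * Real.log n) := by
  have hn0 : (0 : ℝ) < n := by positivity
  rw [cpow_def_of_ne_zero (by exact_mod_cast hn), ← natCast_log, exp_re,
    Real.rpow_def_of_pos hn0]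
  simp only [mul_re, mul_im, ofReal_re, ofReal_im, neg_re, neg_im, zero_mul, sub_zero, add_zero]
  rw [← Real.cos_neg]
  congr 2; ring

/-- The conditional upper bound for `|L(1/2 + z, χ_d)|`. -/
theorem exists_norm_quadraticL_le_exp (hGRH : GRH) : ∃ C X₀ : ℝ, 1 ≤ X₀ ∧ 0 < C ∧
    ∀ X : ℝ, X₀ ≤ X → ∀ d : ℤ, IsFundamentalDiscriminant d → d ≠ 1 → |(d : ℝ)| ≤ X →
    ∀ z : ℂ, 0 ≤ z.re → z.re ≤ 1 / 8 → |z.im| ≤ X → ∀ x : ℝ, 1 < x →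
    ‖quadraticL d (1 / 2 + z)‖ ≤ C * Real.exp (8 * Real.log X / Real.log x +
      ∑ n ∈ Finset.Icc 1 ⌊x⌋₊, ArithmeticFunction.vonMangoldt n * (kroneckerSym d n *
        (n : ℝ) ^ (-(1 / 2 + z.re)) * Real.cos (z.im * Real.log n) * weight x 0 n)) := by
  obtain ⟨C, hC1, hC⟩ := exists_norm_quadraticL_le
  refine ⟨C, Real.exp 5, Real.one_le_exp (by norm_num), by linarith,
    fun X hX d hd hd1 hdX z hz0 hz1 hzX x hx => ?_⟩
  obtain ⟨κ, h⟩ := isCompletable_quadraticL hGRH hd hd1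
  have hX0 : 0 < X := lt_of_lt_of_le (Real.exp_pos 5) hX
  have hlX : 5 ≤ Real.log X := by rwa [Real.le_log_iff_exp_le hX0]
  have hlx := Real.log_pos hx
  -- the bound for `Re z > 0`
  have main : ∀ z : ℂ, 0 < z.re → z.re ≤ 1 / 4 → |z.im| ≤ X →
      ‖quadraticL d (1 / 2 + z)‖ ≤ C * Real.exp (8 * Real.log X / Real.log x +
      ∑ n ∈ Finset.Icc 1 ⌊x⌋₊, ArithmeticFunction.vonMangoldt n * (kroneckerSym d n *
        (n : ℝ) ^ (-(1 / 2 + z.re)) * Real.cos (z.im * Real.log n) * weight x 0 n)) := by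
    intro z hz0 hz1 hzX
    have hsre : (1 / 2 + z : ℂ).re = 1 / 2 + z.re := by simp
    have hsim : (1 / 2 + z : ℂ).im = z.im := by simp
    have h1 := h.norm_le_mul_exp (s := 1 / 2 + z) (by rw [hsre]; linarith)
      (by rw [hsre]; linarith) (by norm_num) hx le_rfl zero_le_one
    rw [ofReal_zero, add_zero] at h1
    refine h1.trans (mul_le_mul (hC d hd _ (by rw [add_re, hsre, one_re]; linarith))
      (Real.exp_le_exp.2 (add_le_add ?_ (le_of_eq ?_))) (Real.exp_pos _).le (by linarith))
    · have hNX : Real.log (d.natAbs : ℝ) ≤ Real.log X := by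
        refine Real.log_le_log (by exact_mod_cast Nat.pos_of_ne_zero hd.natAbs_ne_zero) ?_
        rwa [Nat.cast_natAbs, Int.cast_abs]
      have h3X : Real.log (3 + |z.im|) ≤ Real.log X + 1 := by
        have h2 : 3 + |z.im| ≤ X * Real.exp 1 := by
          have h3 : (2 : ℝ) ≤ Real.exp 1 := by linarith [Real.add_one_le_exp (1 : ℝ)]
          have h4 : (6 : ℝ) ≤ Real.exp 5 := by linarith [Real.add_one_le_exp (5 : ℝ)]
          nlinarith
        refine (Real.log_le_log (by linarith [abs_nonneg z.im]) h2).trans ?_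
        rw [Real.log_mul hX0.ne' (Real.exp_pos 1).ne', Real.log_exp]
      rw [hsim, neg_zero, Real.rpow_zero, mul_one, Nat.cast_zero]
      -- conductor and height contribute `2 log X`, and integrating `1 / cosh ^ 2` gives `4 / log x`
      have h5 : 4 + Real.log (d.natAbs : ℝ) / 2 + Real.log (3 + |z.im|) / 2 + 0 * (4 * Real.sqrt x)
          ≤ 2 * Real.log X := by linarith
      have h6 := mul_le_mul_of_nonneg_right h5 (by positivity : 0 ≤ 4 / Real.log x)
      refine le_trans (by linarith) (h6.trans (le_of_eq (by ring)))
    · rw [re_sum]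
      refine Finset.sum_congr rfl fun n hn => ?_
      have hn0 : n ≠ 0 := by have := (Finset.mem_Icc.1 hn).1; omega
      rw [re_mul_ofReal, re_ofReal_mul, cpow_neg_re hn0, hsre, hsim]
      ring
  -- the boundary case by continuity
  have : NeZero d.natAbs := ⟨hd.natAbs_ne_zero⟩
  have hL : Continuous (quadraticL d) := h.differentiable.continuous
  have hlim1 : Tendsto (fun δ : ℝ => ‖quadraticL d (1 / 2 + (z + δ))‖) (𝓝[>] 0)
      (𝓝 ‖quadraticL d (1 / 2 + (z + (0 : ℝ)))‖) :=
    ((hL.comp (by fun_prop : Continuous fun δ : ℝ => 1 / 2 + (z + δ))).norm.tendsto 0).mono_left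
      nhdsWithin_le_nhds
  have hcont : Continuous fun δ : ℝ => C * Real.exp (8 * Real.log X / Real.log x +
      ∑ n ∈ Finset.Icc 1 ⌊x⌋₊, ArithmeticFunction.vonMangoldt n * (kroneckerSym d n *
        (n : ℝ) ^ (-(1 / 2 + (z.re + δ))) * Real.cos (z.im * Real.log n) * weight x 0 n)) := by
    refine continuous_const.mul (Real.continuous_exp.comp (continuous_const.add
      (continuous_finsetSum _ fun n hn => ?_)))
    have hn0 : (n : ℝ) ≠ 0 := by
      have := (Finset.mem_Icc.1 hn).1
      exact_mod_cast (by omega : n ≠ 0)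
    have : Continuous fun δ : ℝ => (n : ℝ) ^ (-(1 / 2 + (z.re + δ))) :=
      Continuous.rpow continuous_const (by fun_prop) fun _ => Or.inl hn0
    fun_prop
  have hlim2 := (hcont.tendsto 0).mono_left (nhdsWithin_le_nhds (s := Ioi (0 : ℝ)))
  have := le_of_tendsto_of_tendsto hlim1 hlim2 (by
    filter_upwards [Ioo_mem_nhdsGT (by norm_num : (0 : ℝ) < 1 / 8)] with δ hδ
    have hδ0 : 0 < δ := hδ.1
    have hδ1 : δ < 1 / 8 := hδ.2
    have := main (z + δ) (by simp; linarith) (by simp; linarith) (by simpa using hzX)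
    simpa using this)
  simpa using this

/-! ### Sums over primes -/

/-- The lower bound `le_re_logDeriv` for the logarithmic derivative of `(s - 1) ζ(s)` at `s = 1 + δ`
is an upper bound for `-ζ' / ζ`. -/
theorem vonMangoldt_sum_le (hGRH : GRH) {δ : ℝ} (hδ : 0 < δ) (hδ1 : δ ≤ 1) :
    HasSum (fun n : ℕ => ArithmeticFunction.vonMangoldt n * (n : ℝ) ^ (-(1 + δ)))
      (∑' n : ℕ, ArithmeticFunction.vonMangoldt n * (n : ℝ) ^ (-(1 + δ))) ∧
    ∑' n : ℕ, ArithmeticFunction.vonMangoldt n * (n : ℝ) ^ (-(1 + δ)) ≤ 1 / δ + 3 := by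
  have h := isCompletable_zeta hGRH
  have hre : 1 < ((1 + δ : ℝ) : ℂ).re := by rw [ofReal_re]; linarith
  have hterm : ∀ n : ℕ, LSeries.term (fun n => (ArithmeticFunction.vonMangoldt n : ℂ))
      ((1 + δ : ℝ) : ℂ) n = ((ArithmeticFunction.vonMangoldt n * (n : ℝ) ^ (-(1 + δ)) : ℝ) : ℂ) := by
    intro n
    rcases eq_or_ne n 0 with rfl | hn
    · simp
    · rw [LSeries.term_of_ne_zero hn, ofReal_mul, ofReal_cpow n.cast_nonneg, ofReal_neg,
        cpow_neg, ofReal_natCast, div_eq_mul_inv]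
  have hs := h.LSeriesSummable_b hre
  have hs' : Summable fun n : ℕ => ArithmeticFunction.vonMangoldt n * (n : ℝ) ^ (-(1 + δ)) := by
    rw [← Complex.summable_ofReal]
    exact hs.congr fun n => hterm n
  refine ⟨hs'.hasSum, ?_⟩
  have h1 := h.logDeriv_eq _ hre
  have h2 : LSeries (fun n => (ArithmeticFunction.vonMangoldt n : ℂ)) ((1 + δ : ℝ) : ℂ) =
      ((∑' n : ℕ, ArithmeticFunction.vonMangoldt n * (n : ℝ) ^ (-(1 + δ)) : ℝ) : ℂ) := by
    rw [LSeries, ofReal_tsum]; exact tsum_congr hterm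
  have h3 := h.le_re_logDeriv (s := ((1 + δ : ℝ) : ℂ)) (by rw [ofReal_re]; linarith)
  rw [h1, h2, ofReal_re, ofReal_im, Real.log_one] at h3
  have e : ((1 : ℕ) : ℂ) / (((1 + δ : ℝ) : ℂ) - 1) = ((1 / δ : ℝ) : ℂ) := by push_cast; ring
  rw [e, add_re, neg_re, ofReal_re, ofReal_re] at h3
  have h4 : Real.log (1 + δ + |0| + 2) ≤ 2 := by
    rw [abs_zero, Real.log_le_iff_le_exp (by linarith)]
    have h5 : (2 : ℝ) ≤ Real.exp 1 := by linarith [Real.add_one_le_exp (1 : ℝ)]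
    have h6 : Real.exp 2 = Real.exp 1 * Real.exp 1 := by rw [← Real.exp_add]; norm_num
    nlinarith
  rw [abs_zero] at h3 h4
  generalize (∑' n : ℕ, ArithmeticFunction.vonMangoldt n * (n : ℝ) ^ (-(1 + δ))) = T at h3 ⊢
  generalize 1 / δ = D at h3 ⊢
  linarith

theorem exp_sub_one_le (x : ℝ) : Real.exp x - 1 ≤ Real.exp x * x := by
  have h9 := Real.add_one_le_exp (-x)
  have h10 : Real.exp x * Real.exp (-x) = 1 := by
    rw [← Real.exp_add]; simp
  nlinarith [Real.exp_pos x]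

/-- Sums `Σ_{p ≤ y} p^{-1-it}` are `log ζ(1 + 1 / log y + it)` up to a bounded error. -/
theorem exists_abs_sum_cos_sub_log_le (hGRH : GRH) : ∃ C : ℝ, ∀ y : ℝ, Real.exp 1 ≤ y → ∀ t : ℝ,
    |∑ p ∈ (Finset.Icc 1 ⌊y⌋₊).filter Nat.Prime, Real.cos (t * Real.log p) / p -
      Real.log ‖riemannZeta (1 + (1 / Real.log y : ℝ) + t * I)‖| ≤ C := by
  have hsq : Summable fun n : ℕ => 1 / (n : ℝ) ^ 2 := hasSum_zeta_two.summable
  refine ⟨Real.pi ^ 2 / 6 + Real.exp 1 * 4, fun y hy t => ?_⟩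
  have hy0 : 0 < y := (Real.exp_pos 1).trans_le hy
  have hly : 1 ≤ Real.log y := by rwa [Real.le_log_iff_exp_le hy0]
  set δ : ℝ := 1 / Real.log y with hδ
  have hδ0 : 0 < δ := by positivity
  have hδ1 : δ ≤ 1 := by rw [hδ, div_le_one (by linarith)]; exact hly
  have hδy : δ * Real.log y = 1 := by rw [hδ]; field_simp
  set s : ℂ := 1 + (δ : ℝ) + t * I with hs
  have hsre : s.re = 1 + δ := by simp [hs]
  have hsim : s.im = t := by simp [hs]
  obtain ⟨hV, hVle⟩ := vonMangoldt_sum_le hGRH hδ0 hδ1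
  set V : ℕ → ℝ := fun n => ArithmeticFunction.vonMangoldt n * (n : ℝ) ^ (-(1 + δ)) with hVdef
  have hV0 : ∀ n, 0 ≤ V n := fun n =>
    mul_nonneg ArithmeticFunction.vonMangoldt_nonneg (by positivity)
  -- the prime sum as a sum over all primes
  set G : ℕ → ℝ := fun n => if n ≤ ⌊y⌋₊ then Real.cos (t * Real.log n) / n else 0 with hG
  have hGsum : HasSum (fun p : Nat.Primes => G p)
      (∑ p ∈ (Finset.Icc 1 ⌊y⌋₊).filter Nat.Prime, Real.cos (t * Real.log p) / p) := by
    have h1 : HasSum (({p : ℕ | p.Prime}).indicator G)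
        (∑ p ∈ (Finset.Icc 1 ⌊y⌋₊).filter Nat.Prime, ({p : ℕ | p.Prime}).indicator G p) := by
      refine hasSum_sum_of_ne_finset_zero fun n hn => ?_
      by_cases hp : n.Prime
      · have hny : ¬ n ≤ ⌊y⌋₊ := fun h => hn (Finset.mem_filter.2
          ⟨Finset.mem_Icc.2 ⟨hp.one_le, h⟩, hp⟩)
        rw [indicator_of_mem (show n ∈ {p : ℕ | p.Prime} from hp), hG]
        simp only [if_neg hny]
      · exact indicator_of_notMem (show n ∉ {p : ℕ | p.Prime} from hp) _
    have h2 : ∑ p ∈ (Finset.Icc 1 ⌊y⌋₊).filter Nat.Prime, ({p : ℕ | p.Prime}).indicator G p =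
        ∑ p ∈ (Finset.Icc 1 ⌊y⌋₊).filter Nat.Prime, Real.cos (t * Real.log p) / p := by
      refine Finset.sum_congr rfl fun p hp => ?_
      obtain ⟨h3, h4⟩ := Finset.mem_filter.1 hp
      rw [indicator_of_mem (show p ∈ {p : ℕ | p.Prime} from h4), hG]
      simp only [if_pos (Finset.mem_Icc.1 h3).2]
    rw [h2] at h1
    exact (hasSum_subtype_iff_indicator (s := {p : ℕ | p.Prime})).2 h1
  -- the comparison of the summands
  have hlogp : ∀ p : Nat.Primes, |(-Complex.log (1 - (p : ℂ) ^ (-s))).re - G p| ≤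
      1 / (p : ℝ) ^ 2 + Real.exp 1 * δ * V p := by
    intro p
    have hp := p.2
    have hp2 : (2 : ℝ) ≤ (p : ℕ) := by exact_mod_cast hp.two_le
    have hp0 : (0 : ℝ) < (p : ℕ) := by linarith
    have hL : 0 < Real.log (p : ℕ) := Real.log_pos (by linarith)
    have hz : ‖(p : ℂ) ^ (-s)‖ = ((p : ℕ) : ℝ) ^ (-(1 + δ)) := by
      rw [← ofReal_natCast, norm_cpow_eq_rpow_re_of_pos hp0, neg_re, hsre]
    have hz1 : ‖(p : ℂ) ^ (-s)‖ ≤ 1 / (p : ℕ) := by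
      rw [hz, one_div, ← Real.rpow_neg_one]
      exact Real.rpow_le_rpow_of_exponent_le (by linarith) (by linarith)
    have hz2 : ‖(p : ℂ) ^ (-s)‖ ≤ 1 / 2 :=
      hz1.trans (one_div_le_one_div_of_le (by norm_num) hp2)
    have h1 : ‖-Complex.log (1 - (p : ℂ) ^ (-s)) - (p : ℂ) ^ (-s)‖ ≤ 1 / ((p : ℕ) : ℝ) ^ 2 := by
      have h2 := norm_log_one_add_sub_self_le (z := -((p : ℂ) ^ (-s))) (by rw [norm_neg]; linarith)
      rw [norm_neg, ← sub_eq_add_neg, sub_neg_eq_add] at h2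
      rw [show -Complex.log (1 - (p : ℂ) ^ (-s)) - (p : ℂ) ^ (-s) =
        -(Complex.log (1 - (p : ℂ) ^ (-s)) + (p : ℂ) ^ (-s)) by ring, norm_neg]
      refine h2.trans ?_
      have h3 : (1 - ‖(p : ℂ) ^ (-s)‖)⁻¹ ≤ 2 := by
        rw [inv_le_comm₀ (by linarith) (by norm_num)]; linarith
      have h4 : ‖(p : ℂ) ^ (-s)‖ ^ 2 ≤ 1 / ((p : ℕ) : ℝ) ^ 2 := by
        rw [← one_div_pow]; exact pow_le_pow_left₀ (norm_nonneg _) hz1 2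
      have h5 : 0 ≤ ‖(p : ℂ) ^ (-s)‖ ^ 2 := by positivity
      nlinarith
    have h6 : |(-Complex.log (1 - (p : ℂ) ^ (-s))).re - ((p : ℂ) ^ (-s)).re| ≤
        1 / ((p : ℕ) : ℝ) ^ 2 := by
      rw [← sub_re]; exact (abs_re_le_norm _).trans h1
    have h7 : |((p : ℂ) ^ (-s)).re - G p| ≤ Real.exp 1 * δ * V p := by
      rw [cpow_neg_re hp.ne_zero, hsre, hsim]
      have hVp : V p = Real.log (p : ℕ) * ((p : ℕ) : ℝ) ^ (-(1 + δ)) := by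
        rw [hVdef]; simp only; rw [ArithmeticFunction.vonMangoldt_apply_prime hp]
      have hcos := Real.abs_cos_le_one (t * Real.log (p : ℕ))
      rw [hVp]
      have hq : 0 < ((p : ℕ) : ℝ) ^ (-(1 + δ)) := by positivity
      by_cases hpy : (p : ℕ) ≤ ⌊y⌋₊
      · have hpy' : ((p : ℕ) : ℝ) ≤ y := (Nat.le_floor_iff hy0.le).1 hpy
        have hG' : G p = Real.cos (t * Real.log (p : ℕ)) / (p : ℕ) := if_pos hpy
        rw [hG', show ((p : ℕ) : ℝ) ^ (-(1 + δ)) * Real.cos (t * Real.log (p : ℕ)) -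
          Real.cos (t * Real.log (p : ℕ)) / (p : ℕ) = -(Real.cos (t * Real.log (p : ℕ)) *
            (1 / (p : ℕ) - ((p : ℕ) : ℝ) ^ (-(1 + δ)))) by ring, abs_neg, abs_mul]
        have hLy : Real.log (p : ℕ) ≤ Real.log y := Real.log_le_log hp0 hpy'
        have e1 : 1 / ((p : ℕ) : ℝ) = ((p : ℕ) : ℝ) ^ (-(1 + δ)) * Real.exp (δ * Real.log (p : ℕ)) := by
          rw [Real.rpow_def_of_pos hp0, ← Real.exp_add, one_div, ← Real.exp_log (inv_pos.2 hp0),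
            Real.log_inv]
          congr 1; ring
        have hx0 : 0 ≤ δ * Real.log (p : ℕ) := by positivity
        have hx1 : δ * Real.log (p : ℕ) ≤ 1 := by
          rw [← hδy]; exact mul_le_mul_of_nonneg_left hLy hδ0.le
        have h8 : Real.exp (δ * Real.log (p : ℕ)) - 1 ≤ Real.exp 1 * (δ * Real.log (p : ℕ)) :=
          (exp_sub_one_le _).trans
            (mul_le_mul_of_nonneg_right (Real.exp_le_exp.2 hx1) hx0)
        have h9 : 0 ≤ 1 / ((p : ℕ) : ℝ) - ((p : ℕ) : ℝ) ^ (-(1 + δ)) := by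
          rw [e1]
          have := mul_le_mul_of_nonneg_left (Real.one_le_exp hx0) hq.le
          linarith
        rw [abs_of_nonneg h9]
        refine (mul_le_of_le_one_left h9 hcos).trans ?_
        rw [e1]
        have := mul_le_mul_of_nonneg_left h8 hq.le
        linarith
      · have hpy' : y < (p : ℕ) := (Nat.floor_lt hy0.le).1 (not_le.1 hpy)
        have hG' : G p = 0 := if_neg hpy
        rw [hG', sub_zero, abs_mul, abs_of_pos hq]
        have hLy : Real.log y ≤ Real.log (p : ℕ) := Real.log_le_log hy0 hpy'.le
        have h8 : 1 ≤ δ * Real.log (p : ℕ) := by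
          rw [← hδy]; exact mul_le_mul_of_nonneg_left hLy hδ0.le
        have h9 : 1 ≤ Real.exp 1 := Real.one_le_exp zero_le_one
        have h10 : 1 ≤ Real.exp 1 * (δ * Real.log (p : ℕ)) := one_le_mul_of_one_le_of_one_le h9 h8
        refine (mul_le_of_le_one_right hq.le hcos).trans ?_
        have := mul_le_mul_of_nonneg_left h10 hq.le
        linarith
    have := abs_sub_le (-Complex.log (1 - (p : ℂ) ^ (-s))).re ((p : ℂ) ^ (-s)).re (G p)
    linarith
  have hB : HasSum (fun n : ℕ => 1 / (n : ℝ) ^ 2 + Real.exp 1 * δ * V n)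
      (Real.pi ^ 2 / 6 + Real.exp 1 * δ * ∑' n, V n) := hasSum_zeta_two.add (hV.mul_left _)
  have hBp : Summable fun p : Nat.Primes => 1 / (p : ℝ) ^ 2 + Real.exp 1 * δ * V p :=
    hB.summable.subtype _
  have hBp' : ∑' p : Nat.Primes, (1 / (p : ℝ) ^ 2 + Real.exp 1 * δ * V p) ≤
      Real.pi ^ 2 / 6 + Real.exp 1 * δ * ∑' n, V n := by
    rw [← hB.tsum_eq]
    exact hB.summable.tsum_subtype_le (fun n : ℕ => 1 / (n : ℝ) ^ 2 + Real.exp 1 * δ * V n)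
      {p : ℕ | p.Prime} (fun n => by have := hV0 n; positivity)
  have hs1 : 1 < s.re := by rw [hsre]; linarith
  have hE := riemannZeta_eulerProduct_exp_log hs1
  have hlogsum : Summable fun p : Nat.Primes => -Complex.log (1 - (p : ℂ) ^ (-s)) := by
    have := DirichletCharacter.summable_neg_log_one_sub_mul_prime_cpow (N := 1) 1 hs1
    refine this.congr fun p => ?_
    rw [MulChar.one_apply (isUnit_of_subsingleton _), one_mul]
  have hζ : Real.log ‖riemannZeta s‖ = ∑' p : Nat.Primes, (-Complex.log (1 - (p : ℂ) ^ (-s))).re := by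
    rw [← hE, norm_exp, Real.log_exp, re_tsum hlogsum]
  have hresum : Summable fun p : Nat.Primes => (-Complex.log (1 - (p : ℂ) ^ (-s))).re :=
    (hasSum_re hlogsum.hasSum).summable
  rw [hζ, ← hGsum.tsum_eq, ← hGsum.summable.tsum_sub hresum]
  have h1 := tsum_of_norm_bounded (f := fun p : Nat.Primes =>
    G p - (-Complex.log (1 - (p : ℂ) ^ (-s))).re) hBp.hasSum fun p => by
      rw [Real.norm_eq_abs, abs_sub_comm]; exact hlogp p
  rw [Real.norm_eq_abs] at h1
  refine h1.trans (hBp'.trans ?_)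
  have h2 : δ * ∑' n, V n ≤ 4 := by
    have := mul_le_mul_of_nonneg_left hVle hδ0.le
    rw [mul_add, mul_one_div_cancel hδ0.ne'] at this
    linarith
  have h3 := mul_le_mul_of_nonneg_left h2 (Real.exp_pos 1).le
  linarith

/-! ### The zeta function near the line `Re s = 1` -/

/-- By compactness, since the entire function `(s - 1) ζ(s)` has no zeros for `Re s ≥ 1`. -/
theorem exists_zeta_bounds_near_one (hGRH : GRH) : ∃ c C : ℝ, 0 < c ∧ 0 < C ∧
    ∀ δ t : ℝ, 0 < δ → δ ≤ 1 → |t| ≤ 1 →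
      c / ‖(δ : ℂ) + t * I‖ ≤ ‖riemannZeta (1 + δ + t * I)‖ ∧
      ‖riemannZeta (1 + δ + t * I)‖ ≤ C / ‖(δ : ℂ) + t * I‖ := by
  have h := isCompletable_zeta hGRH
  set K : Set (ℝ × ℝ) := Icc 0 1 ×ˢ Icc (-1) 1 with hK
  have hKc : IsCompact K := isCompact_Icc.prod isCompact_Icc
  have hKn : K.Nonempty := ⟨(0, 0), by simp [hK]⟩
  have hcont : Continuous fun q : ℝ × ℝ => ‖zetaEntire (1 + q.1 + q.2 * I)‖ :=
    (h.differentiable.continuous.comp (by fun_prop :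
      Continuous fun q : ℝ × ℝ => (1 + q.1 + q.2 * I : ℂ))).norm
  obtain ⟨q₁, hq₁, hmin⟩ := hKc.exists_isMinOn hKn hcont.continuousOn
  obtain ⟨q₂, hq₂, hmax⟩ := hKc.exists_isMaxOn hKn hcont.continuousOn
  have hpos : ∀ q ∈ K, 0 < ‖zetaEntire (1 + q.1 + q.2 * I)‖ := fun q hq =>
    norm_pos_iff.2 (h.ne_zero _ (by
      have : 0 ≤ q.1 := hq.1.1
      simp; linarith))
  refine ⟨_, _, hpos q₁ hq₁, hpos q₂ hq₂, fun δ t hδ hδ1 ht => ?_⟩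
  have hmem : (δ, t) ∈ K := ⟨⟨hδ.le, hδ1⟩, abs_le.1 ht⟩
  have h1 := hmin hmem
  have h2 := hmax hmem
  simp only [Set.mem_ofPred_eq] at h1 h2
  have hne : (1 + δ + t * I : ℂ) ≠ 1 := by
    intro h0
    have := congrArg re h0
    simp at this
    linarith
  have e : (1 + δ + t * I : ℂ) - 1 = δ + t * I := by ring
  have hn : 0 < ‖(δ : ℂ) + t * I‖ := by
    rw [← e]; exact norm_pos_iff.2 (sub_ne_zero.2 hne)
  rw [zetaEntire_of_ne_one hne, norm_mul, e] at h1 h2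
  rw [div_le_iff₀ hn, le_div_iff₀ hn]
  constructor <;> linarith

/-- Mertens' theorem for `Σ_{p ≤ y} 1 / p`. -/
theorem exists_abs_sum_inv_prime_sub_le (hGRH : GRH) : ∃ C : ℝ, ∀ y : ℝ, Real.exp 1 ≤ y →
    |∑ p ∈ (Finset.Icc 1 ⌊y⌋₊).filter Nat.Prime, 1 / (p : ℝ) - Real.log (Real.log y)| ≤ C := by
  obtain ⟨C, hC⟩ := exists_abs_sum_cos_sub_log_le hGRH
  obtain ⟨c, C', hc, hC', hb⟩ := exists_zeta_bounds_near_one hGRH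
  refine ⟨C + (|Real.log c| + |Real.log C'|), fun y hy => ?_⟩
  have hy0 : 0 < y := (Real.exp_pos 1).trans_le hy
  have hly : 1 ≤ Real.log y := by rwa [Real.le_log_iff_exp_le hy0]
  have h1 := hC y hy 0
  obtain ⟨h2, h3⟩ := hb (1 / Real.log y) 0 (by positivity) (by
    rw [div_le_one (by linarith)]; exact hly) (by simp)
  have e : ‖((1 / Real.log y : ℝ) : ℂ) + (0 : ℝ) * I‖ = 1 / Real.log y := by
    rw [ofReal_zero, zero_mul, add_zero, norm_real, Real.norm_of_nonneg (by positivity)]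
  rw [e, div_div_eq_mul_div, div_one] at h2 h3
  have hz : 0 < ‖riemannZeta (1 + (1 / Real.log y : ℝ) + (0 : ℝ) * I)‖ :=
    lt_of_lt_of_le (by positivity) h2
  have h4 := Real.log_le_log (by positivity) h2
  have h5 := Real.log_le_log hz h3
  rw [Real.log_mul hc.ne' (by linarith)] at h4
  rw [Real.log_mul hC'.ne' (by linarith)] at h5
  simp only [zero_mul, Real.cos_zero] at h1
  rw [abs_le] at h1 ⊢
  have := le_abs_self (Real.log C')
  have := neg_abs_le (Real.log c)
  have := abs_nonneg (Real.log C')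
  have := abs_nonneg (Real.log c)
  constructor <;> linarith [h1.1, h1.2]

/-- A Chebyshev-type bound, from `vonMangoldt_sum_le` with `δ = 1 / log y`. -/
theorem sum_log_div_prime_le (hGRH : GRH) {y : ℝ} (hy : Real.exp 1 ≤ y) :
    ∑ p ∈ (Finset.Icc 1 ⌊y⌋₊).filter Nat.Prime, Real.log p / p ≤ 12 * Real.log y := by
  have hy0 : 0 < y := (Real.exp_pos 1).trans_le hy
  have hly : 1 ≤ Real.log y := by rwa [Real.le_log_iff_exp_le hy0]
  obtain ⟨hV, hVle⟩ := vonMangoldt_sum_le hGRH (δ := 1 / Real.log y) (by positivity) (by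
    rw [div_le_one (by linarith)]; exact hly)
  have h1 : ∑ p ∈ (Finset.Icc 1 ⌊y⌋₊).filter Nat.Prime, Real.log p / p ≤
      ∑ p ∈ (Finset.Icc 1 ⌊y⌋₊).filter Nat.Prime, Real.exp 1 *
        (ArithmeticFunction.vonMangoldt p * (p : ℝ) ^ (-(1 + 1 / Real.log y))) := by
    refine Finset.sum_le_sum fun p hp => ?_
    obtain ⟨hp1, hp⟩ := Finset.mem_filter.1 hp
    have hp0 : (0 : ℝ) < p := by exact_mod_cast hp.pos
    have hpy : (p : ℝ) ≤ y := (Nat.le_floor_iff hy0.le).1 (Finset.mem_Icc.1 hp1).2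
    have hL : 0 ≤ Real.log p := Real.log_nonneg (by exact_mod_cast hp.one_le)
    rw [ArithmeticFunction.vonMangoldt_apply_prime hp, ← mul_assoc, mul_comm (Real.exp 1), mul_assoc,
      div_eq_mul_inv]
    refine mul_le_mul_of_nonneg_left ?_ hL
    rw [neg_add, Real.rpow_add hp0, Real.rpow_neg_one, mul_comm, mul_assoc]
    refine le_mul_of_one_le_right (by positivity) ?_
    rw [Real.rpow_def_of_pos hp0, ← Real.exp_add]
    refine Real.one_le_exp ?_
    have : Real.log p / Real.log y ≤ 1 := by
      rw [div_le_one (by linarith)]; exact Real.log_le_log hp0 hpy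
    have e : Real.log p * -(1 / Real.log y) = -(Real.log p / Real.log y) := by ring
    linarith
  have h2 : ∑ p ∈ (Finset.Icc 1 ⌊y⌋₊).filter Nat.Prime,
      ArithmeticFunction.vonMangoldt p * (p : ℝ) ^ (-(1 + 1 / Real.log y)) ≤
      1 / (1 / Real.log y) + 3 :=
    (hV.summable.sum_le_tsum _ fun n _ => mul_nonneg ArithmeticFunction.vonMangoldt_nonneg
      (by positivity)).trans hVle
  rw [← Finset.mul_sum] at h1
  rw [one_div_one_div] at h2
  have h3 : Real.exp 1 ≤ 3 := by linarith [Real.exp_one_lt_d9]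
  have h4 : 0 ≤ ∑ p ∈ (Finset.Icc 1 ⌊y⌋₊).filter Nat.Prime,
      ArithmeticFunction.vonMangoldt p * (p : ℝ) ^ (-(1 + 1 / Real.log y)) :=
    Finset.sum_nonneg fun n _ => mul_nonneg ArithmeticFunction.vonMangoldt_nonneg (by positivity)
  nlinarith

/-- A Dirichlet polynomial of length `x` on the line `Re s = 1` with coefficients at most
`Λ(n) / log n` is at most `log log x + O(1)`. -/
theorem exists_sum_vonMangoldt_le_log_log (hGRH : GRH) : ∃ C : ℝ, ∀ x : ℝ, Real.exp 1 ≤ x →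
    ∀ g : ℕ → ℝ, (∀ n, 2 ≤ n → n ≤ ⌊x⌋₊ → |g n| ≤ 1 / (n : ℝ) / Real.log n) →
    ∑ n ∈ Finset.Icc 1 ⌊x⌋₊, ArithmeticFunction.vonMangoldt n * g n ≤
      Real.log (Real.log x) + C := by
  obtain ⟨C₂, hC₂, hsum⟩ := exists_sum_vonMangoldt_le
  obtain ⟨C₃, hM⟩ := exists_abs_sum_inv_prime_sub_le hGRH
  refine ⟨C₃ + Real.pi ^ 2 / 6 + C₂, fun x hx g hgb => ?_⟩
  have hlogpos : ∀ n : ℕ, 2 ≤ n → 0 < Real.log n := fun n hn => Real.log_pos (by exact_mod_cast hn)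
  have h5 := hsum ⌊x⌋₊ g fun n hn hnx => (hgb n hn hnx).trans (by
    have hn2 : (2 : ℝ) ≤ n := by exact_mod_cast hn
    refine div_le_div_of_nonneg_right ?_ (hlogpos n hn).le
    rw [one_div, ← Real.rpow_neg_one]
    exact Real.rpow_le_rpow_of_exponent_le (by linarith) (by norm_num))
  have h6 : ∑ p ∈ (Finset.Icc 3 ⌊x⌋₊).filter Nat.Prime, Real.log p * g p ≤
      ∑ p ∈ (Finset.Icc 1 ⌊x⌋₊).filter Nat.Prime, 1 / (p : ℝ) := by
    refine (Finset.sum_le_sum fun p hp => ?_).trans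
      (Finset.sum_le_sum_of_subset_of_nonneg (f := fun p : ℕ => 1 / (p : ℝ)) ?_
        fun p _ _ => by positivity)
    · obtain ⟨hp1, hp⟩ := Finset.mem_filter.1 hp
      have := (le_abs_self _).trans (hgb p hp.two_le (Finset.mem_Icc.1 hp1).2)
      rw [le_div_iff₀ (hlogpos p hp.two_le)] at this
      linarith
    · exact Finset.filter_subset_filter _ (Finset.Icc_subset_Icc (by norm_num) le_rfl)
  have h8 := (abs_le.1 (hM x hx)).2
  have h7 : ∑ p ∈ (Finset.Icc 1 (Nat.sqrt ⌊x⌋₊)).filter Nat.Prime, Real.log p * g (p ^ 2) ≤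
      Real.pi ^ 2 / 6 := by
    refine le_trans (Finset.sum_le_sum fun p hp => ?_)
      (hasSum_zeta_two.summable.sum_le_tsum ((Finset.Icc 1 (Nat.sqrt ⌊x⌋₊)).filter Nat.Prime)
        fun n _ => by positivity) |>.trans_eq hasSum_zeta_two.tsum_eq
    obtain ⟨hp1, hp⟩ := Finset.mem_filter.1 hp
    have hl := hlogpos p hp.two_le
    have h9 := (le_abs_self _).trans (hgb (p ^ 2) (by nlinarith [hp.two_le])
      (Nat.le_sqrt'.1 (Finset.mem_Icc.1 hp1).2))
    push_cast at h9
    rw [Real.log_pow, le_div_iff₀ (by positivity)] at h9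
    push_cast at h9
    have : 0 ≤ 1 / (p : ℝ) ^ 2 := by positivity
    nlinarith
  linarith

set_option maxHeartbeats 1000000 in
/-- A form of Littlewood's conditional bound for `ζ` to the right of the line `Re s = 1`. -/
theorem exists_log_norm_zeta_le (hGRH : GRH) : ∃ C X₀ : ℝ, ∀ X : ℝ, X₀ ≤ X → ∀ δ t : ℝ,
    0 < δ → δ ≤ 1 / 4 → 1 ≤ |t| → |t| ≤ 4 * X →
    Real.log ‖riemannZeta (1 + δ + t * I)‖ ≤ Real.log (Real.log (Real.log X)) + C := by
  have h := isCompletable_zeta hGRH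
  obtain ⟨C₁, hC₁, hL⟩ := exists_norm_quadraticL_le
  obtain ⟨C₂, hsum⟩ := exists_sum_vonMangoldt_le_log_log hGRH
  refine ⟨Real.log C₁ + Real.log 2 + 24 + (Real.log 2 + C₂), Real.exp 16,
    fun X hX δ t hδ hδ1 ht1 htX => ?_⟩
  have hX0 : 0 < X := (Real.exp_pos _).trans_le hX
  set ℓ := Real.log X with hℓ
  have hℓ16 : 16 ≤ ℓ := by rwa [hℓ, Real.le_log_iff_exp_le hX0]
  have hlogℓ : 1 ≤ Real.log ℓ := by
    rw [Real.le_log_iff_exp_le (by linarith)]; linarith [Real.exp_one_lt_d9]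
  -- with this length `√x = log X`: at distance `1 / 2` from the critical line the conductor and the
  -- pole contribute a bounded amount, and `log log x` is `log log log X + O(1)`
  set x : ℝ := ℓ ^ 2 with hx
  have hx1 : 1 < x := by nlinarith
  have hlx : Real.log x = 2 * Real.log ℓ := by rw [hx, Real.log_pow]; norm_num
  have hxsqrt : Real.sqrt x = ℓ := Real.sqrt_sq (by linarith)
  set s : ℂ := 1 / 2 + δ + t * I with hs
  have hsre : s.re = 1 / 2 + δ := by simp [hs]
  have hsim : s.im = t := by simp [hs]
  have key := h.norm_le_mul_exp (s := s) (by rw [hsre]; linarith) (by rw [hsre]; linarith)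
    (fun _ => by rwa [hsim]) hx1 (u := 1 / 2) (by norm_num) (by norm_num)
  have e1 : s + ((1 / 2 : ℝ) : ℂ) = 1 + δ + t * I := by rw [hs]; push_cast; ring
  rw [e1] at key
  have htI : ∀ a : ℝ, (1 + a + t * I : ℂ) ≠ 1 := by
    intro a h0
    have := congrArg im h0
    simp at this
    rw [this] at ht1; norm_num at ht1
  have hne1 := htI δ
  have e2 : s + 1 = 1 + ((1 / 2 + δ : ℝ) : ℂ) + t * I := by rw [hs]; push_cast; ring
  have hne2 : s + 1 ≠ 1 := by rw [e2]; exact htI _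
  rw [zetaEntire_of_ne_one hne1, zetaEntire_of_ne_one hne2, norm_mul, norm_mul] at key
  have f1 : |t| ≤ ‖(1 + δ + t * I : ℂ) - 1‖ := by
    have := abs_im_le_norm ((1 + δ + t * I : ℂ) - 1)
    simpa using this
  have f2 : ‖s + 1 - 1‖ ≤ 2 * |t| := by
    rw [add_sub_cancel_right]
    refine (norm_le_abs_re_add_abs_im s).trans ?_
    rw [hsre, hsim, abs_of_pos (by linarith)]
    linarith
  have f3 : ‖riemannZeta (s + 1)‖ ≤ C₁ := by
    rw [← quadraticL_one]
    refine hL 1 isFundamentalDiscriminant_one _ ?_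
    rw [add_re, hsre, one_re]; linarith
  set E := (4 + Real.log 1 / 2 + Real.log (3 + |s.im|) / 2 + (1 : ℕ) * (4 * Real.sqrt x)) *
        (4 * x ^ (-(1 / 2) : ℝ) / Real.log x) + 4 * (1 : ℕ) +
        (∑ n ∈ Finset.Icc 1 ⌊x⌋₊, (ArithmeticFunction.vonMangoldt n : ℂ) * (n : ℂ) ^ (-s) *
          (weight x (1 / 2) n : ℂ)).re with hE
  have hζ0 : 0 < ‖riemannZeta (1 + δ + t * I)‖ := by
    refine norm_pos_iff.2 (riemannZeta_ne_zero_of_one_le_re ?_)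
    simp; linarith
  have g1 : ‖riemannZeta (1 + δ + t * I)‖ ≤ 2 * C₁ * Real.exp E := by
    have g2 : |t| * ‖riemannZeta (1 + δ + t * I)‖ ≤ 2 * |t| * C₁ * Real.exp E :=
      (mul_le_mul_of_nonneg_right f1 hζ0.le).trans (key.trans (mul_le_mul_of_nonneg_right
        (mul_le_mul f2 f3 (norm_nonneg _) (by positivity)) (Real.exp_pos _).le))
    have ht0 : 0 < |t| := by linarith
    refine le_of_mul_le_mul_left ?_ ht0
    linarith
  have g2 := Real.log_le_log hζ0 g1
  rw [Real.log_mul (by positivity) (Real.exp_pos _).ne', Real.log_exp,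
    Real.log_mul (by norm_num) (by linarith)] at g2
  -- the conductor term
  have hE1 : (4 + Real.log 1 / 2 + Real.log (3 + |s.im|) / 2 + (1 : ℕ) * (4 * Real.sqrt x)) *
        (4 * x ^ (-(1 / 2) : ℝ) / Real.log x) ≤ 20 := by
    have e3 : x ^ (-(1 / 2) : ℝ) = 1 / ℓ := by
      rw [Real.rpow_neg (by linarith), ← Real.sqrt_eq_rpow, hxsqrt, one_div]
    have h3 : Real.log (3 + |s.im|) ≤ ℓ + 2 := by
      rw [hsim]
      have h4 : 3 + |t| ≤ X * Real.exp 2 := by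
        have h5 : (7 : ℝ) ≤ Real.exp 2 := by
          have h6 : Real.exp 2 = Real.exp 1 * Real.exp 1 := by rw [← Real.exp_add]; norm_num
          nlinarith [Real.exp_one_gt_d9]
        have h7 : (1 : ℝ) ≤ X := by linarith [Real.add_one_le_exp (16 : ℝ)]
        nlinarith
      refine (Real.log_le_log (by linarith [abs_nonneg t]) h4).trans ?_
      rw [Real.log_mul hX0.ne' (Real.exp_pos 2).ne', Real.log_exp]
    rw [e3, hxsqrt, hlx, Real.log_one, Nat.cast_one]
    have h4 : 4 + 0 / 2 + Real.log (3 + |s.im|) / 2 + 1 * (4 * ℓ) ≤ 5 * ℓ := by linarith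
    have h5 : 4 * (1 / ℓ) / (2 * Real.log ℓ) ≤ 2 / ℓ := by
      rw [div_le_iff₀ (by linarith)]
      have : 0 < 1 / ℓ := by positivity
      have e4 : 2 / ℓ * (2 * Real.log ℓ) = 4 * (1 / ℓ) * Real.log ℓ := by ring
      rw [e4]
      nlinarith
    refine (mul_le_mul h4 h5 (by positivity) (by linarith)).trans ?_
    have : 5 * ℓ * (2 / ℓ) = 10 := by field_simp; norm_num
    linarith
  -- the Dirichlet polynomial
  have hE2 : (∑ n ∈ Finset.Icc 1 ⌊x⌋₊, (ArithmeticFunction.vonMangoldt n : ℂ) * (n : ℂ) ^ (-s) *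
      (weight x (1 / 2) n : ℂ)).re ≤
      Real.log (Real.log ℓ) + Real.log 2 + C₂ := by
    set g : ℕ → ℝ := fun n => (n : ℝ) ^ (-s.re) * Real.cos (s.im * Real.log n) *
      weight x (1 / 2) n with hg
    have e3 : (∑ n ∈ Finset.Icc 1 ⌊x⌋₊, (ArithmeticFunction.vonMangoldt n : ℂ) * (n : ℂ) ^ (-s) *
      (weight x (1 / 2) n : ℂ)).re =
        ∑ n ∈ Finset.Icc 1 ⌊x⌋₊, ArithmeticFunction.vonMangoldt n * g n := by
      rw [re_sum]
      refine Finset.sum_congr rfl fun n hn => ?_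
      have hn0 : n ≠ 0 := by have := (Finset.mem_Icc.1 hn).1; omega
      rw [re_mul_ofReal, re_ofReal_mul, cpow_neg_re hn0, hg]
      ring
    have hgb : ∀ n : ℕ, 2 ≤ n → n ≤ ⌊x⌋₊ → |g n| ≤ 1 / (n : ℝ) / Real.log n := by
      intro n hn hnx
      have hn2 : (2 : ℝ) ≤ n := by exact_mod_cast hn
      have hn0 : (0 : ℝ) < n := by linarith
      have hnx' : (n : ℝ) ≤ x := (Nat.le_floor_iff (by linarith)).1 hnx
      have hw := weight_le (x := x) (u := 1 / 2) (by norm_num) (by norm_num) hn hnx'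
      have hw0 := weight_nonneg (x := x) (u := 1 / 2) (by norm_num) (by norm_num)
        (by omega : 1 ≤ n) hnx'
      rw [hg]
      simp only [abs_mul]
      rw [abs_of_nonneg hw0, abs_of_nonneg (by positivity : (0 : ℝ) ≤ (n : ℝ) ^ (-s.re))]
      have h6 : (n : ℝ) ^ (-s.re) ≤ (n : ℝ) ^ (-(1 / 2) : ℝ) :=
        Real.rpow_le_rpow_of_exponent_le (by linarith) (by rw [hsre]; linarith)
      have hl := Real.log_pos (by linarith : (1 : ℝ) < n)
      calc (n : ℝ) ^ (-s.re) * |Real.cos (s.im * Real.log n)| * weight x (1 / 2) n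
          ≤ (n : ℝ) ^ (-(1 / 2) : ℝ) * 1 * ((n : ℝ) ^ (-(1 / 2) : ℝ) / Real.log n) := by
            gcongr
            exact Real.abs_cos_le_one _
        _ = _ := by
            rw [mul_one, ← mul_div_assoc, ← Real.rpow_add hn0]
            norm_num
            rw [Real.rpow_neg_one]
    have h5 := hsum x (by rw [hx]; nlinarith [Real.exp_one_lt_d9]) g hgb
    rw [hlx, Real.log_mul (by norm_num) (by linarith)] at h5
    rw [e3]
    linarith
  have hE' : E ≤ 20 + 4 + (Real.log (Real.log ℓ) + Real.log 2 + C₂) := by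
    rw [hE]
    have : (4 : ℝ) * (1 : ℕ) = 4 := by norm_num
    linarith
  linarith

/-! ### Twisted sums over primes -/

/-- `log min {log X, 1 / |t|}`, truncated below at `0`: the size of `Σ_{p ≤ X} cos(t log p) / p`. -/
noncomputable def logMin (X t : ℝ) : ℝ := -Real.log (max (1 / Real.log X) (min 1 |t|))

theorem logMin_nonneg {X : ℝ} (hX : 1 ≤ Real.log X) (t : ℝ) : 0 ≤ logMin X t := by
  rw [logMin, neg_nonneg]
  refine Real.log_nonpos (le_max_of_le_left (by positivity)) (max_le ?_ (min_le_left _ _))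
  rw [div_le_one (by linarith)]; exact hX

theorem logMin_le {X : ℝ} (hX : 1 ≤ Real.log X) (t : ℝ) : logMin X t ≤ Real.log (Real.log X) := by
  rw [logMin, neg_le, ← Real.log_inv, ← one_div]
  exact Real.log_le_log (by positivity) (le_max_left _ _)

/-- Up to a constant, `logMin X t` is decreasing in `|t|`, with room for a factor `4`. -/
theorem logMin_le_add {X : ℝ} (hX : 1 ≤ Real.log X) {t u : ℝ} (h : |u| ≤ 4 * |t|) :
    logMin X t ≤ logMin X u + Real.log 4 := by
  rw [logMin, logMin, neg_le, neg_add, neg_neg, ← sub_eq_add_neg, sub_le_iff_le_add]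
  have h0 : 0 < max (1 / Real.log X) (min 1 |t|) := lt_max_of_lt_left (by positivity)
  rw [← Real.log_mul h0.ne' (by norm_num)]
  refine Real.log_le_log (lt_max_of_lt_left (by positivity)) (max_le ?_ ?_)
  · have : 1 / Real.log X ≤ max (1 / Real.log X) (min 1 |t|) := le_max_left _ _
    linarith
  · have h1 : min 1 |t| ≤ max (1 / Real.log X) (min 1 |t|) := le_max_right _ _
    rcases le_total 1 |t| with h2 | h2
    · rw [min_eq_left h2] at h1 ⊢
      have := min_le_left 1 |u|; linarith
    · rw [min_eq_right h2] at h1 ⊢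
      have := min_le_right 1 |u|; linarith

/-- The factor that depends on the distance of the shifts, as it appears in the final bound. -/
theorem exp_six_mul_logMin_le {X : ℝ} (hX : 1 ≤ Real.log X) (t : ℝ) :
    Real.exp (6 * logMin X t) ≤ 1 + shiftMin X t := by
  have h0 : 0 < max (1 / Real.log X) (min 1 |t|) := lt_max_of_lt_left (by positivity)
  have e : Real.exp (6 * logMin X t) = (max (1 / Real.log X) (min 1 |t|))⁻¹ ^ 6 := by
    rw [logMin, ← Real.log_inv, mul_comm, Real.exp_mul, Real.exp_log (by positivity)]
    norm_cast
  rw [e, shiftMin]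
  have h1 : (max (1 / Real.log X) (min 1 |t|))⁻¹ ≤ Real.log X := by
    rw [inv_le_comm₀ h0 (by linarith), ← one_div]; exact le_max_left _ _
  have h2 : (max (1 / Real.log X) (min 1 |t|))⁻¹ ^ 6 ≤ Real.log X ^ 6 :=
    pow_le_pow_left₀ (by positivity) h1 6
  split_ifs with ht
  · linarith
  · have htp : 0 < |t| := abs_pos.2 ht
    have h4 : 0 < min 1 |t| := lt_min one_pos htp
    have h3 : (max (1 / Real.log X) (min 1 |t|))⁻¹ ^ 6 ≤ 1 + 1 / |t| ^ 6 := by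
      have h5 : (max (1 / Real.log X) (min 1 |t|))⁻¹ ≤ (min 1 |t|)⁻¹ :=
        inv_anti₀ h4 (le_max_right _ _)
      refine (pow_le_pow_left₀ (by positivity) h5 6).trans ?_
      have h6 : 0 ≤ 1 / |t| ^ 6 := by positivity
      rcases le_total 1 |t| with h2 | h2
      · rw [min_eq_left h2]; norm_num
      · rw [min_eq_right h2, inv_pow, ← one_div]; linarith
    rcases le_total (Real.log X ^ 6) (1 / |t| ^ 6) with h | h
    · rw [min_eq_left h]; linarith
    · rw [min_eq_right h]; exact h3

/-- Upper bound for the prime sums that appear in the variance of the Dirichlet polynomial. -/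
theorem exists_sum_cos_le (hGRH : GRH) : ∃ C X₀ : ℝ, ∀ X : ℝ, X₀ ≤ X → ∀ y t : ℝ,
    Real.exp 4 ≤ y → y ≤ X → |t| ≤ 4 * X →
    ∑ p ∈ (Finset.Icc 1 ⌊y⌋₊).filter Nat.Prime, Real.cos (t * Real.log p) / p ≤
      logMin X t + (Real.log (Real.log (Real.log X)) + C) := by
  obtain ⟨C₁, h1⟩ := exists_abs_sum_cos_sub_log_le hGRH
  obtain ⟨c, C₂, -, hC₂, hb⟩ := exists_zeta_bounds_near_one hGRH
  obtain ⟨C₃, X₀, hζ⟩ := exists_log_norm_zeta_le hGRH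
  refine ⟨C₁ + (|Real.log C₂| + |C₃|), max X₀ (Real.exp 16), fun X hX y t hy hyX ht => ?_⟩
  have hX0 : X₀ ≤ X := (le_max_left _ _).trans hX
  have hX1 : Real.exp 16 ≤ X := (le_max_right _ _).trans hX
  have hXpos : 0 < X := (Real.exp_pos _).trans_le hX1
  have hlX : 16 ≤ Real.log X := by rwa [Real.le_log_iff_exp_le hXpos]
  have hlℓ : 1 ≤ Real.log (Real.log X) := by
    rw [Real.le_log_iff_exp_le (by linarith)]; linarith [Real.exp_one_lt_d9]
  have hℓℓ : 0 ≤ Real.log (Real.log (Real.log X)) := Real.log_nonneg hlℓ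
  have hy0 : 0 < y := (Real.exp_pos 4).trans_le hy
  have hly : 4 ≤ Real.log y := by rwa [Real.le_log_iff_exp_le hy0]
  have hlyX : Real.log y ≤ Real.log X := Real.log_le_log hy0 hyX
  have h2 := (abs_le.1 (h1 y ((Real.exp_le_exp.2 (by norm_num)).trans hy) t)).2
  have hδ0 : 0 < 1 / Real.log y := by positivity
  have hδ1 : 1 / Real.log y ≤ 1 / 4 := one_div_le_one_div_of_le (by norm_num) hly
  have hm := logMin_nonneg (X := X) (by linarith) t
  have a2 := abs_nonneg (Real.log C₂)
  have a3 := abs_nonneg C₃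
  rcases le_total |t| 1 with htle | htge
  · obtain ⟨-, h4⟩ := hb (1 / Real.log y) t hδ0 (by linarith) htle
    set w : ℂ := ((1 / Real.log y : ℝ) : ℂ) + t * I with hw
    have hwre : 1 / Real.log y ≤ ‖w‖ := by
      have := re_le_norm w
      rwa [hw, add_re, ofReal_re, re_ofReal_mul, I_re, mul_zero, add_zero] at this
    have hwim : |t| ≤ ‖w‖ := by
      have := abs_im_le_norm w
      rwa [hw, add_im, ofReal_im, im_ofReal_mul, I_im, mul_one, zero_add] at this
    have hmax : max (1 / Real.log X) (min 1 |t|) ≤ ‖w‖ :=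
      max_le ((one_div_le_one_div_of_le (by linarith) hlyX).trans hwre)
        ((min_le_right _ _).trans hwim)
    have hpos : 0 < max (1 / Real.log X) (min 1 |t|) := lt_max_of_lt_left (by positivity)
    have h5 := Real.log_le_log hpos hmax
    have h6 : Real.log ‖riemannZeta (1 + ((1 / Real.log y : ℝ) : ℂ) + t * I)‖ ≤
        Real.log C₂ - Real.log ‖w‖ := by
      rw [← Real.log_div hC₂.ne' (by linarith)]
      refine Real.log_le_log (norm_pos_iff.2 (riemannZeta_ne_zero_of_one_le_re ?_)) h4
      rw [add_re, add_re, one_re, ofReal_re, re_ofReal_mul, I_re]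
      linarith
    have := le_abs_self (Real.log C₂)
    rw [logMin]
    linarith
  · have h4 := hζ X hX0 (1 / Real.log y) t hδ0 hδ1 htge ht
    have := le_abs_self C₃
    linarith

/-- Mertens' theorem on an interval. -/
theorem exists_sum_inv_prime_Ioc_le (hGRH : GRH) : ∃ C : ℝ, ∀ z x : ℝ, Real.exp 1 ≤ z → z ≤ x →
    ∑ p ∈ (Finset.Ioc ⌊z⌋₊ ⌊x⌋₊).filter Nat.Prime, 1 / (p : ℝ) ≤
      Real.log (Real.log x / Real.log z) + C := by
  obtain ⟨C, hC⟩ := exists_abs_sum_inv_prime_sub_le hGRH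
  refine ⟨2 * C, fun z x hz hzx => ?_⟩
  have hz0 : 0 < z := (Real.exp_pos 1).trans_le hz
  have hlz : 1 ≤ Real.log z := by rwa [Real.le_log_iff_exp_le hz0]
  have hlzx : Real.log z ≤ Real.log x := Real.log_le_log hz0 hzx
  have h1 := (abs_le.1 (hC z hz)).1
  have h2 := (abs_le.1 (hC x (hz.trans hzx))).2
  have hfl : ⌊z⌋₊ ≤ ⌊x⌋₊ := Nat.floor_mono hzx
  have e : Finset.Icc 1 ⌊x⌋₊ = Finset.Icc 1 ⌊z⌋₊ ∪ Finset.Ioc ⌊z⌋₊ ⌊x⌋₊ := by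
    ext n; simp only [Finset.mem_Icc, Finset.mem_union, Finset.mem_Ioc]; omega
  have hdisj : Disjoint ((Finset.Icc 1 ⌊z⌋₊).filter Nat.Prime)
      ((Finset.Ioc ⌊z⌋₊ ⌊x⌋₊).filter Nat.Prime) := by
    refine Finset.disjoint_filter_filter ?_
    rw [Finset.disjoint_left]
    intro n; simp only [Finset.mem_Icc, Finset.mem_Ioc]; omega
  rw [e, Finset.filter_union, Finset.sum_union hdisj] at h2
  rw [Real.log_div (by linarith) (by linarith)]
  linarith

/-- The sum of `1 / p` over the primes dividing `d` is at most `log log log X + O(1)`: there are at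
most `2 log X` such primes, and those larger than `log X` contribute at most `2`. -/
theorem exists_sum_inv_prime_dvd_le (hGRH : GRH) : ∃ C X₀ : ℝ, ∀ X : ℝ, X₀ ≤ X → ∀ d : ℕ, d ≠ 0 →
    (d : ℝ) ≤ X → ∑ p ∈ d.primeFactors, 1 / (p : ℝ) ≤ Real.log (Real.log (Real.log X)) + C := by
  obtain ⟨C, hC⟩ := exists_abs_sum_inv_prime_sub_le hGRH
  refine ⟨C + 2, Real.exp (Real.exp 1), fun X hX d hd hdX => ?_⟩
  have hX0 : 0 < X := (Real.exp_pos _).trans_le hX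
  have hw : Real.exp 1 ≤ Real.log X := by rwa [Real.le_log_iff_exp_le hX0]
  have hw0 : 0 < Real.log X := (Real.exp_pos 1).trans_le hw
  have h1 := (abs_le.1 (hC _ hw)).2
  have hcard : (d.primeFactors.card : ℝ) ≤ 2 * Real.log X := by
    have h2 : 2 ^ d.primeFactors.card ≤ d := by
      refine le_trans ?_ (Nat.le_of_dvd (Nat.pos_of_ne_zero hd) (Nat.prod_primeFactors_dvd d))
      rw [← Finset.prod_const]
      exact Finset.prod_le_prod' fun p hp => (Nat.prime_of_mem_primeFactors hp).two_le
    have h3 : (2 : ℝ) ^ d.primeFactors.card ≤ X := le_trans (by exact_mod_cast h2) hdX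
    have h4 := Real.log_le_log (by positivity) h3
    rw [Real.log_pow] at h4
    nlinarith [Real.log_two_gt_d9, (d.primeFactors.card.cast_nonneg : (0 : ℝ) ≤ _)]
  rw [← Finset.sum_filter_add_sum_filter_not d.primeFactors (fun p => p ≤ ⌊Real.log X⌋₊)]
  have h5 : ∑ p ∈ d.primeFactors.filter (fun p => p ≤ ⌊Real.log X⌋₊), 1 / (p : ℝ) ≤
      ∑ p ∈ (Finset.Icc 1 ⌊Real.log X⌋₊).filter Nat.Prime, 1 / (p : ℝ) := by
    refine Finset.sum_le_sum_of_subset_of_nonneg (fun p hp => ?_) fun p _ _ => by positivity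
    obtain ⟨hp1, hp2⟩ := Finset.mem_filter.1 hp
    have := Nat.prime_of_mem_primeFactors hp1
    exact Finset.mem_filter.2 ⟨Finset.mem_Icc.2 ⟨this.one_le, hp2⟩, this⟩
  have h6 : ∑ p ∈ d.primeFactors.filter (fun p => ¬ p ≤ ⌊Real.log X⌋₊), 1 / (p : ℝ) ≤ 2 := by
    calc ∑ p ∈ d.primeFactors.filter (fun p => ¬ p ≤ ⌊Real.log X⌋₊), 1 / (p : ℝ)
        ≤ ∑ p ∈ d.primeFactors.filter (fun p => ¬ p ≤ ⌊Real.log X⌋₊), 1 / Real.log X := by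
          refine Finset.sum_le_sum fun p hp => ?_
          have h7 := (Finset.mem_filter.1 hp).2
          have h8 := (Nat.floor_lt hw0.le).1 (not_le.1 h7)
          exact one_div_le_one_div_of_le hw0 h8.le
      _ ≤ ∑ p ∈ d.primeFactors, 1 / Real.log X :=
          Finset.sum_le_sum_of_subset_of_nonneg (Finset.filter_subset _ _)
            fun p _ _ => by positivity
      _ ≤ 2 := by
          rw [Finset.sum_const, nsmul_eq_mul, mul_one_div, div_le_iff₀ hw0]
          exact hcard
  linarith

/-! ### Random signs -/

/-- The sign `± 1` encoded by a Boolean. -/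
def sgn (u : Bool) : ℝ := if u then 1 else -1

section signs

variable {ι : Type*} [Fintype ι] [DecidableEq ι]

/-- The average over all choices of signs. -/
noncomputable def signAvg (F : (ι → Bool) → ℝ) : ℝ := (∑ s, F s) / 2 ^ Fintype.card ι

theorem signAvg_mono {F G : (ι → Bool) → ℝ} (h : ∀ s, F s ≤ G s) : signAvg F ≤ signAvg G :=
  div_le_div_of_nonneg_right (Finset.sum_le_sum fun s _ => h s) (by positivity)

theorem signAvg_const_mul (c : ℝ) (F : (ι → Bool) → ℝ) :
    signAvg (fun s => c * F s) = c * signAvg F := by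
  rw [signAvg, signAvg, ← Finset.mul_sum, mul_div_assoc]

theorem signAvg_sum {α : Type*} (T : Finset α) (F : α → (ι → Bool) → ℝ) :
    signAvg (fun s => ∑ a ∈ T, F a s) = ∑ a ∈ T, signAvg (F a) := by
  simp only [signAvg]
  rw [Finset.sum_comm, Finset.sum_div]

theorem signAvg_prod (f : ι → Bool → ℝ) :
    signAvg (fun s => ∏ i, f i (s i)) = ∏ i, (f i true + f i false) / 2 := by
  rw [signAvg, Finset.prod_div_distrib, Finset.prod_const, Finset.card_univ]
  congr 1
  have h := Finset.prod_univ_sum (fun _ : ι => (Finset.univ : Finset Bool)) f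
  rw [Fintype.piFinset_univ] at h
  rw [← h]
  exact Finset.prod_congr rfl fun i _ => by rw [Fintype.sum_bool]

/-- The random signs are sub-Gaussian: `cosh b ≤ exp (b ^ 2 / 2)`. -/
theorem signAvg_exp_le (b : ι → ℝ) (l : ℝ) :
    signAvg (fun s => Real.exp (l * ∑ i, b i * sgn (s i))) ≤
      Real.exp (l ^ 2 * (∑ i, b i ^ 2) / 2) := by
  have e : (fun s : ι → Bool => Real.exp (l * ∑ i, b i * sgn (s i))) =
      fun s => ∏ i, Real.exp (l * (b i * sgn (s i))) := by
    funext s; rw [Finset.mul_sum, Real.exp_sum]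
  rw [e, signAvg_prod (fun i u => Real.exp (l * (b i * sgn u))), Finset.mul_sum, Finset.sum_div,
    Real.exp_sum]
  refine Finset.prod_le_prod (fun i _ => by positivity) fun i _ => ?_
  have h := Real.cosh_le_exp_half_sq (l * b i)
  rw [Real.cosh_eq] at h
  simp only [sgn, if_true, mul_one, Bool.false_eq_true, if_false, mul_neg]
  refine h.trans (le_of_eq ?_)
  congr 1; ring

theorem signAvg_cosh_le (b : ι → ℝ) (l : ℝ) :
    signAvg (fun s => Real.cosh (l * ∑ i, b i * sgn (s i))) ≤
      Real.exp (l ^ 2 * (∑ i, b i ^ 2) / 2) := by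
  have h1 := signAvg_exp_le b l
  have h2 := signAvg_exp_le b (-l)
  have e : signAvg (fun s => Real.cosh (l * ∑ i, b i * sgn (s i))) =
      (signAvg (fun s => Real.exp (l * ∑ i, b i * sgn (s i))) +
        signAvg (fun s => Real.exp (-l * ∑ i, b i * sgn (s i)))) / 2 := by
    simp only [signAvg, Real.cosh_eq, neg_mul]
    rw [← Finset.sum_div, Finset.sum_add_distrib]; ring
  rw [neg_sq] at h2
  rw [e]; linarith

theorem pow_two_mul_le_cosh (k : ℕ) (x : ℝ) : x ^ (2 * k) / (2 * k).factorial ≤ Real.cosh x := by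
  have h := Real.hasSum_cosh x
  rw [← h.tsum_eq]
  exact h.summable.le_tsum k fun j _ => div_nonneg (by rw [pow_mul]; positivity) (by positivity)

/-- Moments from the exponential moment, with a free parameter `l`. -/
theorem signAvg_pow_le (b : ι → ℝ) {l : ℝ} (hl : 0 < l) (k : ℕ) :
    signAvg (fun s => (∑ i, b i * sgn (s i)) ^ (2 * k)) ≤
      (2 * k).factorial / l ^ (2 * k) * Real.exp (l ^ 2 * (∑ i, b i ^ 2) / 2) := by
  have h1 : signAvg (fun s => (∑ i, b i * sgn (s i)) ^ (2 * k)) ≤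
      signAvg (fun s => (2 * k).factorial / l ^ (2 * k) *
        Real.cosh (l * ∑ i, b i * sgn (s i))) := by
    refine signAvg_mono fun s => ?_
    have := pow_two_mul_le_cosh k (l * ∑ i, b i * sgn (s i))
    rw [div_le_iff₀ (by positivity), mul_pow] at this
    rw [div_mul_eq_mul_div, le_div_iff₀ (by positivity)]
    linarith
  rw [signAvg_const_mul] at h1
  exact h1.trans (mul_le_mul_of_nonneg_left (signAvg_cosh_le b l) (by positivity))

/-- The truncated exponential moment of random signs. -/
theorem sum_signAvg_pow_div_le (b : ι → ℝ) (K : ℕ) :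
    ∑ k ∈ Finset.range K, signAvg (fun s => (∑ i, b i * sgn (s i)) ^ (2 * k)) /
      (2 * k).factorial ≤ Real.exp ((∑ i, b i ^ 2) / 2) := by
  have h := signAvg_cosh_le b 1
  simp only [one_mul, one_pow] at h
  refine le_trans ?_ h
  have e : ∑ k ∈ Finset.range K, signAvg (fun s => (∑ i, b i * sgn (s i)) ^ (2 * k)) /
      (2 * k).factorial = signAvg (fun s => ∑ k ∈ Finset.range K,
        (∑ i, b i * sgn (s i)) ^ (2 * k) / (2 * k).factorial) := by
    rw [signAvg_sum]
    refine Finset.sum_congr rfl fun k _ => ?_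
    simp only [signAvg]
    rw [← Finset.sum_div]; ring
  rw [e]
  refine signAvg_mono fun s => ?_
  have h := Real.hasSum_cosh (∑ i, b i * sgn (s i))
  rw [← h.tsum_eq]
  exact h.summable.sum_le_tsum _ fun j _ => div_nonneg (by rw [pow_mul]; positivity) (by positivity)

/-- The multiplicity of `i` in a tuple. -/
def mult {m : ℕ} (τ : Fin m → ι) (i : ι) : ℕ := (Finset.univ.filter fun j => τ j = i).card

theorem prod_tuple {R : Type*} [CommMonoid R] {m : ℕ} (τ : Fin m → ι) (f : ι → R) :
    ∏ j, f (τ j) = ∏ i, f i ^ mult τ i := by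
  rw [← Finset.prod_fiberwise Finset.univ τ]
  refine Finset.prod_congr rfl fun i _ => ?_
  rw [mult, ← Finset.prod_const]
  refine Finset.prod_congr rfl fun j hj => ?_
  rw [(Finset.mem_filter.1 hj).2]

/-- A product of signs in which every sign occurs an even number of times is `1`. -/
theorem signAvg_tuple_of_even {m : ℕ} {τ : Fin m → ι} (h : ∀ i, Even (mult τ i)) :
    signAvg (fun s : ι → Bool => ∏ j, sgn (s (τ j))) = 1 := by
  have e : (fun s : ι → Bool => ∏ j, sgn (s (τ j))) = fun s => ∏ i, sgn (s i) ^ mult τ i :=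
    funext fun s => prod_tuple τ fun i => sgn (s i)
  rw [e, signAvg_prod fun i u => sgn u ^ mult τ i]
  refine Finset.prod_eq_one fun i _ => ?_
  simp [sgn, (h i).neg_one_pow]

/-- A product of signs in which some sign occurs an odd number of times averages to `0`. -/
theorem signAvg_tuple_of_odd {m : ℕ} {τ : Fin m → ι} {i₀ : ι} (h : Odd (mult τ i₀)) :
    signAvg (fun s : ι → Bool => ∏ j, sgn (s (τ j))) = 0 := by
  have e : (fun s : ι → Bool => ∏ j, sgn (s (τ j))) = fun s => ∏ i, sgn (s i) ^ mult τ i :=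
    funext fun s => prod_tuple τ fun i => sgn (s i)
  rw [e, signAvg_prod fun i u => sgn u ^ mult τ i]
  refine Finset.prod_eq_zero (Finset.mem_univ i₀) ?_
  simp [sgn, h.neg_one_pow]

end signs

/-! ### Character sums over discriminants -/

theorem abs_jacobiSym_le_one (a : ℤ) (n : ℕ) : |(jacobiSym a n : ℝ)| ≤ 1 := by
  rcases jacobiSym.trichotomy a n with h | h | h <;> simp [h]

/-- Multiplication by `g` permutes the residues and changes the sign of the sum. -/
theorem sum_range_jacobiSym_eq_zero {n : ℕ} {g : ℕ} (hg : jacobiSym g n = -1) :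
    ∑ k ∈ Finset.range n, (jacobiSym k n : ℝ) = 0 := by
  rcases n.eq_zero_or_pos with rfl | hn
  · simp
  have : NeZero n := ⟨hn.ne'⟩
  have hcop : g.Coprime n := by
    by_contra h
    have : jacobiSym g n = 0 := jacobiSym.eq_zero_iff_not_coprime.2 h
    rw [this] at hg; norm_num at hg
  have e : ∀ f : ZMod n → ℝ, ∑ k ∈ Finset.range n, f (k : ZMod n) = ∑ a : ZMod n, f a := by
    intro f
    refine Finset.sum_nbij' (fun k => (k : ZMod n)) ZMod.val ?_ ?_ ?_ ?_ ?_
    · simp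
    · intro a _; simpa using ZMod.val_lt a
    · intro a ha; exact ZMod.val_cast_of_lt (by simpa using ha)
    · intro a _; simp
    · intro a _; rfl
  set F : ZMod n → ℝ := fun a => (jacobiSym a.val n : ℝ) with hF
  have hFn : ∀ k : ℕ, F (k : ZMod n) = jacobiSym k n := fun k => by
    simp only [hF]
    rw [ZMod.val_natCast, jacobiSym.mod_left (k : ℤ)]
    push_cast; rfl
  have h1 : ∑ k ∈ Finset.range n, (jacobiSym k n : ℝ) = ∑ a : ZMod n, F a := by
    rw [← e F]; exact Finset.sum_congr rfl fun k _ => (hFn k).symm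
  have hmul : ∀ a : ZMod n, F ((g : ZMod n) * a) = -F a := fun a => by
    have h2 := hFn (g * a.val)
    rw [Nat.cast_mul, ZMod.natCast_zmod_val] at h2
    rw [h2]
    push_cast
    rw [jacobiSym.mul_left, hg]
    simp [hF]
  have h3 : ∑ a : ZMod n, F a = ∑ a : ZMod n, F ((g : ZMod n) * a) := by
    have hu := (ZMod.isUnit_iff_coprime g n).2 hcop
    exact (Equiv.sum_comp (Units.mulLeft hu.unit) F).symm
  simp only [hmul, Finset.sum_neg_distrib] at h3
  rw [h1]; linarith

/-- The sums over positive and over negative `d` agree up to sign, and each is a partial sum of a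
periodic sequence with mean zero. -/
theorem abs_sum_jacobiSym_le {n : ℕ} (hn : Odd n) {g : ℕ} (hg : jacobiSym g n = -1) (Y : ℕ) :
    |∑ d ∈ Finset.Icc (-(Y : ℤ)) Y, (jacobiSym d n : ℝ)| ≤ 2 * n := by
  have hn0 : n ≠ 0 := by rintro rfl; simp at hn
  have h1 := abs_sum_periodic_le (f := fun k : ℕ => (jacobiSym k n : ℝ)) hn0
    (fun k => abs_jacobiSym_le_one k n) (fun k => by
      have : jacobiSym ((k + n : ℕ) : ℤ) n = jacobiSym k n := by
        refine jacobiSym.mod_left' ?_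
        push_cast
        exact Int.add_emod_right _ _
      simp only [this]) (sum_range_jacobiSym_eq_zero hg) (Y + 1)
  set T := ∑ k ∈ Finset.range (Y + 1), (jacobiSym k n : ℝ) with hT
  have hn1 : n ≠ 1 := by rintro rfl; rw [jacobiSym.one_right] at hg; norm_num at hg
  have h0 : jacobiSym 0 n = 0 := jacobiSym.zero_left (by omega)
  have hpos : ∑ d ∈ Finset.Icc (0 : ℤ) Y, (jacobiSym d n : ℝ) = T := by
    rw [hT]
    refine Finset.sum_nbij' Int.toNat (fun k : ℕ => (k : ℤ)) ?_ ?_ ?_ ?_ ?_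
    · intro a ha; simp only [Finset.mem_Icc, Finset.mem_range] at ha ⊢; omega
    · intro a ha; simp only [Finset.mem_Icc, Finset.mem_range] at ha ⊢; omega
    · intro a ha; simp only [Finset.mem_Icc] at ha ⊢; omega
    · intro a _; simp
    · intro a ha
      rw [Int.toNat_of_nonneg (Finset.mem_Icc.1 ha).1]
  have hneg : ∑ d ∈ Finset.Icc (-(Y : ℤ)) (-1), (jacobiSym d n : ℝ) = (ZMod.χ₄ n : ℝ) * T := by
    rw [hT, Finset.mul_sum, Finset.sum_range_eq_add_Ico _ (by omega)]
    rw [Nat.cast_zero, h0, Int.cast_zero, mul_zero, zero_add]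
    refine Finset.sum_nbij' (fun a => (-a).toNat) (fun k : ℕ => -(k : ℤ)) ?_ ?_ ?_ ?_ ?_
    · intro a ha; simp only [Finset.mem_Icc, Finset.mem_Ico] at ha ⊢; omega
    · intro a ha; simp only [Finset.mem_Icc, Finset.mem_Ico] at ha ⊢; omega
    · intro a ha; simp only [Finset.mem_Icc] at ha ⊢; omega
    · intro a _; simp
    · intro a ha
      have : 0 ≤ -a := by have := (Finset.mem_Icc.1 ha).2; omega
      rw [Int.toNat_of_nonneg this]
      conv_lhs => rw [← neg_neg a, jacobiSym.neg _ hn]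
      push_cast; rfl
  have hsplit : Finset.Icc (-(Y : ℤ)) Y = Finset.Icc (-(Y : ℤ)) (-1) ∪ Finset.Icc (0 : ℤ) Y := by
    ext a; simp only [Finset.mem_Icc, Finset.mem_union]; omega
  have hdisj : Disjoint (Finset.Icc (-(Y : ℤ)) (-1)) (Finset.Icc (0 : ℤ) Y) := by
    rw [Finset.disjoint_left]; intro a; simp only [Finset.mem_Icc]; omega
  rw [hsplit, Finset.sum_union hdisj, hpos, hneg]
  have hχ : |(ZMod.χ₄ n : ℝ)| ≤ 1 := by
    rcases Nat.odd_mod_four_iff.1 (Nat.odd_iff.1 hn) with h | h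
    · rw [ZMod.χ₄_nat_one_mod_four h]; norm_num
    · rw [ZMod.χ₄_nat_three_mod_four h]; norm_num
  refine (abs_add_le _ _).trans ?_
  rw [abs_mul]
  have := mul_le_mul hχ h1 (abs_nonneg _) zero_le_one
  linarith

/-- The Jacobi symbol modulo a number divisible by an odd prime to an odd power is a nontrivial
character. -/
theorem exists_jacobiSym_mul_eq_neg_one {p c n : ℕ} (hp : p.Prime) (hp2 : p ≠ 2) (hc : Odd c)
    (hco : Nat.Coprime p n) (hn : n ≠ 0) : ∃ g : ℕ, jacobiSym g (p ^ c * n) = -1 := by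
  obtain ⟨a, ha⟩ := exists_jacobiSym_eq_neg_one hp hp2
  obtain ⟨g, hg1, hg2⟩ := Nat.chineseRemainder hco a 1
  refine ⟨g, ?_⟩
  have h1 : jacobiSym g p = -1 := by
    rw [← ha]; exact jacobiSym.mod_left' (by exact_mod_cast hg1)
  have h2 : jacobiSym g n = 1 := by
    rw [← jacobiSym.one_left n]
    refine jacobiSym.mod_left' ?_
    exact_mod_cast hg2
  rw [jacobiSym.mul_right' _ (pow_ne_zero _ hp.ne_zero) hn, jacobiSym.pow_right, h1, h2, mul_one,
    hc.neg_one_pow]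

/-! ### Moments of Dirichlet polynomials over discriminants -/

theorem jacobiSym_prod {α : Type*} (T : Finset α) (q : α → ℕ) (hq : ∀ i ∈ T, q i ≠ 0) (a : ℤ) :
    jacobiSym a (∏ i ∈ T, q i) = ∏ i ∈ T, jacobiSym a (q i) := by
  classical
  induction T using Finset.induction_on with
  | empty => simp
  | insert i T hi ih =>
    rw [Finset.prod_insert hi, Finset.prod_insert hi, jacobiSym.mul_right' _
      (hq i (Finset.mem_insert_self i T))
      (Finset.prod_ne_zero_iff.2 fun j hj => hq j (Finset.mem_insert_of_mem hj)),
      ih fun j hj => hq j (Finset.mem_insert_of_mem hj)]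

section tuples

variable {ι : Type*} [Fintype ι] [DecidableEq ι]

/-- If some prime occurs an odd number of times, the modulus is not a square and the character sum
cancels. -/
theorem abs_sum_prod_jacobiSym_le {q : ι → ℕ} (hq : ∀ i, (q i).Prime) (hq2 : ∀ i, q i ≠ 2)
    (hinj : Function.Injective q) {m : ℕ} (τ : Fin m → ι) {i₀ : ι} (h : Odd (mult τ i₀)) (Y : ℕ) :
    |∑ d ∈ Finset.Icc (-(Y : ℤ)) Y, ∏ j, (jacobiSym d (q (τ j)) : ℝ)| ≤ 2 * ∏ j, (q (τ j) : ℝ) := by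
  set n := ∏ j, q (τ j) with hn
  have hodd : Odd n := by
    refine Finset.prod_induction _ Odd (fun a b ha hb => ha.mul hb) odd_one fun j _ => ?_
    exact (hq _).odd_of_ne_two (hq2 _)
  have hfac : n = q i₀ ^ mult τ i₀ * ∏ i ∈ Finset.univ.erase i₀, q i ^ mult τ i := by
    rw [hn, prod_tuple τ q]
    exact (Finset.mul_prod_erase _ (fun i => q i ^ mult τ i) (Finset.mem_univ i₀)).symm
  have hco : Nat.Coprime (q i₀) (∏ i ∈ Finset.univ.erase i₀, q i ^ mult τ i) := by
    refine Nat.Coprime.prod_right fun i hi => Nat.Coprime.pow_right _ ?_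
    exact (Nat.coprime_primes (hq _) (hq _)).2 fun h0 =>
      (Finset.mem_erase.1 hi).1 (hinj h0.symm)
  obtain ⟨g, hg⟩ := exists_jacobiSym_mul_eq_neg_one (hq i₀) (hq2 i₀) h hco
    (Finset.prod_ne_zero_iff.2 fun i _ => pow_ne_zero _ (hq i).ne_zero)
  rw [← hfac] at hg
  have h1 := abs_sum_jacobiSym_le hodd hg Y
  have e : ∀ d : ℤ, ∏ j, (jacobiSym d (q (τ j)) : ℝ) = (jacobiSym d n : ℝ) := fun d => by
    rw [hn, jacobiSym_prod _ _ (fun j _ => (hq _).ne_zero)]; push_cast; rfl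
  have e2 : ∏ j, (q (τ j) : ℝ) = n := by rw [hn]; push_cast; rfl
  simp only [e, e2]
  exact h1

/-- Moments of a short sum of characters over all integers `|d| ≤ Y` are bounded by those of random
signs. When the power is expanded, the characters of a tuple of primes add up to at most `2 Y + 1` if
the product of the tuple is a square, where the random signs average to `1`, and to at most twice the
product otherwise, where they average to `0`. -/
theorem sum_pow_jacobiSym_le {q : ι → ℕ} (hq : ∀ i, (q i).Prime) (hq2 : ∀ i, q i ≠ 2)
    (hinj : Function.Injective q) (b : ι → ℝ) (m Y : ℕ) :
    ∑ d ∈ Finset.Icc (-(Y : ℤ)) Y, (∑ i, b i * (jacobiSym d (q i) : ℝ)) ^ m ≤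
      (2 * Y + 1) * signAvg (fun s : ι → Bool => (∑ i, b i * sgn (s i)) ^ m) +
        2 * (∑ i, |b i| * q i) ^ m := by
  have e1 : ∑ d ∈ Finset.Icc (-(Y : ℤ)) Y, (∑ i, b i * (jacobiSym d (q i) : ℝ)) ^ m =
      ∑ τ : Fin m → ι, (∏ j, b (τ j)) *
        ∑ d ∈ Finset.Icc (-(Y : ℤ)) Y, ∏ j, (jacobiSym d (q (τ j)) : ℝ) := by
    simp only [Fintype.sum_pow, Finset.prod_mul_distrib]
    rw [Finset.sum_comm]
    exact Finset.sum_congr rfl fun τ _ => by rw [Finset.mul_sum]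
  have e2 : signAvg (fun s : ι → Bool => (∑ i, b i * sgn (s i)) ^ m) =
      ∑ τ : Fin m → ι, (∏ j, b (τ j)) * signAvg fun s : ι → Bool => ∏ j, sgn (s (τ j)) := by
    simp only [Fintype.sum_pow, Finset.prod_mul_distrib]
    rw [signAvg_sum]
    exact Finset.sum_congr rfl fun τ _ => signAvg_const_mul _ _
  have e3 : 2 * (∑ i, |b i| * q i) ^ m =
      ∑ τ : Fin m → ι, 2 * ((∏ j, |b (τ j)|) * ∏ j, (q (τ j) : ℝ)) := by
    rw [Fintype.sum_pow, Finset.mul_sum]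
    exact Finset.sum_congr rfl fun τ _ => by rw [Finset.prod_mul_distrib]
  rw [e1, e2, e3, Finset.mul_sum, ← Finset.sum_add_distrib]
  refine Finset.sum_le_sum fun τ _ => ?_
  have hp : (0 : ℝ) ≤ 2 * ((∏ j, |b (τ j)|) * ∏ j, (q (τ j) : ℝ)) := by positivity
  by_cases h : ∀ i, Even (mult τ i)
  · have hb : 0 ≤ ∏ j, b (τ j) := by
      rw [prod_tuple τ b]
      exact Finset.prod_nonneg fun i _ => (h i).pow_nonneg _
    rw [signAvg_tuple_of_even h, mul_one]
    have h1 : ∑ d ∈ Finset.Icc (-(Y : ℤ)) Y, ∏ j, (jacobiSym d (q (τ j)) : ℝ) ≤ 2 * Y + 1 := by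
      refine (Finset.sum_le_sum (g := fun _ => 1) fun d _ => ?_).trans (le_of_eq ?_)
      · refine (le_abs_self _).trans ?_
        rw [Finset.abs_prod]
        exact Finset.prod_le_one (fun _ _ => abs_nonneg _) fun j _ => abs_jacobiSym_le_one _ _
      · rw [Finset.sum_const, Int.card_Icc, nsmul_eq_mul, mul_one]
        have : ((Y : ℤ) + 1 - -(Y : ℤ)).toNat = 2 * Y + 1 := by omega
        rw [this]; push_cast; ring
    have := mul_le_mul_of_nonneg_left h1 hb
    linarith
  · obtain ⟨i₀, hi₀⟩ := not_forall.1 h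
    rw [Nat.not_even_iff_odd] at hi₀
    rw [signAvg_tuple_of_odd hi₀, mul_zero, mul_zero, zero_add]
    refine (le_abs_self _).trans ?_
    rw [abs_mul, Finset.abs_prod]
    have := mul_le_mul_of_nonneg_left (abs_sum_prod_jacobiSym_le hq hq2 hinj τ hi₀ Y)
      (Finset.prod_nonneg (s := Finset.univ) fun j _ => abs_nonneg (b (τ j)))
    linarith

end tuples

/-- The Dirichlet polynomial `Σ_{p ∈ P} b_p χ_d(p)`. -/
noncomputable def charSum (P : Finset ℕ) (b : ℕ → ℝ) (d : ℤ) : ℝ :=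
  ∑ p ∈ P, b p * (kroneckerSym d p : ℝ)

/-- Comparison of the even moments of `charSum` with those `M k` of random signs. Even powers are
nonnegative, so extending the sum from fundamental discriminants to all integers only increases
it. -/
theorem exists_signAvg_bound {P : Finset ℕ} (hP : ∀ p ∈ P, p.Prime ∧ p ≠ 2) (b : ℕ → ℝ) {y : ℝ}
    (hy : ∀ p ∈ P, (p : ℝ) ≤ y) (hb : ∀ p ∈ P, |b p| ≤ 4) :
    ∃ M : ℕ → ℝ, (∀ l : ℝ, 0 < l → ∀ k, M k ≤
        (2 * k).factorial / l ^ (2 * k) * Real.exp (l ^ 2 * (∑ p ∈ P, b p ^ 2) / 2)) ∧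
      (∀ K, ∑ k ∈ Finset.range K, M k / (2 * k).factorial ≤
        Real.exp ((∑ p ∈ P, b p ^ 2) / 2)) ∧
      ∀ X : ℝ, 1 ≤ X → ∀ k, (4 * y ^ 2) ^ (2 * k) ≤ X →
        ∑ d ∈ fundamentalDiscriminants X, charSum P b d ^ (2 * k) ≤ 3 * X * M k + 2 * X := by
  classical
  set q : P → ℕ := fun p => p with hq
  set b' : P → ℝ := fun p => b p with hb'
  have hsq : ∑ i, b' i ^ 2 = ∑ p ∈ P, b p ^ 2 := Finset.sum_coe_sort P fun p => b p ^ 2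
  refine ⟨fun k => signAvg fun s : P → Bool => (∑ i, b' i * sgn (s i)) ^ (2 * k),
    fun l hl k => ?_, fun K => ?_, fun X hX k hk => ?_⟩
  · rw [← hsq]; exact signAvg_pow_le b' hl k
  · rw [← hsq]; exact sum_signAvg_pow_div_le b' K
  · have hX0 : 0 ≤ X := by linarith
    have h1 := sum_pow_jacobiSym_le (q := q) (fun i => (hP i i.2).1) (fun i => (hP i i.2).2)
      Subtype.val_injective b' (2 * k) ⌊X⌋₊
    have hS : ∀ d : ℤ, charSum P b d = ∑ i, b' i * (jacobiSym d (q i) : ℝ) := fun d => by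
      rw [charSum, ← Finset.sum_coe_sort P]
      refine Finset.sum_congr rfl fun p _ => ?_
      rw [kroneckerSym_of_odd d (((hP p p.2).1.eq_two_or_odd).resolve_left (hP p p.2).2)]
    have hsub : fundamentalDiscriminants X ⊆ Finset.Icc (-((⌊X⌋₊ : ℕ) : ℤ)) (⌊X⌋₊ : ℕ) := by
      rw [Int.natCast_floor_eq_floor hX0]
      exact Finset.filter_subset _ _
    have h2 : ∑ d ∈ fundamentalDiscriminants X, charSum P b d ^ (2 * k) ≤
        ∑ d ∈ Finset.Icc (-((⌊X⌋₊ : ℕ) : ℤ)) (⌊X⌋₊ : ℕ),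
          (∑ i, b' i * (jacobiSym d (q i) : ℝ)) ^ (2 * k) := by
      simp only [hS]
      exact Finset.sum_le_sum_of_subset_of_nonneg hsub fun d _ _ => by
        rw [pow_mul]; positivity
    have hM0 : 0 ≤ signAvg fun s : P → Bool => (∑ i, b' i * sgn (s i)) ^ (2 * k) :=
      div_nonneg (Finset.sum_nonneg fun s _ => by rw [pow_mul]; positivity) (by positivity)
    have h3 : (2 * (⌊X⌋₊ : ℝ) + 1) ≤ 3 * X := by
      have := Nat.floor_le hX0; linarith
    have h4 : (∑ i, |b' i| * q i) ^ (2 * k) ≤ X := by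
      refine le_trans (pow_le_pow_left₀ (Finset.sum_nonneg fun i _ => by positivity) ?_ _) hk
      have e : ∑ i, |b' i| * (q i : ℝ) = ∑ p ∈ P, |b p| * (p : ℝ) :=
        Finset.sum_coe_sort P fun p => |b p| * (p : ℝ)
      rw [e]
      rcases P.eq_empty_or_nonempty with hPe | ⟨p₀, hp₀⟩
      · rw [hPe, Finset.sum_empty]; positivity
      have hy0 : 0 ≤ y := (Nat.cast_nonneg p₀).trans (hy p₀ hp₀)
      have hcard : (P.card : ℝ) ≤ y := by
        have hPs : P ⊆ Finset.Icc 1 ⌊y⌋₊ := fun p hp =>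
          Finset.mem_Icc.2 ⟨(hP p hp).1.one_le, Nat.le_floor (hy p hp)⟩
        have := Finset.card_le_card hPs
        rw [Nat.card_Icc, Nat.add_sub_cancel] at this
        exact le_trans (by exact_mod_cast this) (Nat.floor_le hy0)
      calc ∑ p ∈ P, |b p| * (p : ℝ) ≤ ∑ p ∈ P, 4 * y :=
            Finset.sum_le_sum fun p hp =>
              mul_le_mul (hb p hp) (hy p hp) (Nat.cast_nonneg _) (by norm_num)
        _ = P.card * (4 * y) := by rw [Finset.sum_const, nsmul_eq_mul]
        _ ≤ y * (4 * y) := mul_le_mul_of_nonneg_right hcard (by positivity)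
        _ = 4 * y ^ 2 := by ring
    have h5 := mul_le_mul_of_nonneg_right h3 hM0
    linarith

/-- High moments of the Dirichlet polynomial; `l` is a free parameter. -/
theorem sum_charSum_pow_le {P : Finset ℕ} (hP : ∀ p ∈ P, p.Prime ∧ p ≠ 2) (b : ℕ → ℝ) {y : ℝ}
    (hy : ∀ p ∈ P, (p : ℝ) ≤ y) (hb : ∀ p ∈ P, |b p| ≤ 4) {X : ℝ} (hX : 1 ≤ X) {k : ℕ}
    (hk : (4 * y ^ 2) ^ (2 * k) ≤ X) {l : ℝ} (hl : 0 < l) :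
    ∑ d ∈ fundamentalDiscriminants X, charSum P b d ^ (2 * k) ≤
      3 * X * ((2 * k / l) ^ (2 * k) * Real.exp (l ^ 2 * (∑ p ∈ P, b p ^ 2) / 2)) + 2 * X := by
  obtain ⟨M, hM, -, h⟩ := exists_signAvg_bound hP b hy hb
  refine (h X hX k hk).trans ?_
  have h1 := hM l hl k
  have h2 : ((2 * k).factorial : ℝ) / l ^ (2 * k) ≤ (2 * k / l) ^ (2 * k) := by
    rw [div_pow]
    refine div_le_div_of_nonneg_right ?_ (by positivity)
    exact_mod_cast Nat.factorial_le_pow (2 * k)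
  have h3 := mul_le_mul_of_nonneg_right h2
    (Real.exp_pos (l ^ 2 * (∑ p ∈ P, b p ^ 2) / 2)).le
  have h4 := mul_le_mul_of_nonneg_left (h1.trans h3) (by linarith : 0 ≤ 3 * X)
  linarith

/-- The truncated hyperbolic cosine. -/
noncomputable def coshTrunc (K : ℕ) (u : ℝ) : ℝ :=
  ∑ k ∈ Finset.range K, u ^ (2 * k) / (2 * k).factorial

/-- The truncated exponential moment is at most of Gaussian size. -/
theorem sum_coshTrunc_le {P : Finset ℕ} (hP : ∀ p ∈ P, p.Prime ∧ p ≠ 2) (b : ℕ → ℝ) {y : ℝ}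
    (hy : ∀ p ∈ P, (p : ℝ) ≤ y) (hb : ∀ p ∈ P, |b p| ≤ 4) {X : ℝ} (hX : 1 ≤ X) {K : ℕ}
    (hy1 : 1 ≤ y) (hK : (4 * y ^ 2) ^ (2 * K) ≤ X) :
    ∑ d ∈ fundamentalDiscriminants X, coshTrunc K (charSum P b d) ≤
      7 * X * Real.exp ((∑ p ∈ P, b p ^ 2) / 2) := by
  obtain ⟨M, -, hM, h⟩ := exists_signAvg_bound hP b hy hb
  simp only [coshTrunc]
  rw [Finset.sum_comm]
  have h1 : ∀ k ∈ Finset.range K, ∑ d ∈ fundamentalDiscriminants X,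
      charSum P b d ^ (2 * k) / (2 * k).factorial ≤
      3 * X * (M k / (2 * k).factorial) + 2 * X * (1 ^ (2 * k) / (2 * k).factorial) := by
    intro k hk
    rw [← Finset.sum_div, div_le_iff₀ (by positivity)]
    have h2 := h X hX k (le_trans (pow_le_pow_right₀ (by nlinarith)
      (by have := Finset.mem_range.1 hk; omega)) hK)
    have hf : ((2 * k).factorial : ℝ) ≠ 0 := by positivity
    refine h2.trans (le_of_eq ?_)
    rw [one_pow, add_mul]
    field_simp
  refine (Finset.sum_le_sum h1).trans ?_
  rw [Finset.sum_add_distrib, ← Finset.mul_sum, ← Finset.mul_sum]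
  have h3 := hM K
  have h4 : ∑ k ∈ Finset.range K, (1 : ℝ) ^ (2 * k) / (2 * k).factorial ≤ 2 := by
    have h5 := Real.hasSum_cosh 1
    refine (h5.summable.sum_le_tsum _ fun j _ => by positivity).trans ?_
    rw [h5.tsum_eq, Real.cosh_eq]
    have : Real.exp (-1) ≤ 1 := Real.exp_le_one_iff.2 (by norm_num)
    linarith [Real.exp_one_lt_d9]
  have h5 : 1 ≤ Real.exp ((∑ p ∈ P, b p ^ 2) / 2) := Real.one_le_exp (by positivity)
  have h6 := mul_le_mul_of_nonneg_left h3 (by linarith : 0 ≤ 3 * X)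
  have h7 := mul_le_mul_of_nonneg_left h4 (by linarith : 0 ≤ 2 * X)
  nlinarith

/-- The truncation is harmless for arguments of size less than the order of truncation. -/
theorem exp_le_four_mul_coshTrunc {u : ℝ} {K : ℕ} (hu : |u| + 1 ≤ K) :
    Real.exp u ≤ 4 * coshTrunc K u := by
  obtain ⟨k₀, rfl⟩ : ∃ k₀, K = k₀ + 1 := ⟨K - 1, by
    have : (1 : ℝ) ≤ K := by linarith [abs_nonneg u]
    have : 1 ≤ K := by exact_mod_cast this
    omega⟩
  set t : ℕ → ℝ := fun k => u ^ (2 * k) / (2 * k).factorial with ht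
  have ht0 : ∀ k, 0 ≤ t k := fun k => div_nonneg (by rw [pow_mul]; positivity) (by positivity)
  have hstep : ∀ i, t (k₀ + (i + 1)) ≤ t (k₀ + i) / 2 := by
    intro i
    have hu2 : u ^ 2 ≤ (k₀ : ℝ) ^ 2 := by
      rw [← sq_abs u]; push_cast at hu
      exact pow_le_pow_left₀ (abs_nonneg u) (by linarith) 2
    have e : t (k₀ + (i + 1)) = t (k₀ + i) * (u ^ 2 / ((2 * (k₀ + i) + 1) * (2 * (k₀ + i) + 2))) := by
      simp only [ht]
      rw [show 2 * (k₀ + (i + 1)) = 2 * (k₀ + i) + 1 + 1 by ring, Nat.factorial_succ,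
        Nat.factorial_succ, pow_succ, pow_succ]
      have hf : ((2 * (k₀ + i)).factorial : ℝ) ≠ 0 := by positivity
      push_cast
      field_simp
      ring
    rw [e, div_eq_mul_one_div (t (k₀ + i)) 2]
    refine mul_le_mul_of_nonneg_left ?_ (ht0 _)
    rw [div_le_iff₀ (by positivity)]
    have h1 : (0 : ℝ) ≤ k₀ := k₀.cast_nonneg
    have h2 : (0 : ℝ) ≤ i := i.cast_nonneg
    nlinarith [mul_nonneg h1 h2]
  have hgeo : ∀ i, t (i + (k₀ + 1)) ≤ t k₀ * ((1 / 2) ^ i / 2) := by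
    intro i
    induction i with
    | zero => have := hstep 0; simp only [add_zero, zero_add] at this ⊢; linarith
    | succ i ih =>
      have h1 := hstep (i + 1)
      have e1 : k₀ + (i + 1 + 1) = i + 1 + (k₀ + 1) := by ring
      have e2 : k₀ + (i + 1) = i + (k₀ + 1) := by ring
      rw [e1, e2] at h1
      rw [pow_succ]
      linarith
  have hs : HasSum t (Real.cosh u) := Real.hasSum_cosh u
  have hgs : HasSum (fun i : ℕ => t k₀ * ((1 / 2 : ℝ) ^ i / 2)) (t k₀ * (2 / 2)) :=
    (hasSum_geometric_two.div_const 2).mul_left _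
  have htail : ∑' i, t (i + (k₀ + 1)) ≤ t k₀ := by
    have h1 := ((summable_nat_add_iff (k₀ + 1)).2 hs.summable).tsum_le_tsum hgeo hgs.summable
    rw [hgs.tsum_eq] at h1
    linarith
  have hsplit := hs.summable.sum_add_tsum_nat_add (k₀ + 1)
  rw [hs.tsum_eq] at hsplit
  have hle : t k₀ ≤ coshTrunc (k₀ + 1) u := by
    rw [coshTrunc]
    exact Finset.single_le_sum (f := t) (fun k _ => ht0 k) (Finset.self_mem_range_succ k₀)
  have hcosh : Real.cosh u ≤ 2 * coshTrunc (k₀ + 1) u := by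
    rw [coshTrunc] at hle ⊢
    linarith
  have hexp : Real.exp u ≤ 2 * Real.cosh u := by
    rw [Real.cosh_eq]; have := Real.exp_pos (-u); linarith
  linarith

/-! ### The product of two `L`-values -/

/-- The shifts of the theorem: to the right of the critical line by at most `1 / log X`, and of
height at most `X`. -/
def IsShift (X : ℝ) (z : ℂ) : Prop := 0 ≤ z.re ∧ z.re ≤ 1 / Real.log X ∧ |z.im| ≤ X

/-- The quantity that is averaged over the fundamental discriminants `d`. -/
noncomputable def shiftedValue (z₁ z₂ : ℂ) (d : ℤ) : ℝ :=
  ‖quadraticL d (1 / 2 + z₁)‖ ^ 2 * ‖quadraticL d (1 / 2 + z₂)‖ ^ 2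

theorem shiftedValue_nonneg (z₁ z₂ : ℂ) (d : ℤ) : 0 ≤ shiftedValue z₁ z₂ d := by
  unfold shiftedValue; positivity

/-- The sum of the two twists `Re n ^ (-1/2-z)`. -/
noncomputable def twist (z₁ z₂ : ℂ) (n : ℕ) : ℝ :=
  (n : ℝ) ^ (-(1 / 2 + z₁.re)) * Real.cos (z₁.im * Real.log n) +
    (n : ℝ) ^ (-(1 / 2 + z₂.re)) * Real.cos (z₂.im * Real.log n)

/-- The coefficient of `χ_d(p)` in the bound for `log |L(1/2+z₁, χ_d)² L(1/2+z₂, χ_d)²|` by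
primes up to `x`. -/
noncomputable def primeCoeff (x : ℝ) (z₁ z₂ : ℂ) (p : ℕ) : ℝ :=
  2 * (Real.log p * weight x 0 p) * twist z₁ z₂ p

/-- The contribution of `p²` to the bound for `log |L(1/2+z₁, χ_d)² L(1/2+z₂, χ_d)²|`. -/
noncomputable def squareTerm (x : ℝ) (z₁ z₂ : ℂ) (d : ℤ) (p : ℕ) : ℝ :=
  (kroneckerSym d p : ℝ) ^ 2 * (2 * Real.log p * weight x 0 (p ^ 2)) * twist z₁ z₂ (p ^ 2)

/-- The primes in `[3, N]`. -/
def oddPrimes (N : ℕ) : Finset ℕ := (Finset.Icc 3 N).filter Nat.Prime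

/-- The primes up to `N`. -/
def primesUpTo (N : ℕ) : Finset ℕ := (Finset.Icc 1 N).filter Nat.Prime

/-- The sum of the contributions of the squares of primes. -/
noncomputable def squareSum (x : ℝ) (z₁ z₂ : ℂ) (d : ℤ) : ℝ :=
  ∑ p ∈ primesUpTo (Nat.sqrt ⌊x⌋₊), squareTerm x z₁ z₂ d p

theorem mem_oddPrimes {N p : ℕ} : p ∈ oddPrimes N ↔ 3 ≤ p ∧ p ≤ N ∧ p.Prime := by
  simp [oddPrimes, and_assoc]

theorem mem_primesUpTo {N p : ℕ} : p ∈ primesUpTo N ↔ p ≤ N ∧ p.Prime := by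
  simp only [primesUpTo, Finset.mem_filter, Finset.mem_Icc]
  exact ⟨fun h => ⟨h.1.2, h.2⟩, fun h => ⟨⟨h.2.one_lt.le, h.1⟩, h.2⟩⟩

theorem oddPrimes_subset (N : ℕ) : oddPrimes N ⊆ primesUpTo N := fun p hp => by
  rw [mem_oddPrimes] at hp; exact mem_primesUpTo.2 hp.2

theorem abs_twist_le {z₁ z₂ : ℂ} (h₁ : 0 ≤ z₁.re) (h₂ : 0 ≤ z₂.re) {n : ℕ} (hn : 1 ≤ n) :
    |twist z₁ z₂ n| ≤ 2 * (n : ℝ) ^ (-(1 / 2) : ℝ) := by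
  have hn1 : (1 : ℝ) ≤ n := by exact_mod_cast hn
  have key : ∀ z : ℂ, 0 ≤ z.re →
      |(n : ℝ) ^ (-(1 / 2 + z.re)) * Real.cos (z.im * Real.log n)| ≤ (n : ℝ) ^ (-(1 / 2) : ℝ) := by
    intro z hz
    rw [abs_mul, abs_of_nonneg (by positivity : (0 : ℝ) ≤ (n : ℝ) ^ (-(1 / 2 + z.re)))]
    calc _ ≤ (n : ℝ) ^ (-(1 / 2 + z.re)) * 1 :=
          mul_le_mul_of_nonneg_left (Real.abs_cos_le_one _) (by positivity)
      _ ≤ _ := by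
          rw [mul_one]; exact Real.rpow_le_rpow_of_exponent_le hn1 (by linarith)
  rw [twist]
  linarith [abs_add_le ((n : ℝ) ^ (-(1 / 2 + z₁.re)) * Real.cos (z₁.im * Real.log n))
    ((n : ℝ) ^ (-(1 / 2 + z₂.re)) * Real.cos (z₂.im * Real.log n)), key z₁ h₁, key z₂ h₂]

theorem log_mul_weight_mem {x : ℝ} {n : ℕ} (hn : 2 ≤ n) (hnx : (n : ℝ) ≤ x) :
    0 ≤ Real.log n * weight x 0 n ∧ Real.log n * weight x 0 n ≤ 1 := by
  have hn2 : (2 : ℝ) ≤ n := by exact_mod_cast hn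
  have hlog : 0 < Real.log n := Real.log_pos (by linarith)
  have h0 := weight_nonneg (x := x) le_rfl zero_le_one (by omega : 1 ≤ n) hnx
  have h1 := weight_le (x := x) le_rfl zero_le_one hn hnx
  rw [neg_zero, Real.rpow_zero, le_div_iff₀ hlog] at h1
  exact ⟨by positivity, by linarith⟩

theorem abs_primeCoeff_le {x : ℝ} {z₁ z₂ : ℂ} (h₁ : 0 ≤ z₁.re) (h₂ : 0 ≤ z₂.re) {p : ℕ}
    (hp : 2 ≤ p) (hpx : (p : ℝ) ≤ x) : |primeCoeff x z₁ z₂ p| ≤ 4 * (p : ℝ) ^ (-(1 / 2) : ℝ) := by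
  obtain ⟨h0, h1⟩ := log_mul_weight_mem hp hpx
  rw [primeCoeff, abs_mul, abs_mul, abs_of_nonneg h0, abs_two]
  have h3 := abs_twist_le h₁ h₂ (by omega : 1 ≤ p)
  calc _ ≤ 2 * 1 * (2 * (p : ℝ) ^ (-(1 / 2) : ℝ)) := by gcongr
    _ = _ := by ring

theorem abs_primeCoeff_le_four {x : ℝ} {z₁ z₂ : ℂ} (h₁ : 0 ≤ z₁.re) (h₂ : 0 ≤ z₂.re) {p : ℕ}
    (hp : 2 ≤ p) (hpx : (p : ℝ) ≤ x) : |primeCoeff x z₁ z₂ p| ≤ 4 := by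
  have hp1 : (1 : ℝ) ≤ p := by exact_mod_cast (by omega : 1 ≤ p)
  have := Real.rpow_le_one_of_one_le_of_nonpos hp1 (by norm_num : (-(1 / 2) : ℝ) ≤ 0)
  linarith [abs_primeCoeff_le h₁ h₂ hp hpx]

theorem primeCoeff_sq_le {x : ℝ} {z₁ z₂ : ℂ} (h₁ : 0 ≤ z₁.re) (h₂ : 0 ≤ z₂.re) {p : ℕ}
    (hp : 2 ≤ p) (hpx : (p : ℝ) ≤ x) : primeCoeff x z₁ z₂ p ^ 2 ≤ 16 * (1 / p) := by
  have h := pow_le_pow_left₀ (abs_nonneg _) (abs_primeCoeff_le h₁ h₂ hp hpx) 2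
  have e : ((p : ℝ) ^ (-(1 / 2) : ℝ)) ^ 2 = 1 / p := by
    rw [← Real.rpow_natCast, ← Real.rpow_mul (Nat.cast_nonneg _)]
    norm_num [Real.rpow_neg_one]
  rw [sq_abs, mul_pow, e] at h
  linarith

theorem abs_squareTerm_le {x : ℝ} {z₁ z₂ : ℂ} (h₁ : 0 ≤ z₁.re) (h₂ : 0 ≤ z₂.re) (d : ℤ) {p : ℕ}
    (hp : 2 ≤ p) (hpx : ((p ^ 2 : ℕ) : ℝ) ≤ x) : |squareTerm x z₁ z₂ d p| ≤ 2 * (1 / p) := by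
  obtain ⟨h0, h1⟩ := log_mul_weight_mem (n := p ^ 2) (by nlinarith) hpx
  have hp0 : (0 : ℝ) < p := by exact_mod_cast (by omega : 0 < p)
  have e : Real.log (p ^ 2 : ℕ) = 2 * Real.log p := by
    push_cast; rw [Real.log_pow]; norm_num
  rw [e] at h0 h1
  have h3 := abs_twist_le h₁ h₂ (n := p ^ 2) (Nat.one_le_pow _ _ (by omega))
  have e2 : (((p ^ 2 : ℕ) : ℝ)) ^ (-(1 / 2) : ℝ) = 1 / p := by
    push_cast
    rw [← Real.rpow_natCast, ← Real.rpow_mul hp0.le]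
    norm_num [Real.rpow_neg_one]
  rw [e2] at h3
  have h4 : (kroneckerSym d p : ℝ) ^ 2 ≤ 1 := by
    rw [← sq_abs]; exact pow_le_one₀ (abs_nonneg _) (abs_kroneckerSym_le_one d p)
  rw [squareTerm, abs_mul, abs_mul, abs_of_nonneg h0, abs_of_nonneg (sq_nonneg _)]
  calc _ ≤ 1 * 1 * (2 * (1 / (p : ℝ))) := by gcongr
    _ = _ := by ring

/-- On the Riemann hypothesis, the values of `L` are bounded by a short sum over primes, the error
being governed by the length of the sum. -/
theorem exists_shiftedValue_le (hGRH : GRH) : ∃ C X₀ : ℝ, 0 < C ∧ ∀ X : ℝ, X₀ ≤ X → ∀ z₁ z₂ : ℂ,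
    IsShift X z₁ → IsShift X z₂ → ∀ d ∈ fundamentalDiscriminants X, d ≠ 1 → ∀ x : ℝ, 1 < x →
    shiftedValue z₁ z₂ d ≤ C * Real.exp (32 * (Real.log X / Real.log x) +
      charSum (oddPrimes ⌊x⌋₊) (primeCoeff x z₁ z₂) d + squareSum x z₁ z₂ d) := by
  obtain ⟨C₁, X₀, hX₀, hC₁, hL⟩ := exists_norm_quadraticL_le_exp hGRH
  obtain ⟨C₂, hC₂, hΛ⟩ := exists_sum_vonMangoldt_le
  refine ⟨C₁ ^ 4 * Real.exp (4 * C₂), max X₀ (Real.exp 8), by positivity,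
    fun X hX z₁ z₂ hz₁ hz₂ d hd hd1 x hx => ?_⟩
  have hX8 : 8 ≤ Real.log X := by
    rw [Real.le_log_iff_exp_le (lt_of_lt_of_le (Real.exp_pos 8) ((le_max_right _ _).trans hX))]
    exact (le_max_right _ _).trans hX
  rw [mem_fundamentalDiscriminants] at hd
  have h8 : 1 / Real.log X ≤ 1 / 8 := one_div_le_one_div_of_le (by norm_num) hX8
  set A : ℂ → ℝ := fun z => ∑ n ∈ Finset.Icc 1 ⌊x⌋₊, ArithmeticFunction.vonMangoldt n *
    (kroneckerSym d n * (n : ℝ) ^ (-(1 / 2 + z.re)) * Real.cos (z.im * Real.log n) *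
      weight x 0 n) with hA
  have hb : ∀ z, IsShift X z → ‖quadraticL d (1 / 2 + z)‖ ≤
      C₁ * Real.exp (8 * Real.log X / Real.log x + A z) := fun z hz =>
    hL X ((le_max_left _ _).trans hX) d hd.2 hd1 hd.1 z hz.1 (hz.2.1.trans h8) hz.2.2 x hx
  set g : ℕ → ℝ := fun n => kroneckerSym d n * weight x 0 n * twist z₁ z₂ n / 2 with hg
  have hsum : A z₁ + A z₂ =
      2 * ∑ n ∈ Finset.Icc 1 ⌊x⌋₊, ArithmeticFunction.vonMangoldt n * g n := by
    rw [hA, ← Finset.sum_add_distrib, Finset.mul_sum]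
    refine Finset.sum_congr rfl fun n _ => ?_
    simp only [hg, twist]; ring
  have hle := hΛ ⌊x⌋₊ g fun n hn hnx => by
    have hnx' : (n : ℝ) ≤ x := (Nat.le_floor_iff (by linarith)).1 hnx
    have hn2 : (2 : ℝ) ≤ n := by exact_mod_cast hn
    have hlog : 0 < Real.log n := Real.log_pos (by linarith)
    obtain ⟨h0, h1⟩ := log_mul_weight_mem hn hnx'
    have h3 := abs_twist_le hz₁.1 hz₂.1 (by omega : 1 ≤ n)
    have hw := weight_nonneg (x := x) le_rfl zero_le_one (by omega : 1 ≤ n) hnx'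
    rw [le_div_iff₀ hlog]
    simp only [hg]
    rw [abs_div, abs_mul, abs_mul, abs_two, abs_of_nonneg hw]
    calc |(kroneckerSym d n : ℝ)| * weight x 0 n * |twist z₁ z₂ n| / 2 * Real.log n
        = |(kroneckerSym d n : ℝ)| * (Real.log n * weight x 0 n) * |twist z₁ z₂ n| / 2 := by ring
      _ ≤ 1 * 1 * (2 * (n : ℝ) ^ (-(1 / 2) : ℝ)) / 2 := by
          have := abs_kroneckerSym_le_one d n
          gcongr
      _ = _ := by ring
  have e1 : charSum (oddPrimes ⌊x⌋₊) (primeCoeff x z₁ z₂) d =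
      4 * ∑ p ∈ (Finset.Icc 3 ⌊x⌋₊).filter Nat.Prime, Real.log p * g p := by
    rw [charSum, oddPrimes, Finset.mul_sum]
    refine Finset.sum_congr rfl fun p _ => ?_
    simp only [hg, primeCoeff]; ring
  have e2 : squareSum x z₁ z₂ d =
      4 * ∑ p ∈ (Finset.Icc 1 (Nat.sqrt ⌊x⌋₊)).filter Nat.Prime, Real.log p * g (p ^ 2) := by
    rw [squareSum, primesUpTo, Finset.mul_sum]
    refine Finset.sum_congr rfl fun p hp => ?_
    have hp0 : p ≠ 0 := (Finset.mem_filter.1 hp).2.ne_zero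
    simp only [hg, squareTerm]
    rw [pow_two p, kroneckerSym_mul_of_ne_zero d hp0 hp0]
    push_cast; ring
  have hexp : 2 * A z₁ + 2 * A z₂ ≤ 4 * C₂ + charSum (oddPrimes ⌊x⌋₊) (primeCoeff x z₁ z₂) d +
      squareSum x z₁ z₂ d := by
    rw [e1, e2]; linarith
  calc shiftedValue z₁ z₂ d
      ≤ (C₁ * Real.exp (8 * Real.log X / Real.log x + A z₁)) ^ 2 *
        (C₁ * Real.exp (8 * Real.log X / Real.log x + A z₂)) ^ 2 := by
        unfold shiftedValue
        gcongr
        · exact hb z₁ hz₁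
        · exact hb z₂ hz₂
    _ = C₁ ^ 4 * Real.exp (32 * (Real.log X / Real.log x) + (2 * A z₁ + 2 * A z₂)) := by
        rw [mul_pow, mul_pow, ← Real.exp_nat_mul, ← Real.exp_nat_mul]
        rw [show 32 * (Real.log X / Real.log x) + (2 * A z₁ + 2 * A z₂) =
          (2 : ℕ) * (8 * Real.log X / Real.log x + A z₁) +
          (2 : ℕ) * (8 * Real.log X / Real.log x + A z₂) by push_cast; ring, Real.exp_add]
        ring
    _ ≤ C₁ ^ 4 * Real.exp (4 * C₂ + (32 * (Real.log X / Real.log x) +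
          charSum (oddPrimes ⌊x⌋₊) (primeCoeff x z₁ z₂) d + squareSum x z₁ z₂ d)) := by
        refine mul_le_mul_of_nonneg_left (Real.exp_le_exp.2 ?_) (by positivity)
        linarith
    _ = _ := by rw [Real.exp_add]; ring

/-- Mertens' theorem, as an upper bound for primes up to `x ≤ X`. -/
theorem exists_sum_inv_prime_le (hGRH : GRH) : ∃ C : ℝ, ∀ X : ℝ, Real.exp 1 ≤ X → ∀ N : ℕ,
    (N : ℝ) ≤ X → ∑ p ∈ primesUpTo N, 1 / (p : ℝ) ≤ Real.log (Real.log X) + C := by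
  obtain ⟨C, hC⟩ := exists_abs_sum_inv_prime_sub_le hGRH
  refine ⟨C, fun X hX N hN => ?_⟩
  have hX0 : 0 ≤ X := (Real.exp_pos 1).le.trans hX
  have h := (abs_le.1 (hC X hX)).2
  have hsub : ∑ p ∈ primesUpTo N, 1 / (p : ℝ) ≤ ∑ p ∈ primesUpTo ⌊X⌋₊, 1 / (p : ℝ) :=
    Finset.sum_le_sum_of_subset_of_nonneg
      (fun p hp => by
        rw [mem_primesUpTo] at hp ⊢
        exact ⟨hp.1.trans ((Nat.le_floor_iff hX0).2 hN), hp.2⟩) fun _ _ _ => by positivity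
  rw [primesUpTo, primesUpTo] at hsub
  rw [primesUpTo]
  linarith

/-- The trivial bound for the squares of primes. -/
theorem exists_squareSum_le (hGRH : GRH) : ∃ C : ℝ, ∀ X : ℝ, Real.exp 1 ≤ X → ∀ z₁ z₂ : ℂ,
    0 ≤ z₁.re → 0 ≤ z₂.re → ∀ (d : ℤ) (x : ℝ), 1 < x → x ≤ X →
    squareSum x z₁ z₂ d ≤ 2 * Real.log (Real.log X) + C := by
  obtain ⟨C, hC⟩ := exists_sum_inv_prime_le hGRH
  refine ⟨2 * C, fun X hX z₁ z₂ h₁ h₂ d x hx hxX => ?_⟩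
  have hfl : ((⌊x⌋₊ : ℕ) : ℝ) ≤ x := Nat.floor_le (by linarith)
  have h := hC X hX (Nat.sqrt ⌊x⌋₊) ((Nat.cast_le.2 (Nat.sqrt_le_self _)).trans (hfl.trans hxX))
  calc squareSum x z₁ z₂ d ≤ ∑ p ∈ primesUpTo (Nat.sqrt ⌊x⌋₊), 2 * (1 / (p : ℝ)) := by
        refine Finset.sum_le_sum fun p hp => (le_abs_self _).trans ?_
        rw [mem_primesUpTo] at hp
        refine abs_squareTerm_le h₁ h₂ d hp.2.two_le ?_
        exact (Nat.cast_le.2 (Nat.le_sqrt'.1 hp.1)).trans hfl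
    _ ≤ _ := by rw [← Finset.mul_sum]; linarith

/-- The trivial bound for the variance. -/
theorem exists_sum_primeCoeff_sq_le (hGRH : GRH) : ∃ C : ℝ, ∀ X : ℝ, Real.exp 1 ≤ X →
    ∀ z₁ z₂ : ℂ, 0 ≤ z₁.re → 0 ≤ z₂.re → ∀ x : ℝ, 1 < x → x ≤ X →
    ∀ P ⊆ oddPrimes ⌊x⌋₊,
    ∑ p ∈ P, primeCoeff x z₁ z₂ p ^ 2 ≤ 16 * Real.log (Real.log X) + C := by
  obtain ⟨C, hC⟩ := exists_sum_inv_prime_le hGRH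
  refine ⟨16 * C, fun X hX z₁ z₂ h₁ h₂ x hx hxX P hP => ?_⟩
  have hfl : ((⌊x⌋₊ : ℕ) : ℝ) ≤ x := Nat.floor_le (by linarith)
  have h := hC X hX ⌊x⌋₊ (hfl.trans hxX)
  calc _ ≤ ∑ p ∈ P, 16 * (1 / (p : ℝ)) := by
        refine Finset.sum_le_sum fun p hp => ?_
        have hp' := mem_oddPrimes.1 (hP hp)
        exact primeCoeff_sq_le h₁ h₂ (by omega) ((Nat.cast_le.2 hp'.2.1).trans hfl)
    _ ≤ ∑ p ∈ primesUpTo ⌊x⌋₊, 16 * (1 / (p : ℝ)) :=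
        Finset.sum_le_sum_of_subset_of_nonneg (hP.trans (oddPrimes_subset _))
          fun _ _ _ => by positivity
    _ ≤ _ := by rw [← Finset.mul_sum]; linarith

/-! ### The variance -/

/-- At most one of the three terms on the left is essentially larger than `logMin X (t - u)`. If `t`
is much smaller than `t - u`, then `u` and `t + u` are of the size of `t - u`, and likewise with `t`
and `u` exchanged; if neither is, then `2 t` and `2 u` are not small compared with `t - u`. The
exceptional term is at most `log log X`. -/
theorem logMin_add_add_le {X : ℝ} (hX : 1 ≤ Real.log X) (t u : ℝ) :
    logMin X (2 * t) + logMin X (2 * u) + logMin X (t + u) ≤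
      Real.log (Real.log X) + 2 * logMin X (t - u) + 2 * Real.log 4 := by
  have h4 : 0 ≤ Real.log 4 := Real.log_nonneg (by norm_num)
  have key : ∀ a b : ℝ, 8 * |a| ≤ |a - b| → |a - b| ≤ 4 * |2 * b| ∧ |a - b| ≤ 4 * |a + b| := by
    intro a b h
    have h1 : |a - b| ≤ |a| + |b| := abs_sub a b
    have h2 : |b| ≤ |a + b| + |a| := by
      have := abs_sub (a + b) a
      rwa [add_sub_cancel_left] at this
    rw [abs_mul, abs_two]
    constructor <;> linarith [abs_nonneg (a - b)]
  rcases le_total (8 * |t|) |t - u| with h | h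
  · obtain ⟨h1, h2⟩ := key t u h
    linarith [logMin_le_add hX h1, logMin_le_add hX h2, logMin_le hX (2 * t)]
  rcases le_total (8 * |u|) |t - u| with h' | h'
  · rw [abs_sub_comm] at h'
    obtain ⟨h1, h2⟩ := key u t h'
    rw [abs_sub_comm] at h1 h2
    rw [add_comm u t] at h2
    linarith [logMin_le_add hX h1, logMin_le_add hX h2, logMin_le hX (2 * u)]
  · have h1 := logMin_le_add hX (t := 2 * t) (u := t - u) (by rw [abs_mul, abs_two]; linarith)
    have h2 := logMin_le_add hX (t := 2 * u) (u := t - u) (by rw [abs_mul, abs_two]; linarith)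
    linarith [logMin_le hX (t + u)]

/-- Replacing the factors `k`, `c`, `q` of a bounded quantity by `1`. -/
theorem mul_sq_mul_le {k c q A : ℝ} (hk : 0 ≤ k) (hk1 : k ≤ 1) (hc : 0 ≤ c) (hc1 : c ≤ 1)
    (hq : 0 ≤ q) (hq1 : q ≤ 1) (hA : |A| ≤ 1) :
    k * c * (q ^ 2 * A) ≤ A + ((1 - k) + (1 - c) + 2 * (1 - q)) := by
  have hkc : 1 - k * c ≤ (1 - k) + (1 - c) := by nlinarith [mul_nonneg (sub_nonneg.2 hk1) (sub_nonneg.2 hc1)]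
  have hkc1 : k * c ≤ 1 := mul_le_one₀ hk1 hc hc1
  have hkc0 : 0 ≤ k * c := mul_nonneg hk hc
  have hq2 : 1 - q ^ 2 ≤ 2 * (1 - q) := by nlinarith [sq_nonneg (1 - q)]
  have hq3 : q ^ 2 ≤ 1 := pow_le_one₀ hq hq1
  have h1 : 1 - k * c * q ^ 2 ≤ (1 - k * c) + (1 - q ^ 2) := by
    nlinarith [mul_nonneg (sub_nonneg.2 hkc1) (sub_nonneg.2 hq3)]
  have h0 : 0 ≤ 1 - k * c * q ^ 2 := by
    have := mul_le_one₀ hkc1 (sq_nonneg q) hq3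
    linarith
  have h2 := mul_le_mul_of_nonneg_left (neg_le_of_abs_le hA) h0
  linarith

/-- Replacing the factors `c`, `q`, `r` by `1` in the square of a bounded sum. -/
theorem sq_mul_sq_add_le {c q r a b : ℝ} (hc : 0 ≤ c) (hc1 : c ≤ 1) (hq : 0 ≤ q) (hq1 : q ≤ 1)
    (hr : 0 ≤ r) (hr1 : r ≤ 1) (ha : |a| ≤ 1) (hb : |b| ≤ 1) :
    c ^ 2 * (q * a + r * b) ^ 2 ≤ (a + b) ^ 2 + 4 * ((1 - q) + (1 - r)) := by
  have hc2 : c ^ 2 ≤ 1 := pow_le_one₀ hc hc1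
  have h0 : c ^ 2 * (q * a + r * b) ^ 2 ≤ 1 * (q * a + r * b) ^ 2 :=
    mul_le_mul_of_nonneg_right hc2 (sq_nonneg _)
  have h1 : |q * a + r * b - (a + b)| ≤ (1 - q) + (1 - r) := by
    have e : q * a + r * b - (a + b) = -((1 - q) * a) + -((1 - r) * b) := by ring
    rw [e]
    refine (abs_add_le _ _).trans ?_
    rw [abs_neg, abs_neg, abs_mul, abs_mul, abs_of_nonneg (sub_nonneg.2 hq1),
      abs_of_nonneg (sub_nonneg.2 hr1)]
    have := mul_le_mul_of_nonneg_left ha (sub_nonneg.2 hq1)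
    have := mul_le_mul_of_nonneg_left hb (sub_nonneg.2 hr1)
    linarith
  have h2 : |q * a + r * b + (a + b)| ≤ 4 := by
    have e : q * a + r * b + (a + b) = (1 + q) * a + (1 + r) * b := by ring
    rw [e]
    refine (abs_add_le _ _).trans ?_
    rw [abs_mul, abs_mul, abs_of_nonneg (by linarith : (0 : ℝ) ≤ 1 + q),
      abs_of_nonneg (by linarith : (0 : ℝ) ≤ 1 + r)]
    have := mul_le_mul_of_nonneg_left ha (by linarith : (0 : ℝ) ≤ 1 + q)
    have := mul_le_mul_of_nonneg_left hb (by linarith : (0 : ℝ) ≤ 1 + r)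
    linarith
  have h3 : (q * a + r * b) ^ 2 - (a + b) ^ 2 ≤ ((1 - q) + (1 - r)) * 4 := by
    have e : (q * a + r * b) ^ 2 - (a + b) ^ 2 =
        (q * a + r * b - (a + b)) * (q * a + r * b + (a + b)) := by ring
    rw [e]
    refine (le_abs_self _).trans ?_
    rw [abs_mul]
    exact mul_le_mul h1 h2 (abs_nonneg _) (by linarith)
  linarith

theorem one_sub_rpow_neg_le {r : ℝ} {p : ℕ} (hp : 2 ≤ p) :
    1 - (p : ℝ) ^ (-r) ≤ r * Real.log p := by
  have hp0 : (0 : ℝ) < p := by exact_mod_cast (by omega : 0 < p)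
  rw [Real.rpow_def_of_pos hp0]
  linarith [Real.add_one_le_exp (Real.log p * -r)]

/-- The contribution of a single prime to the exponent `squareSum + variance / 2`; the five cosines
come from `2 (cos α + cos β)² = 2 + cos 2α + cos 2β + 2 cos (α - β) + 2 cos (α + β)`. -/
theorem squareTerm_add_primeCoeff_sq_le {X x : ℝ} (hX : 0 < Real.log X) (hx : 1 < x) {z₁ z₂ : ℂ}
    (hz₁ : IsShift X z₁) (hz₂ : IsShift X z₂) (d : ℤ) {p : ℕ} (hp : 2 ≤ p)
    (hpx : ((p ^ 2 : ℕ) : ℝ) ≤ x) :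
    squareTerm x z₁ z₂ d p + primeCoeff x z₁ z₂ p ^ 2 / 2 ≤
      2 * (Real.cos (0 * Real.log p) / p) + 2 * (Real.cos (2 * z₁.im * Real.log p) / p) +
      2 * (Real.cos (2 * z₂.im * Real.log p) / p) +
      2 * (Real.cos ((z₁.im - z₂.im) * Real.log p) / p) +
      2 * (Real.cos ((z₁.im + z₂.im) * Real.log p) / p) +
      (2 * ((1 - (kroneckerSym d p : ℝ) ^ 2) * (1 / p)) + 2 * (1 / (p : ℝ) ^ 3) +
        (16 / Real.log x + 20 / Real.log X) * (Real.log p / p)) := by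
  have hp0 : (0 : ℝ) < p := by exact_mod_cast (by omega : 0 < p)
  have hp1 : (1 : ℝ) ≤ p := by exact_mod_cast (by omega : 1 ≤ p)
  have hlogx : 0 < Real.log x := Real.log_pos hx
  have hlogp : 0 ≤ Real.log p := Real.log_nonneg hp1
  have hpx' : (p : ℝ) ≤ x := by
    refine le_trans ?_ hpx
    exact_mod_cast Nat.le_self_pow two_ne_zero p
  obtain ⟨hc0, hc1⟩ := log_mul_weight_mem hp hpx'
  have hp22 : 2 ≤ p ^ 2 := by nlinarith
  obtain ⟨hw0, hw1⟩ := log_mul_weight_mem hp22 hpx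
  have hw2 := le_weight hx hp22 hpx
  have elog : Real.log (p ^ 2 : ℕ) = 2 * Real.log p := by
    push_cast; rw [Real.log_pow]; norm_num
  rw [elog] at hw0 hw1 hw2
  push_cast at hw2
  set c := Real.log p * weight x 0 p with hc
  set w := 2 * Real.log p * weight x 0 (p ^ 2) with hw
  set q : ℂ → ℝ := fun z => (p : ℝ) ^ (-z.re) with hq
  have hq01 : ∀ z, IsShift X z → 0 ≤ q z ∧ q z ≤ 1 ∧ 1 - q z ≤ Real.log p / Real.log X := by
    intro z hz
    refine ⟨by positivity, Real.rpow_le_one_of_one_le_of_nonpos hp1 (by linarith [hz.1]), ?_⟩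
    refine (one_sub_rpow_neg_le hp).trans ?_
    have := mul_le_mul_of_nonneg_right hz.2.1 hlogp
    rwa [one_div_mul_eq_div] at this
  obtain ⟨h10, h11, h12⟩ := hq01 z₁ hz₁
  obtain ⟨h20, h21, h22⟩ := hq01 z₂ hz₂
  have et1 : twist z₁ z₂ p = (p : ℝ) ^ (-(1 / 2) : ℝ) *
      (q z₁ * Real.cos (z₁.im * Real.log p) + q z₂ * Real.cos (z₂.im * Real.log p)) := by
    simp only [twist, hq, neg_add, Real.rpow_add hp0]; ring
  have et2 : twist z₁ z₂ (p ^ 2) = 1 / p *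
      (q z₁ ^ 2 * Real.cos (2 * (z₁.im * Real.log p)) +
        q z₂ ^ 2 * Real.cos (2 * (z₂.im * Real.log p))) := by
    have e : ∀ z : ℂ, ((p ^ 2 : ℕ) : ℝ) ^ (-(1 / 2 + z.re)) = 1 / p * q z ^ 2 := fun z => by
      push_cast
      rw [← Real.rpow_natCast, ← Real.rpow_mul hp0.le, hq, ← Real.rpow_natCast,
        ← Real.rpow_mul hp0.le, show (1 : ℝ) / p = (p : ℝ) ^ (-1 : ℝ) by
          rw [Real.rpow_neg_one, one_div], ← Real.rpow_add hp0]
      congr 1; push_cast; ring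
    rw [twist, e, e, elog, show z₁.im * (2 * Real.log p) = 2 * (z₁.im * Real.log p) by ring,
      show z₂.im * (2 * Real.log p) = 2 * (z₂.im * Real.log p) by ring]
    ring
  have ehalf : ((p : ℝ) ^ (-(1 / 2) : ℝ)) ^ 2 = 1 / p := by
    rw [← Real.rpow_natCast, ← Real.rpow_mul hp0.le]
    norm_num [Real.rpow_neg_one]
  set α := z₁.im * Real.log p with hα
  set β := z₂.im * Real.log p with hβ
  have hk : (kroneckerSym d p : ℝ) ^ 2 ≤ 1 := by
    rw [← sq_abs]; exact pow_le_one₀ (abs_nonneg _) (abs_kroneckerSym_le_one d p)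
  have i1 := mul_sq_mul_le (sq_nonneg (kroneckerSym d p : ℝ)) hk hw0 hw1 h10 h11
    (Real.abs_cos_le_one (2 * α))
  have i2 := mul_sq_mul_le (sq_nonneg (kroneckerSym d p : ℝ)) hk hw0 hw1 h20 h21
    (Real.abs_cos_le_one (2 * β))
  have i3 := sq_mul_sq_add_le hc0 hc1 h10 h11 h20 h21 (Real.abs_cos_le_one α)
    (Real.abs_cos_le_one β)
  have id1 : 2 * (Real.cos α + Real.cos β) ^ 2 = 2 + Real.cos (2 * α) + Real.cos (2 * β) +
      2 * Real.cos (α - β) + 2 * Real.cos (α + β) := by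
    rw [Real.cos_two_mul, Real.cos_two_mul, Real.cos_sub, Real.cos_add]; ring
  have e1 : squareTerm x z₁ z₂ d p + primeCoeff x z₁ z₂ p ^ 2 / 2 =
      1 / p * (kroneckerSym d p ^ 2 * w * (q z₁ ^ 2 * Real.cos (2 * α)) +
        kroneckerSym d p ^ 2 * w * (q z₂ ^ 2 * Real.cos (2 * β)) +
        2 * (c ^ 2 * (q z₁ * Real.cos α + q z₂ * Real.cos β) ^ 2)) := by
    rw [squareTerm, primeCoeff, et1, et2, ← hw, ← hc]
    linear_combination 2 * c ^ 2 * (q z₁ * Real.cos α + q z₂ * Real.cos β) ^ 2 * ehalf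
  rw [e1, zero_mul, Real.cos_zero, show 2 * z₁.im * Real.log p = 2 * α by rw [hα]; ring,
    show 2 * z₂.im * Real.log p = 2 * β by rw [hβ]; ring,
    show (z₁.im - z₂.im) * Real.log p = α - β by rw [hα, hβ]; ring,
    show (z₁.im + z₂.im) * Real.log p = α + β by rw [hα, hβ]; ring]
  have hfin : kroneckerSym d p ^ 2 * w * (q z₁ ^ 2 * Real.cos (2 * α)) +
        kroneckerSym d p ^ 2 * w * (q z₂ ^ 2 * Real.cos (2 * β)) +
        2 * (c ^ 2 * (q z₁ * Real.cos α + q z₂ * Real.cos β) ^ 2) ≤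
      2 + 2 * Real.cos (2 * α) + 2 * Real.cos (2 * β) + 2 * Real.cos (α - β) +
        2 * Real.cos (α + β) + (2 * (1 - (kroneckerSym d p : ℝ) ^ 2) + 2 * (1 / (p : ℝ) ^ 2) +
          (16 / Real.log x + 20 / Real.log X) * Real.log p) := by
    have r1 : (16 / Real.log x + 20 / Real.log X) * Real.log p =
      2 * (4 * (2 * Real.log p) / Real.log x) + 20 * (Real.log p / Real.log X) := by ring
    rw [r1]
    linarith
  refine (mul_le_mul_of_nonneg_left hfin (by positivity : (0 : ℝ) ≤ 1 / p)).trans (le_of_eq ?_)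
  field_simp

theorem dvd_natAbs_of_kroneckerSym_eq_zero {d : ℤ} {p : ℕ} (hp : p.Prime)
    (h : kroneckerSym d p = 0) : p ∣ d.natAbs := by
  rcases hp.eq_two_or_odd with rfl | hodd
  · rw [kroneckerSym_two, ZMod.χ₈_int_eq_if_mod_eight] at h
    split_ifs at h <;> omega
  · rw [kroneckerSym_of_odd d hodd] at h
    have : NeZero p := ⟨hp.ne_zero⟩
    have hg := jacobiSym.eq_zero_iff_not_coprime.1 h
    have h2 : Int.gcd d p ∣ p := by
      have := Int.gcd_dvd_natAbs_right d p
      simpa using this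
    rcases (Nat.dvd_prime hp).1 h2 with h3 | h3
    · exact absurd h3 hg
    · have := Int.gcd_dvd_natAbs_left d p
      rwa [h3] at this

/-- The squares of primes are seen by `χ_d` except for the divisors of `d`. -/
theorem one_sub_kroneckerSym_sq_le (d : ℤ) {p : ℕ} (hp : p.Prime) :
    1 - (kroneckerSym d p : ℝ) ^ 2 ≤ if p ∣ d.natAbs then 1 else 0 := by
  split_ifs with h
  · linarith [sq_nonneg (kroneckerSym d p : ℝ)]
  · rcases kroneckerSym_eq d p with h1 | h1 | h1
    · exact absurd (dvd_natAbs_of_kroneckerSym_eq_zero hp h1) h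
    · simp [h1]
    · simp [h1]

/-- The variance of the random model, together with the squares of primes, has size
`(log X) ^ 4 * min (log X, 1 / |t₁ - t₂|) ^ 6` up to smaller factors. -/
theorem exists_squareSum_add_le (hGRH : GRH) : ∃ C X₀ : ℝ, ∀ X : ℝ, X₀ ≤ X → ∀ z₁ z₂ : ℂ,
    IsShift X z₁ → IsShift X z₂ → ∀ d ∈ fundamentalDiscriminants X, ∀ x y : ℝ,
    Real.exp 4 ≤ y → y ^ 2 ≤ x → x ≤ X →
    squareSum x z₁ z₂ d + (∑ p ∈ oddPrimes ⌊y⌋₊, primeCoeff x z₁ z₂ p ^ 2) / 2 ≤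
      4 * Real.log (Real.log X) + 6 * logMin X (z₁.im - z₂.im) +
        2 * Real.log (Real.log x / Real.log y) +
        12 * Real.log (Real.log (Real.log X)) + C := by
  obtain ⟨C₁, X₁, h1⟩ := exists_sum_cos_le hGRH
  obtain ⟨C₂, X₂, h2⟩ := exists_sum_inv_prime_dvd_le hGRH
  obtain ⟨C₃, h3⟩ := exists_sum_inv_prime_Ioc_le hGRH
  have hs : Summable fun n : ℕ => 1 / (n : ℝ) ^ 3 := Real.summable_one_div_nat_pow.2 (by norm_num)
  set C₄ := ∑' n : ℕ, 1 / (n : ℝ) ^ 3 with hC₄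
  refine ⟨10 * C₁ + 2 * C₂ + 2 * C₃ + 2 * C₄ + 432 + 4 * Real.log 4,
    max (max X₁ X₂) (Real.exp 1), fun X hX z₁ z₂ hz₁ hz₂ d hd x y hy hyx hxX => ?_⟩
  have hXe : Real.exp 1 ≤ X := (le_max_right _ _).trans hX
  have hX0 : 0 < X := (Real.exp_pos 1).trans_le hXe
  have hL1 : 1 ≤ Real.log X := (Real.le_log_iff_exp_le hX0).2 hXe
  have hy0 : 0 < y := (Real.exp_pos 4).trans_le hy
  have hy4 : 4 ≤ Real.log y := (Real.le_log_iff_exp_le hy0).2 hy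
  have hy1 : 1 ≤ y := (Real.one_le_exp (by norm_num)).trans hy
  have hyx1 : y ≤ x := by nlinarith
  have hy1' : 1 < y := lt_of_lt_of_le (Real.one_lt_exp_iff.2 (by norm_num)) hy
  have hx1 : 1 < x := hy1'.trans_le hyx1
  have hye : Real.exp 1 ≤ y := (Real.exp_le_exp.2 (by norm_num)).trans hy
  have hlogx : Real.log y ≤ Real.log x := Real.log_le_log hy0 hyx1
  have hlogX : Real.log x ≤ Real.log X := Real.log_le_log (by linarith) hxX
  have hflx : ((⌊x⌋₊ : ℕ) : ℝ) ≤ x := Nat.floor_le (by linarith)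
  have hfly : ((⌊y⌋₊ : ℕ) : ℝ) ≤ y := Nat.floor_le (by linarith)
  have hp2x : ∀ p : ℕ, p ≤ Nat.sqrt ⌊x⌋₊ → ((p ^ 2 : ℕ) : ℝ) ≤ x := fun p hp =>
    (Nat.cast_le.2 (Nat.le_sqrt'.1 hp)).trans hflx
  have hyM : ⌊y⌋₊ ≤ Nat.sqrt ⌊x⌋₊ := by
    rw [Nat.le_sqrt', Nat.le_floor_iff (by linarith)]
    push_cast
    exact (pow_le_pow_left₀ (Nat.cast_nonneg _) hfly 2).trans hyx
  -- the squares of primes beyond `y`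
  have hsplit : squareSum x z₁ z₂ d ≤ ∑ p ∈ primesUpTo ⌊y⌋₊, squareTerm x z₁ z₂ d p +
      2 * (Real.log (Real.log x / Real.log y) + C₃) := by
    have hsub : primesUpTo ⌊y⌋₊ ⊆ primesUpTo (Nat.sqrt ⌊x⌋₊) := fun p hp => by
      rw [mem_primesUpTo] at hp ⊢
      exact ⟨hp.1.trans hyM, hp.2⟩
    rw [squareSum, ← Finset.sum_sdiff hsub, add_comm]
    gcongr
    calc ∑ p ∈ primesUpTo (Nat.sqrt ⌊x⌋₊) \ primesUpTo ⌊y⌋₊, squareTerm x z₁ z₂ d p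
        ≤ ∑ p ∈ primesUpTo (Nat.sqrt ⌊x⌋₊) \ primesUpTo ⌊y⌋₊, 2 * (1 / (p : ℝ)) := by
          refine Finset.sum_le_sum fun p hp => (le_abs_self _).trans ?_
          rw [Finset.mem_sdiff, mem_primesUpTo] at hp
          exact abs_squareTerm_le hz₁.1 hz₂.1 d hp.1.2.two_le (hp2x p hp.1.1)
      _ ≤ ∑ p ∈ (Finset.Ioc ⌊y⌋₊ ⌊x⌋₊).filter Nat.Prime, 2 * (1 / (p : ℝ)) := by
          refine Finset.sum_le_sum_of_subset_of_nonneg (fun p hp => ?_) fun _ _ _ => by positivity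
          rw [Finset.mem_sdiff, mem_primesUpTo, mem_primesUpTo] at hp
          rw [Finset.mem_filter, Finset.mem_Ioc]
          refine ⟨⟨?_, hp.1.1.trans (Nat.sqrt_le_self _)⟩, hp.1.2⟩
          by_contra hcon
          exact hp.2 ⟨not_lt.1 hcon, hp.1.2⟩
      _ ≤ _ := by
          rw [← Finset.mul_sum]
          exact mul_le_mul_of_nonneg_left (h3 y x hye hyx1) zero_le_two
  have hvar : ∑ p ∈ oddPrimes ⌊y⌋₊, primeCoeff x z₁ z₂ p ^ 2 ≤
      ∑ p ∈ primesUpTo ⌊y⌋₊, primeCoeff x z₁ z₂ p ^ 2 :=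
    Finset.sum_le_sum_of_subset_of_nonneg (oddPrimes_subset _) fun _ _ _ => sq_nonneg _
  have hpt := Finset.sum_le_sum fun p (hp : p ∈ primesUpTo ⌊y⌋₊) =>
    squareTerm_add_primeCoeff_sq_le (by linarith) hx1 hz₁ hz₂ d
      (mem_primesUpTo.1 hp).2.two_le (hp2x p ((mem_primesUpTo.1 hp).1.trans hyM))
  simp only [Finset.sum_add_distrib, ← Finset.mul_sum, ← Finset.sum_div] at hpt
  -- the error terms
  have hX₁ : X₁ ≤ X := ((le_max_left _ _).trans (le_max_left _ _)).trans hX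
  have hX₂ : X₂ ≤ X := ((le_max_right _ _).trans (le_max_left _ _)).trans hX
  have hd' := mem_fundamentalDiscriminants.1 hd
  have hE1 : ∑ p ∈ primesUpTo ⌊y⌋₊, (1 - (kroneckerSym d p : ℝ) ^ 2) * (1 / (p : ℝ)) ≤
      Real.log (Real.log (Real.log X)) + C₂ := by
    refine le_trans ?_ (h2 X hX₂ d.natAbs hd'.2.natAbs_ne_zero (by
      rw [Nat.cast_natAbs]; push_cast; exact hd'.1))
    calc _ ≤ ∑ p ∈ primesUpTo ⌊y⌋₊, if p ∣ d.natAbs then 1 / (p : ℝ) else 0 := by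
          refine Finset.sum_le_sum fun p hp => ?_
          have h := mul_le_mul_of_nonneg_right
            (one_sub_kroneckerSym_sq_le d (mem_primesUpTo.1 hp).2)
            (by positivity : (0 : ℝ) ≤ 1 / p)
          refine h.trans (le_of_eq ?_)
          split_ifs <;> simp
      _ ≤ _ := by
          rw [← Finset.sum_filter]
          refine Finset.sum_le_sum_of_subset_of_nonneg (fun p hp => ?_) fun _ _ _ => by positivity
          rw [Finset.mem_filter, mem_primesUpTo] at hp
          exact Nat.mem_primeFactors.2 ⟨hp.1.2, hp.2, hd'.2.natAbs_ne_zero⟩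
  have hE2 : ∑ p ∈ primesUpTo ⌊y⌋₊, 1 / (p : ℝ) ^ 3 ≤ C₄ :=
    hs.sum_le_tsum _ fun _ _ => by positivity
  have hE3 : (16 / Real.log x + 20 / Real.log X) * ∑ p ∈ primesUpTo ⌊y⌋₊, Real.log p / (p : ℝ) ≤
      432 := by
    have hm : ∑ p ∈ primesUpTo ⌊y⌋₊, Real.log p / (p : ℝ) ≤ 12 * Real.log y :=
      sum_log_div_prime_le hGRH hye
    have hlx : 0 < Real.log x := by linarith
    have hlX : 0 < Real.log X := by linarith
    have hdx : Real.log y / Real.log x ≤ 1 := (div_le_one hlx).2 hlogx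
    have hdX : Real.log y / Real.log X ≤ 1 := (div_le_one hlX).2 (hlogx.trans hlogX)
    calc _ ≤ (16 / Real.log x + 20 / Real.log X) * (12 * Real.log y) :=
          mul_le_mul_of_nonneg_left hm (by positivity)
      _ = 192 * (Real.log y / Real.log x) + 240 * (Real.log y / Real.log X) := by ring
      _ ≤ 432 := by linarith
  -- the cosine sums
  have hcos : ∀ t : ℝ, |t| ≤ 4 * X → ∑ p ∈ primesUpTo ⌊y⌋₊, Real.cos (t * Real.log p) / p ≤
      logMin X t + (Real.log (Real.log (Real.log X)) + C₁) := fun t ht =>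
    h1 X hX₁ y t hy (hyx1.trans hxX) ht
  have c0 := hcos 0 (by rw [abs_zero]; positivity)
  have c1 := hcos (2 * z₁.im) (by rw [abs_mul, abs_two]; linarith [hz₁.2.2])
  have c2 := hcos (2 * z₂.im) (by rw [abs_mul, abs_two]; linarith [hz₂.2.2])
  have c3 := hcos (z₁.im - z₂.im) (by linarith [abs_sub z₁.im z₂.im, hz₁.2.2, hz₂.2.2])
  have c4 := hcos (z₁.im + z₂.im) (by linarith [abs_add_le z₁.im z₂.im, hz₁.2.2, hz₂.2.2])
  have m0 := logMin_le hL1 0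
  have m1 := logMin_add_add_le hL1 z₁.im z₂.im
  linarith

/-! ### A crude bound for the second moment -/

theorem exists_le_log_log (M : ℝ) : ∃ X₀ : ℝ, 1 ≤ X₀ ∧
    ∀ X, X₀ ≤ X → M ≤ Real.log (Real.log X) := by
  have h : Tendsto (fun X => Real.log (Real.log X)) atTop atTop :=
    Real.tendsto_log_atTop.comp Real.tendsto_log_atTop
  obtain ⟨X₀, hX₀⟩ := eventually_atTop.1 (h.eventually_ge_atTop M)
  exact ⟨max 1 X₀, le_max_left _ _, fun X hX => hX₀ X ((le_max_right _ _).trans hX)⟩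

/-- The condition on the order `2 k` of the moments under which the off-diagonal terms are at most `X`,
in logarithmic form. -/
theorem four_mul_sq_pow_le {X y : ℝ} {k : ℕ} (hX : 0 < X) (hy : 0 < y)
    (h : 2 * k * (2 + 2 * Real.log y) ≤ Real.log X) : (4 * y ^ 2) ^ (2 * k) ≤ X := by
  rw [← Real.log_le_log_iff (by positivity) hX, Real.log_pow,
    Real.log_mul (by norm_num) (by positivity), Real.log_pow]
  have h4 : Real.log 4 ≤ 2 := by
    rw [show (4 : ℝ) = 2 ^ 2 by norm_num, Real.log_pow]
    push_cast
    linarith [Real.log_two_lt_d9]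
  refine le_trans ?_ h
  push_cast
  have : (0 : ℝ) ≤ 2 * k := by positivity
  exact mul_le_mul_of_nonneg_left (by linarith) this

/-- The moments of `charSum` in a normalized form; `l` is the parameter of the exponential
moment of the random model. -/
theorem sum_charSum_div_pow_le {P : Finset ℕ} (hP : ∀ p ∈ P, p.Prime ∧ p ≠ 2) {b : ℕ → ℝ} {y : ℝ}
    (hy : ∀ p ∈ P, (p : ℝ) ≤ y) (hb : ∀ p ∈ P, |b p| ≤ 4) {X : ℝ} (hX : 1 ≤ X)
    {k : ℕ} (hk : (4 * y ^ 2) ^ (2 * k) ≤ X) {l T ρ v : ℝ} (hl : 0 < l) (hT : 0 < T)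
    (hρ : 1 / T ≤ ρ) (hρ' : 2 * k / (l * T) ≤ ρ) (hv : ∑ p ∈ P, b p ^ 2 ≤ v) :
    ∑ d ∈ fundamentalDiscriminants X, (charSum P b d / T) ^ (2 * k) ≤
      5 * X * (ρ ^ (2 * k) * Real.exp (l ^ 2 * v / 2)) := by
  have h := sum_charSum_pow_le hP b hy hb hX hk hl
  have hv0 : 0 ≤ ∑ p ∈ P, b p ^ 2 := Finset.sum_nonneg fun _ _ => sq_nonneg _
  have hT1 : 0 ≤ 1 / T := by positivity
  have e1 : Real.exp (l ^ 2 * (∑ p ∈ P, b p ^ 2) / 2) ≤ Real.exp (l ^ 2 * v / 2) :=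
    Real.exp_le_exp.2 (by gcongr)
  have e0 : 1 ≤ Real.exp (l ^ 2 * v / 2) :=
    Real.one_le_exp (by have := hv0.trans hv; positivity)
  calc ∑ d ∈ fundamentalDiscriminants X, (charSum P b d / T) ^ (2 * k)
      = (1 / T) ^ (2 * k) * ∑ d ∈ fundamentalDiscriminants X, charSum P b d ^ (2 * k) := by
        rw [Finset.mul_sum]
        refine Finset.sum_congr rfl fun d _ => ?_
        rw [← mul_pow, one_div_mul_eq_div]
    _ ≤ (1 / T) ^ (2 * k) * (3 * X * ((2 * k / l) ^ (2 * k) *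
          Real.exp (l ^ 2 * (∑ p ∈ P, b p ^ 2) / 2)) + 2 * X) :=
        mul_le_mul_of_nonneg_left h (by positivity)
    _ = 3 * X * ((2 * k / (l * T)) ^ (2 * k) * Real.exp (l ^ 2 * (∑ p ∈ P, b p ^ 2) / 2)) +
          2 * X * ((1 / T) ^ (2 * k) * 1) := by
        rw [show 2 * (k : ℝ) / (l * T) = 1 / T * (2 * k / l) by field_simp, mul_pow]
        ring
    _ ≤ 3 * X * (ρ ^ (2 * k) * Real.exp (l ^ 2 * v / 2)) +
          2 * X * (ρ ^ (2 * k) * Real.exp (l ^ 2 * v / 2)) := by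
        have : 0 ≤ ρ := hT1.trans hρ
        gcongr
    _ = _ := by ring

theorem card_fundamentalDiscriminants_le {X : ℝ} (hX : 1 ≤ X) :
    ((fundamentalDiscriminants X).card : ℝ) ≤ 3 * X := by
  have hsub : fundamentalDiscriminants X ⊆ Finset.Icc (-⌊X⌋) ⌊X⌋ := by
    classical exact Finset.filter_subset _ _
  have h := Finset.card_le_card hsub
  have hf : 0 ≤ ⌊X⌋ := Int.floor_nonneg.2 (by linarith)
  rw [Int.card_Icc] at h
  have h2 : ((fundamentalDiscriminants X).card : ℤ) ≤ 2 * ⌊X⌋ + 1 := by omega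
  have h3 : ((fundamentalDiscriminants X).card : ℝ) ≤ 2 * ⌊X⌋ + 1 := by exact_mod_cast h2
  linarith [Int.floor_le X]

theorem oddPrimes_spec {x : ℝ} (hx : 0 ≤ x) {z₁ z₂ : ℂ} (h₁ : 0 ≤ z₁.re) (h₂ : 0 ≤ z₂.re) :
    (∀ p ∈ oddPrimes ⌊x⌋₊, p.Prime ∧ p ≠ 2) ∧ (∀ p ∈ oddPrimes ⌊x⌋₊, (p : ℝ) ≤ x) ∧
    ∀ p ∈ oddPrimes ⌊x⌋₊, |primeCoeff x z₁ z₂ p| ≤ 4 := by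
  have hle : ∀ p ∈ oddPrimes ⌊x⌋₊, (p : ℝ) ≤ x := fun p hp =>
    (Nat.cast_le.2 (mem_oddPrimes.1 hp).2.1).trans (Nat.floor_le hx)
  refine ⟨fun p hp => ?_, hle, fun p hp => ?_⟩
  · have := mem_oddPrimes.1 hp; exact ⟨this.2.2, by omega⟩
  · exact abs_primeCoeff_le_four h₁ h₂ (by have := mem_oddPrimes.1 hp; omega) (hle p hp)

theorem sum_exp_neg_le (s : Finset ℕ) : ∑ j ∈ s, Real.exp (-(j : ℝ)) ≤ 2 := by
  have h : ∀ j : ℕ, Real.exp (-(j : ℝ)) ≤ (1 / 2) ^ j := fun j => by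
    rw [show -(j : ℝ) = j * (-1) by ring, Real.exp_nat_mul]
    refine pow_le_pow_left₀ (Real.exp_pos _).le ?_ _
    rw [Real.exp_neg, one_div]
    exact inv_anti₀ two_pos (by linarith [Real.add_one_le_exp (1 : ℝ)])
  calc _ ≤ ∑ j ∈ s, (1 / 2 : ℝ) ^ j := Finset.sum_le_sum fun j _ => h j
    _ ≤ 2 := sum_le_hasSum s (fun _ _ => by positivity) hasSum_geometric_two

/-- If `V` has no better bound than the ones by sums `S x` over primes up to `x`, with error
`32 L / log x`, then a large value of `V` forces a large value of `S x` for a suitable `x`. -/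
theorem sq_le_exp_add_sum {V L c : ℝ} (hV0 : 0 ≤ V) (hL : 0 < L) {j₀ : ℕ} (hj₀ : 0 < j₀)
    (hc : c ≤ j₀ / 4) (hcL : c ≤ L) {S : ℝ → ℝ} (hS : ∀ x, x < 3 → S x = 0)
    (hV : ∀ x, 1 < x → Real.log x ≤ 128 * L / j₀ → V ≤ Real.exp (32 * (L / Real.log x) + S x + c))
    (h1 : 1 ≤ 128 * L / j₀) (k : ℕ → ℕ) :
    V ^ 2 ≤ Real.exp (2 * j₀) + ∑ j ∈ Finset.Icc j₀ ⌊33 * L⌋₊,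
      Real.exp (2 * j + 2) * (S (Real.exp (128 * L / j)) / (j / 2)) ^ (2 * k j) := by
  have hnn : ∀ j ∈ Finset.Icc j₀ ⌊33 * L⌋₊, 0 ≤ Real.exp (2 * j + 2) *
      (S (Real.exp (128 * L / j)) / (j / 2)) ^ (2 * k j) := fun j _ => by
    rw [pow_mul]; positivity
  rcases le_or_gt V (Real.exp j₀) with h | h
  · have := pow_le_pow_left₀ hV0 h 2
    rw [← Real.exp_nat_mul] at this
    push_cast at this
    linarith [Finset.sum_nonneg hnn]
  have hVpos : 0 < V := (Real.exp_pos _).trans h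
  have hlog : (j₀ : ℝ) < Real.log V := (Real.lt_log_iff_exp_lt hVpos).2 h
  have hlog0 : 0 ≤ Real.log V := (Nat.cast_nonneg _).trans hlog.le
  set j := ⌊Real.log V⌋₊ with hj
  have hj₀j : j₀ ≤ j := Nat.le_floor hlog.le
  have hjV : (j : ℝ) ≤ Real.log V := Nat.floor_le hlog0
  have hVj : Real.log V < j + 1 := Nat.lt_floor_add_one _
  have hjpos : (0 : ℝ) < j := by exact_mod_cast lt_of_lt_of_le hj₀ hj₀j
  have hj₀' : (0 : ℝ) < j₀ := by exact_mod_cast hj₀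
  have hj₀j' : (j₀ : ℝ) ≤ j := by exact_mod_cast hj₀j
  have hJ : j ≤ ⌊33 * L⌋₊ := by
    have := hV (Real.exp 1) (Real.one_lt_exp_iff.2 one_pos) (by rwa [Real.log_exp])
    rw [hS _ Real.exp_one_lt_three, Real.log_exp, ← Real.log_le_iff_le_exp hVpos] at this
    exact Nat.floor_le_floor (by linarith)
  have hSj : 1 ≤ S (Real.exp (128 * L / j)) / (j / 2) := by
    rw [one_le_div (by positivity)]
    have := hV (Real.exp (128 * L / j)) (Real.one_lt_exp_iff.2 (by positivity)) (by
      rw [Real.log_exp]; gcongr)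
    rw [Real.log_exp, ← Real.log_le_iff_le_exp hVpos,
      show 32 * (L / (128 * L / j)) = (j : ℝ) / 4 by field_simp; norm_num] at this
    linarith
  have hterm : V ^ 2 ≤ Real.exp (2 * j + 2) *
      (S (Real.exp (128 * L / j)) / (j / 2)) ^ (2 * k j) := by
    calc V ^ 2 = Real.exp (2 * Real.log V) := by
          rw [← Real.exp_log hVpos, Real.log_exp, ← Real.exp_nat_mul]; norm_num
      _ ≤ Real.exp (2 * j + 2) * 1 := by
          rw [mul_one]; exact Real.exp_le_exp.2 (by linarith)
      _ ≤ _ := mul_le_mul_of_nonneg_left (one_le_pow₀ hSj) (Real.exp_pos _).le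
  have := Finset.single_le_sum hnn (Finset.mem_Icc.2 ⟨hj₀j, hJ⟩)
  have h0 : 0 ≤ Real.exp (2 * (j₀ : ℝ)) := (Real.exp_pos _).le
  linarith

/-- The bound by primes, with the contribution of the squares of primes estimated trivially. -/
theorem exists_shiftedValue_le_exp (hGRH : GRH) : ∃ c X₀ : ℝ, ∀ X : ℝ, X₀ ≤ X →
    ∀ z₁ z₂ : ℂ, IsShift X z₁ → IsShift X z₂ → ∀ d ∈ fundamentalDiscriminants X, d ≠ 1 →
    ∀ x : ℝ, 1 < x → x ≤ X → shiftedValue z₁ z₂ d ≤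
      Real.exp (32 * (Real.log X / Real.log x) +
        charSum (oddPrimes ⌊x⌋₊) (primeCoeff x z₁ z₂) d + (2 * Real.log (Real.log X) + c)) := by
  obtain ⟨C₁, X₁, hC₁, h1⟩ := exists_shiftedValue_le hGRH
  obtain ⟨C₂, h2⟩ := exists_squareSum_le hGRH
  refine ⟨Real.log C₁ + C₂, max X₁ (Real.exp 1), fun X hX z₁ z₂ hz₁ hz₂ d hd hd1 x hx hxX => ?_⟩
  have h3 := h2 X ((le_max_right _ _).trans hX) z₁ z₂ hz₁.1 hz₂.1 d x hx hxX
  refine (h1 X ((le_max_left _ _).trans hX) z₁ z₂ hz₁ hz₂ d hd hd1 x hx).trans ?_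
  conv_lhs => rw [← Real.exp_log hC₁, ← Real.exp_add]
  exact Real.exp_le_exp.2 (by linarith)

theorem inv_exp_pow_le {A j : ℝ} (hA : A = 1536) {k : ℕ} (hk : j / 1024 - 1 ≤ k) :
    (Real.exp (-A)) ^ (2 * k) ≤ Real.exp (3072 - 3 * j) := by
  rw [← Real.exp_nat_mul]
  refine Real.exp_le_exp.2 ?_
  push_cast
  subst hA
  linarith

/-- A bound for the second moment of the averaged quantity, of the right size up to a power of
`log X`. -/
theorem exists_sum_shiftedValue_sq_le (hGRH : GRH) : ∃ K X₀ : ℝ, 0 ≤ K ∧ ∀ X : ℝ, X₀ ≤ X →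
    ∀ z₁ z₂ : ℂ, IsShift X z₁ → IsShift X z₂ →
    ∑ d ∈ (fundamentalDiscriminants X).erase 1, shiftedValue z₁ z₂ d ^ 2 ≤
      X * Real.exp (K * Real.log (Real.log X)) := by
  obtain ⟨c, X₁, hV⟩ := exists_shiftedValue_le_exp hGRH
  obtain ⟨C, hC⟩ := exists_sum_primeCoeff_sq_le hGRH
  -- The discriminants are sorted by the integral part `j` of the logarithm of `shiftedValue`, with
  -- primes up to `X ^ (128 / j)` and moments of order `2 k j`, where `k j = ⌊j / 1024⌋` satisfies the
  -- condition of `four_mul_sq_pow_le`. For `l = e ^ 1536`, up to a constant `l ^ (-2 k j)` is at most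
  -- `e ^ (-3 j)`, which compensates for the weight `e ^ (2 j)` and leaves a convergent sum over `j`.
  obtain ⟨A, hA⟩ : ∃ A : ℝ, A = 1536 := ⟨_, rfl⟩
  set l := Real.exp A with hl
  have hl0 : 0 < l := Real.exp_pos A
  have hρ : Real.exp (-A) = 1 / l := by rw [Real.exp_neg, one_div]
  obtain ⟨X₂, hX₂, hM⟩ := exists_le_log_log (max (max 11 c) (max l (3077 + l ^ 2 * C / 2)))
  refine ⟨26 + 8 * l ^ 2, max X₁ X₂, by positivity, fun X hX z₁ z₂ hz₁ hz₂ => ?_⟩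
  have hX1 : 1 ≤ X := hX₂.trans ((le_max_right _ _).trans hX)
  have hm := hM X ((le_max_right _ _).trans hX)
  set ℓ := Real.log (Real.log X) with hℓ
  set L := Real.log X with hL
  have hm1 : 11 ≤ ℓ := (le_max_left _ _).trans ((le_max_left _ _).trans hm)
  have hm2 : c ≤ ℓ := (le_max_right _ _).trans ((le_max_left _ _).trans hm)
  have hm3 : l ≤ ℓ := (le_max_left _ _).trans ((le_max_right _ _).trans hm)
  have hm4 : 3077 + l ^ 2 * C / 2 ≤ ℓ := (le_max_right _ _).trans ((le_max_right _ _).trans hm)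
  have hL0 : 0 < L := by
    have : 0 ≤ L := Real.log_nonneg hX1
    rcases this.eq_or_lt with h | h
    · rw [hℓ, ← h, Real.log_zero] at hm1; linarith
    · exact h
  have hLexp : L = Real.exp ℓ := (Real.exp_log hL0).symm
  have hLℓ : 5 * ℓ ≤ L := by
    rw [hLexp]; nlinarith [Real.quadratic_le_exp_of_nonneg (by linarith : 0 ≤ ℓ)]
  have hXexp : X = Real.exp L := (Real.exp_log (by linarith)).symm
  have hXe : Real.exp 1 ≤ X := by rw [hXexp]; exact Real.exp_le_exp.2 (by linarith)
  -- beyond `j₀` the contribution `2 ℓ + c` of the squares of primes is at most `j / 4`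
  set j₀ := ⌈12 * ℓ⌉₊ with hj₀
  have hj1 : 12 * ℓ ≤ j₀ := Nat.le_ceil _
  have hj2 : (j₀ : ℝ) < 12 * ℓ + 1 := Nat.ceil_lt_add_one (by linarith)
  have hjpos : (0 : ℝ) < j₀ := by linarith
  have hj128 : 128 * L / j₀ ≤ L := by
    rw [div_le_iff₀ hjpos]; nlinarith
  have h1j : 1 ≤ 128 * L / j₀ := by rw [le_div_iff₀ hjpos]; linarith
  set S : ℤ → ℝ → ℝ := fun d x => charSum (oddPrimes ⌊x⌋₊) (primeCoeff x z₁ z₂) d with hS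
  set k : ℕ → ℕ := fun j => j / 1024 with hk
  have hpt : ∀ d ∈ (fundamentalDiscriminants X).erase 1, shiftedValue z₁ z₂ d ^ 2 ≤
      Real.exp (2 * j₀) + ∑ j ∈ Finset.Icc j₀ ⌊33 * L⌋₊,
        Real.exp (2 * j + 2) * (S d (Real.exp (128 * L / j)) / (j / 2)) ^ (2 * k j) := by
    intro d hd
    rw [Finset.mem_erase] at hd
    refine sq_le_exp_add_sum (c := 2 * ℓ + c) (shiftedValue_nonneg _ _ _) hL0
      (by exact_mod_cast hjpos) (by linarith) (by linarith) (S := S d) (fun x hx => ?_)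
      (fun x hx hx2 => ?_) h1j k
    · rw [hS]
      refine Finset.sum_eq_zero_iff_of_nonneg ?_ |>.2 ?_ <;>
      · intro p hp
        have := mem_oddPrimes.1 hp
        have h3 : 3 ≤ ⌊x⌋₊ := this.1.trans this.2.1
        have := (Nat.le_floor_iff' (by norm_num)).1 h3
        norm_num at this; linarith
    · refine hV X ((le_max_left _ _).trans hX) z₁ z₂ hz₁ hz₂ d hd.2 hd.1 x hx ?_
      rw [← Real.log_le_log_iff (by linarith) (by linarith)]
      exact hx2.trans hj128
  have hterm : ∀ j ∈ Finset.Icc j₀ ⌊33 * L⌋₊, ∑ d ∈ fundamentalDiscriminants X,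
      Real.exp (2 * j + 2) * (S d (Real.exp (128 * L / j)) / (j / 2)) ^ (2 * k j) ≤
      5 * X * Real.exp (3074 + l ^ 2 * C / 2 + 8 * l ^ 2 * ℓ) * Real.exp (-(j : ℝ)) := by
    intro j hj
    rw [Finset.mem_Icc] at hj
    have hjj : (j₀ : ℝ) ≤ j := by exact_mod_cast hj.1
    have hjL : (j : ℝ) ≤ 33 * L := (Nat.le_floor_iff (by linarith)).1 hj.2
    have hj0 : (0 : ℝ) < j := hjpos.trans_le hjj
    have hxX : Real.exp (128 * L / j) ≤ X := by
      rw [hXexp]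
      refine Real.exp_le_exp.2 (le_trans ?_ hj128)
      gcongr
    have hk1 : (k j : ℝ) ≤ j / 1024 := by
      have := @Nat.cast_div_le ℝ _ _ _ j 1024
      simpa [hk] using this
    have hk2 : (j : ℝ) / 1024 - 1 ≤ k j := by
      have h : j < 1024 * (j / 1024 + 1) := Nat.lt_mul_div_succ j (by norm_num)
      have h' : (j : ℝ) < 1024 * ((k j : ℕ) + 1) := by exact_mod_cast h
      linarith
    obtain ⟨s1, s2, s3⟩ := oddPrimes_spec (Real.exp_pos (128 * L / j)).le hz₁.1 hz₂.1
    have hcond : (4 * Real.exp (128 * L / j) ^ 2) ^ (2 * k j) ≤ X := by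
      refine four_mul_sq_pow_le (by linarith) (Real.exp_pos _) ?_
      rw [Real.log_exp]
      calc 2 * (k j : ℝ) * (2 + 2 * (128 * L / j)) ≤
            2 * (j / 1024) * (2 + 2 * (128 * L / j)) := by gcongr
        _ = j / 256 + L / 2 := by field_simp; ring
        _ ≤ L := by linarith
    have hmom := sum_charSum_div_pow_le s1 s2 s3 hX1 hcond hl0 (T := j / 2) (ρ := Real.exp (-A))
      (by positivity) (by
        rw [hρ]
        exact one_div_le_one_div_of_le hl0 (by linarith)) (by
        rw [hρ, div_le_div_iff₀ (by positivity) hl0]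
        have : 2 * (k j : ℝ) ≤ j / 2 := by linarith
        nlinarith)
      (hC X hXe z₁ z₂ hz₁.1 hz₂.1 _ (Real.one_lt_exp_iff.2 (by positivity)) hxX _
        (Finset.Subset.refl _))
    rw [← Finset.mul_sum]
    calc _ ≤ Real.exp (2 * j + 2) * (5 * X * (Real.exp (-A) ^ (2 * k j) *
          Real.exp (l ^ 2 * (16 * ℓ + C) / 2))) :=
          mul_le_mul_of_nonneg_left hmom (Real.exp_pos _).le
      _ ≤ Real.exp (2 * j + 2) * (5 * X * (Real.exp (3072 - 3 * j) *
          Real.exp (l ^ 2 * (16 * ℓ + C) / 2))) := by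
          gcongr
          exact inv_exp_pow_le hA hk2
      _ = 5 * X * (Real.exp (2 * j + 2) * (Real.exp (3072 - 3 * j) *
          Real.exp (l ^ 2 * (16 * ℓ + C) / 2))) := by ring
      _ = _ := by
          rw [mul_assoc (5 * X), ← Real.exp_add, ← Real.exp_add, ← Real.exp_add]
          congr 2; ring
  have hcard : (((fundamentalDiscriminants X).erase 1).card : ℝ) ≤ 3 * X :=
    (Nat.cast_le.2 (Finset.card_le_card (Finset.erase_subset _ _))).trans
      (card_fundamentalDiscriminants_le hX1)
  have hsum : ∑ d ∈ (fundamentalDiscriminants X).erase 1, shiftedValue z₁ z₂ d ^ 2 ≤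
      3 * X * Real.exp (2 * j₀) +
        5 * X * Real.exp (3074 + l ^ 2 * C / 2 + 8 * l ^ 2 * ℓ) * 2 := by
    refine (Finset.sum_le_sum hpt).trans ?_
    rw [Finset.sum_add_distrib, Finset.sum_const, nsmul_eq_mul, Finset.sum_comm]
    refine add_le_add (mul_le_mul_of_nonneg_right hcard (Real.exp_pos _).le) ?_
    calc _ ≤ ∑ j ∈ Finset.Icc j₀ ⌊33 * L⌋₊,
          5 * X * Real.exp (3074 + l ^ 2 * C / 2 + 8 * l ^ 2 * ℓ) * Real.exp (-(j : ℝ)) := by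
          refine Finset.sum_le_sum fun j hj => le_trans ?_ (hterm j hj)
          refine Finset.sum_le_sum_of_subset_of_nonneg (Finset.erase_subset _ _) fun d _ _ => ?_
          rw [pow_mul]; positivity
      _ ≤ _ := by
          rw [← Finset.mul_sum]
          exact mul_le_mul_of_nonneg_left (sum_exp_neg_le _) (by positivity)
  have hnum : (20 : ℝ) ≤ Real.exp 3 := by
    have := Real.exp_one_gt_d9
    have h3 : Real.exp 3 = Real.exp 1 ^ 3 := by rw [← Real.exp_nat_mul]; norm_num
    rw [h3]
    calc (20 : ℝ) ≤ 2.7182818283 ^ 3 := by norm_num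
      _ ≤ _ := by gcongr
  have hl2 : 0 ≤ l ^ 2 * ℓ := by positivity
  have b1 : 3 * Real.exp (2 * (j₀ : ℝ)) ≤ Real.exp ((26 + 8 * l ^ 2) * ℓ) / 2 := by
    have : Real.exp 3 * Real.exp (2 * (j₀ : ℝ)) ≤ Real.exp ((26 + 8 * l ^ 2) * ℓ) := by
      rw [← Real.exp_add]; exact Real.exp_le_exp.2 (by linarith)
    nlinarith [Real.exp_pos (2 * (j₀ : ℝ))]
  have b2 : 10 * Real.exp (3074 + l ^ 2 * C / 2 + 8 * l ^ 2 * ℓ) ≤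
      Real.exp ((26 + 8 * l ^ 2) * ℓ) / 2 := by
    have : Real.exp 3 * Real.exp (3074 + l ^ 2 * C / 2 + 8 * l ^ 2 * ℓ) ≤
        Real.exp ((26 + 8 * l ^ 2) * ℓ) := by
      rw [← Real.exp_add]; exact Real.exp_le_exp.2 (by linarith)
    nlinarith [Real.exp_pos (3074 + l ^ 2 * C / 2 + 8 * l ^ 2 * ℓ)]
  have hX0 : 0 ≤ X := by linarith
  have := mul_le_mul_of_nonneg_left (add_le_add b1 b2) hX0
  refine hsum.trans (le_trans (le_of_eq ?_) (this.trans (le_of_eq ?_))) <;> ring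

/-! ### Rare discriminants -/

/-- Markov's inequality for the high moments of `charSum`. -/
theorem card_lt_abs_charSum_le {P : Finset ℕ} (hP : ∀ p ∈ P, p.Prime ∧ p ≠ 2) {b : ℕ → ℝ} {y : ℝ}
    (hy : ∀ p ∈ P, (p : ℝ) ≤ y) (hb : ∀ p ∈ P, |b p| ≤ 4) {X : ℝ} (hX : 1 ≤ X)
    {k : ℕ} (hk : (4 * y ^ 2) ^ (2 * k) ≤ X) {l T ρ v : ℝ} (hl : 0 < l) (hT : 0 < T)
    (hρ : 1 / T ≤ ρ) (hρ' : 2 * k / (l * T) ≤ ρ) (hv : ∑ p ∈ P, b p ^ 2 ≤ v) :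
    (((fundamentalDiscriminants X).filter fun d => T < |charSum P b d|).card : ℝ) ≤
      5 * X * (ρ ^ (2 * k) * Real.exp (l ^ 2 * v / 2)) := by
  refine le_trans ?_ (sum_charSum_div_pow_le hP hy hb hX hk hl hT hρ hρ' hv)
  have hnn : ∀ d, 0 ≤ (charSum P b d / T) ^ (2 * k) := fun d => by rw [pow_mul]; positivity
  calc (((fundamentalDiscriminants X).filter fun d => T < |charSum P b d|).card : ℝ)
      = ∑ d ∈ (fundamentalDiscriminants X).filter fun d => T < |charSum P b d|, (1 : ℝ) := by simp
    _ ≤ ∑ d ∈ (fundamentalDiscriminants X).filter fun d => T < |charSum P b d|,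
          (charSum P b d / T) ^ (2 * k) := by
        refine Finset.sum_le_sum fun d hd => ?_
        have h := (Finset.mem_filter.1 hd).2
        rw [← (even_two_mul k).pow_abs, abs_div, abs_of_pos hT]
        exact one_le_pow₀ ((one_le_div hT).2 h.le)
    _ ≤ _ := Finset.sum_le_sum_of_subset_of_nonneg (Finset.filter_subset _ _) fun d _ _ => hnn d

theorem growth_of_le {ℓ : ℝ} (hℓ : 100 ≤ ℓ) :
    4 * ℓ ^ 3 ≤ Real.exp ℓ ∧ 16 * ℓ ^ 2 ≤ Real.exp ℓ ∧ 16 * ℓ ≤ Real.exp ℓ := by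
  have h := Real.pow_div_factorial_le_exp ℓ (by linarith) 4
  norm_num [Nat.factorial] at h
  have h2 : 4 * ℓ ^ 3 ≤ ℓ ^ 4 / 24 := by
    have : 0 ≤ ℓ ^ 3 * (ℓ - 96) := by
      have : 0 ≤ ℓ - 96 := by linarith
      positivity
    nlinarith
  have h3 : 16 * ℓ ^ 2 ≤ 4 * ℓ ^ 3 := by nlinarith [sq_nonneg ℓ]
  have h4 : 16 * ℓ ≤ 16 * ℓ ^ 2 := by nlinarith
  exact ⟨by linarith, by linarith, by linarith⟩

theorem exp_neg_three_le : Real.exp (-3) ≤ 1 / 10 := by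
  rw [Real.exp_neg, inv_eq_one_div]
  refine one_div_le_one_div_of_le (by norm_num) ?_
  have h3 : Real.exp 3 = Real.exp 1 ^ 3 := by rw [← Real.exp_nat_mul]; norm_num
  rw [h3]
  calc (10 : ℝ) ≤ 2.7182818283 ^ 3 := by norm_num
    _ ≤ _ := by gcongr; exact Real.exp_one_gt_d9.le

/-- The sum over the small primes, those up to `X ^ (1 / ℓ ^ 3)` with `ℓ = log log X`, rarely exceeds
`ℓ ^ 2`. Its variance is `O(ℓ)`, and moments of order about `2 ℓ` suffice. -/
theorem eventually_card_small_le (hGRH : GRH) {B : ℝ} (hB : 0 ≤ B) :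
    ∀ᶠ X : ℝ in atTop, ∀ z₁ z₂ : ℂ, IsShift X z₁ → IsShift X z₂ → ∀ x y : ℝ, 1 < y →
    Real.log y ≤ Real.log X / Real.log (Real.log X) ^ 3 → y ≤ x → x ≤ X →
    (((fundamentalDiscriminants X).filter fun d => Real.log (Real.log X) ^ 2 <
      |charSum (oddPrimes ⌊y⌋₊) (primeCoeff x z₁ z₂) d|).card : ℝ) ≤
      X * Real.exp (-(B * Real.log (Real.log X))) / 2 := by
  obtain ⟨C, hC⟩ := exists_sum_primeCoeff_sq_le hGRH
  set D := B + 9 with hD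
  have hlim : Tendsto (fun X => Real.log (Real.log X)) atTop atTop :=
    Real.tendsto_log_atTop.comp Real.tendsto_log_atTop
  filter_upwards [hlim.eventually_ge_atTop (max 100 (max (4 * Real.exp D) (3 + C / 2))),
    eventually_ge_atTop (Real.exp 1)] with X hm hX z₁ z₂ hz₁ hz₂ x y hy1 hy hyx hxX
  set ℓ := Real.log (Real.log X) with hℓ
  set L := Real.log X with hL
  have hm1 : 100 ≤ ℓ := (le_max_left _ _).trans hm
  have hm2 : 4 * Real.exp D ≤ ℓ := ((le_max_left _ _).trans (le_max_right _ _)).trans hm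
  have hm3 : 3 + C / 2 ≤ ℓ := ((le_max_right _ _).trans (le_max_right _ _)).trans hm
  have hX0 : 0 < X := (Real.exp_pos 1).trans_le hX
  have hL1 : 1 ≤ L := (Real.le_log_iff_exp_le hX0).2 hX
  have hLexp : L = Real.exp ℓ := (Real.exp_log (by linarith)).symm
  obtain ⟨g1, g2, g3⟩ := growth_of_le hm1
  rw [← hLexp] at g1 g2 g3
  have hℓ0 : 0 < ℓ := by linarith
  have hX1 : 1 ≤ X := (Real.one_le_exp zero_le_one).trans hX
  have hsub : oddPrimes ⌊y⌋₊ ⊆ oddPrimes ⌊x⌋₊ := fun p hp => by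
    rw [mem_oddPrimes] at hp ⊢
    exact ⟨hp.1, hp.2.1.trans (Nat.floor_le_floor hyx), hp.2.2⟩
  obtain ⟨s1, -, s3⟩ := oddPrimes_spec (by linarith : 0 ≤ x) hz₁.1 hz₂.1
  obtain ⟨-, s2, -⟩ := oddPrimes_spec (by linarith : 0 ≤ y) hz₁.1 hz₂.1
  set k := ⌈ℓ⌉₊ with hk
  have hk1 : ℓ ≤ k := Nat.le_ceil _
  have hk2 : (k : ℝ) ≤ 2 * ℓ := by linarith [Nat.ceil_lt_add_one hℓ0.le]
  have hρ : 4 / ℓ ≤ Real.exp (-D) := by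
    rw [Real.exp_neg, div_le_iff₀ hℓ0, inv_mul_eq_div, le_div_iff₀ (Real.exp_pos _)]
    exact hm2
  have hcond : (4 * y ^ 2) ^ (2 * k) ≤ X := by
    refine four_mul_sq_pow_le hX0 (by linarith) ?_
    rw [← hL]
    calc 2 * (k : ℝ) * (2 + 2 * Real.log y) ≤ 2 * (2 * ℓ) * (2 + 2 * (L / ℓ ^ 3)) := by
          have := Real.log_nonneg hy1.le
          gcongr
      _ = 8 * ℓ + 8 / ℓ ^ 2 * L := by field_simp; ring
      _ ≤ L / 2 + 1 / 2 * L := by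
          have hq : 8 / ℓ ^ 2 ≤ 1 / 2 := by rw [div_le_iff₀ (by positivity)]; nlinarith
          have := mul_le_mul_of_nonneg_right hq (by linarith : 0 ≤ L)
          linarith
      _ = L := by ring
  have h := card_lt_abs_charSum_le (fun p hp => s1 p (hsub hp)) s2 (fun p hp => s3 p (hsub hp))
    hX1 hcond one_pos (T := ℓ ^ 2) (ρ := Real.exp (-D)) (by positivity)
    (le_trans (by rw [div_le_div_iff₀ (by positivity) hℓ0]; nlinarith) hρ)
    (le_trans (by
      rw [one_mul, div_le_div_iff₀ (by positivity) hℓ0]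
      nlinarith) hρ)
    (hC X hX z₁ z₂ hz₁.1 hz₂.1 x (hy1.trans_le hyx) hxX _ hsub)
  refine h.trans ?_
  have e : Real.exp (-D) ^ (2 * k) * Real.exp (1 ^ 2 * (16 * ℓ + C) / 2) ≤
      Real.exp (-3) * Real.exp (-(B * ℓ)) := by
    rw [← Real.exp_nat_mul, ← Real.exp_add, ← Real.exp_add]
    refine Real.exp_le_exp.2 ?_
    push_cast
    have h1 : ℓ * D ≤ k * D := mul_le_mul_of_nonneg_right hk1 (by linarith)
    have h2 : 0 ≤ B * ℓ := by positivity
    have h3 : ℓ * D = B * ℓ + 9 * ℓ := by rw [hD]; ring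
    linarith
  have e3 := exp_neg_three_le
  calc _ ≤ 5 * X * (Real.exp (-3) * Real.exp (-(B * ℓ))) :=
        mul_le_mul_of_nonneg_left e (by positivity)
    _ ≤ 5 * X * (1 / 10 * Real.exp (-(B * ℓ))) := by gcongr
    _ = _ := by ring

/-- The sum over the medium primes, those between `X ^ (1 / ℓ ^ 3)` and `X ^ (1 / (η ℓ))` with
`ℓ = log log X`, rarely exceeds `η ℓ`. Its variance is only `O(log ℓ)`. -/
theorem eventually_card_medium_le (hGRH : GRH) {B η : ℝ} (hB : 0 ≤ B) (hη : 0 < η) (hη1 : η ≤ 1) :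
    ∀ᶠ X : ℝ in atTop, ∀ z₁ z₂ : ℂ, IsShift X z₁ → IsShift X z₂ → ∀ x y : ℝ, Real.exp 1 ≤ y →
    Real.log y = Real.log X / Real.log (Real.log X) ^ 3 →
    Real.log x = Real.log X / (η * Real.log (Real.log X)) → y ≤ x → x ≤ X →
    (((fundamentalDiscriminants X).filter fun d => η * Real.log (Real.log X) <
      |charSum (oddPrimes ⌊x⌋₊ \ oddPrimes ⌊y⌋₊) (primeCoeff x z₁ z₂) d|).card : ℝ) ≤
      X * Real.exp (-(B * Real.log (Real.log X))) / 2 := by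
  obtain ⟨C, hC⟩ := exists_sum_inv_prime_Ioc_le hGRH
  -- the moments have order `2 k` with `k = ⌊η ℓ / 16⌋`, and `e ^ (-2 A k)` beats `e ^ (-B ℓ)`
  set A := 16 * (B + 1) / η with hA
  set l := Real.exp A with hl
  have hA0 : 0 ≤ A := by positivity
  have hl0 : 0 < l := Real.exp_pos A
  have hρ : Real.exp (-A) = 1 / l := by rw [Real.exp_neg, one_div]
  have hlim : Tendsto (fun X => Real.log (Real.log X)) atTop atTop :=
    Real.tendsto_log_atTop.comp Real.tendsto_log_atTop
  have hlog := hlim.eventually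
    (Real.isLittleO_log_id_atTop.def (by positivity : 0 < 1 / (32 * l ^ 2)))
  filter_upwards [hlim.eventually_ge_atTop (max 100 (max (l / η)
      (2 * (3 + 2 * A + 8 * l ^ 2 * (C - Real.log η))))), hlog,
    eventually_ge_atTop (Real.exp 1)] with X hm hlog hX z₁ z₂ hz₁ hz₂ x y hye hy hx hyx hxX
  set ℓ := Real.log (Real.log X) with hℓ
  set L := Real.log X with hL
  have hm1 : 100 ≤ ℓ := (le_max_left _ _).trans hm
  have hm2 : l / η ≤ ℓ := ((le_max_left _ _).trans (le_max_right _ _)).trans hm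
  have hm3 : 2 * (3 + 2 * A + 8 * l ^ 2 * (C - Real.log η)) ≤ ℓ :=
    ((le_max_right _ _).trans (le_max_right _ _)).trans hm
  have hX0 : 0 < X := (Real.exp_pos 1).trans_le hX
  have hL1 : 1 ≤ L := (Real.le_log_iff_exp_le hX0).2 hX
  have hLexp : L = Real.exp ℓ := (Real.exp_log (by linarith)).symm
  obtain ⟨-, -, g3⟩ := growth_of_le hm1
  rw [← hLexp] at g3
  have hℓ0 : 0 < ℓ := by linarith
  have hX1 : 1 ≤ X := (Real.one_le_exp zero_le_one).trans hX
  have hy1 : 1 ≤ y := (Real.one_le_exp zero_le_one).trans hye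
  have hlη : l ≤ η * ℓ := by rwa [div_le_iff₀' hη] at hm2
  have hηℓ : η * ℓ ≤ ℓ := by nlinarith
  have hηℓ0 : 0 < η * ℓ := by positivity
  have hlogℓ : 16 * l ^ 2 * Real.log ℓ ≤ ℓ / 2 := by
    rw [Real.norm_eq_abs, Real.norm_eq_abs, id, abs_of_pos hℓ0] at hlog
    have h1 := (le_abs_self _).trans hlog
    rw [one_div_mul_eq_div, le_div_iff₀ (by positivity)] at h1
    linarith
  obtain ⟨s1, s2, s3⟩ := oddPrimes_spec (by linarith : 0 ≤ x) hz₁.1 hz₂.1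
  set P := oddPrimes ⌊x⌋₊ \ oddPrimes ⌊y⌋₊ with hP
  have hsub : P ⊆ oddPrimes ⌊x⌋₊ := Finset.sdiff_subset
  set k := ⌊η * ℓ / 16⌋₊ with hk
  have hk1 : η * ℓ / 16 - 1 ≤ k := by linarith [Nat.lt_floor_add_one (η * ℓ / 16)]
  have hk2 : (k : ℝ) ≤ η * ℓ / 16 := Nat.floor_le (by positivity)
  have hcond : (4 * x ^ 2) ^ (2 * k) ≤ X := by
    refine four_mul_sq_pow_le hX0 (by linarith) ?_
    rw [hx, ← hL]
    calc 2 * (k : ℝ) * (2 + 2 * (L / (η * ℓ))) ≤ 2 * (η * ℓ / 16) * (2 + 2 * (L / (η * ℓ))) := by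
          gcongr
      _ = η * ℓ / 4 + L / 4 := by field_simp; ring
      _ ≤ L := by linarith
  have hv : ∑ p ∈ P, primeCoeff x z₁ z₂ p ^ 2 ≤ 16 * (2 * Real.log ℓ - Real.log η + C) := by
    have h1 := hC y x hye hyx
    rw [hx, hy, show L / (η * ℓ) / (L / ℓ ^ 3) = ℓ ^ 2 / η by field_simp,
      Real.log_div (by positivity) hη.ne', Real.log_pow] at h1
    push_cast at h1
    calc ∑ p ∈ P, primeCoeff x z₁ z₂ p ^ 2 ≤ ∑ p ∈ P, 16 * (1 / (p : ℝ)) := by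
          refine Finset.sum_le_sum fun p hp => ?_
          have := mem_oddPrimes.1 (hsub hp)
          exact primeCoeff_sq_le hz₁.1 hz₂.1 (by omega) (s2 p (hsub hp))
      _ ≤ ∑ p ∈ (Finset.Ioc ⌊y⌋₊ ⌊x⌋₊).filter Nat.Prime, 16 * (1 / (p : ℝ)) := by
          refine Finset.sum_le_sum_of_subset_of_nonneg (fun p hp => ?_) fun _ _ _ => by positivity
          rw [hP, Finset.mem_sdiff, mem_oddPrimes, mem_oddPrimes] at hp
          rw [Finset.mem_filter, Finset.mem_Ioc]
          refine ⟨⟨?_, hp.1.2.1⟩, hp.1.2.2⟩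
          by_contra hcon
          exact hp.2 ⟨hp.1.1, not_lt.1 hcon, hp.1.2.2⟩
      _ ≤ _ := by
          rw [← Finset.mul_sum]
          exact mul_le_mul_of_nonneg_left h1 (by norm_num)
  have h := card_lt_abs_charSum_le (fun p hp => s1 p (hsub hp)) (fun p hp => s2 p (hsub hp))
    (fun p hp => s3 p (hsub hp)) hX1 hcond hl0 (T := η * ℓ) (ρ := Real.exp (-A)) hηℓ0
    (by rw [hρ]; exact one_div_le_one_div_of_le hl0 hlη)
    (by
      rw [hρ, div_le_div_iff₀ (by positivity) hl0]
      nlinarith) hv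
  refine h.trans ?_
  have e : Real.exp (-A) ^ (2 * k) *
      Real.exp (l ^ 2 * (16 * (2 * Real.log ℓ - Real.log η + C)) / 2) ≤
      Real.exp (-3) * Real.exp (-(B * ℓ)) := by
    rw [← Real.exp_nat_mul, ← Real.exp_add, ← Real.exp_add]
    refine Real.exp_le_exp.2 ?_
    push_cast
    have h1 : (η * ℓ / 16 - 1) * A ≤ k * A := mul_le_mul_of_nonneg_right hk1 hA0
    have h2 : 0 ≤ B * ℓ := by positivity
    have h3 : η * ℓ / 16 * A = B * ℓ + ℓ := by rw [hA]; field_simp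
    linarith
  have e3 := exp_neg_three_le
  calc _ ≤ 5 * X * (Real.exp (-3) * Real.exp (-(B * ℓ))) :=
        mul_le_mul_of_nonneg_left e (by positivity)
    _ ≤ 5 * X * (1 / 10 * Real.exp (-(B * ℓ))) := by gcongr
    _ = _ := by ring

/-! ### The sum over `d ≠ 1` -/

theorem coshTrunc_nonneg (K : ℕ) (u : ℝ) : 0 ≤ coshTrunc K u :=
  Finset.sum_nonneg fun k _ => div_nonneg (by rw [pow_mul]; positivity) (by positivity)

/-- A rare set contributes little, by the Cauchy–Schwarz inequality. -/
theorem sum_le_of_sum_sq_le {α : Type*} {s t : Finset α} (hts : t ⊆ s) {f : α → ℝ}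
    (hf : ∀ a, 0 ≤ f a) {X u : ℝ} (hX : 0 ≤ X) (hs : ∑ a ∈ s, f a ^ 2 ≤ X * Real.exp u)
    (ht : (t.card : ℝ) ≤ X * Real.exp (-u)) : ∑ a ∈ t, f a ≤ X := by
  have h1 := sq_sum_le_card_mul_sum_sq (s := t) (f := f)
  have h2 : ∑ a ∈ t, f a ^ 2 ≤ X * Real.exp u :=
    (Finset.sum_le_sum_of_subset_of_nonneg hts fun _ _ _ => sq_nonneg _).trans hs
  have h3 : (t.card : ℝ) * ∑ a ∈ t, f a ^ 2 ≤ (X * Real.exp (-u)) * (X * Real.exp u) :=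
    mul_le_mul ht h2 (Finset.sum_nonneg fun _ _ => sq_nonneg _) (by positivity)
  have h4 : (X * Real.exp (-u)) * (X * Real.exp u) = X ^ 2 := by
    have : Real.exp (-u) * Real.exp u = 1 := by rw [← Real.exp_add]; simp
    linear_combination X ^ 2 * this
  rw [h4] at h3
  exact (pow_le_pow_iff_left₀ (Finset.sum_nonneg fun a _ => hf a) hX two_ne_zero).1 (h1.trans h3)

set_option maxHeartbeats 1000000 in
/-- The sum over the discriminants `d ≠ 1`. -/
theorem exists_sum_erase_shiftedValue_le (hGRH : GRH) {η : ℝ} (hη : 0 < η) (hη1 : η ≤ 1) :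
    ∃ C : ℝ, 0 ≤ C ∧ ∀ᶠ X : ℝ in atTop, ∀ z₁ z₂ : ℂ, IsShift X z₁ → IsShift X z₂ →
    ∑ d ∈ (fundamentalDiscriminants X).erase 1, shiftedValue z₁ z₂ d ≤
      X + C * (X * Real.exp ((4 + 34 * η) * Real.log (Real.log X) +
        6 * logMin X (z₁.im - z₂.im))) := by
  obtain ⟨C₁, X₁, hC₁, hV⟩ := exists_shiftedValue_le hGRH
  obtain ⟨C₂, X₂, hvar⟩ := exists_squareSum_add_le hGRH
  obtain ⟨B, X₃, hB, hcrude⟩ := exists_sum_shiftedValue_sq_le hGRH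
  have hlim : Tendsto (fun X => Real.log (Real.log X)) atTop atTop :=
    Real.tendsto_log_atTop.comp Real.tendsto_log_atTop
  have hlog := hlim.eventually
    (Real.isLittleO_log_id_atTop.def (by positivity : 0 < η / 16))
  refine ⟨28 * C₁ * Real.exp (C₂ - 2 * Real.log η), by positivity, ?_⟩
  filter_upwards [eventually_card_small_le hGRH hB, eventually_card_medium_le hGRH hB hη hη1, hlog,
    hlim.eventually_ge_atTop (max 100 (1 / η)), eventually_ge_atTop (Real.exp 1),
    eventually_ge_atTop X₁, eventually_ge_atTop X₂, eventually_ge_atTop X₃] with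
    X hsmall hmedium hlog hm hX hX₁ hX₂ hX₃ z₁ z₂ hz₁ hz₂
  have hcr := hcrude X hX₃ z₁ z₂ hz₁ hz₂
  have hX0 : 0 < X := (Real.exp_pos 1).trans_le hX
  have hX1 : 1 ≤ X := (Real.one_le_exp zero_le_one).trans hX
  have hL1 : 1 ≤ Real.log X := (Real.le_log_iff_exp_le hX0).2 hX
  -- the length `x` costs `32 η ℓ` in the exponent, and `y` is small enough for moments of order
  -- `4 ℓ ^ 2` of the sum over primes up to `y`
  set x := Real.exp (Real.log X / (η * Real.log (Real.log X))) with hx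
  set y := Real.exp (Real.log X / Real.log (Real.log X) ^ 3) with hy
  have hlx : Real.log x = Real.log X / (η * Real.log (Real.log X)) := Real.log_exp _
  have hly : Real.log y = Real.log X / Real.log (Real.log X) ^ 3 := Real.log_exp _
  set m := logMin X (z₁.im - z₂.im) with hm'
  set ℓ := Real.log (Real.log X) with hℓ
  have hm1 : 100 ≤ ℓ := (le_max_left _ _).trans hm
  have hm2 : 1 / η ≤ ℓ := (le_max_right _ _).trans hm
  have hLexp : Real.log X = Real.exp ℓ := (Real.exp_log (by linarith)).symm
  have hXexp : Real.exp (Real.log X) = X := Real.exp_log hX0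
  obtain ⟨g1, g2, g3⟩ := growth_of_le hm1
  rw [← hLexp] at g1 g2 g3
  have hℓ0 : 0 < ℓ := by linarith
  have hηℓ : 1 ≤ η * ℓ := by rwa [div_le_iff₀' hη] at hm2
  have hηℓ1 : η * ℓ ≤ ℓ := by nlinarith
  have hη0 : 0 < η * ℓ := by positivity
  have hy4 : Real.exp 4 ≤ y := by
    rw [hy]; refine Real.exp_le_exp.2 ?_
    rw [le_div_iff₀ (by positivity)]; linarith
  have hye : Real.exp 1 ≤ y := (Real.exp_le_exp.2 (by norm_num)).trans hy4
  have hy1 : 1 < y := lt_of_lt_of_le (Real.one_lt_exp_iff.2 (by norm_num)) hy4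
  have hyx : y ^ 2 ≤ x := by
    rw [hy, hx, ← Real.exp_nat_mul]
    refine Real.exp_le_exp.2 ?_
    push_cast
    rw [← mul_div_assoc, div_le_div_iff₀ (by positivity) hη0]
    have : 2 * (η * ℓ) ≤ ℓ ^ 3 := by nlinarith [sq_nonneg ℓ]
    nlinarith
  have hyx1 : y ≤ x := by nlinarith
  have hx1 : 1 < x := hy1.trans_le hyx1
  have hxX : x ≤ X := by
    rw [hx]; refine le_trans (Real.exp_le_exp.2 (div_le_self (by linarith) hηℓ)) hXexp.le
  have hlogℓ : 16 * Real.log ℓ ≤ η * ℓ := by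
    rw [Real.norm_eq_abs, Real.norm_eq_abs, id, abs_of_pos hℓ0] at hlog
    have h1 := (le_abs_self _).trans hlog
    linarith
  obtain ⟨s1, s2, s3⟩ := oddPrimes_spec (by linarith : 0 ≤ x) hz₁.1 hz₂.1
  obtain ⟨-, s2', -⟩ := oddPrimes_spec (by linarith : 0 ≤ y) hz₁.1 hz₂.1
  have hsub : oddPrimes ⌊y⌋₊ ⊆ oddPrimes ⌊x⌋₊ := fun p hp => by
    rw [mem_oddPrimes] at hp ⊢
    exact ⟨hp.1, hp.2.1.trans (Nat.floor_le_floor hyx1), hp.2.2⟩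
  set a := primeCoeff x z₁ z₂ with ha
  set S₁ := charSum (oddPrimes ⌊y⌋₊) a with hS₁
  set S₂ := charSum (oddPrimes ⌊x⌋₊ \ oddPrimes ⌊y⌋₊) a with hS₂
  set v := ∑ p ∈ oddPrimes ⌊y⌋₊, a p ^ 2 with hv
  have hS : ∀ d, charSum (oddPrimes ⌊x⌋₊) a d = S₁ d + S₂ d := fun d => by
    rw [hS₁, hS₂, charSum, charSum, charSum, add_comm]
    exact (Finset.sum_sdiff hsub).symm
  -- the rare discriminants
  set D := fundamentalDiscriminants X with hD
  set bad := (D.filter fun d => ℓ ^ 2 < |S₁ d|) ∪ (D.filter fun d => η * ℓ < |S₂ d|) with hbad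
  have hcard : (bad.card : ℝ) ≤ X * Real.exp (-(B * ℓ)) := by
    have h1 := hsmall z₁ z₂ hz₁ hz₂ x y hy1 hly.le hyx1 hxX
    have h2 := hmedium z₁ z₂ hz₁ hz₂ x y hye hly hlx hyx1 hxX
    have h3 : (bad.card : ℝ) ≤ ((D.filter fun d => ℓ ^ 2 < |S₁ d|).card : ℝ) +
        ((D.filter fun d => η * ℓ < |S₂ d|).card : ℝ) := by
      exact_mod_cast Finset.card_union_le _ _
    linarith
  have hcard' : (((D.erase 1).filter (· ∈ bad)).card : ℝ) ≤ X * Real.exp (-(B * ℓ)) := by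
    refine le_trans (Nat.cast_le.2 (Finset.card_le_card fun d hd => ?_)) hcard
    exact (Finset.mem_filter.1 hd).2
  have hbadsum : ∑ d ∈ (D.erase 1).filter (· ∈ bad), shiftedValue z₁ z₂ d ≤ X :=
    sum_le_of_sum_sq_le (Finset.filter_subset _ _) (shiftedValue_nonneg z₁ z₂) hX0.le hcr hcard'
  -- the other discriminants
  -- the truncation of the exponential series at `K` is harmless where `|S₁ d| ≤ ℓ ^ 2`
  set K := ⌈ℓ ^ 2⌉₊ + 1 with hK
  have hK1 : ℓ ^ 2 + 1 ≤ K := by rw [hK]; push_cast; linarith [Nat.le_ceil (ℓ ^ 2)]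
  have hK2 : (K : ℝ) ≤ 2 * ℓ ^ 2 := by
    rw [hK]; push_cast
    have := Nat.ceil_lt_add_one (sq_nonneg ℓ)
    nlinarith
  have hcond : (4 * y ^ 2) ^ (2 * K) ≤ X := by
    refine four_mul_sq_pow_le hX0 (by linarith) ?_
    rw [hly]
    calc 2 * (K : ℝ) * (2 + 2 * (Real.log X / ℓ ^ 3)) ≤
          2 * (2 * ℓ ^ 2) * (2 + 2 * (Real.log X / ℓ ^ 3)) := by gcongr
      _ = 8 * ℓ ^ 2 + 8 / ℓ * Real.log X := by field_simp; ring
      _ ≤ Real.log X := by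
          have hq : 8 / ℓ ≤ 1 / 2 := by rw [div_le_iff₀ hℓ0]; linarith
          have := mul_le_mul_of_nonneg_right hq (by linarith : 0 ≤ Real.log X)
          linarith
  set W := (4 + 34 * η) * ℓ + 6 * m + (C₂ - 2 * Real.log η) with hW
  have hgood : ∀ d ∈ (D.erase 1).filter (· ∉ bad), shiftedValue z₁ z₂ d ≤
      4 * C₁ * Real.exp (W - v / 2) * coshTrunc K (S₁ d) := by
    intro d hd
    rw [Finset.mem_filter, Finset.mem_erase, hbad, Finset.mem_union, Finset.mem_filter,
      Finset.mem_filter, not_or] at hd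
    obtain ⟨⟨hd1, hdD⟩, hb1, hb2⟩ := hd
    have hb1' : |S₁ d| ≤ ℓ ^ 2 := not_lt.1 fun h => hb1 ⟨hdD, h⟩
    have hb2' : |S₂ d| ≤ η * ℓ := not_lt.1 fun h => hb2 ⟨hdD, h⟩
    have h1 := hV X hX₁ z₁ z₂ hz₁ hz₂ d hdD hd1 x hx1
    have h2 := hvar X hX₂ z₁ z₂ hz₁ hz₂ d hdD x y hy4 hyx hxX
    rw [hlx, hly, show Real.log X / (η * ℓ) / (Real.log X / ℓ ^ 3) = ℓ ^ 2 / η by field_simp,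
      Real.log_div (by positivity) hη.ne', Real.log_pow] at h2
    push_cast at h2
    rw [hlx, show Real.log X / (Real.log X / (η * ℓ)) = η * ℓ by field_simp, hS] at h1
    have h3 : 32 * (η * ℓ) + (S₁ d + S₂ d) + squareSum x z₁ z₂ d ≤ (W - v / 2) + S₁ d := by
      have := (le_abs_self _).trans hb2'
      rw [hW]
      linarith
    calc shiftedValue z₁ z₂ d ≤ C₁ * Real.exp ((W - v / 2) + S₁ d) :=
          h1.trans (mul_le_mul_of_nonneg_left (Real.exp_le_exp.2 h3) hC₁.le)
      _ = C₁ * Real.exp (W - v / 2) * Real.exp (S₁ d) := by rw [Real.exp_add]; ring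
      _ ≤ C₁ * Real.exp (W - v / 2) * (4 * coshTrunc K (S₁ d)) :=
          mul_le_mul_of_nonneg_left (exp_le_four_mul_coshTrunc (by linarith)) (by positivity)
      _ = _ := by ring
  have hgoodsum : ∑ d ∈ (D.erase 1).filter (· ∉ bad), shiftedValue z₁ z₂ d ≤
      28 * C₁ * (X * Real.exp W) := by
    have hmom := sum_coshTrunc_le (fun p hp => s1 p (hsub hp)) a s2' (fun p hp => s3 p (hsub hp))
      hX1 hy1.le hcond
    calc _ ≤ ∑ d ∈ (D.erase 1).filter (· ∉ bad),
          4 * C₁ * Real.exp (W - v / 2) * coshTrunc K (S₁ d) := Finset.sum_le_sum hgood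
      _ ≤ ∑ d ∈ D, 4 * C₁ * Real.exp (W - v / 2) * coshTrunc K (S₁ d) :=
          Finset.sum_le_sum_of_subset_of_nonneg
            ((Finset.filter_subset _ _).trans (Finset.erase_subset _ _)) fun d _ _ =>
            mul_nonneg (by positivity) (coshTrunc_nonneg _ _)
      _ ≤ 4 * C₁ * Real.exp (W - v / 2) * (7 * X * Real.exp (v / 2)) := by
          rw [← Finset.mul_sum]
          exact mul_le_mul_of_nonneg_left hmom (by positivity)
      _ = 28 * C₁ * X * (Real.exp (W - v / 2) * Real.exp (v / 2)) := by ring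
      _ = _ := by rw [← Real.exp_add, sub_add_cancel]; ring
  have hW2 : Real.exp W = Real.exp (C₂ - 2 * Real.log η) * Real.exp ((4 + 34 * η) * ℓ + 6 * m) := by
    rw [hW, ← Real.exp_add, add_comm]
  rw [← Finset.sum_filter_add_sum_filter_not (D.erase 1) (· ∈ bad)]
  rw [hW2] at hgoodsum
  linarith

/-! ### The contribution of `d = 1` -/

/-- The inequality `norm_le_mul_exp` with a polynomial of fixed length `x`, chosen such that the factor
`4 / log x` of the conductor term gives a small power of the height. -/
theorem exists_norm_zeta_le_of_one_le (hGRH : GRH) : ∃ C : ℝ, 0 < C ∧ ∀ δ t : ℝ, 0 < δ →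
    δ ≤ 1 / 4 → 1 ≤ |t| →
    ‖riemannZeta (1 / 2 + δ + t * I)‖ ≤ C * Real.exp (Real.log (3 + |t|) / 16) := by
  have h := isCompletable_zeta hGRH
  obtain ⟨C₁, hC₁, hL⟩ := exists_norm_quadraticL_le
  set x := Real.exp 32 with hx
  have hx1 : 1 < x := Real.one_lt_exp_iff.2 (by norm_num)
  set S := ∑ n ∈ Finset.Icc 1 ⌊x⌋₊, ArithmeticFunction.vonMangoldt n * weight x 0 n with hS
  refine ⟨4 * C₁ * Real.exp ((4 + 4 * Real.sqrt x) / 8 + 4 + S), by positivity,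
    fun δ t hδ hδ1 ht => ?_⟩
  set s : ℂ := 1 / 2 + δ + t * I with hs
  have hsre : s.re = 1 / 2 + δ := by simp [hs]
  have hsim : s.im = t := by simp [hs]
  have key := h.norm_le_mul_exp (s := s) (by rw [hsre]; linarith) (by rw [hsre]; linarith)
    (fun _ => by rwa [hsim]) hx1 (u := 0) le_rfl zero_le_one
  have hne : s ≠ 1 := by
    intro h0
    rw [h0, one_im] at hsim
    rw [← hsim] at ht; norm_num at ht
  have hne' : s + 1 ≠ 1 := by
    intro h0
    have : s.im = 0 := by rw [add_eq_right.1 h0, zero_im]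
    rw [← hsim, this] at ht; norm_num at ht
  rw [ofReal_zero, add_zero, zetaEntire_of_ne_one hne, zetaEntire_of_ne_one hne', norm_mul,
    norm_mul, add_sub_cancel_right] at key
  have f1 : |t| ≤ ‖s - 1‖ := by
    have := abs_im_le_norm (s - 1)
    rwa [sub_im, hsim, one_im, sub_zero] at this
  have f2 : ‖s‖ ≤ 2 * |t| := by
    refine (norm_le_abs_re_add_abs_im s).trans ?_
    rw [hsre, hsim, abs_of_pos (by linarith)]
    linarith
  have f3 : ‖riemannZeta (s + 1)‖ ≤ C₁ := by
    rw [← quadraticL_one]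
    refine hL 1 isFundamentalDiscriminant_one _ ?_
    rw [add_re, hsre, one_re]; linarith
  have f4 : (∑ n ∈ Finset.Icc 1 ⌊x⌋₊, (ArithmeticFunction.vonMangoldt n : ℂ) * (n : ℂ) ^ (-s) *
      (weight x 0 n : ℂ)).re ≤ S := by
    refine (re_le_norm _).trans ((norm_sum_le _ _).trans (Finset.sum_le_sum fun n hn => ?_))
    rw [Finset.mem_Icc] at hn
    have hnx : (n : ℝ) ≤ x := (Nat.le_floor_iff (by linarith)).1 hn.2
    have hw := weight_nonneg (x := x) le_rfl zero_le_one hn.1 hnx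
    have hn1 : (1 : ℝ) ≤ n := by exact_mod_cast hn.1
    have hp : ‖(n : ℂ) ^ (-s)‖ ≤ 1 := by
      rw [Complex.norm_natCast_cpow_of_pos (by omega), neg_re]
      exact Real.rpow_le_one_of_one_le_of_nonpos hn1 (by linarith)
    have hv := ArithmeticFunction.vonMangoldt_nonneg (n := n)
    rw [norm_mul, norm_mul, norm_real, norm_real, Real.norm_of_nonneg hw, Real.norm_of_nonneg hv]
    refine mul_le_mul_of_nonneg_right ?_ hw
    exact mul_le_of_le_one_right hv hp
  have f5 : (4 + Real.log 1 / 2 + Real.log (3 + |s.im|) / 2 + (1 : ℕ) * (4 * Real.sqrt x)) *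
        (4 * x ^ (-0 : ℝ) / Real.log x) + 4 * (1 : ℕ) +
      (∑ n ∈ Finset.Icc 1 ⌊x⌋₊, (ArithmeticFunction.vonMangoldt n : ℂ) * (n : ℂ) ^ (-s) *
        (weight x 0 n : ℂ)).re ≤
      ((4 + 4 * Real.sqrt x) / 8 + 4 + S) + Real.log (3 + |t|) / 16 := by
    rw [hsim, neg_zero, Real.rpow_zero, hx, Real.log_exp, Nat.cast_one, Real.log_one]
    rw [hx] at f4
    linarith
  have ht0 : 0 < |t| := by linarith
  have g2 : |t| * ‖riemannZeta s‖ ≤ 2 * |t| * C₁ *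
      Real.exp (((4 + 4 * Real.sqrt x) / 8 + 4 + S) + Real.log (3 + |t|) / 16) :=
    (mul_le_mul_of_nonneg_right f1 (norm_nonneg _)).trans (key.trans
      (mul_le_mul (mul_le_mul f2 f3 (norm_nonneg _) (by positivity)) (Real.exp_le_exp.2 f5)
        (Real.exp_pos _).le (by positivity)))
  rw [Real.exp_add] at g2
  refine le_of_mul_le_mul_left ?_ ht0
  refine g2.trans ?_
  have : 0 ≤ |t| * C₁ * (Real.exp ((4 + 4 * Real.sqrt x) / 8 + 4 + S) *
    Real.exp (Real.log (3 + |t|) / 16)) := by positivity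
  linarith

/-- A subconvex bound for `ζ` near the critical line. -/
theorem exists_norm_zeta_le (hGRH : GRH) : ∃ C X₀ : ℝ, 0 < C ∧ ∀ X : ℝ, X₀ ≤ X → ∀ z : ℂ,
    IsShift X z → ‖riemannZeta (1 / 2 + z)‖ ≤ C * Real.exp (Real.log X / 8) := by
  obtain ⟨C₁, hC₁, hlarge⟩ := exists_norm_zeta_le_of_one_le hGRH
  have hdiff := (isCompletable_zeta hGRH).differentiable
  set K : Set (ℝ × ℝ) := Icc 0 (1 / 4) ×ˢ Icc (-1) 1 with hK
  have hKc : IsCompact K := isCompact_Icc.prod isCompact_Icc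
  have hcont : Continuous fun q : ℝ × ℝ => zetaEntire (1 / 2 + q.1 + q.2 * I) :=
    hdiff.continuous.comp (by fun_prop)
  obtain ⟨M, hM⟩ := hKc.exists_bound_of_continuousOn hcont.continuousOn
  refine ⟨C₁ + 4 * |M|, Real.exp 8, by positivity, fun X hX z hz => ?_⟩
  have hX0 : 0 < X := (Real.exp_pos 8).trans_le hX
  have hL : 8 ≤ Real.log X := (Real.le_log_iff_exp_le hX0).2 hX
  have hX4 : 4 ≤ X := by linarith [Real.add_one_le_exp (8 : ℝ)]
  have hre : z.re ≤ 1 / 8 := hz.2.1.trans (one_div_le_one_div_of_le (by norm_num) hL)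
  have hz' : 1 / 2 + z = 1 / 2 + (z.re : ℂ) + z.im * I := by
    conv_lhs => rw [← re_add_im z]
    ring
  have hE : 1 ≤ Real.exp (Real.log X / 8) := Real.one_le_exp (by linarith)
  have hne : ∀ δ t : ℝ, δ ≤ 1 / 4 → (1 / 2 + δ + t * I : ℂ) ≠ 1 := fun δ t hδ h0 => by
    have := congrArg re h0
    simp at this
    linarith
  rw [hz']
  rcases le_or_gt 1 |z.im| with ht | ht
  · have hlim : Tendsto (fun δ : ℝ => ‖riemannZeta (1 / 2 + δ + z.im * I)‖) (𝓝[>] z.re)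
        (𝓝 ‖riemannZeta (1 / 2 + (z.re : ℂ) + z.im * I)‖) := by
      refine tendsto_nhdsWithin_of_tendsto_nhds ?_
      have h1 : ContinuousAt riemannZeta (1 / 2 + (z.re : ℂ) + z.im * I) :=
        (differentiableAt_riemannZeta (hne _ _ (by linarith))).continuousAt
      have h2 : ContinuousAt (fun δ : ℝ => (1 / 2 + δ + z.im * I : ℂ)) z.re := by fun_prop
      exact (ContinuousAt.comp (f := fun δ : ℝ => (1 / 2 + δ + z.im * I : ℂ)) h1 h2).norm
    have hb : ‖riemannZeta (1 / 2 + (z.re : ℂ) + z.im * I)‖ ≤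
        C₁ * Real.exp (Real.log (3 + |z.im|) / 16) := by
      refine le_of_tendsto hlim ?_
      filter_upwards [Ioo_mem_nhdsGT (by linarith : z.re < 1 / 4)] with δ hδ
      exact hlarge δ z.im (hz.1.trans_lt hδ.1) hδ.2.le ht
    have hlog : Real.log (3 + |z.im|) ≤ 2 * Real.log X := by
      have h1 : 3 + |z.im| ≤ X ^ 2 := by nlinarith [hz.2.2]
      have h2 := Real.log_le_log (by positivity) h1
      rw [Real.log_pow] at h2
      exact_mod_cast h2
    calc _ ≤ C₁ * Real.exp (Real.log (3 + |z.im|) / 16) := hb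
      _ ≤ C₁ * Real.exp (Real.log X / 8) :=
          mul_le_mul_of_nonneg_left (Real.exp_le_exp.2 (by linarith)) hC₁.le
      _ ≤ _ := by
          have := abs_nonneg M
          gcongr
          linarith
  · have h1 := hM (z.re, z.im) ⟨⟨hz.1, by linarith⟩, abs_le.1 ht.le⟩
    simp only at h1
    rw [zetaEntire_of_ne_one (hne _ _ (by linarith)), norm_mul] at h1
    have h2 : 1 / 4 ≤ ‖1 / 2 + (z.re : ℂ) + z.im * I - 1‖ := by
      refine le_trans ?_ (abs_re_le_norm _)
      have e : (1 / 2 + (z.re : ℂ) + z.im * I - 1).re = z.re - 1 / 2 := by simp; ring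
      rw [e, abs_of_neg (by linarith)]
      linarith
    have h3 := mul_le_mul_of_nonneg_right h2
      (norm_nonneg (riemannZeta (1 / 2 + (z.re : ℂ) + z.im * I)))
    have h4 : ‖riemannZeta (1 / 2 + (z.re : ℂ) + z.im * I)‖ ≤ 4 * |M| := by
      linarith [le_abs_self M]
    have h5 : 0 ≤ |M| := abs_nonneg M
    nlinarith

/-- The discriminant `1`, for which the `L`-function is `ζ`, is estimated on its own. -/
theorem exists_shiftedValue_one_le (hGRH : GRH) : ∃ C X₀ : ℝ, 0 < C ∧ ∀ X : ℝ, X₀ ≤ X →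
    ∀ z₁ z₂ : ℂ, IsShift X z₁ → IsShift X z₂ → shiftedValue z₁ z₂ 1 ≤ C * X := by
  obtain ⟨C, X₀, hC, h⟩ := exists_norm_zeta_le hGRH
  refine ⟨C ^ 4, max X₀ 1, by positivity, fun X hX z₁ z₂ hz₁ hz₂ => ?_⟩
  have hX1 : 1 ≤ X := (le_max_right _ _).trans hX
  have h1 := h X ((le_max_left _ _).trans hX) z₁ hz₁
  have h2 := h X ((le_max_left _ _).trans hX) z₂ hz₂
  rw [shiftedValue, quadraticL_one, quadraticL_one]
  calc _ ≤ (C * Real.exp (Real.log X / 8)) ^ 2 * (C * Real.exp (Real.log X / 8)) ^ 2 := by gcongr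
    _ = C ^ 4 * Real.exp (Real.log X / 2) := by
        rw [← pow_add, mul_pow, ← Real.exp_nat_mul]
        congr 2; push_cast; ring
    _ ≤ C ^ 4 * Real.exp (Real.log X) := by
        have := Real.log_nonneg hX1
        gcongr
        linarith
    _ = C ^ 4 * X := by rw [Real.exp_log (by linarith)]

end QuadraticMoment

theorem theorem2p4 (hGRH : QuadraticMoment.GRH) (ε : ℝ) (hε : 0 < ε) :
    ∃ C X₀ : ℝ, ∀ X : ℝ, X₀ ≤ X → ∀ z₁ z₂ : ℂ,
      0 ≤ z₁.re → z₁.re ≤ 1 / Real.log X → 0 ≤ z₂.re → z₂.re ≤ 1 / Real.log X →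
      |z₁.im| ≤ X → |z₂.im| ≤ X →
      ∑ d ∈ QuadraticMoment.fundamentalDiscriminants X,
          ‖QuadraticMoment.quadraticL d (1 / 2 + z₁)‖ ^ 2 *
            ‖QuadraticMoment.quadraticL d (1 / 2 + z₂)‖ ^ 2
        ≤ C * (X * Real.log X ^ (4 + ε) *
            (1 + QuadraticMoment.shiftMin X (z₁.im - z₂.im))) := by
  -- the sum over `d ≠ 1` loses a factor `(log X) ^ (34 η)`; the term `d = 1` is `O(X)`
  obtain ⟨C₁, X₁, hC₁, hone⟩ := QuadraticMoment.exists_shiftedValue_one_le hGRH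
  obtain ⟨C₂, hC₂, hev⟩ := QuadraticMoment.exists_sum_erase_shiftedValue_le hGRH
    (η := min 1 (ε / 34)) (by positivity) (min_le_left _ _)
  obtain ⟨X₂, hX₂⟩ := eventually_atTop.1 hev
  refine ⟨C₁ + 1 + C₂, max (max X₁ X₂) (Real.exp 1),
    fun X hX z₁ z₂ h1 h2 h3 h4 h5 h6 => ?_⟩
  have hXe : Real.exp 1 ≤ X := (le_max_right _ _).trans hX
  have hX0 : 0 < X := (Real.exp_pos 1).trans_le hXe
  have hL1 : 1 ≤ Real.log X := (Real.le_log_iff_exp_le hX0).2 hXe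
  have hX1 : 1 ≤ X := (Real.one_le_exp zero_le_one).trans hXe
  have b1 := hone X ((le_max_left _ _).trans ((le_max_left _ _).trans hX)) z₁ z₂
    ⟨h1, h2, h5⟩ ⟨h3, h4, h6⟩
  have b2 := hX₂ X ((le_max_right _ _).trans ((le_max_left _ _).trans hX)) z₁ z₂
    ⟨h1, h2, h5⟩ ⟨h3, h4, h6⟩
  have hmem : (1 : ℤ) ∈ QuadraticMoment.fundamentalDiscriminants X :=
    QuadraticMoment.mem_fundamentalDiscriminants.2
      ⟨by simpa using hX1, QuadraticMoment.isFundamentalDiscriminant_one⟩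
  have hlog : Real.exp ((4 + 34 * min 1 (ε / 34)) * Real.log (Real.log X)) ≤
      Real.log X ^ (4 + ε) := by
    rw [Real.rpow_def_of_pos (by linarith), mul_comm (Real.log (Real.log X))]
    refine Real.exp_le_exp.2 (mul_le_mul_of_nonneg_right ?_ (Real.log_nonneg hL1))
    linarith [min_le_right 1 (ε / 34)]
  have hshift := QuadraticMoment.exp_six_mul_logMin_le hL1 (z₁.im - z₂.im)
  have hshift1 : 1 ≤ 1 + QuadraticMoment.shiftMin X (z₁.im - z₂.im) :=
    (Real.one_le_exp (by linarith [QuadraticMoment.logMin_nonneg hL1 (z₁.im - z₂.im)])).trans hshift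
  have hlog1 : 1 ≤ Real.log X ^ (4 + ε) := Real.one_le_rpow hL1 (by linarith)
  set R := X * Real.log X ^ (4 + ε) * (1 + QuadraticMoment.shiftMin X (z₁.im - z₂.im)) with hR
  have r1 : X ≤ R := by
    have := one_le_mul_of_one_le_of_one_le hlog1 hshift1
    rw [hR, mul_assoc]
    exact le_mul_of_one_le_right hX0.le this
  have r2 : X * Real.exp ((4 + 34 * min 1 (ε / 34)) * Real.log (Real.log X) +
      6 * QuadraticMoment.logMin X (z₁.im - z₂.im)) ≤ R := by
    rw [hR, mul_assoc, Real.exp_add]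
    exact mul_le_mul_of_nonneg_left
      (mul_le_mul hlog hshift (Real.exp_pos _).le (by linarith)) hX0.le
  have hsum := Finset.add_sum_erase (QuadraticMoment.fundamentalDiscriminants X)
    (QuadraticMoment.shiftedValue z₁ z₂) hmem
  simp only [QuadraticMoment.shiftedValue] at hsum b1 b2
  rw [← hsum]
  calc _ ≤ C₁ * X + (X + C₂ * (X * Real.exp ((4 + 34 * min 1 (ε / 34)) * Real.log (Real.log X) +
          6 * QuadraticMoment.logMin X (z₁.im - z₂.im)))) := add_le_add b1 b2
    _ ≤ C₁ * R + (R + C₂ * R) := by gcongr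
    _ = (C₁ + 1 + C₂) * R := by ring
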